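/- **Setting.** $\lambda$ is the security parameter; "efficient" means computed by (probabilistic) Boolean circuits of size polynomial in $\lambda$ (non-uniform PPT); a function is negligible if it decays faster than every inverse polynomial. A *group generator* is an efficient algorithm that outputs a description of a group $\mathbb G$ of prime order $p$ with $\lfloor\log_2 p\rfloor=\lambda$ and a generator $g$, with efficient group operations on injectively encoded elements. DL (CDH) is the assumption that every non-uniform PPT adversary, given the description and $g^{a}$ (resp. $g^{a_1},g^{a_2}$) for uniform exponents in $\mathbb Z_p$, outputs $a$ (resp. $g^{a_1a_2}$) with negligible probability only. An *additively homomorphic encryption scheme* consists of efficient algorithms $\mathtt{KGen},\mathtt{Enc},\mathtt{Dec}$ with plaintext space $\mathbb Z_N$ ($N$ depending on the public key) and efficient, possibly randomised, operations $\boxplus,\boxtimes$ such that decryption is correct, $\mathtt{Dec}(\mathtt{Enc}(m_1)\boxplus\mathtt{Enc}(m_2))=m_1+m_2$ and $\mathtt{Dec}(\mathtt{Enc}(m)\boxtimes c)=m\cdot c$. The operations return encryptions: up to negligible statistical distance, the $\boxplus$ of independent encryptions of $m_1,m_2$ is distributed as $\mathtt{Enc}(m_1+m_2)$, and for every given encryption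 of $m$, its $\boxtimes$ with $c$ is (over the coins of $\boxtimes$) distributed as $\mathtt{Enc}(mc)$. Messages have $\sigma=\sigma(\lambda)$ bits, $\sigma$ polynomially bounded. $\mathtt G$ is a hash function with values in $\{0,1\}^{\sigma+\lambda}$, modelled as a random oracle. Encoded group elements and $(\sigma+\lambda)$-bit strings are numbers smaller than $N$. **Functionality.** Sender $S$ holds $\bm m=[(m_{0,0},m_{1,0}),\dots,(m_{0,z-1},m_{1,z-1})]$; issuer $T$ holds $(v,s,z)$ with $0\le v<z$, $s\in\{0,1\}$; proxies $P_1,P_2$ and receiver $R$ have no input ($\epsilon$). $\mathcal F(\bm m,(v,s,z),\epsilon,\epsilon,\epsilon)=(\epsilon,\epsilon,z,\epsilon,m_{s,v})$ for $(S,T,P_1,P_2,R)$. **Protocol DUQ$^{\mathrm{MR}}$-OT.** 1. $S$ runs the group generator, picks a uniform $C=g^a\in\mathbb G$ and publishes the description, $g$, $p$, $C$. 2. $R$ runs $\mathtt{KGen}\to(sk,pk)$ and publishes $pk$. 3. $T$ sends to $P_1$ the vector $\bm w$ with $\bm w[t]=\mathtt{Enc}(pk,1)$ for $t=v$ and $\mathtt{Enc}(pk,0)$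 otherwise. 4. $R$ picks $r_1,r_2\leftarrow\mathbb Z_p$ and sends $r_i$ to $P_i$. 5. $T$ picks random bits $s_1,s_2$ with $s_1\oplus s_2=s$, and $r_3\leftarrow\{0,1\}^\lambda$; it sends $s_1$ to $P_1$, $s_2$ to $P_2$, $r_3$ to $S$, $(s_2,r_3)$ to $R$. 6. $P_2$ sends $\delta_{s_2}=g^{r_2}$, $\delta_{1-s_2}=C/g^{r_2}$ to $P_1$; $P_1$ sends $\beta_{s_1}=\delta_0g^{r_1}$, $\beta_{1-s_1}=\delta_1/g^{r_1}$ to $S$. 7. $S$ aborts if $C\ne\beta_0\beta_1$. For every $t<z$ it forms $e_{i,t}=(g^{y_{i,t}},\mathtt G(\beta_i^{y_{i,t}})\oplus(m_{i,t}\|r_3))$, $i\in\{0,1\}$, with fresh $y_{i,t}\leftarrow\mathbb Z_p$, randomly permutes the pair $(e_{0,t},e_{1,t})$ to $(e'_{0,t},e'_{1,t})$ and sends all pairs to $P_1$. 8. Writing $e'_{i,i',t}$, $i'\in\{0,1\}$, for the components of $e'_{i,t}$, $P_1$ sends $o_{i,i'}=(\bm w[0]\boxtimes e'_{i,i',0})\boxplus\dots\boxplus(\bm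 w[z-1]\boxtimes e'_{i,i',z-1})$ to $R$. 9. $R$ decrypts to $o'_{i,i'}$, sets $x=r_2+r_1(-1)^{s_2}$ and outputs $u_1$ if $\mathtt G((o'_{i,0})^x)\oplus o'_{i,1}=u_1\|u_2$ with $u_2=r_3$, for $i=0,1$. **Theorem.** If DL and CDH hold for the group generator, $\mathtt G$ is a random oracle, and the additively homomorphic encryption scheme is IND-CPA, then DUQ$^{\mathrm{MR}}$-OT securely computes $\mathcal F$ in the presence of non-colluding semi-honest adversaries: for each party $Q\in\{S,T,P_1,P_2,R\}$ there is a non-uniform PPT simulator $\mathtt{Sim}_Q$, given only $\lambda$ and the input and output of $Q$ in $\mathcal F$, such that no non-uniform PPT distinguisher with access to $\mathtt G$ distinguishes, with more than negligible advantage and uniformly over all inputs $(\bm m,v,s,z)$ of polynomial size, the output of $\mathtt{Sim}_Q$ from the view of $Q$ in the protocol (its input, coins and received messages and, for $R$, its output). That is, $\mathtt{Sim}_S(\bm m,\epsilon)$, $\mathtt{Sim}_T((v,s,z),\epsilon)$, $\mathtt{Sim}_{P_1}(\epsilon,z)$, $\mathtt{Sim}_{P_2}(\epsilon,\epsilon)$,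 $\mathtt{Sim}_R(\epsilon,m_{s,v})$ are computationally indistinguishable from the respective views. In particular the view of $R$ is simulated without $z$, and that of $S$ without $(v,s)$. -/

import Mathlib

noncomputable section

namespace DUQMR

/-! ### Bit strings and uniform sampling -/

/-- Bit strings of length `n`. -/
abbrev Bits (n : ℕ) : Type := Fin n → Bool

/-- A fixed-length bit string as a list. -/
def toL {n : ℕ} (b : Bits n) : List Bool := List.ofFn b

/-- Binary representation (least significant bit first) on `len` bits. -/
def natBits (len a : ℕ) : Bits len := fun i => a.testBit i

/-- The natural number represented by a list of bits (least significant bit first). -/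
def natOf (l : List Bool) : ℕ := Nat.ofDigits 2 (l.map Bool.toNat)

/-- Bitwise exclusive or. -/
def xorBits {n : ℕ} (a b : Bits n) : Bits n := fun i => xor (a i) (b i)

/-- Concatenation of the values of a list-valued function on `Fin z`. -/
def catFin {z : ℕ} (f : Fin z → List Bool) : List Bool := (List.finRange z).flatMap f

/-- Concatenation of the two values of a list-valued function on `{0, 1}`. -/
def catBool (f : Bool → List Bool) : List Bool := f false ++ f true

/-- The uniform distribution on a finite nonempty type. -/
def unif (α : Type) [Fintype α] [Nonempty α] : PMF α := PMF.uniformOfFintype α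

/-- `f` is bounded by a polynomial. -/
def PolyBounded (f : ℕ → ℕ) : Prop := ∃ q : Polynomial ℕ, ∀ n, f n ≤ q.eval n

/-- Negligible functions: they decay faster than every inverse polynomial. -/
def Negligible (μ : ℕ → ℝ) : Prop :=
  Asymptotics.SuperpolynomialDecay Filter.atTop (fun n : ℕ => (n : ℝ)) μ

/-- Statistical (total variation) distance. -/
def statDist {α : Type} [Fintype α] (P Q : PMF α) : ℝ :=
  (∑ x, |(P x).toReal - (Q x).toReal|) / 2

/-! ### Non-uniform probabilistic polynomial time: Boolean circuits with oracle gates -/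

/-- A gate reads earlier wires and appends new ones: an arbitrary Boolean function of three wires,
or the answer of the oracle to the string on the listed wires. -/
inductive Gate : Type
  | op (f : Bool → Bool → Bool → Bool) (i j k : ℕ)
  | query (q : List ℕ)

/-- The cost of a gate is one plus the length of its oracle query, if it makes one. -/
def Gate.cost : Gate → ℕ
  | .op _ _ _ _ => 1
  | .query q => 1 + q.length

/-- Effect of one gate on the list of wire values (a wire that does not exist reads `false`). -/
def Gate.step (O : List Bool → List Bool) (mem : List Bool) : Gate → List Bool
  | .op f i j k => mem ++ [f (mem.getD i false) (mem.getD j false) (mem.getD k false)]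
  | .query q => mem ++ O (q.map fun i => mem.getD i false)

/-- A circuit: gates in topological order, and the output wires. The input occupies the first
wires. -/
structure Circuit : Type where
  gates : List Gate
  outs : List ℕ

/-- Size of a circuit. -/
def Circuit.size (c : Circuit) : ℕ := (c.gates.map Gate.cost).sum + c.outs.length

/-- Output of a circuit with oracle `O` on input `x`. -/
def Circuit.eval (O : List Bool → List Bool) (c : Circuit) (x : List Bool) : List Bool :=
  c.outs.map fun i => (c.gates.foldl (Gate.step O) x).getD i false

/-- The trivial oracle, which always answers with the empty string: circuits evaluated with it
are ordinary circuits without oracle. -/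
def noOracle : List Bool → List Bool := fun _ => []

/-- A probabilistic circuit: its first `coins` input wires carry uniformly random bits. -/
structure RandCircuit : Type extends Circuit where
  coins : ℕ

/-- Size of a probabilistic circuit, coins included. -/
def RandCircuit.size (c : RandCircuit) : ℕ := c.toCircuit.size + c.coins

/-- Output distribution of a probabilistic circuit with oracle `O` on input `x`. -/
def RandCircuit.run (O : List Bool → List Bool) (c : RandCircuit) (x : List Bool) :
    PMF (List Bool) :=
  (unif (Bits c.coins)).map fun r => c.toCircuit.eval O (toL r ++ x)

/-- The family of functions `inp i ↦ out i`, where the index `i` at security parameter `n`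
ranges over `ι n`, is computed by circuits of polynomial size. -/
def PolyComputable {ι : ℕ → Type} (inp out : (n : ℕ) → ι n → List Bool) : Prop :=
  ∃ c : ℕ → Circuit, PolyBounded (fun n => (c n).size) ∧
    ∀ n i, (c n).eval noOracle (inp n i) = out n i

/-! ### Group generators, DL and CDH -/

/-- A group-generator scheme. On security parameter `n` and coins `c` it outputs a description
`gen n c` of a group of prime order `p` with `⌊log₂ p⌋ = n` and of a generator `g` of it. Group
elements are encoded injectively as strings of `elemLen n` bits. Generation, the order, the
generator and the group operations are computed by polynomial-size circuits. -/
structure GroupGen : Type 1 where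
  coinLen : ℕ → ℕ
  descLen : ℕ → ℕ
  elemLen : ℕ → ℕ
  gen : (n : ℕ) → Bits (coinLen n) → Bits (descLen n)
  Grp : (n : ℕ) → Bits (descLen n) → Type
  commGroup : (n : ℕ) → (d : Bits (descLen n)) → CommGroup (Grp n d)
  fintype : (n : ℕ) → (d : Bits (descLen n)) → Fintype (Grp n d)
  g : (n : ℕ) → (d : Bits (descLen n)) → Grp n d
  encode : (n : ℕ) → (d : Bits (descLen n)) → Grp n d → Bits (elemLen n)
  prime_card : ∀ n c, (Fintype.card (Grp n (gen n c))).Prime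
  log_card : ∀ n c, 1 ≤ n → Nat.log 2 (Fintype.card (Grp n (gen n c))) = n
  g_generates : ∀ n c (x : Grp n (gen n c)), x ∈ Subgroup.zpowers (g n (gen n c))
  encode_injective : ∀ n c, Function.Injective (encode n (gen n c))
  coinLen_poly : PolyBounded coinLen
  descLen_poly : PolyBounded descLen
  elemLen_poly : PolyBounded elemLen
  gen_poly : PolyComputable (ι := fun n => Bits (coinLen n))
    (fun _ c => toL c) (fun n c => toL (gen n c))
  order_poly : PolyComputable (ι := fun n => Bits (coinLen n))
    (fun n c => toL (gen n c))
    (fun n c => toL (natBits (n + 1) (Fintype.card (Grp n (gen n c)))))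
  g_poly : PolyComputable (ι := fun n => Bits (coinLen n))
    (fun n c => toL (gen n c)) (fun n c => toL (encode n (gen n c) (g n (gen n c))))
  mul_poly : PolyComputable
    (ι := fun n => Σ c : Bits (coinLen n), Grp n (gen n c) × Grp n (gen n c))
    (fun n i => toL (gen n i.1) ++ toL (encode n _ i.2.1) ++ toL (encode n _ i.2.2))
    (fun n i => toL (encode n _ (i.2.1 * i.2.2)))
  inv_poly : PolyComputable (ι := fun n => Σ c : Bits (coinLen n), Grp n (gen n c))
    (fun n i => toL (gen n i.1) ++ toL (encode n _ i.2))
    (fun n i => toL (encode n _ i.2⁻¹))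

attribute [instance] GroupGen.commGroup GroupGen.fintype

/-- The order `p` of the group with description `d`. -/
abbrev GroupGen.p (𝔾 : GroupGen) (n : ℕ) (d : Bits (𝔾.descLen n)) : ℕ :=
  Fintype.card (𝔾.Grp n d)

instance GroupGen.neZero_p (𝔾 : GroupGen) (n : ℕ) (d : Bits (𝔾.descLen n)) :
    NeZero (𝔾.p n d) := ⟨Fintype.card_ne_zero⟩

/-- `h ^ a` for an exponent `a` modulo `p`. -/
def zpw {H : Type} [CommGroup H] {p : ℕ} (h : H) (a : ZMod p) : H := h ^ a.val

/-- Encoding of an exponent modulo `p` (which has `n + 1` bits) as a bit list. -/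
def expL (n : ℕ) {p : ℕ} (a : ZMod p) : List Bool := toL (natBits (n + 1) a.val)

/-- Probability that `A`, given the group and `g ^ a`, outputs the uniformly random `a`. -/
def GroupGen.dlProb (𝔾 : GroupGen) (n : ℕ) (A : RandCircuit) : ℝ :=
  ((do
    let c ← unif (Bits (𝔾.coinLen n))
    let d := 𝔾.gen n c
    let a ← unif (ZMod (𝔾.p n d))
    let out ← A.run noOracle (toL d ++ toL (𝔾.encode n d (zpw (𝔾.g n d) a)))
    pure (decide (out = expL n a)) : PMF Bool) true).toReal

/-- The discrete logarithm (DL) assumption. -/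
def GroupGen.DL (𝔾 : GroupGen) : Prop :=
  ∀ B : ℕ → ℕ, PolyBounded B → ∃ μ : ℕ → ℝ, Negligible μ ∧
    ∀ n (A : RandCircuit), A.size ≤ B n → 𝔾.dlProb n A ≤ μ n

/-- Probability that `A`, given the group, `g ^ a₁` and `g ^ a₂`, outputs `g ^ (a₁ * a₂)`. -/
def GroupGen.cdhProb (𝔾 : GroupGen) (n : ℕ) (A : RandCircuit) : ℝ :=
  ((do
    let c ← unif (Bits (𝔾.coinLen n))
    let d := 𝔾.gen n c
    let a₁ ← unif (ZMod (𝔾.p n d))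
    let a₂ ← unif (ZMod (𝔾.p n d))
    let out ← A.run noOracle (toL d ++ toL (𝔾.encode n d (zpw (𝔾.g n d) a₁)) ++
      toL (𝔾.encode n d (zpw (𝔾.g n d) a₂)))
    pure (decide (out = toL (𝔾.encode n d (zpw (𝔾.g n d) (a₁ * a₂))))) : PMF Bool) true).toReal

/-- The computational Diffie-Hellman (CDH) assumption. -/
def GroupGen.CDH (𝔾 : GroupGen) : Prop :=
  ∀ B : ℕ → ℕ, PolyBounded B → ∃ μ : ℕ → ℝ, Negligible μ ∧
    ∀ n (A : RandCircuit), A.size ≤ B n → 𝔾.cdhProb n A ≤ μ n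

/-! ### Additively homomorphic encryption -/

/-- An additively homomorphic public-key encryption scheme with plaintext space `ℤ_N`, where
`N = modulus n pk`; plaintexts are represented by the numbers `0, …, N - 1`. The algorithms are
explicit functions of their coins, and are computed by polynomial-size circuits: key generation
(giving the secret and the public key), encryption, decryption, homomorphic addition of two
ciphertexts, and homomorphic multiplication of a ciphertext by a plaintext. -/
structure AHE : Type where
  keyCoins : ℕ → ℕ
  encCoins : ℕ → ℕ
  addCoins : ℕ → ℕ
  mulCoins : ℕ → ℕ
  skLen : ℕ → ℕ
  pkLen : ℕ → ℕ
  ptLen : ℕ → ℕ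
  ctLen : ℕ → ℕ
  modulus : (n : ℕ) → Bits (pkLen n) → ℕ
  kgen : (n : ℕ) → Bits (keyCoins n) → Bits (skLen n) × Bits (pkLen n)
  enc : (n : ℕ) → Bits (pkLen n) → ℕ → Bits (encCoins n) → Bits (ctLen n)
  dec : (n : ℕ) → Bits (skLen n) → Bits (ctLen n) → ℕ
  add : (n : ℕ) → Bits (pkLen n) → Bits (ctLen n) → Bits (ctLen n) → Bits (addCoins n) →
    Bits (ctLen n)
  mul : (n : ℕ) → Bits (pkLen n) → Bits (ctLen n) → ℕ → Bits (mulCoins n) → Bits (ctLen n)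
  modulus_pos : ∀ n k, 0 < modulus n (kgen n k).2
  modulus_le : ∀ n k, modulus n (kgen n k).2 ≤ 2 ^ ptLen n
  dec_enc : ∀ n k m r, m < modulus n (kgen n k).2 →
    dec n (kgen n k).1 (enc n (kgen n k).2 m r) = m
  dec_add : ∀ n k m₁ m₂ r₁ r₂ r,
    m₁ < modulus n (kgen n k).2 → m₂ < modulus n (kgen n k).2 →
    dec n (kgen n k).1
      (add n (kgen n k).2 (enc n (kgen n k).2 m₁ r₁) (enc n (kgen n k).2 m₂ r₂) r) =
      (m₁ + m₂) % modulus n (kgen n k).2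
  dec_mul : ∀ n k m a r₁ r, m < modulus n (kgen n k).2 → a < modulus n (kgen n k).2 →
    dec n (kgen n k).1 (mul n (kgen n k).2 (enc n (kgen n k).2 m r₁) a r) =
      (m * a) % modulus n (kgen n k).2
  len_poly : PolyBounded fun n => keyCoins n + encCoins n + addCoins n + mulCoins n +
    skLen n + pkLen n + ptLen n + ctLen n
  kgen_poly : PolyComputable (ι := fun n => Bits (keyCoins n))
    (fun _ k => toL k) (fun n k => toL (kgen n k).1 ++ toL (kgen n k).2)
  enc_poly : PolyComputable
    (ι := fun n => Σ k : Bits (keyCoins n), Fin (modulus n (kgen n k).2) × Bits (encCoins n))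
    (fun n i => toL (kgen n i.1).2 ++ toL (natBits (ptLen n) i.2.1) ++ toL i.2.2)
    (fun n i => toL (enc n (kgen n i.1).2 i.2.1 i.2.2))
  dec_poly : PolyComputable (ι := fun n => Bits (keyCoins n) × Bits (ctLen n))
    (fun n i => toL (kgen n i.1).1 ++ toL i.2)
    (fun n i => toL (natBits (ptLen n) (dec n (kgen n i.1).1 i.2)))
  add_poly : PolyComputable
    (ι := fun n => Bits (keyCoins n) × Bits (ctLen n) × Bits (ctLen n) × Bits (addCoins n))
    (fun n i => toL (kgen n i.1).2 ++ toL i.2.1 ++ toL i.2.2.1 ++ toL i.2.2.2)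
    (fun n i => toL (add n (kgen n i.1).2 i.2.1 i.2.2.1 i.2.2.2))
  mul_poly : PolyComputable
    (ι := fun n => Σ k : Bits (keyCoins n),
      Bits (ctLen n) × Fin (modulus n (kgen n k).2) × Bits (mulCoins n))
    (fun n i => toL (kgen n i.1).2 ++ toL i.2.1 ++ toL (natBits (ptLen n) i.2.2.1) ++
      toL i.2.2.2)
    (fun n i => toL (mul n (kgen n i.1).2 i.2.1 i.2.2.1 i.2.2.2))

/-- A chosen-plaintext adversary: `choose` picks two plaintexts from the public key and the coins;
`guess` sees the public key, the coins and the challenge ciphertext. -/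
structure CPAAdversary : Type where
  coins : ℕ
  choose : Circuit
  guess : Circuit

/-- Size of a chosen-plaintext adversary. -/
def CPAAdversary.size (A : CPAAdversary) : ℕ := A.coins + A.choose.size + A.guess.size

/-- Probability that the adversary answers `1` when the `b`-th chosen plaintext is encrypted. -/
def AHE.cpaProb (E : AHE) (n : ℕ) (A : CPAAdversary) (b : Bool) : ℝ :=
  ((do
    let k ← unif (Bits (E.keyCoins n))
    let pk := (E.kgen n k).2
    let r ← unif (Bits A.coins)
    let ms := A.choose.eval noOracle (toL r ++ toL pk)
    let m₀ := natOf (ms.take (E.ptLen n)) % E.modulus n pk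
    let m₁ := natOf ((ms.drop (E.ptLen n)).take (E.ptLen n)) % E.modulus n pk
    let re ← unif (Bits (E.encCoins n))
    let ct := E.enc n pk (if b then m₁ else m₀) re
    pure (decide (A.guess.eval noOracle (toL r ++ toL pk ++ toL ct) = [true])) :
      PMF Bool) true).toReal

/-- Indistinguishability under chosen-plaintext attacks. -/
def AHE.INDCPA (E : AHE) : Prop :=
  ∀ B : ℕ → ℕ, PolyBounded B → ∃ μ : ℕ → ℝ, Negligible μ ∧
    ∀ n (A : CPAAdversary), A.size ≤ B n → |E.cpaProb n A true - E.cpaProb n A false| ≤ μ n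

/-- Homomorphic operations return encryptions, up to a negligible statistical distance: the sum of
two independent encryptions of `m₁` and `m₂` is distributed like an encryption of `m₁ + m₂`, and
multiplying any given encryption of `m` by `a` gives, over the coins of the multiplication, an
encryption of `m * a`. -/
def AHE.ReturnsEncryptions (E : AHE) : Prop :=
  ∃ μ : ℕ → ℝ, Negligible μ ∧ ∀ n k, let pk := (E.kgen n k).2; let N := E.modulus n pk
    (∀ m₁ m₂, m₁ < N → m₂ < N →
      statDist
        ((unif (Bits (E.encCoins n) × Bits (E.encCoins n) × Bits (E.addCoins n))).map
          fun r => E.add n pk (E.enc n pk m₁ r.1) (E.enc n pk m₂ r.2.1) r.2.2)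
        ((unif (Bits (E.encCoins n))).map fun r => E.enc n pk ((m₁ + m₂) % N) r) ≤ μ n) ∧
    (∀ m a r₁, m < N → a < N →
      statDist
        ((unif (Bits (E.mulCoins n))).map fun r => E.mul n pk (E.enc n pk m r₁) a r)
        ((unif (Bits (E.encCoins n))).map fun r => E.enc n pk ((m * a) % N) r) ≤ μ n)

/-! ### The functionality -/

/-- Sender `S`, query issuer `T`, proxies `P₁` and `P₂`, receiver `R`. -/
inductive Party : Type
  | S | T | P1 | P2 | R

/-- Joint input: the `z` pairs `(m t 0, m t 1)` of `σ`-bit messages of `S`, and the triple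
`(v, s, z)` of `T`. The other parties have no input. -/
structure Input (σ : ℕ) : Type where
  z : ℕ
  m : Fin z → Bool → Bits σ
  v : Fin z
  s : Bool

/-- The number `z` in unary. -/
def unary (z : ℕ) : List Bool := List.replicate z true

/-- The (encoded) input of each party. -/
def Input.of {σ : ℕ} (x : Input σ) : Party → List Bool
  | .S => unary x.z ++ [false] ++ catFin fun t => catBool fun i => toL (x.m t i)
  | .T => unary x.z ++ [false] ++ toL (natBits x.z x.v) ++ [x.s]
  | .P1 => []
  | .P2 => []
  | .R => []

/-- The functionality `(m, (v, s, z), ε, ε, ε) ↦ (ε, ε, z, ε, m_{s,v})`: the (encoded) output of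
each party. -/
def functionality {σ : ℕ} (x : Input σ) : Party → List Bool
  | .S => []
  | .T => []
  | .P1 => unary x.z
  | .P2 => []
  | .R => toL (x.m x.v x.s)

/-! ### The algorithms of the protocol -/

/-- `P₂`'s query generation: `δ_{s₂} = g ^ r₂` and `δ_{1-s₂} = C / g ^ r₂`. -/
def genQueryP2 {H : Type} [CommGroup H] {p : ℕ} (g C : H) (r₂ : ZMod p) (s₂ : Bool) : Bool → H :=
  fun b => if b = s₂ then zpw g r₂ else C / zpw g r₂

/-- `P₁`'s query generation: `β_{s₁} = δ₀ * g ^ r₁` and `β_{1-s₁} = δ₁ / g ^ r₁`. -/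
def genQueryP1 {H : Type} [CommGroup H] {p : ℕ} (g : H) (r₁ : ZMod p) (s₁ : Bool)
    (δ : Bool → H) : Bool → H :=
  fun b => if b = s₁ then δ false * zpw g r₁ else δ true / zpw g r₁

/-- `S`'s response generation: abort unless `C = β₀ * β₁`; for each `t` form
`e_{i,t} = (g ^ y_{i,t}, G (β_i ^ y_{i,t}) ⊕ (m_{i,t} ‖ r₃))` and swap the pair `(e_{0,t}, e_{1,t})`
if the random bit `π t` is set. -/
def genRes {H : Type} [CommGroup H] {p ℓ σ n z : ℕ} (encode : H → Bits ℓ)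
    (G : Bits ℓ → Bits (σ + n)) (g C : H) (β : Bool → H) (m : Fin z → Bool → Bits σ) (r₃ : Bits n)
    (y : Fin z → Bool → ZMod p) (π : Fin z → Bool) : Option (Fin z → Bool → H × Bits (σ + n)) :=
  open Classical in
  if C = β false * β true then
    some fun t j =>
      let i := xor j (π t)
      (zpw g (y t i), xorBits (G (encode (zpw (β i) (y t i)))) (Fin.append (m t i) r₃))
  else none

/-- The two components `e_{·,0}` and `e_{·,1}` of a response element, as plaintexts. -/
def component {H : Type} {ℓ k : ℕ} (encode : H → Bits ℓ) (e : H × Bits k) (i' : Bool) : ℕ :=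
  if i' then natOf (toL e.2) else natOf (toL (encode e.1))

/-- Homomorphic sum `c 0 ⊞ c 1 ⊞ … ⊞ c (z-1)` with coins `r`. -/
def AHE.homSum (E : AHE) (n : ℕ) (pk : Bits (E.pkLen n)) {z : ℕ} (c : Fin z → Bits (E.ctLen n))
    (r : Fin z → Bits (E.addCoins n)) : Bits (E.ctLen n) :=
  match List.finRange z with
  | [] => fun _ => false
  | t :: ts => ts.foldl (fun acc u => E.add n pk acc (c u) (r u)) (c t)

/-- `P₁`'s oblivious filtering: `o_{i,i'} = Σ_t e'_{i,i',t} × w[t]`, computed homomorphically. -/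
def oblFilter (E : AHE) (n : ℕ) (pk : Bits (E.pkLen n)) {H : Type} {ℓ k z : ℕ}
    (encode : H → Bits ℓ) (res : Fin z → Bool → H × Bits k) (w : Fin z → Bits (E.ctLen n))
    (ra : Bool → Bool → Fin z → Bits (E.addCoins n))
    (rm : Bool → Bool → Fin z → Bits (E.mulCoins n)) : Bool → Bool → Bits (E.ctLen n) :=
  fun i i' => E.homSum n pk
    (fun t => E.mul n pk (w t) (component encode (res t i) i') (rm i i' t)) (ra i i')

/-- The group element represented by a plaintext (`1` if there is none). -/
def decodeElem {H : Type} [CommGroup H] {ℓ : ℕ} (encode : H → Bits ℓ) (a : ℕ) : H :=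
  open Classical in
  if h : ∃ u, natOf (toL (encode u)) = a then h.choose else 1

/-- `R`'s message extraction: decrypt, set `x = r₂ + r₁ * (-1) ^ s₂`, and for `i = 0, 1` set the
output to `u₁` if `G (o'_{i,0} ^ x) ⊕ o'_{i,1} = u₁ ‖ u₂` with `u₂ = r₃`. -/
def retrieve (E : AHE) (n : ℕ) (sk : Bits (E.skLen n)) {H : Type} [CommGroup H] {p ℓ σ : ℕ}
    (encode : H → Bits ℓ) (G : Bits ℓ → Bits (σ + n)) (r₁ r₂ : ZMod p) (s₂ : Bool) (r₃ : Bits n)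
    (o : Bool → Bool → Bits (E.ctLen n)) : Option (Bits σ) :=
  let x : ZMod p := r₂ + r₁ * (-1) ^ s₂.toNat
  let attempt : Bool → Option (Bits σ) := fun i =>
    let y := xorBits (G (encode (zpw (decodeElem encode (E.dec n sk (o i false))) x)))
      (natBits (σ + n) (E.dec n sk (o i true)))
    if (fun j => y (Fin.natAdd σ j)) = r₃ then some fun j => y (Fin.castAdd n j) else none
  (attempt true).or (attempt false)

/-! ### The protocol -/

/-- One execution of the protocol with hash function `G`: the joint distribution of the views of
the parties. A view consists of the party's input, its coins, the messages it receives and, for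
`R`, its output. -/
def protocol (𝔾 : GroupGen) (E : AHE) (σ : ℕ → ℕ) (n : ℕ) (x : Input (σ n))
    (G : Bits (𝔾.elemLen n) → Bits (σ n + n)) : PMF (Party → List Bool) := do
  -- S-side initialization
  let gc ← unif (Bits (𝔾.coinLen n))
  let d := 𝔾.gen n gc
  let g := 𝔾.g n d
  let encode := 𝔾.encode n d
  let a ← unif (ZMod (𝔾.p n d))
  let C := zpw g a
  let pub := toL d ++ toL (encode C)
  -- R-side one-off setup
  let kc ← unif (Bits (E.keyCoins n))
  let sk := (E.kgen n kc).1
  let pk := (E.kgen n kc).2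
  -- T-side one-off setup
  let rT ← unif (Fin x.z → Bits (E.encCoins n))
  let w := fun t => E.enc n pk (if t = x.v then 1 else 0) (rT t)
  -- R-side delegation
  let r₁ ← unif (ZMod (𝔾.p n d))
  let r₂ ← unif (ZMod (𝔾.p n d))
  -- T-side query generation
  let s₁ ← unif Bool
  let s₂ := xor s₁ x.s
  let r₃ ← unif (Bits n)
  -- query generation by the proxies
  let δ := genQueryP2 g C r₂ s₂
  let β := genQueryP1 g r₁ s₁ δ
  -- S-side response generation
  let y ← unif (Fin x.z → Bool → ZMod (𝔾.p n d))
  let π ← unif (Fin x.z → Bool)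
  let res := genRes encode G g C β x.m r₃ y π
  -- P1-side oblivious filtering
  let ra ← unif (Bool → Bool → Fin x.z → Bits (E.addCoins n))
  let rm ← unif (Bool → Bool → Fin x.z → Bits (E.mulCoins n))
  let o := res.map fun e => oblFilter E n pk encode e w ra rm
  -- R-side message extraction
  let out := o.bind (retrieve E n sk encode G r₁ r₂ s₂ r₃)
  pure fun
    | .S => x.of .S ++
        (toL gc ++ expL n a ++ (catFin fun t => catBool fun i => expL n (y t i)) ++ toL π) ++
        (toL pk ++ toL r₃ ++ catBool fun i => toL (encode (β i)))
    | .T => x.of .T ++ ((catFin fun t => toL (rT t)) ++ [s₁] ++ toL r₃) ++ (pub ++ toL pk)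
    | .P1 => x.of .P1 ++
        ((catBool fun i => catBool fun i' => catFin fun t => toL (ra i i' t)) ++
          catBool fun i => catBool fun i' => catFin fun t => toL (rm i i' t)) ++
        (pub ++ toL pk ++ (catFin fun t => toL (w t)) ++ expL n r₁ ++ [s₁] ++
          (catBool fun i => toL (encode (δ i))) ++
          res.elim [] fun e => catFin fun t => catBool fun i =>
            toL (encode (e t i).1) ++ toL (e t i).2)
    | .P2 => x.of .P2 ++ (pub ++ expL n r₂ ++ [s₂])
    | .R => x.of .R ++ (toL kc ++ expL n r₁ ++ expL n r₂) ++
        (pub ++ [s₂] ++ toL r₃ ++ o.elim [] fun c => catBool fun i => catBool fun i' =>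
          toL (c i i')) ++
        out.elim [] toL

/-! ### Security in the random oracle model -/

/-- The oracle given by a function on strings of length `ℓ` (other queries are not answered). -/
def oracleOf {ℓ k : ℕ} (G : Bits ℓ → Bits k) : List Bool → List Bool := fun q =>
  if h : q.length = ℓ then toL (G fun i => q.get (Fin.cast h.symm i)) else []

/-- Probability, over a uniformly random `G`, that the distinguisher `D` with oracle `G` accepts a
sample of the distribution `X G`. -/
def acceptProb {ℓ k : ℕ} (X : (Bits ℓ → Bits k) → PMF (List Bool)) (D : RandCircuit) : ℝ :=
  ((do
    let G ← unif (Bits ℓ → Bits k)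
    let view ← X G
    let out ← D.run (oracleOf G) view
    pure (decide (out = [true])) : PMF Bool) true).toReal

/-- The protocol `Γ` securely computes the functionality in the presence of a semi-honest adversary
that corrupts one party, in the random oracle model. For every party there is a simulator, a family
of probabilistic oracle circuits of polynomial size, indexed by the security parameter and the
length of what it is given, that gets only the input and the output of that party, and whose output
is computationally indistinguishable from the view of that party, uniformly in all inputs of
polynomial size. -/
def SecurelyComputes (ℓ k σ : ℕ → ℕ)
    (Γ : (n : ℕ) → Input (σ n) → (Bits (ℓ n) → Bits (k n)) → PMF (Party → List Bool)) : Prop :=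
  ∀ P : Party, ∃ Sim : ℕ → ℕ → RandCircuit,
    (∃ q : Polynomial ℕ, ∀ n L, (Sim n L).size ≤ q.eval (n + L)) ∧
    ∀ B : ℕ → ℕ, PolyBounded B → ∃ μ : ℕ → ℝ, Negligible μ ∧
      ∀ n (x : Input (σ n)) (D : RandCircuit), x.z ≤ B n → D.size ≤ B n →
        |acceptProb (fun G : Bits (ℓ n) → Bits (k n) =>
            (Sim n (x.of P ++ functionality x P).length).run (oracleOf G)
              (x.of P ++ functionality x P)) D -
          acceptProb (fun G => (Γ n x G).map fun views => views P) D| ≤ μ n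

end DUQMR

end

noncomputable section

namespace DUQMR

/-! The views of `S`, `T` and `P₂` are matched exactly. What `S` receives that could depend on the
query is the pair `β`, whose product is `C`. For fixed `a`, `r₁`, `s₁` the exponent of `β i` is an
affine bijection of `r₂`, hence uniform whatever `s` is (`exists_query_equiv`). `T` receives only
public data, and `P₂` sees `s₂ = s₁ ⊕ s`, which `s₁` pads. The only error there is that circuits
sample exponents modulo `p` approximately, by rejection.

For `P₁`, the sender's pads are oracle values at the points `β_i ^ y`. Oracle values at distinct
points may be exchanged for independent uniform strings, the error being the probability that the
distinguisher queries one of the points (`rom_swap`, `rom_mask`). Coincidences among the points are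
rare (`collision_le`). A query of such a point breaks CDH: `β_i = g ^ b` and `g ^ y` are uniform,
the rest of the view can be produced from these two elements without their exponents (`coreP1`), and
the distinguisher cut off at the guessed query outputs `g ^ (b * y)` (`cdh_P1`). After the exchange,
messages, tag and permutation have disappeared from the view. A single application of IND-CPA then
turns the only encryption of `1` into one of `0` (`cpa_P1`), which hides the position `v`; only `z`
remains.

For `R`, the homomorphic operations return encryptions, so the four ciphertexts may be replaced by
fresh encryptions of the two components of the selected pair (`oblFilter_near`); this removes `z`
and all other messages. Next, extraction yields `m_{s,v}` unless the wrong half of the pair passes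
the tag test, which needs a coincidence of group elements or of `n`-bit strings (`retrieved_near`).
Finally, with `x` the exponent known to `R`, the query for the other message is `C / g ^ x = g ^ (a
- x)`; since `a` is uniform, this is a CDH challenge together with `g ^ y₁`, and the other pad may
be replaced by a uniform string (`cdh_R`, `masked_near`). The place of the chosen half in the pair
is a uniform bit.

The distinguisher has a random oracle while the adversaries in CDH and IND-CPA are plain circuits.
The reductions therefore sample the oracle lazily: a table of earlier queries is carried along the
run (`lazyRun_dist`, `lazy_circuit`).

Polynomial size is tracked through families of circuits. `FComp` is deterministic computation,
`FSamp` approximate sampling of a uniform element, `FRand` approximate sampling of a distribution. A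
circuit may depend on the parameter `θ` but not on the index, and all strings have lengths depending
on `θ` alone, so concatenations can be taken apart again. -/

open scoped ENNReal

/-! ### Expectations and closeness of distributions -/

/-- Expectation of a nonnegative function. -/
def ex {α : Type} (P : PMF α) (φ : α → ℝ≥0∞) : ℝ≥0∞ := ∑' a, P a * φ a

section
variable {α β γ : Type}

@[simp] theorem ex_pure (a : α) (φ : α → ℝ≥0∞) : ex (PMF.pure a) φ = φ a := by
  unfold ex
  rw [tsum_eq_single a]
  · simp
  · intro b hb; simp [PMF.pure_apply_of_ne _ _ hb]

@[simp] theorem ex_bind (P : PMF α) (f : α → PMF β) (φ : β → ℝ≥0∞) :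
    ex (P.bind f) φ = ex P fun a => ex (f a) φ := by
  unfold ex
  simp only [PMF.bind_apply, ← ENNReal.tsum_mul_right, ← ENNReal.tsum_mul_left]
  rw [ENNReal.tsum_comm]
  simp only [mul_assoc]

@[simp] theorem ex_map (P : PMF α) (f : α → β) (φ : β → ℝ≥0∞) :
    ex (P.map f) φ = ex P fun a => φ (f a) := by
  simp [PMF.map]

@[simp] theorem ex_const (P : PMF α) (c : ℝ≥0∞) : ex P (fun _ => c) = c := by
  simp [ex, ENNReal.tsum_mul_right, P.tsum_coe]

theorem ex_mono {P : PMF α} {φ ψ : α → ℝ≥0∞} (h : ∀ a, φ a ≤ ψ a) : ex P φ ≤ ex P ψ :=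
  ENNReal.tsum_le_tsum fun a => by gcongr; exact h a

theorem ex_le {P : PMF α} {φ : α → ℝ≥0∞} {c : ℝ≥0∞} (h : ∀ a, φ a ≤ c) : ex P φ ≤ c :=
  (ex_mono h).trans_eq (ex_const P c)

theorem ex_add (P : PMF α) (φ ψ : α → ℝ≥0∞) :
    ex P (fun a => φ a + ψ a) = ex P φ + ex P ψ := by
  simp [ex, mul_add, ENNReal.tsum_add]

theorem ex_sum {κ : Type} (s : Finset κ) (P : PMF α) (φ : κ → α → ℝ≥0∞) :
    ex P (fun a => ∑ k ∈ s, φ k a) = ∑ k ∈ s, ex P (φ k) := by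
  classical
  induction s using Finset.induction_on with
  | empty => simp
  | insert a s ha ih => simp only [Finset.sum_insert ha, ex_add, ih]

theorem ex_eq_apply [DecidableEq α] (P : PMF α) (a : α) :
    ex P (fun x => if x = a then 1 else 0) = P a := by
  unfold ex
  rw [tsum_eq_single a]
  · simp
  · intro b hb; simp [hb]

/-- Distributions are compared through expectations throughout: there `bind` becomes nesting, unused
samples vanish by `ex_const`, and independent samples commute by `ex_comm`. -/
theorem pmf_ext_ex {P Q : PMF α} (h : ∀ φ, ex P φ = ex Q φ) : P = Q := by
  classical
  ext a
  rw [← ex_eq_apply, ← ex_eq_apply, h]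

/-- Expectations of functions bounded by `1` differ by at most `ε`. -/
def Close (ε : ℝ≥0∞) (P Q : PMF α) : Prop :=
  ∀ φ : α → ℝ≥0∞, (∀ a, φ a ≤ 1) → ex P φ ≤ ex Q φ + ε

theorem Close.refl (P : PMF α) (ε : ℝ≥0∞) : Close ε P P := fun _ _ => le_self_add

theorem Close.of_eq {P Q : PMF α} (h : P = Q) {ε : ℝ≥0∞} : Close ε P Q := h ▸ Close.refl P ε

theorem Close.one (P Q : PMF α) {ε : ℝ≥0∞} (h : 1 ≤ ε) : Close ε P Q := fun _ hφ =>
  (ex_le hφ).trans (h.trans le_add_self)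

theorem Close.mono {ε δ : ℝ≥0∞} {P Q : PMF α} (h : Close ε P Q) (hε : ε ≤ δ) : Close δ P Q :=
  fun φ hφ => (h φ hφ).trans (by gcongr)

/-- Apply the one-sided bound to the complementary test `1 - φ`; finiteness of the expectations
allows the cancellation. -/
theorem Close.symm {ε : ℝ≥0∞} {P Q : PMF α} (h : Close ε P Q) : Close ε Q P := by
  intro φ hφ
  have key : ∀ R : PMF α, ex R φ + ex R (fun a => 1 - φ a) = 1 := fun R => by
    rw [← ex_add]; simp [add_tsub_cancel_of_le (hφ _)]
  have h1 := h (fun a => 1 - φ a) fun a => tsub_le_self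
  have hfin : ex P (fun a => 1 - φ a) ≠ ∞ :=
    ((ex_le fun a => tsub_le_self).trans_lt ENNReal.one_lt_top).ne
  have hfin' : ex Q (fun a => 1 - φ a) ≠ ∞ :=
    ((ex_le fun a => tsub_le_self).trans_lt ENNReal.one_lt_top).ne
  have : ex Q φ + ex Q (fun a => 1 - φ a) ≤ ex P φ + ε + ex Q (fun a => 1 - φ a) := by
    rw [key Q, add_assoc, add_comm ε]; nth_rw 1 [← key P]; gcongr
  exact (ENNReal.add_le_add_iff_right hfin').1 this

theorem Close.trans {ε δ : ℝ≥0∞} {P Q R : PMF α} (h : Close ε P Q) (h' : Close δ Q R) :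
    Close (ε + δ) P R := fun φ hφ =>
  (h φ hφ).trans (by rw [add_comm ε, ← add_assoc]; gcongr; exact h' φ hφ)

theorem Close.bind_left {ε : ℝ≥0∞} {P Q : PMF α} (h : Close ε P Q) (f : α → PMF β) :
    Close ε (P.bind f) (Q.bind f) := fun φ hφ => by
  simp only [ex_bind]; exact h _ fun a => ex_le hφ

theorem Close.map {ε : ℝ≥0∞} {P Q : PMF α} (h : Close ε P Q) (f : α → β) :
    Close ε (P.map f) (Q.map f) := h.bind_left _

/-- The error may depend on the sample, and only its mean is charged. Rejection sampling rests on
this: an error survives only on rejected draws. -/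
theorem Close.bind_ex {P : PMF α} {δ : α → ℝ≥0∞} {f g : α → PMF β}
    (h : ∀ a, Close (δ a) (f a) (g a)) : Close (ex P δ) (P.bind f) (P.bind g) := fun φ hφ => by
  simp only [ex_bind, ← ex_add]; exact ex_mono fun a => h a φ hφ

theorem Close.bind_right {P : PMF α} {δ : ℝ≥0∞} {f g : α → PMF β}
    (h : ∀ a, Close δ (f a) (g a)) : Close δ (P.bind f) (P.bind g) := by
  simpa using Close.bind_ex (P := P) h

/-- The factor `2` undoes the halving in `statDist`: pointwise, `P a` exceeds `Q a` by at most the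
absolute difference, and the test is at most `1`. -/
theorem close_of_statDist [Fintype α] {P Q : PMF α} {μ : ℝ} (h : statDist P Q ≤ μ) :
    Close (ENNReal.ofReal (2 * μ)) P Q := fun φ hφ => by
  have h2 : ∑ x, |(P x).toReal - (Q x).toReal| ≤ 2 * μ := by
    unfold statDist at h; linarith
  simp only [ex, tsum_fintype]
  calc ∑ a, P a * φ a
      ≤ ∑ a, (Q a * φ a + ENNReal.ofReal |(P a).toReal - (Q a).toReal|) := by
        refine Finset.sum_le_sum fun a _ => ?_
        have : P a ≤ Q a + ENNReal.ofReal |(P a).toReal - (Q a).toReal| := by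
          rw [← ENNReal.ofReal_toReal (P.apply_ne_top a),
            ← ENNReal.ofReal_toReal (Q.apply_ne_top a), ← ENNReal.ofReal_add (by positivity)
              (by positivity)]
          refine ENNReal.ofReal_le_ofReal ?_
          simp only [ENNReal.toReal_ofReal ENNReal.toReal_nonneg]
          linarith [le_abs_self ((P a).toReal - (Q a).toReal)]
        calc P a * φ a ≤ (Q a + ENNReal.ofReal |(P a).toReal - (Q a).toReal|) * φ a := by gcongr
          _ = Q a * φ a + ENNReal.ofReal |(P a).toReal - (Q a).toReal| * φ a := add_mul _ _ _
          _ ≤ _ := by gcongr; exact mul_le_of_le_one_right' (hφ a)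
    _ = ∑ a, Q a * φ a + ENNReal.ofReal (∑ a, |(P a).toReal - (Q a).toReal|) := by
        rw [Finset.sum_add_distrib, ENNReal.ofReal_sum_of_nonneg fun _ _ => abs_nonneg _]
    _ ≤ _ := by gcongr

theorem Close.apply_le {ε : ℝ≥0∞} {P Q : PMF α} (h : Close ε P Q) (a : α) : P a ≤ Q a + ε := by
  classical
  have := h (fun x => if x = a then 1 else 0) fun x => by split_ifs <;> simp
  simpa only [ex_eq_apply] using this

end

/-! ### Uniform distributions -/

section
variable {α β γ : Type} [Fintype α] [Nonempty α] [Fintype β] [Nonempty β]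

theorem ex_unif (φ : α → ℝ≥0∞) : ex (unif α) φ = (∑ a, φ a) / Fintype.card α := by
  simp [ex, unif, tsum_fintype, ENNReal.div_eq_inv_mul, Finset.mul_sum]

theorem unif_map_equiv (e : α ≃ β) : (unif α).map e = unif β := by
  refine pmf_ext_ex fun φ => ?_
  rw [ex_map, ex_unif, ex_unif, Fintype.card_congr e, ← e.sum_comp]

theorem unif_bind_equiv (e : α ≃ β) (f : β → PMF γ) :
    ((unif α).bind fun a => f (e a)) = (unif β).bind f := by
  rw [← unif_map_equiv e, PMF.bind_map]; rfl

theorem unif_bind_prod (f : α → β → PMF γ) :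
    ((unif α).bind fun a => (unif β).bind fun b => f a b) =
      (unif (α × β)).bind fun x => f x.1 x.2 := by
  refine pmf_ext_ex fun φ => ?_
  simp only [ex_bind, ex_unif, Fintype.sum_prod_type, Fintype.card_prod, ENNReal.div_eq_inv_mul,
    ← Finset.mul_sum, Nat.cast_mul]
  rw [ENNReal.mul_inv (by simp) (by simp), mul_assoc]

theorem unif_prod : unif (α × β) = (unif α).bind fun a => (unif β).map fun b => (a, b) := by
  have := unif_bind_prod (α := α) (β := β) fun a b => PMF.pure (a, b)
  simp only [Prod.mk.eta] at this
  rw [PMF.bind_pure] at this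
  exact this.symm

theorem ex_unif_eq [DecidableEq α] (a : α) :
    ex (unif α) (fun x => if x = a then 1 else 0) = (Fintype.card α : ℝ≥0∞)⁻¹ := by
  rw [ex_eq_apply]; simp [unif]

end

/-! ### Resampling a random function at given points. -/

section override
variable {J A B γ : Type}

/-- `G` with its values at the points `pts` replaced by `u`. -/
def override (G : A → B) (pts : J → A) (u : J → B) : A → B := fun q =>
  open Classical in if h : ∃ j, pts j = q then u h.choose else G q

theorem override_pts (G : A → B) {pts : J → A} (hp : Function.Injective pts) (u : J → B) (j : J) :
    override G pts u (pts j) = u j := by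
  have h : ∃ j', pts j' = pts j := ⟨j, rfl⟩
  rw [override, dif_pos h]
  exact congrArg u (hp h.choose_spec)

theorem override_of_ne (G : A → B) (pts : J → A) (u : J → B) {q : A} (h : ∀ j, pts j ≠ q) :
    override G pts u q = G q := dif_neg (by simpa using h)

variable [Fintype J] [DecidableEq J] [Fintype A] [DecidableEq A] [Fintype B] [Nonempty B]

/-- Exchanging the values of `G` at the points with `u` is an involution of the pairs `(G, u)`, so
the first component stays uniform. Injectivity of `pts` is what allows `u` to be read back. -/
theorem unif_bind_override {pts : J → A} (hp : Function.Injective pts) (f : (A → B) → PMF γ) :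
    ((unif (A → B)).bind fun G => (unif (J → B)).bind fun u => f (override G pts u)) =
      (unif (A → B)).bind f := by
  let φ : (A → B) × (J → B) → (A → B) × (J → B) := fun x => (override x.1 pts x.2, x.1 ∘ pts)
  have hφ : Function.Involutive φ := by
    rintro ⟨G, u⟩
    refine Prod.ext (funext fun q => ?_) (funext fun j => override_pts _ hp _ _)
    by_cases h : ∃ j, pts j = q
    · obtain ⟨j, rfl⟩ := h
      exact override_pts _ hp _ _
    · push Not at h
      simp only [φ]
      rw [override_of_ne _ _ _ h, override_of_ne _ _ _ h]
  rw [unif_bind_prod]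
  rw [← unif_bind_equiv (hφ.toPerm φ)]
  have : (fun a : (A → B) × (J → B) => f (override (hφ.toPerm φ a).1 pts (hφ.toPerm φ a).2)) =
      fun a => f a.1 := by
    funext a
    have := congrArg Prod.fst (hφ a)
    exact congrArg f this
  rw [this, ← unif_bind_prod fun G _ => f G]
  simp

/-- A uniform function may be resampled at one point. -/
theorem unif_resample (q : A) (f : (A → B) → PMF γ) :
    ((unif (A → B)).bind fun G => (unif B).bind fun b => f (Function.update G q b)) =
      (unif (A → B)).bind f := by
  rw [← unif_bind_override (pts := fun _ : Unit => q) (fun _ _ _ => rfl) f]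
  congr 1; funext G
  rw [← unif_bind_equiv (Equiv.funUnique Unit B)]
  congr 1; funext u; congr 1; funext q'
  by_cases h : q' = q
  · subst h
    have := override_pts (J := Unit) G (pts := fun _ => q') (fun _ _ _ => rfl) u ()
    rw [this]; simp
  · rw [override_of_ne _ _ _ (by simpa using Ne.symm h), Function.update_of_ne h]

end override

/-- Resample the row `t`, then one entry of that row. This isolates a single exponent of the sender
as an independent uniform variable. -/
theorem unif_resample₂ {A C B γ : Type} [Fintype A] [DecidableEq A] [Fintype C] [DecidableEq C]
    [Fintype B] [Nonempty B] (t : A) (i : C) (f : (A → C → B) → PMF γ) :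
    ((unif (A → C → B)).bind fun y => (unif B).bind fun b =>
      f (Function.update y t (Function.update (y t) i b))) = (unif (A → C → B)).bind f := by
  rw [← unif_resample t, ← unif_resample t f]
  congr 1; funext y
  simp only [Function.update_self, Function.update_idem]
  exact unif_resample i fun g => f (Function.update y t g)

/-! ### Negligible error bounds -/

/-- Error bounds dominated by a negligible function. -/
def ENeg (ε : ℕ → ℝ≥0∞) : Prop :=
  ∃ μ : ℕ → ℝ, Negligible μ ∧ (∀ n, 0 ≤ μ n) ∧ ∀ n, ε n ≤ ENNReal.ofReal (μ n)

theorem Negligible.abs {μ : ℕ → ℝ} (h : Negligible μ) : Negligible fun n => |μ n| :=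
  by
  have := (Asymptotics.superpolynomialDecay_iff_superpolynomialDecay_abs _ _ _).1 h
  simp only [Nat.abs_cast] at this
  exact this

theorem ENeg.of_negligible {μ : ℕ → ℝ} (h : Negligible μ) : ENeg fun n => ENNReal.ofReal (μ n) :=
  ⟨_, h.abs, fun _ => abs_nonneg _, fun _ => ENNReal.ofReal_le_ofReal (le_abs_self _)⟩

theorem ENeg.mono {ε δ : ℕ → ℝ≥0∞} (h : ENeg ε) (hδ : ∀ n, δ n ≤ ε n) : ENeg δ :=
  let ⟨μ, h1, h2, h3⟩ := h
  ⟨μ, h1, h2, fun n => (hδ n).trans (h3 n)⟩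

theorem ENeg.add {ε δ : ℕ → ℝ≥0∞} (h : ENeg ε) (h' : ENeg δ) : ENeg fun n => ε n + δ n :=
  let ⟨μ, h1, h2, h3⟩ := h
  let ⟨ν, k1, k2, k3⟩ := h'
  ⟨fun n => μ n + ν n, Asymptotics.SuperpolynomialDecay.add h1 k1,
    fun n => add_nonneg (h2 n) (k2 n), fun n => by
    rw [ENNReal.ofReal_add (h2 n) (k2 n)]; exact add_le_add (h3 n) (k3 n)⟩

theorem ENeg.poly_mul {ε : ℕ → ℝ≥0∞} (h : ENeg ε) {f : ℕ → ℕ} (hf : PolyBounded f) :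
    ENeg fun n => f n * ε n := by
  obtain ⟨μ, h1, h2, h3⟩ := h
  obtain ⟨q, hq⟩ := hf
  refine ⟨fun n => ((q.eval n : ℕ) : ℝ) * μ n, ?_, fun n => by have := h2 n; positivity, fun n => ?_⟩
  · have := Asymptotics.SuperpolynomialDecay.polynomial_mul h1 (q.map (Nat.castRingHom ℝ))
    refine this.congr fun n => ?_
    simp only [Polynomial.eval_natCast_map, Nat.coe_castRingHom, Nat.cast_id]
  · rw [ENNReal.ofReal_mul (by positivity), ENNReal.ofReal_natCast]
    exact mul_le_mul' (by exact_mod_cast hq n) (h3 n)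

theorem ENeg.two_pow : ENeg fun n => ((2 : ℝ≥0∞) ^ n)⁻¹ := by
  refine ⟨fun n => ((2 : ℝ) ^ n)⁻¹, ?_, fun n => by positivity, fun n => ?_⟩
  · intro k
    have := tendsto_pow_const_mul_const_pow_of_lt_one k (r := (1 / 2 : ℝ)) (by norm_num)
      (by norm_num)
    simpa using this
  · rw [ENNReal.ofReal_inv_of_pos (by positivity), ENNReal.ofReal_pow (by norm_num)]
    simp

/-! ### Composition of circuits -/

/-- The memory after running a list of gates. -/
def runGates (O : List Bool → List Bool) (gs : List Gate) (mem : List Bool) : List Bool :=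
  gs.foldl (Gate.step O) mem

/-- Total cost of a list of gates. -/
def gatesCost (gs : List Gate) : ℕ := (gs.map Gate.cost).sum

/-- The gate with all its wires shifted by `d`. -/
def Gate.shift (d : ℕ) : Gate → Gate
  | .op f i j k => .op f (d + i) (d + j) (d + k)
  | .query q => .query (q.map (d + ·))

@[simp] theorem Gate.cost_shift (d : ℕ) (g : Gate) : (g.shift d).cost = g.cost := by
  cases g <;> simp [Gate.shift, Gate.cost]

theorem gatesCost_append (gs gs' : List Gate) :
    gatesCost (gs ++ gs') = gatesCost gs + gatesCost gs' := by simp [gatesCost]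

theorem gatesCost_shift (d : ℕ) (gs : List Gate) :
    gatesCost (gs.map (Gate.shift d)) = gatesCost gs := by
  simp [gatesCost, Function.comp_def]

theorem runGates_append (O : List Bool → List Bool) (gs gs' : List Gate) (mem : List Bool) :
    runGates O (gs ++ gs') mem = runGates O gs' (runGates O gs mem) := List.foldl_append

theorem getD_shift (X m : List Bool) (i : ℕ) :
    (X ++ m).getD (X.length + i) false = m.getD i false := by
  rw [List.getD_append_right _ _ _ _ (Nat.le_add_right _ _), Nat.add_sub_cancel_left]

theorem step_shift (O : List Bool → List Bool) (X m : List Bool) (g : Gate) :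
    (g.shift X.length).step O (X ++ m) = X ++ g.step O m := by
  cases g with
  | op f i j k => simp only [Gate.shift, Gate.step, getD_shift, List.append_assoc]
  | query q =>
    simp only [Gate.shift, Gate.step, List.map_map, Function.comp_def, getD_shift,
      List.append_assoc]

/-- Shifted gates never look at the prefix `X`. Composition works because one run leaves its result
at the end of the memory and the next run, shifted, sees only that. -/
theorem runGates_shift (O : List Bool → List Bool) (X : List Bool) (gs : List Gate) :
    ∀ m, runGates O (gs.map (Gate.shift X.length)) (X ++ m) = X ++ runGates O gs m := by
  induction gs with
  | nil => intro m; rfl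
  | cons g gs ih => intro m; simp only [runGates, List.map_cons, List.foldl_cons, step_shift]; exact ih _

theorem runGates_prefix (O : List Bool → List Bool) (gs : List Gate) :
    ∀ m, ∃ X, runGates O gs m = m ++ X := by
  induction gs with
  | nil => intro m; exact ⟨[], by simp [runGates]⟩
  | cons g gs ih =>
    intro m
    obtain ⟨X, hX⟩ := ih (g.step O m)
    cases g <;> exact ⟨_, by simp only [runGates, List.foldl_cons] at hX ⊢; rw [hX]; simp only [Gate.step, List.append_assoc]; rfl⟩

/-- The number of wires that a gate adds. -/
def Gate.grow (ol : ℕ → ℕ) : Gate → ℕ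
  | .op _ _ _ _ => 1
  | .query q => ol q.length

/-- The length of an answer depends only on the length of the question. -/
def AnswerLen {ι : Type} (O : ι → List Bool → List Bool) (ol : ℕ → ℕ) : Prop :=
  ∀ i q, (O i q).length = ol q.length

/-- The memory length is the same for every input of the family, so the positions of wires are known
when a circuit is built. -/
theorem length_runGates {ι : Type} {O : ι → List Bool → List Bool} {ol : ℕ → ℕ}
    (hO : AnswerLen O ol) (i : ι) (gs : List Gate) :
    ∀ m, (runGates (O i) gs m).length = m.length + (gs.map (Gate.grow ol)).sum := by
  induction gs with
  | nil => intro m; simp [runGates]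
  | cons g gs ih =>
    intro m
    have := ih (g.step (O i) m)
    simp only [runGates, List.foldl_cons, List.map_cons, List.sum_cons] at this ⊢
    rw [this]
    cases g <;> simp [Gate.step, Gate.grow, hO i _] <;> ring

/-- A gate that computes a function of three of the first `Λ` wires. -/
def localGate (Λ : ℕ) (s : (Bool → Bool → Bool → Bool) × ℕ × ℕ × ℕ) : Gate :=
  .op (fun x y z => s.1 (decide (s.2.1 < Λ) && x) (decide (s.2.2.1 < Λ) && y)
    (decide (s.2.2.2 < Λ) && z)) s.2.1 s.2.2.1 s.2.2.2

/-- The value computed by a local gate. -/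
def localVal (mem : List Bool) (s : (Bool → Bool → Bool → Bool) × ℕ × ℕ × ℕ) : Bool :=
  s.1 (mem.getD s.2.1 false) (mem.getD s.2.2.1 false) (mem.getD s.2.2.2 false)

/-- Explains the guard in `localGate`: a wire missing from the original memory must read `false`
even after earlier gates have appended a wire with that number. -/
theorem and_getD_append (mem X : List Bool) (i : ℕ) :
    (decide (i < mem.length) && (mem ++ X).getD i false) = mem.getD i false := by
  by_cases h : i < mem.length
  · rw [List.getD_append _ _ _ _ h]; simp [h]
  · simp [h]

theorem runGates_local (O : List Bool → List Bool) (mem : List Bool)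
    (L : List ((Bool → Bool → Bool → Bool) × ℕ × ℕ × ℕ)) :
    ∀ X, runGates O (L.map (localGate mem.length)) (mem ++ X) =
      mem ++ X ++ L.map (localVal mem) := by
  induction L with
  | nil => intro X; simp [runGates]
  | cons s L ih =>
    intro X
    have h := ih (X ++ [localVal mem s])
    simp only [runGates, List.map_cons, List.foldl_cons] at h ⊢
    rw [localGate, Gate.step, and_getD_append, and_getD_append, and_getD_append]
    rw [List.append_assoc mem X, ← localVal, h]
    simp

theorem gatesCost_local (Λ : ℕ) (L : List ((Bool → Bool → Bool → Bool) × ℕ × ℕ × ℕ)) :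
    gatesCost (L.map (localGate Λ)) = L.length := by
  induction L with
  | nil => rfl
  | cons s L ih =>
    simp only [gatesCost, List.map_cons, List.sum_cons] at ih ⊢
    rw [ih]; simp [localGate, Gate.cost]; ring

/-- Local gates that copy the wires `idx`. -/
def copySpec (idx : List ℕ) : List ((Bool → Bool → Bool → Bool) × ℕ × ℕ × ℕ) :=
  idx.map fun i => (fun x _ _ => x, i, 0, 0)

theorem copySpec_val (mem : List Bool) (idx : List ℕ) :
    (copySpec idx).map (localVal mem) = idx.map fun i => mem.getD i false := by
  simp [copySpec, localVal, Function.comp_def]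

theorem map_getD_range' (X b : List Bool) :
    ((List.range' X.length b.length).map fun i => (X ++ b).getD i false) = b := by
  apply List.ext_getElem
  · simp
  · intro i h1 h2
    simp only [List.getElem_map, List.getElem_range', one_mul, getD_shift]
    simp [h2]

theorem map_getD_range (b : List Bool) :
    ((List.range b.length).map fun i => b.getD i false) = b := by
  have := map_getD_range' [] b
  simpa [List.range_eq_range'] using this

/-! ### Single circuits: composition, concatenation, iteration. -/

section Comp
variable {ι : Type} {O : ι → List Bool → List Bool} {inp mid out : ι → List Bool}

/-- A circuit of size at most `s` computes `inp i ↦ out i` with oracle `O i`. -/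
def Comp (O : ι → List Bool → List Bool) (inp : ι → List Bool) (s : ℕ) (out : ι → List Bool) :
    Prop :=
  ∃ c : Circuit, c.size ≤ s ∧ ∀ i, c.eval (O i) (inp i) = out i

theorem Comp.mono {s s' : ℕ} (h : Comp O inp s out) (hs : s ≤ s') : Comp O inp s' out :=
  let ⟨c, h1, h2⟩ := h
  ⟨c, h1.trans hs, h2⟩

theorem Comp.rewire (idx : List ℕ) :
    Comp O inp idx.length fun i => idx.map fun j => (inp i).getD j false :=
  ⟨⟨[], idx⟩, by simp [Circuit.size], fun i => rfl⟩

theorem Comp.id {Λ : ℕ} (hΛ : ∀ i, (inp i).length = Λ) : Comp O inp Λ inp := by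
  have h := Comp.rewire (O := O) (inp := inp) (List.range Λ)
  rw [List.length_range] at h
  convert h using 2 with i
  rw [← hΛ i, map_getD_range]

/-- A circuit can be made to leave its output at the end of the memory. -/
theorem Comp.norm {s Λ : ℕ} {ol : ℕ → ℕ} (hO : AnswerLen O ol) (hΛ : ∀ i, (inp i).length = Λ)
    (h : Comp O inp s out) : ∃ (gs : List Gate) (D m : ℕ) (X : ι → List Bool), gatesCost gs ≤ s ∧
      m ≤ s ∧ (∀ i, (X i).length = D) ∧ (∀ i, (out i).length = m) ∧
      ∀ i, runGates (O i) gs (inp i) = X i ++ out i := by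
  obtain ⟨c, hc, he⟩ := h
  have hl : ∀ i, (runGates (O i) c.gates (inp i)).length =
      Λ + (c.gates.map (Gate.grow ol)).sum := fun i => by
    rw [length_runGates hO, hΛ]
  refine ⟨c.gates ++ (copySpec c.outs).map
      (localGate (Λ + (c.gates.map (Gate.grow ol)).sum)), _, c.outs.length,
    fun i => runGates (O i) c.gates (inp i), ?_, le_trans (by simp [Circuit.size]) hc, hl,
    fun i => ?_, fun i => ?_⟩
  · rw [gatesCost_append, gatesCost_local]
    simpa [copySpec, Circuit.size, gatesCost] using hc
  · rw [← he i]; simp [Circuit.eval]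
  · rw [runGates_append, ← hl i]
    have := runGates_local (O i) (runGates (O i) c.gates (inp i)) (copySpec c.outs) []
    simp only [List.append_nil, copySpec_val] at this
    rw [this, ← he i]; rfl

theorem Comp.length_out {s : ℕ} (h : Comp O inp s out) : ∃ m ≤ s, ∀ i, (out i).length = m := by
  obtain ⟨c, hc, he⟩ := h
  exact ⟨c.outs.length, le_trans (by simp [Circuit.size]) hc, fun i => by
    rw [← he i]; simp [Circuit.eval]⟩

/-- The first circuit is normalised so that its output follows a prefix of fixed length `D`; the
second is shifted by `D`. -/
theorem Comp.comp {s s' Λ : ℕ} {ol : ℕ → ℕ} (hO : AnswerLen O ol)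
    (hΛ : ∀ i, (inp i).length = Λ) (h : Comp O inp s mid) (h' : Comp O mid s' out) :
    Comp O inp (s + s') out := by
  obtain ⟨gs, D, m, X, h1, -, h2, -, h3⟩ := h.norm hO hΛ
  obtain ⟨c, hc, he⟩ := h'
  refine ⟨⟨gs ++ c.gates.map (Gate.shift D), c.outs.map (D + ·)⟩, ?_, fun i => ?_⟩
  · rw [Circuit.size, ← gatesCost, gatesCost_append, gatesCost_shift]
    rw [Circuit.size, ← gatesCost] at hc
    simp only [List.length_map]; omega
  · rw [Circuit.eval, ← runGates, runGates_append, h3, ← h2 i, runGates_shift, ← he i,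
      List.map_map]
    simp only [Function.comp_def, getD_shift]; rfl

/-- After the first output a copy of the input is appended, and the second circuit runs on that
copy. The cost is `s` for the first run, `Λ` for the copy, `s'` for the second circuit, and at most
another `s` for the output wires of the first. -/
theorem Comp.append {s s' Λ : ℕ} {ol : ℕ → ℕ} (hO : AnswerLen O ol)
    (hΛ : ∀ i, (inp i).length = Λ) (h : Comp O inp s mid) (h' : Comp O inp s' out) :
    Comp O inp (2 * s + Λ + s') fun i => mid i ++ out i := by
  obtain ⟨gs, D, m, X, h1, hm, h2, hml, h3⟩ := h.norm hO hΛ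
  obtain ⟨c, hc, he⟩ := h'
  have hl : ∀ i, (X i ++ mid i).length = D + m := fun i => by
    rw [List.length_append, h2, hml]
  have hcopy : ∀ i, runGates (O i) (gs ++ (copySpec (List.range Λ)).map (localGate (D + m)))
      (inp i) = (X i ++ mid i) ++ inp i := fun i => by
    rw [runGates_append, h3]
    have := runGates_local (O i) (X i ++ mid i) (copySpec (List.range Λ)) []
    rw [List.append_nil, hl, copySpec_val] at this
    rw [this]
    congr 1
    obtain ⟨Y, hY⟩ := runGates_prefix (O i) gs (inp i)
    rw [← h3, hY]
    conv_rhs => rw [← map_getD_range (inp i), hΛ i]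
    refine List.map_congr_left fun j hj => ?_
    rw [List.getD_append]
    rw [hΛ]; exact List.mem_range.1 hj
  refine ⟨⟨gs ++ (copySpec (List.range Λ)).map (localGate (D + m)) ++
    c.gates.map (Gate.shift (D + m)), List.range' D m ++ c.outs.map (D + m + ·)⟩, ?_, fun i => ?_⟩
  · rw [Circuit.size, ← gatesCost, gatesCost_append, gatesCost_append, gatesCost_shift,
      gatesCost_local]
    rw [Circuit.size, ← gatesCost] at hc
    simp only [List.length_append, List.length_map, List.length_range', copySpec,
      List.length_range]
    omega
  · rw [Circuit.eval, ← runGates, runGates_append, hcopy, ← hl i, runGates_shift, List.map_append,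
      List.map_map]
    congr 1
    · rw [← h2 i, ← hml i]
      conv_rhs => rw [← map_getD_range' (X i) (mid i)]
      refine List.map_congr_left fun j hj => ?_
      rw [List.getD_append]
      rw [List.mem_range'_1] at hj
      simpa using hj.2
    · rw [← he i]
      simp only [Function.comp_def, getD_shift]; rfl

theorem Comp.local {Λ : ℕ} (hΛ : ∀ i, (inp i).length = Λ)
    (L : List ((Bool → Bool → Bool → Bool) × ℕ × ℕ × ℕ)) :
    Comp O inp (2 * L.length) fun i => L.map (localVal (inp i)) := by
  refine ⟨⟨L.map (localGate Λ), List.range' Λ L.length⟩, ?_, fun i => ?_⟩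
  · rw [Circuit.size, ← gatesCost, gatesCost_local]; simp; omega
  · rw [Circuit.eval, ← runGates]
    have := runGates_local (O i) (inp i) L []
    rw [List.append_nil, hΛ] at this
    rw [this]
    have h := map_getD_range' (inp i) (L.map (localVal (inp i)))
    rwa [List.length_map, hΛ] at h

theorem Comp.query {Λ : ℕ} {ol : ℕ → ℕ} (hO : AnswerLen O ol) (hΛ : ∀ i, (inp i).length = Λ) :
    Comp O inp (1 + Λ + ol Λ) fun i => O i (inp i) := by
  refine ⟨⟨[.query (List.range Λ)], List.range' Λ (ol Λ)⟩, ?_, fun i => ?_⟩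
  · simp [Circuit.size, Gate.cost]
  · have h1 : (List.range Λ).map (fun j => (inp i).getD j false) = inp i := by
      rw [← hΛ i, map_getD_range]
    simp only [Circuit.eval, List.foldl_cons, List.foldl_nil, Gate.step, h1]
    have h := map_getD_range' (inp i) (O i (inp i))
    rwa [hΛ, hO, hΛ] at h

theorem Comp.iterate {s Λ : ℕ} {ol : ℕ → ℕ} (hO : AnswerLen O ol) (st : ℕ → ι → List Bool)
    (hΛ : ∀ i, (st 0 i).length = Λ) :
    ∀ T, (∀ j < T, Comp O (st j) s (st (j + 1))) → Comp O (st 0) (Λ + T * s) (st T) := by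
  intro T
  induction T with
  | zero => intro _; simpa using Comp.id hΛ
  | succ T ih =>
    intro h
    have := (ih fun j hj => h j (by omega)).comp hO hΛ (h T (by omega))
    exact this.mono (by ring_nf; omega)

theorem Comp.nil {s : ℕ} : Comp O inp s fun _ => [] :=
  ⟨⟨[], []⟩, by simp [Circuit.size], fun _ => rfl⟩

theorem Comp.flatMap {κ : Type} {s Λ : ℕ} {ol : ℕ → ℕ} (hO : AnswerLen O ol)
    (hΛ : ∀ i, (inp i).length = Λ) {out : κ → ι → List Bool} :
    ∀ L : List κ, (∀ t ∈ L, Comp O inp s (out t)) →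
      Comp O inp (L.length * (2 * s + Λ)) fun i => L.flatMap fun t => out t i := by
  intro L
  induction L with
  | nil => intro _; exact Comp.nil
  | cons t L ih =>
    intro h
    have := (h t (by simp)).append hO hΛ (ih fun u hu => h u (by simp [hu]))
    simp only [List.flatMap_cons]
    exact this.mono (by simp only [List.length_cons]; ring_nf; omega)

theorem Comp.reindex {κ : Type} {s : ℕ} (f : κ → ι) (h : Comp O inp s out) :
    Comp (fun i => O (f i)) (fun i => inp (f i)) s fun i => out (f i) :=
  let ⟨c, h1, h2⟩ := h
  ⟨c, h1, fun i => h2 (f i)⟩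

end Comp

/-- The circuit without its oracle gates. -/
def Circuit.strip (c : Circuit) : Circuit where
  gates := c.gates.filter fun g => match g with
    | .op _ _ _ _ => true
    | .query _ => false
  outs := c.outs

theorem Circuit.size_strip (c : Circuit) : c.strip.size ≤ c.size := by
  unfold Circuit.size Circuit.strip
  gcongr
  exact List.Sublist.sum_le_sum (List.filter_sublist.map _) (by simp)

/-- Under the trivial oracle a query gate appends nothing, so deleting it moves no wire. Circuits
specified without oracle thereby become usable where an oracle is present. -/
theorem Circuit.eval_strip (O : List Bool → List Bool) (c : Circuit) (x : List Bool) :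
    c.strip.eval O x = c.eval noOracle x := by
  obtain ⟨gs, outs⟩ := c
  unfold Circuit.eval Circuit.strip
  suffices h : ∀ m, (gs.filter fun g => match g with
      | .op _ _ _ _ => true
      | .query _ => false).foldl (Gate.step O) m = gs.foldl (Gate.step noOracle) m by
    simp only [h]
  induction gs with
  | nil => intro m; rfl
  | cons g gs ih =>
    intro m
    cases g with
    | op f i j k => simpa [Gate.step] using ih (m ++ [f (m.getD i false) (m.getD j false) (m.getD k false)])
    | query q => simpa [Gate.step, noOracle] using ih _

/-! ### Families of circuits of polynomial size -/

theorem eval_mono (q : Polynomial ℕ) {a b : ℕ} (h : a ≤ b) : q.eval a ≤ q.eval b := by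
  simp only [Polynomial.eval_eq_sum, Polynomial.sum]
  gcongr

/-- A family of index types with oracles: the parameter `θ` has security level `n θ` and size
`sz θ`; circuits may depend on `θ` but not on the index in `ι θ`. -/
structure Fam : Type 1 where
  Θ : Type
  n : Θ → ℕ
  sz : Θ → ℕ
  ι : Θ → Type
  O : ∀ θ, ι θ → List Bool → List Bool
  ol : Θ → ℕ → ℕ
  K : Θ → ℕ
  n_le : ∀ θ, n θ ≤ sz θ
  hO : ∀ θ, AnswerLen (O θ) (ol θ)
  hK : ∀ θ m, ol θ m ≤ K θ
  hKpoly : ∃ q : Polynomial ℕ, ∀ θ, K θ ≤ q.eval (sz θ)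

/-- Strings indexed by a family. -/
abbrev Fam.Str (F : Fam) : Type := ∀ θ, F.ι θ → List Bool

/-- Functions of the parameter that are polynomial in its size. -/
def Fam.PB (F : Fam) (f : F.Θ → ℕ) : Prop := ∃ q : Polynomial ℕ, ∀ θ, f θ ≤ q.eval (F.sz θ)

section PB
variable {F : Fam} {f g : F.Θ → ℕ}

theorem Fam.PB.mono (h : F.PB f) (hg : ∀ θ, g θ ≤ f θ) : F.PB g :=
  let ⟨q, hq⟩ := h
  ⟨q, fun θ => (hg θ).trans (hq θ)⟩

theorem Fam.PB.const (c : ℕ) : F.PB fun _ => c := ⟨Polynomial.C c, fun _ => by simp⟩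

theorem Fam.PB.sz : F.PB F.sz := ⟨Polynomial.X, fun _ => by simp⟩

theorem Fam.PB.n : F.PB F.n := Fam.PB.sz.mono F.n_le

theorem Fam.PB.add (h : F.PB f) (h' : F.PB g) : F.PB fun θ => f θ + g θ :=
  let ⟨q, hq⟩ := h
  let ⟨r, hr⟩ := h'
  ⟨q + r, fun θ => by rw [Polynomial.eval_add]; exact add_le_add (hq θ) (hr θ)⟩

theorem Fam.PB.mul (h : F.PB f) (h' : F.PB g) : F.PB fun θ => f θ * g θ :=
  let ⟨q, hq⟩ := h
  let ⟨r, hr⟩ := h'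
  ⟨q * r, fun θ => by rw [Polynomial.eval_mul]; exact Nat.mul_le_mul (hq θ) (hr θ)⟩

theorem Fam.PB.poly {b : ℕ → ℕ} (hb : PolyBounded b) : F.PB fun θ => b (F.n θ) :=
  let ⟨q, hq⟩ := hb
  ⟨q, fun θ => (hq _).trans (eval_mono q (F.n_le θ))⟩

end PB

/-- Strings whose length depends only on the parameter, polynomially. -/
def FLen (F : Fam) (inp : F.Str) : Prop :=
  ∃ L : F.Θ → ℕ, F.PB L ∧ ∀ θ i, (inp θ i).length = L θ

/-- `inp ↦ out` is computed by oracle circuits of polynomial size. -/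
def FComp (F : Fam) (inp out : F.Str) : Prop :=
  ∃ s : F.Θ → ℕ, F.PB s ∧ ∀ θ, Comp (F.O θ) (inp θ) (s θ) (out θ)

section FComp
variable {F : Fam} {inp mid out X Y : F.Str}

theorem FComp.len (h : FComp F inp out) : FLen F out := by
  obtain ⟨s, hs, h⟩ := h
  choose m hm hl using fun θ => (h θ).length_out
  exact ⟨m, hs.mono hm, hl⟩

theorem FLen.append (h : FLen F X) (h' : FLen F Y) : FLen F fun θ i => X θ i ++ Y θ i :=
  let ⟨a, ha, hx⟩ := h
  let ⟨b, hb, hy⟩ := h'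
  ⟨_, ha.add hb, fun θ i => by rw [List.length_append, hx, hy]⟩

theorem FLen.toL {m : F.Θ → ℕ} (hm : F.PB m) (b : ∀ θ, F.ι θ → Bits (m θ)) :
    FLen F fun θ i => toL (b θ i) := ⟨m, hm, fun θ i => by simp [DUQMR.toL]⟩

theorem FLen.expL {p : ∀ θ, F.ι θ → ℕ} (a : ∀ θ i, ZMod (p θ i)) :
    FLen F fun θ i => expL (F.n θ) (a θ i) := FLen.toL (Fam.PB.n.add (.const 1)) _

theorem FLen.single (b : ∀ θ, F.ι θ → Bool) : FLen F fun θ i => [b θ i] :=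
  ⟨fun _ => 1, .const 1, fun _ _ => rfl⟩

theorem FComp.comp (hI : FLen F inp) (h : FComp F inp mid) (h' : FComp F mid out) :
    FComp F inp out :=
  let ⟨_, _, hL⟩ := hI
  let ⟨_, hs, k⟩ := h
  let ⟨_, hs', k'⟩ := h'
  ⟨_, hs.add hs', fun θ => (k θ).comp (F.hO θ) (hL θ) (k' θ)⟩

theorem FComp.append (hI : FLen F inp) (h : FComp F inp X) (h' : FComp F inp Y) :
    FComp F inp fun θ i => X θ i ++ Y θ i :=
  let ⟨_, hl, hL⟩ := hI
  let ⟨_, hs, k⟩ := h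
  let ⟨_, hs', k'⟩ := h'
  ⟨_, (((Fam.PB.const 2).mul hs).add hl).add hs', fun θ => (k θ).append (F.hO θ) (hL θ) (k' θ)⟩

theorem FComp.id (hI : FLen F inp) : FComp F inp inp :=
  let ⟨_, hl, hL⟩ := hI
  ⟨_, hl, fun θ => Comp.id (hL θ)⟩

theorem FComp.local (hI : FLen F inp) (hX : FComp F inp X)
    (L : F.Θ → List ((Bool → Bool → Bool → Bool) × ℕ × ℕ × ℕ)) (hL : F.PB fun θ => (L θ).length) :
    FComp F inp fun θ i => (L θ).map (localVal (X θ i)) := by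
  obtain ⟨l, hl, hl'⟩ := hX.len
  exact FComp.comp hI hX ⟨_, (Fam.PB.const 2).mul hL, fun θ => Comp.local (hl' θ) (L θ)⟩

theorem FComp.const (hI : FLen F inp) (l : F.Θ → List Bool) (hl : F.PB fun θ => (l θ).length) :
    FComp F inp fun θ _ => l θ := by
  have := FComp.local hI (.id hI) (fun θ => (l θ).map fun b => (fun _ _ _ => b, 0, 0, 0))
    (by simpa using hl)
  simpa [localVal, Function.comp_def] using this

theorem FComp.rewire (hI : FLen F inp) (hX : FComp F inp X) (idx : F.Θ → List ℕ)
    (h : F.PB fun θ => (idx θ).length) :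
    FComp F inp fun θ i => (idx θ).map fun j => (X θ i).getD j false :=
  FComp.comp hI hX ⟨_, h, fun _ => Comp.rewire _⟩

theorem FComp.slice (hI : FLen F inp) (hX : FComp F inp X) (a b : F.Θ → ℕ) :
    FComp F inp fun θ i => ((X θ i).drop (a θ)).take (b θ) := by
  obtain ⟨l, hl, hl'⟩ := hX.len
  have := FComp.rewire hI hX (fun θ => List.range' (a θ) (min (b θ) (l θ - a θ)))
    (hl.mono fun θ => by simp)
  convert this using 3 with θ i
  apply List.ext_getElem
  · simp [hl']
  · intro j h1 h2
    simp only [List.length_take, List.length_drop, hl'] at h1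
    simp only [List.getElem_take, List.getElem_drop, List.getElem_map, List.getElem_range',
      one_mul]
    rw [List.getD_eq_getElem]

/-- Concatenations can be parsed because the lengths depend on the parameter only. The circuits
below recover their variables from their input in this way. -/
theorem FComp.left (hI : FLen F inp) (hX : FLen F X)
    (h : FComp F inp fun θ i => X θ i ++ Y θ i) : FComp F inp X := by
  obtain ⟨l, hl, hl'⟩ := hX
  have := FComp.slice hI h (fun _ => 0) l
  convert this using 3 with θ i
  simp [← hl' θ i]

theorem FComp.right (hI : FLen F inp) (hX : FLen F X) (hY : FLen F Y)
    (h : FComp F inp fun θ i => X θ i ++ Y θ i) : FComp F inp Y := by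
  obtain ⟨l, hl, hl'⟩ := hX
  obtain ⟨m, hm, hm'⟩ := hY
  have := FComp.slice hI h l m
  convert this using 3 with θ i
  simp [← hl' θ i, ← hm' θ i]

theorem FComp.query (hI : FLen F inp) (hX : FComp F inp X) :
    FComp F inp fun θ i => F.O θ i (X θ i) := by
  obtain ⟨l, hl, hl'⟩ := hX.len
  have hKp : F.PB F.K := F.hKpoly
  exact FComp.comp hI hX ⟨_, ((Fam.PB.const 1).add hl).add (hKp.mono fun θ => F.hK θ (l θ)),
    fun θ => Comp.query (F.hO θ) (hl' θ)⟩

theorem FComp.circuit (hI : FLen F inp) (hX : FComp F inp X) (c : F.Θ → Circuit)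
    (hc : F.PB fun θ => (c θ).size) :
    FComp F inp fun θ i => (c θ).eval (F.O θ i) (X θ i) :=
  FComp.comp hI hX ⟨_, hc, fun θ => ⟨c θ, le_rfl, fun _ => rfl⟩⟩

end FComp

/-! ### Change of family -/

/-- The family with an additional parameter `t < T θ`. -/
@[reducible] def Fam.loop (F : Fam) (T : F.Θ → ℕ) : Fam where
  Θ := Σ θ, Fin (T θ)
  n p := F.n p.1
  sz p := F.sz p.1
  ι p := F.ι p.1
  O p := F.O p.1
  ol p := F.ol p.1
  K p := F.K p.1
  n_le p := F.n_le p.1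
  hO p := F.hO p.1
  hK p := F.hK p.1
  hKpoly := let ⟨q, hq⟩ := F.hKpoly; ⟨q, fun p => hq p.1⟩

/-- The family with an additional index. -/
@[reducible] def Fam.ext (F : Fam) (A : ∀ θ, F.ι θ → Type) : Fam where
  Θ := F.Θ
  n := F.n
  sz := F.sz
  ι θ := Σ i, A θ i
  O θ p := F.O θ p.1
  ol := F.ol
  K := F.K
  n_le := F.n_le
  hO θ p := F.hO θ p.1
  hK := F.hK
  hKpoly := F.hKpoly

/-- The family restricted to parameters with a property. -/
@[reducible] def Fam.sub (F : Fam) (P : F.Θ → Prop) : Fam where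
  Θ := {θ // P θ}
  n p := F.n p.1
  sz p := F.sz p.1
  ι p := F.ι p.1
  O p := F.O p.1
  ol p := F.ol p.1
  K p := F.K p.1
  n_le p := F.n_le p.1
  hO p := F.hO p.1
  hK p := F.hK p.1
  hKpoly := let ⟨q, hq⟩ := F.hKpoly; ⟨q, fun p => hq p.1⟩

section change
variable {F : Fam} {inp mid out X Y : F.Str}

/-- A case distinction on the parameter is made when the circuit is chosen, so it costs no gates.
The sum of the two polynomials bounds both cases. -/
theorem FComp.cases_sub (P : F.Θ → Prop)
    (h : FComp (F.sub P) (fun p i => inp p.1 i) fun p i => out p.1 i)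
    (h' : FComp (F.sub fun θ => ¬ P θ) (fun p i => inp p.1 i) fun p i => out p.1 i) :
    FComp F inp out := by
  obtain ⟨s, ⟨q, hq⟩, k⟩ := h
  obtain ⟨s', ⟨q', hq'⟩, k'⟩ := h'
  refine ⟨fun θ => q.eval (F.sz θ) + q'.eval (F.sz θ), Fam.PB.add ⟨q, fun _ => le_rfl⟩
    ⟨q', fun _ => le_rfl⟩, fun θ => ?_⟩
  by_cases hP : P θ
  · exact (k ⟨θ, hP⟩).mono ((hq ⟨θ, hP⟩).trans (Nat.le_add_right _ _))
  · exact (k' ⟨θ, hP⟩).mono ((hq' ⟨θ, hP⟩).trans (Nat.le_add_left _ _))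

theorem Fam.PB.loop {T f : F.Θ → ℕ} (h : F.PB f) : (F.loop T).PB fun p => f p.1 :=
  let ⟨q, hq⟩ := h
  ⟨q, fun p => hq p.1⟩

theorem FLen.loop {T : F.Θ → ℕ} (h : FLen F X) : FLen (F.loop T) fun p i => X p.1 i :=
  let ⟨_, h1, h2⟩ := h
  ⟨_, h1.loop, fun p i => h2 p.1 i⟩

theorem FComp.loop {T : F.Θ → ℕ} (h : FComp F inp out) :
    FComp (F.loop T) (fun p i => inp p.1 i) fun p i => out p.1 i :=
  let ⟨_, h1, h2⟩ := h
  ⟨_, h1.loop, fun p => h2 p.1⟩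

theorem FLen.ext {A : ∀ θ, F.ι θ → Type} (h : FLen F X) :
    FLen (F.ext A) fun θ p => X θ p.1 :=
  let ⟨_, h1, h2⟩ := h
  ⟨_, h1, fun θ i => h2 θ i.1⟩

theorem FComp.ext {A : ∀ θ, F.ι θ → Type} (h : FComp F inp out) :
    FComp (F.ext A) (fun θ p => inp θ p.1) fun θ p => out θ p.1 :=
  let ⟨_, h1, h2⟩ := h
  ⟨_, h1, fun θ => (h2 θ).reindex Sigma.fst⟩

theorem FLen.sub {P : F.Θ → Prop} (h : FLen F X) : FLen (F.sub P) fun p i => X p.1 i :=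
  let ⟨_, ⟨q, h1⟩, h2⟩ := h
  ⟨_, ⟨q, fun p => h1 p.1⟩, fun p i => h2 p.1 i⟩

theorem FComp.sub {P : F.Θ → Prop} (h : FComp F inp out) :
    FComp (F.sub P) (fun p i => inp p.1 i) fun p i => out p.1 i :=
  let ⟨_, ⟨q, h1⟩, h2⟩ := h
  ⟨_, ⟨q, fun p => h1 p.1⟩, fun p => h2 p.1⟩

/-- Demanding the step in the family `F.loop T`, with the step number as a parameter, makes one
polynomial bound all steps at once. -/
theorem FComp.iterate (hI : FLen F inp) {T : F.Θ → ℕ} (hT : F.PB T)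
    (st : ∀ θ, ℕ → F.ι θ → List Bool) (h0 : FComp F inp fun θ i => st θ 0 i)
    (h : FComp (F.loop T) (fun p i => st p.1 p.2 i) fun p i => st p.1 (p.2 + 1) i) :
    FComp F inp fun θ i => st θ (T θ) i := by
  obtain ⟨l, hl, hl'⟩ := h0.len
  obtain ⟨s, ⟨q, hq⟩, k⟩ := h
  refine FComp.comp hI h0 ⟨fun θ => l θ + T θ * q.eval (F.sz θ),
    hl.add (hT.mul ⟨q, fun _ => le_rfl⟩), fun θ => ?_⟩
  exact Comp.iterate (F.hO θ) (st θ) (hl' θ) _ fun j hj =>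
    (k ⟨θ, ⟨j, hj⟩⟩).mono (hq ⟨θ, ⟨j, hj⟩⟩)

theorem FComp.catFin (hI : FLen F inp) {z : F.Θ → ℕ} (hz : F.PB z)
    {f : ∀ θ, F.ι θ → Fin (z θ) → List Bool}
    (h : FComp (F.loop z) (fun p i => inp p.1 i) fun p i => f p.1 i p.2) :
    FComp F inp fun θ i => catFin (f θ i) := by
  obtain ⟨l, hl, hl'⟩ := hI
  obtain ⟨s, ⟨q, hq⟩, k⟩ := h
  refine ⟨fun θ => z θ * (2 * q.eval (F.sz θ) + l θ),
    hz.mul (((Fam.PB.const 2).mul ⟨q, fun _ => le_rfl⟩).add hl), fun θ => ?_⟩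
  have := Comp.flatMap (F.hO θ) (hl' θ) (out := fun (t : Fin (z θ)) i => f θ i t)
    (s := q.eval (F.sz θ)) (List.finRange (z θ)) fun t _ => (k ⟨θ, t⟩).mono (hq ⟨θ, t⟩)
  rw [List.length_finRange] at this
  exact this

theorem FComp.catBool (hI : FLen F inp) {f : ∀ θ, F.ι θ → Bool → List Bool}
    (h : FComp F inp fun θ i => f θ i false) (h' : FComp F inp fun θ i => f θ i true) :
    FComp F inp fun θ i => catBool (f θ i) := h.append hI h'

end change

theorem length_flatMap_const {κ : Type} {m : ℕ} {f : κ → List Bool} (L : List κ)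
    (hf : ∀ t ∈ L, (f t).length = m) : (L.flatMap f).length = L.length * m := by
  induction L with
  | nil => simp
  | cons t L ih =>
    simp only [List.flatMap_cons, List.length_append, hf t (by simp),
      ih fun u hu => hf u (by simp [hu]), List.length_cons]
    ring

theorem slice_flatMap {κ : Type} {m : ℕ} {f : κ → List Bool} :
    ∀ (L : List κ) (_ : ∀ t ∈ L, (f t).length = m) (j : ℕ) (hj : j < L.length),
      ((L.flatMap f).drop (j * m)).take m = f L[j] := by
  intro L
  induction L with
  | nil => intro _ j hj; simp at hj
  | cons t L ih =>
    intro hf j hj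
    have ht := hf t (by simp)
    cases j with
    | zero => simp [← ht]
    | succ j =>
      have := ih (fun u hu => hf u (by simp [hu])) j (by simpa using hj)
      simp only [List.flatMap_cons, List.getElem_cons_succ]
      rw [← this, show (j + 1) * m = (f t).length + j * m by rw [ht]; ring,
        List.drop_length_add_append]

theorem length_catFin {z m : ℕ} {f : Fin z → List Bool} (hf : ∀ t, (f t).length = m) :
    (catFin f).length = z * m := by
  rw [catFin, length_flatMap_const _ fun t _ => hf t, List.length_finRange]

theorem slice_catFin {z m : ℕ} {f : Fin z → List Bool} (hf : ∀ t, (f t).length = m) (t : Fin z) :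
    ((catFin f).drop (t * m)).take m = f t := by
  have := slice_flatMap (List.finRange z) (fun t _ => hf t) t (by simp)
  rw [catFin, this]; simp

section slices
variable {F : Fam} {inp mid out X Y : F.Str}

theorem FLen.catFin {z m : F.Θ → ℕ} (hz : F.PB z) (hm : F.PB m)
    {f : ∀ θ, F.ι θ → Fin (z θ) → List Bool} (hf : ∀ θ i t, (f θ i t).length = m θ) :
    FLen F fun θ i => catFin (f θ i) :=
  ⟨_, hz.mul hm, fun θ i => length_catFin (hf θ i)⟩

theorem FLen.catBool {f : ∀ θ, F.ι θ → Bool → List Bool}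
    (hf : ∀ b, FLen F fun θ i => f θ i b) : FLen F fun θ i => catBool (f θ i) :=
  (hf false).append (hf true)

theorem FComp.catFin_get {z m : F.Θ → ℕ} {f : ∀ θ, F.ι θ → Fin (z θ) → List Bool}
    (hf : ∀ θ i t, (f θ i t).length = m θ) (hI : FLen F inp)
    (h : FComp F inp fun θ i => DUQMR.catFin (f θ i)) :
    FComp (F.loop z) (fun p i => inp p.1 i) fun p i => f p.1 i p.2 := by
  have := FComp.slice hI.loop (FComp.loop (T := z) h) (fun p => p.2 * m p.1) (fun p => m p.1)
  convert this using 3 with p i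
  exact (slice_catFin (hf p.1 i) p.2).symm

end slices

/-! ### Bitwise operations, comparisons -/

section gadgets
variable {F : Fam} {inp mid out X Y : F.Str}

theorem FComp.mux (hI : FLen F inp) {b : ∀ θ, F.ι θ → Bool} (hb : FComp F inp fun θ i => [b θ i])
    (hX : FComp F inp X) (hY : FComp F inp Y) (hl : ∀ θ i, (X θ i).length = (Y θ i).length) :
    FComp F inp fun θ i => if b θ i then X θ i else Y θ i := by
  obtain ⟨l, hl1, hl2⟩ := hX.len
  have := FComp.local hI (hb.append hI (hX.append hI hY))
    (fun θ => (List.range (l θ)).map fun j => (fun b x y => if b then x else y, 0, 1 + j,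
      1 + (l θ + j))) (by simpa using hl1)
  convert this using 3 with θ i
  have hx := hl2 θ i
  have hy := hl θ i
  apply List.ext_getElem
  · split_ifs <;> simp [← hl, hx]
  · intro j h1 h2
    have hj : j < l θ := by simpa using h2
    have e1 : ([b θ i] ++ (X θ i ++ Y θ i)).getD (1 + j) false = (X θ i).getD j false := by
      rw [show (1 : ℕ) = [b θ i].length from rfl, getD_shift, List.getD_append _ _ _ _ (hx ▸ hj)]
    have e2 : ([b θ i] ++ (X θ i ++ Y θ i)).getD (1 + (l θ + j)) false = (Y θ i).getD j false := by
      rw [show (1 : ℕ) = [b θ i].length from rfl, getD_shift, ← hx, getD_shift]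
    simp only [List.map_map, List.getElem_map, Function.comp_apply, localVal, List.getElem_range,
      e1, e2, show ([b θ i] ++ (X θ i ++ Y θ i)).getD 0 false = b θ i from rfl]
    rw [List.getD_eq_getElem _ _ (show j < (Y θ i).length by omega),
      List.getD_eq_getElem _ _ (show j < (X θ i).length by omega)]
    by_cases hb : b θ i <;> simp [hb]

theorem FComp.zipWith (g : Bool → Bool → Bool) (hI : FLen F inp) (hX : FComp F inp X)
    (hY : FComp F inp Y) (hl : ∀ θ i, (X θ i).length = (Y θ i).length) :
    FComp F inp fun θ i => List.zipWith g (X θ i) (Y θ i) := by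
  obtain ⟨l, hl1, hl2⟩ := hX.len
  have := FComp.local hI (hX.append hI hY)
    (fun θ => (List.range (l θ)).map fun j => (fun x y _ => g x y, j, l θ + j, 0))
    (by simpa using hl1)
  convert this using 3 with θ i
  have hx := hl2 θ i
  have hy := hl θ i
  apply List.ext_getElem
  · simp [← hl, hx]
  · intro j h1 h2
    have hj : j < l θ := by simpa using h2
    have e1 : (X θ i ++ Y θ i).getD j false = (X θ i).getD j false := by
      rw [List.getD_append _ _ _ _ (hx ▸ hj)]
    have e2 : (X θ i ++ Y θ i).getD (l θ + j) false = (Y θ i).getD j false := by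
      rw [← hx, getD_shift]
    simp only [List.map_map, List.getElem_map, Function.comp_apply, localVal, List.getElem_range,
      e1, e2, List.getElem_zipWith]
    rw [List.getD_eq_getElem _ _ (show j < (X θ i).length by omega),
      List.getD_eq_getElem _ _ (show j < (Y θ i).length by omega)]

theorem toL_xorBits {m : ℕ} (a b : Bits m) :
    toL (xorBits a b) = List.zipWith xor (toL a) (toL b) := by
  apply List.ext_getElem
  · simp [toL]
  · intro j h1 h2
    simp [toL, xorBits]

theorem FComp.xorBits {m : F.Θ → ℕ} {a b : ∀ θ, F.ι θ → Bits (m θ)} (hI : FLen F inp)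
    (ha : FComp F inp fun θ i => toL (a θ i)) (hb : FComp F inp fun θ i => toL (b θ i)) :
    FComp F inp fun θ i => toL (xorBits (a θ i) (b θ i)) := by
  simp only [toL_xorBits]
  exact FComp.zipWith _ hI ha hb fun θ i => by simp [toL]

/-- A one-bit automaton that reads `X` and `Y` in parallel; its state is kept in front of the two
strings. Equality and comparison of numbers are instances. -/
theorem FComp.fold (f : Bool → Bool → Bool → Bool) (hI : FLen F inp) (hX : FComp F inp X)
    (hY : FComp F inp Y) {T : F.Θ → ℕ} (hXT : ∀ θ i, (X θ i).length = T θ)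
    (hT : F.PB T) (acc : ∀ θ, ℕ → F.ι θ → Bool) (h0 : FComp F inp fun θ i => [acc θ 0 i])
    (hacc : ∀ θ i, ∀ j < T θ, acc θ (j + 1) i =
      f (acc θ j i) ((X θ i).getD j false) ((Y θ i).getD j false)) :
    FComp F inp fun θ i => [acc θ (T θ) i] := by
  obtain ⟨ly, hy1, hy2⟩ := hY.len
  have key := FComp.iterate hI hT (fun θ j i => [acc θ j i] ++ (X θ i ++ Y θ i))
    (h0.append hI (hX.append hI hY)) (by
      have hl : FLen (F.loop T) fun p i => [acc p.1 p.2 i] ++ (X p.1 i ++ Y p.1 i) :=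
        (FLen.single _).append (FLen.loop (hX.len.append hY.len))
      have h1 := FComp.local hl (FComp.id hl) (fun p => [(f, 0, 1 + p.2, 1 + (T p.1 + p.2))])
        (Fam.PB.const 1)
      have h2 : FComp (F.loop T) (fun p i => [acc p.1 p.2 i] ++ (X p.1 i ++ Y p.1 i))
          fun p i => X p.1 i ++ Y p.1 i :=
        FComp.right hl (FLen.single _) (FLen.loop (hX.len.append hY.len)) (FComp.id hl)
      convert h1.append hl h2 using 4 with p i
      simp only [List.map_cons, List.map_nil, localVal]
      congr 1
      rw [hacc _ _ _ p.2.2]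
      congr 1
      · rw [show (1 : ℕ) = [acc p.1 p.2 i].length from rfl, getD_shift,
          List.getD_append _ _ _ _ (by rw [hXT]; exact p.2.2)]
      · rw [show (1 : ℕ) = [acc p.1 p.2 i].length from rfl, getD_shift]
        have := getD_shift (X p.1 i) (Y p.1 i) p.2
        rw [hXT] at this
        exact this.symm)
  exact FComp.left hI (FLen.single _) key

theorem FComp.eq (hI : FLen F inp) (hX : FComp F inp X) (hY : FComp F inp Y)
    (hl : ∀ θ i, (X θ i).length = (Y θ i).length) :
    FComp F inp fun θ i => [decide (X θ i = Y θ i)] := by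
  obtain ⟨l, hl1, hl2⟩ := hX.len
  have := FComp.fold (fun a x y => a && (x == y)) hI hX hY hl2 hl1
    (fun θ j i => decide ((X θ i).take j = (Y θ i).take j))
    (by simpa using FComp.const hI (fun _ => [true]) (.const 1)) (by
      intro θ i j hj
      have hx : j < (X θ i).length := hl2 θ i ▸ hj
      have hy : j < (Y θ i).length := hl θ i ▸ hx
      rw [List.take_succ_eq_append_getElem hx, List.take_succ_eq_append_getElem hy,
        List.getD_eq_getElem _ _ hx, List.getD_eq_getElem _ _ hy]
      have key : ∀ (A B : List Bool) (x y : Bool), A ++ [x] = B ++ [y] ↔ A = B ∧ x = y :=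
        fun A B x y => ⟨fun h => by simpa using List.append_inj' h rfl,
          fun h => by rw [h.1, h.2]⟩
      simp only [key, Bool.decide_and, Bool.beq_eq_decide_eq])
  convert this using 4 with θ i
  rw [← hl2 θ i, List.take_length, hl, List.take_length]

end gadgets

/-! ### Binary representation of numbers. -/

theorem natOf_cons (b : Bool) (l : List Bool) : natOf (b :: l) = b.toNat + 2 * natOf l := by
  simp [natOf, Nat.ofDigits_cons]

@[simp] theorem natOf_nil : natOf [] = 0 := rfl

theorem natOf_append (l l' : List Bool) : natOf (l ++ l') = natOf l + 2 ^ l.length * natOf l' := by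
  induction l with
  | nil => simp
  | cons b l ih => simp only [List.cons_append, natOf_cons, ih, List.length_cons]; ring

theorem natOf_lt (l : List Bool) : natOf l < 2 ^ l.length := by
  induction l with
  | nil => simp
  | cons b l ih =>
    rw [natOf_cons, List.length_cons, pow_succ]
    have := Bool.toNat_le b; omega

theorem testBit_natOf (l : List Bool) : ∀ j, (natOf l).testBit j = l.getD j false := by
  induction l with
  | nil => simp
  | cons b l ih =>
    intro j
    rw [natOf_cons]
    cases j with
    | zero => cases b <;> simp [Nat.testBit_zero, Nat.add_mod]
    | succ j =>
      rw [Nat.testBit_add_one, show (b.toNat + 2 * natOf l) / 2 = natOf l by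
        have := Bool.toNat_le b; omega, ih]
      rfl

theorem length_toL {m : ℕ} (b : Bits m) : (toL b).length = m := by simp [toL]

theorem getD_toL {m : ℕ} (b : Bits m) (j : ℕ) :
    (toL b).getD j false = if h : j < m then b ⟨j, h⟩ else false := by
  split_ifs with h
  · rw [List.getD_eq_getElem _ _ (by simpa [toL] using h)]; simp [toL]
  · rw [List.getD_eq_default]; simpa [toL] using h

theorem natBits_natOf {m : ℕ} (b : Bits m) : natBits m (natOf (toL b)) = b := by
  funext j
  rw [natBits, testBit_natOf, getD_toL, dif_pos j.2]

theorem natOf_natBits (m a : ℕ) : natOf (toL (natBits m a)) = a % 2 ^ m := by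
  apply Nat.eq_of_testBit_eq
  intro j
  rw [testBit_natOf, getD_toL, Nat.testBit_mod_two_pow]
  by_cases h : j < m <;> simp [h, natBits]

theorem natOf_toL_injective {m : ℕ} : Function.Injective fun b : Bits m => natOf (toL b) :=
  fun a b h => by rw [← natBits_natOf a, ← natBits_natOf b]; exact congrArg _ h

/-- Widening a string, read as a number, only appends zeros. Group elements and masked messages are
turned into plaintexts of `ptLen` bits this way. -/
theorem toL_natBits_natOf {m k : ℕ} (h : k ≤ m) (b : Bits k) :
    toL (natBits m (natOf (toL b))) = toL b ++ List.replicate (m - k) false := by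
  apply List.ext_getElem
  · simp [toL]; omega
  · intro j h1 h2
    have := testBit_natOf (toL b) j
    rw [getD_toL] at this
    simp only [toL, List.getElem_ofFn, natBits]
    erw [this]
    by_cases hj : j < k
    · simp [hj]
    · simp [hj, List.getElem_append]

section lt
variable {F : Fam} {inp X Y : F.Str}

/-- Bits come least significant first, so the last position where the numbers differ decides: equal
bits keep the verdict, different bits replace it by the bit of `Y`. -/
theorem FComp.lt (hI : FLen F inp) (hX : FComp F inp X) (hY : FComp F inp Y)
    (hl : ∀ θ i, (X θ i).length = (Y θ i).length) :
    FComp F inp fun θ i => [decide (natOf (X θ i) < natOf (Y θ i))] := by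
  obtain ⟨l, hl1, hl2⟩ := hX.len
  have := FComp.fold (fun a x y => if x = y then a else y) hI hX hY hl2 hl1
    (fun θ j i => decide (natOf ((X θ i).take j) < natOf ((Y θ i).take j)))
    (by simpa using FComp.const hI (fun _ => [false]) (.const 1)) (by
      intro θ i j hj
      have hx : j < (X θ i).length := hl2 θ i ▸ hj
      have hy : j < (Y θ i).length := hl θ i ▸ hx
      rw [List.take_succ_eq_append_getElem hx, List.take_succ_eq_append_getElem hy,
        List.getD_eq_getElem _ _ hx, List.getD_eq_getElem _ _ hy, natOf_append, natOf_append]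
      have b1 := natOf_lt ((X θ i).take j)
      have b2 := natOf_lt ((Y θ i).take j)
      rw [List.length_take, min_eq_left hx.le] at *
      rw [List.length_take, min_eq_left hy.le] at *
      cases (X θ i)[j] <;> cases (Y θ i)[j] <;> simp [natOf_cons] <;> omega)
  convert this using 4 with θ i
  rw [← hl2 θ i, List.take_length, hl, List.take_length]

end lt

/-! ### Randomised circuit families and samplers -/

theorem Fam.PB.ext {F : Fam} {A : ∀ θ, F.ι θ → Type} {f : F.Θ → ℕ} (h : F.PB f) :
    (F.ext A).PB f := h

/-- Imports the circuits that come with the group generator and the encryption scheme. Their query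
gates are stripped, since the oracle of the family would answer them. -/
theorem FComp.apply {ι' : ℕ → Type} {inp' out' : (n : ℕ) → ι' n → List Bool}
    (h : PolyComputable inp' out') {F : Fam} {inp : F.Str} (hI : FLen F inp)
    (idx : ∀ θ, F.ι θ → ι' (F.n θ)) (hX : FComp F inp fun θ i => inp' (F.n θ) (idx θ i)) :
    FComp F inp fun θ i => out' (F.n θ) (idx θ i) := by
  obtain ⟨c, hc, he⟩ := h
  have := FComp.circuit hI hX (fun θ => (c (F.n θ)).strip)
    ((Fam.PB.poly hc).mono fun θ => Circuit.size_strip _)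
  simpa only [Circuit.eval_strip, he] using this

/-- The distributions `D θ i` are approximately the output distributions of randomised circuits of
polynomial size on `inp θ i`. -/
def FRand (F : Fam) (inp : F.Str) (D : ∀ θ, F.ι θ → PMF (List Bool)) : Prop :=
  ∃ s : F.Θ → ℕ, F.PB s ∧ ∀ θ, ∃ c : RandCircuit, c.size ≤ s θ ∧
    ∀ i, Close (s θ / 2 ^ F.n θ) (c.run (F.O θ i) (inp θ i)) (D θ i)

/-- Uniform elements of `A θ i`, encoded by `e`, are approximately sampled by circuits of
polynomial size. -/
def FSamp (F : Fam) (inp : F.Str) (A : ∀ θ, F.ι θ → Type) [∀ θ i, Fintype (A θ i)]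
    [∀ θ i, Nonempty (A θ i)] (e : ∀ θ i, A θ i → List Bool) : Prop :=
  ∃ (κ : F.Θ → ℕ) (c : F.Θ → Circuit) (f : ∀ θ i, Bits (κ θ) → A θ i) (m s : F.Θ → ℕ),
    F.PB κ ∧ F.PB (fun θ => (c θ).size) ∧ F.PB m ∧ F.PB s ∧
    (∀ θ i a, (e θ i a).length = m θ) ∧
    (∀ θ i r, (c θ).eval (F.O θ i) (toL r ++ inp θ i) = e θ i (f θ i r)) ∧
    ∀ θ i, Close (s θ / 2 ^ F.n θ) ((unif (Bits (κ θ))).map (f θ i)) (unif (A θ i))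

theorem toL_append {a b : ℕ} (x : Bits a) (y : Bits b) :
    toL (Fin.append x y : Bits (a + b)) = toL x ++ toL y := List.ofFn_fin_append x y

theorem unif_bits_add {γ : Type} {a b : ℕ} (f : Bits (a + b) → PMF γ) :
    (unif (Bits (a + b))).bind f =
      (unif (Bits a)).bind fun x => (unif (Bits b)).bind fun y => f (Fin.append x y) := by
  rw [unif_bind_prod fun (x : Bits a) (y : Bits b) => f (Fin.append x y),
    ← unif_bind_equiv (Fin.appendEquiv a b)]
  rfl

section
variable {F : Fam} {inp : F.Str}

theorem FRand.pure {out : F.Str} (h : FComp F inp out) :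
    FRand F inp fun θ i => PMF.pure (out θ i) := by
  obtain ⟨s, hs, h⟩ := h
  refine ⟨s, hs, fun θ => ?_⟩
  obtain ⟨c, hc, he⟩ := h θ
  refine ⟨⟨c, 0⟩, by simpa [RandCircuit.size] using hc, fun i => Close.of_eq ?_⟩
  have : ∀ r : Bits 0, c.eval (F.O θ i) (toL r ++ inp θ i) = out θ i := fun r => by
    simpa [toL] using he i
  simp only [RandCircuit.run, this]
  exact PMF.map_const _ _

theorem FSamp.flen {A : ∀ θ, F.ι θ → Type} [∀ θ i, Fintype (A θ i)]
    [∀ θ i, Nonempty (A θ i)] {e : ∀ θ i, A θ i → List Bool} (h : FSamp F inp A e) :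
    FLen (F.ext A) fun θ p => e θ p.1 p.2 := by
  obtain ⟨κ, c, f, m, s, h1, h2, h3, h4, h5, h6, h7⟩ := h
  exact ⟨m, h3, fun θ p => h5 θ p.1 p.2⟩

theorem FSamp.mk' (hI : FLen F inp) {A : ∀ θ, F.ι θ → Type} [∀ θ i, Fintype (A θ i)]
    [∀ θ i, Nonempty (A θ i)] {e : ∀ θ i, A θ i → List Bool} {κ m s : F.Θ → ℕ}
    (hκ : F.PB κ) (hm : F.PB m) (hs : F.PB s) (f : ∀ θ i, Bits (κ θ) → A θ i)
    (hl : ∀ θ i a, (e θ i a).length = m θ)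
    (hc : FLen (F.ext fun θ _ => Bits (κ θ)) (fun θ p => toL p.2 ++ inp θ p.1) →
      FComp (F.ext fun θ _ => Bits (κ θ)) (fun θ p => toL p.2 ++ inp θ p.1)
      fun θ p => e θ p.1 (f θ p.1 p.2))
    (hf : ∀ θ i, Close (s θ / 2 ^ F.n θ) ((unif (Bits (κ θ))).map (f θ i)) (unif (A θ i))) :
    FSamp F inp A e := by
  obtain ⟨t, ht, h⟩ := hc ((FLen.toL hκ.ext _).append hI.ext)
  choose c hc he using h
  exact ⟨κ, c, f, m, s, hκ, Fam.PB.mono ht hc, hm, hs, hl, fun θ i r => he θ ⟨i, r⟩, hf⟩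

theorem ofNat_div_add (a b : ℕ) (x : ℝ≥0∞) :
    (a : ℝ≥0∞) / x + b / x = ((a + b : ℕ) : ℝ≥0∞) / x := by
  rw [Nat.cast_add, ENNReal.add_div]

/-- Sample a uniform element and continue with its encoding appended to the input. -/
theorem FRand.bind (hI : FLen F inp) {A : ∀ θ, F.ι θ → Type} [∀ θ i, Fintype (A θ i)]
    [∀ θ i, Nonempty (A θ i)] {e : ∀ θ i, A θ i → List Bool} (hA : FSamp F inp A e)
    {D : ∀ θ i, A θ i → PMF (List Bool)}
    (h : FLen (F.ext A) (fun θ p => inp θ p.1 ++ e θ p.1 p.2) →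
      FRand (F.ext A) (fun θ p => inp θ p.1 ++ e θ p.1 p.2) fun θ p => D θ p.1 p.2) :
    FRand F inp fun θ i => (unif (A θ i)).bind (D θ i) := by
  obtain ⟨t, ht, hr⟩ := h (hI.ext.append hA.flen)
  obtain ⟨κ, c, f, m, s, h1, h2, h3, h4, h5, h6, h7⟩ := hA
  choose c' hc' hD using hr
  have hκ' : F.PB fun θ => (c' θ).coins := Fam.PB.mono ht fun θ =>
    le_trans (by simp [RandCircuit.size]) (hc' θ)
  have hs' : F.PB fun θ => (c' θ).toCircuit.size := Fam.PB.mono ht fun θ =>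
    le_trans (by simp [RandCircuit.size]) (hc' θ)
  let F' := F.ext fun θ _ => Bits (κ θ) × Bits (c' θ).coins
  let src : F'.Str := fun θ p => toL p.2.1 ++ (toL p.2.2 ++ inp θ p.1)
  have l1 : FLen F' fun θ p => toL p.2.1 := FLen.toL h1.ext _
  have l2 : FLen F' fun θ p => toL p.2.2 := FLen.toL hκ'.ext _
  have l3 : FLen F' fun θ p => inp θ p.1 := hI.ext
  have l : FLen F' src := l1.append (l2.append l3)
  have k1 : FComp F' src fun θ p => toL p.2.1 := (FComp.id l).left l l1
  have k23 := (FComp.id l).right l l1 (l2.append l3)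
  have k2 : FComp F' src fun θ p => toL p.2.2 := k23.left l l2
  have k3 : FComp F' src fun θ p => inp θ p.1 := k23.right l l2 l3
  have k4 := FComp.circuit l (k1.append l k3) c h2
  have k5 := FComp.circuit l (k2.append l (k3.append l k4)) (fun θ => (c' θ).toCircuit) hs'
  obtain ⟨u, hu, hk⟩ := k5
  refine ⟨fun θ => u θ + (κ θ + (c' θ).coins) + (s θ + t θ),
    (Fam.PB.add (F := F) hu (h1.add hκ')).add (h4.add ht), fun θ => ?_⟩
  obtain ⟨C, hC, hCe⟩ := hk θ
  refine ⟨⟨C, κ θ + (c' θ).coins⟩, ?_, fun i => ?_⟩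
  · simp only [RandCircuit.size]; omega
  -- Drawing the coins of the sampler and of the continuation as one string is the same as sampling
  -- the approximate element and then running the continuation on its encoding.
  · have e1 : RandCircuit.run (F.O θ i) ⟨C, κ θ + (c' θ).coins⟩ (inp θ i) =
        ((unif (Bits (κ θ))).map (f θ i)).bind fun a =>
          (c' θ).run (F.O θ i) (inp θ i ++ e θ i a) := by
      rw [RandCircuit.run, PMF.map, unif_bits_add, PMF.bind_map]
      congr 1; funext r
      simp only [Function.comp_apply, RandCircuit.run, PMF.map]
      congr 1; funext r'
      simp only [Function.comp_apply]
      have := hCe ⟨i, r, r'⟩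
      change C.eval (F.O θ i) (toL r ++ (toL r' ++ inp θ i)) =
        (c' θ).toCircuit.eval (F.O θ i) (toL r' ++ (inp θ i ++ (c θ).eval (F.O θ i)
          (toL r ++ inp θ i))) at this
      rw [h6] at this
      rw [← this, toL_append, List.append_assoc]
    rw [e1]
    -- The sampler contributes `s θ`, the continuation `t θ`, both over `2 ^ n`.
    refine (((h7 θ i).bind_left _).trans (Close.bind_right fun a => hD θ ⟨i, a⟩)).mono ?_
    rw [ofNat_div_add]
    gcongr
    exact_mod_cast Nat.le_add_left _ _

/-- Feed a distribution to a family of randomised circuits. -/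
theorem FRand.run (hI : FLen F inp) {D : ∀ θ, F.ι θ → PMF (List Bool)} (hD : FRand F inp D)
    (c : F.Θ → RandCircuit) (hc : F.PB fun θ => (c θ).size) :
    FRand F inp fun θ i => (D θ i).bind fun x => (c θ).run (F.O θ i) x := by
  obtain ⟨s, hs, hr⟩ := hD
  choose b hb he using hr
  have hκ : F.PB fun θ => (c θ).coins := hc.mono fun θ => by simp [RandCircuit.size]
  have hκ' : F.PB fun θ => (b θ).coins := hs.mono fun θ =>
    le_trans (by simp [RandCircuit.size]) (hb θ)
  let F' := F.ext fun θ _ => Bits (c θ).coins × Bits (b θ).coins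
  let src : F'.Str := fun θ p => toL p.2.1 ++ (toL p.2.2 ++ inp θ p.1)
  have l1 : FLen F' fun θ p => toL p.2.1 := FLen.toL hκ.ext _
  have l2 : FLen F' fun θ p => toL p.2.2 := FLen.toL hκ'.ext _
  have l3 : FLen F' fun θ p => inp θ p.1 := hI.ext
  have l : FLen F' src := l1.append (l2.append l3)
  have k1 : FComp F' src fun θ p => toL p.2.1 := (FComp.id l).left l l1
  have k23 := (FComp.id l).right l l1 (l2.append l3)
  have k4 := FComp.circuit l k23 (fun θ => (b θ).toCircuit)
    (hs.mono fun θ => le_trans (by simp [RandCircuit.size]) (hb θ))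
  obtain ⟨u, hu, hk⟩ := FComp.circuit l (k1.append l k4) (fun θ => (c θ).toCircuit)
    (hc.mono fun θ => by simp [RandCircuit.size])
  refine ⟨fun θ => u θ + ((c θ).coins + (b θ).coins) + s θ,
    (Fam.PB.add (F := F) hu (hκ.add hκ')).add hs, fun θ => ?_⟩
  obtain ⟨C, hC, hCe⟩ := hk θ
  refine ⟨⟨C, (c θ).coins + (b θ).coins⟩, ?_, fun i => ?_⟩
  · simp only [RandCircuit.size]; omega
  · have : RandCircuit.run (F.O θ i) ⟨C, (c θ).coins + (b θ).coins⟩ (inp θ i) =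
        ((b θ).run (F.O θ i) (inp θ i)).bind fun x => (c θ).run (F.O θ i) x := by
      rw [RandCircuit.run, PMF.map, unif_bits_add]
      simp only [RandCircuit.run, PMF.map, PMF.bind_bind, Function.comp_apply, PMF.pure_bind]
      rw [PMF.bind_comm]
      congr 1; funext r; congr 1; funext r'
      have := hCe ⟨i, r', r⟩
      change C.eval (F.O θ i) (toL r' ++ (toL r ++ inp θ i)) =
        (c θ).toCircuit.eval (F.O θ i) (toL r' ++ (b θ).toCircuit.eval (F.O θ i)
          (toL r ++ inp θ i)) at this
      simp only [Function.comp_apply]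
      rw [← this, toL_append, List.append_assoc]
    rw [this]
    refine ((he θ i).bind_left _).mono ?_
    gcongr
    exact Nat.le_add_left _ _

/-! ### Samplers -/

theorem FSamp.bits (hI : FLen F inp) {m : F.Θ → ℕ} (hm : F.PB m) :
    FSamp F inp (fun θ _ => Bits (m θ)) fun _ _ r => toL r := by
  refine FSamp.mk' hI hm hm (.const 0) (fun _ _ r => r) (fun _ _ _ => length_toL _)
    (fun l => (FComp.id l).left l (FLen.toL hm.ext _)) fun θ i => Close.of_eq (PMF.map_id _)

theorem FSamp.map {A A' : ∀ θ, F.ι θ → Type} [∀ θ i, Fintype (A θ i)]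
    [∀ θ i, Nonempty (A θ i)] [∀ θ i, Fintype (A' θ i)]
    [∀ θ i, Nonempty (A' θ i)] {e : ∀ θ i, A θ i → List Bool} {e' : ∀ θ i, A' θ i → List Bool}
    (h : FSamp F inp A e) (g : ∀ θ i, A θ i ≃ A' θ i)
    (he : ∀ θ i a, e' θ i (g θ i a) = e θ i a) : FSamp F inp A' e' := by
  obtain ⟨κ, c, f, m, s, h1, h2, h3, h4, h5, h6, h7⟩ := h
  refine ⟨κ, c, fun θ i r => g θ i (f θ i r), m, s, h1, h2, h3, h4, fun θ i a => ?_, fun θ i r => ?_,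
    fun θ i => ?_⟩
  · obtain ⟨b, rfl⟩ := (g θ i).surjective a
    rw [he, h5]
  · rw [he, h6]
  · have := (h7 θ i).map (g θ i)
    rw [unif_map_equiv, PMF.map_comp] at this
    exact this

theorem FSamp.bool (hI : FLen F inp) : FSamp F inp (fun _ _ => Bool) fun _ _ b => [b] :=
  (FSamp.bits hI (.const 1)).map (fun _ _ => Equiv.funUnique (Fin 1) Bool) fun _ _ a => by
    simp [toL]

theorem unif_fin_succ {B : Type} [Fintype B] [Nonempty B] (z : ℕ) : unif (Fin (z + 1) → B) =
    (unif B).bind fun b => (unif (Fin z → B)).bind fun g => PMF.pure (Fin.cons b g) := by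
  rw [unif_bind_prod fun (b : B) (g : Fin z → B) => PMF.pure (Fin.cons b g : Fin (z + 1) → B)]
  rw [← unif_map_equiv (Fin.consEquiv fun _ : Fin (z + 1) => B)]
  rfl

/-- Hybrid argument over the coordinates, each of which costs `ε`. -/
theorem close_pi {R A : Type} [Fintype R] [Nonempty R] [Fintype A] [Nonempty A] {f : R → A}
    {ε : ℝ≥0∞} (h : Close ε ((unif R).map f) (unif A)) (z : ℕ) :
    Close (z * ε) ((unif (Fin z → R)).map fun r t => f (r t)) (unif (Fin z → A)) := by
  induction z with
  | zero =>
    refine Close.of_eq ?_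
    rw [show (fun (r : Fin 0 → R) (t : Fin 0) => f (r t)) = Equiv.ofUnique _ _ from
      funext fun r => Subsingleton.elim _ _]
    exact unif_map_equiv _
  | succ z ih =>
    rw [unif_fin_succ, unif_fin_succ, PMF.map_bind]
    simp only [PMF.map_bind, PMF.pure_map]
    have e : ∀ (a : R) (g : Fin z → R), (fun t => f (Fin.cons (α := fun _ => R) a g t)) =
        Fin.cons (α := fun _ => A) (f a) fun t => f (g t) := fun a g => by
      funext t; refine Fin.cases ?_ (fun t => ?_) t <;> simp
    simp only [e]
    have h1 := h.bind_left fun b => ((unif (Fin z → R)).map fun r t => f (r t)).bind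
      fun g => PMF.pure (Fin.cons (α := fun _ => A) b g)
    have h2 : Close (z * ε) _ _ := Close.bind_right (P := unif A) fun b => ih.bind_left
      fun g => PMF.pure (Fin.cons (α := fun _ => A) b g)
    have h3 := (h1.trans h2).mono (show ε + z * ε ≤ ((z + 1 : ℕ) : ℝ≥0∞) * ε by
      push_cast; rw [add_mul, one_mul, add_comm])
    simpa only [PMF.bind_map, Function.comp_def] using h3

/-- A string of `z * m` bits is a family of `z` strings of `m` bits. -/
def splitBits (z m : ℕ) : Bits (z * m) ≃ (Fin z → Bits m) :=
  (finProdFinEquiv.symm.arrowCongr (Equiv.refl Bool)).trans (Equiv.curry _ _ _)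

theorem toL_splitBits {z m : ℕ} (r : Bits (z * m)) :
    catFin (fun t => toL (splitBits z m r t)) = toL r := by
  rw [toL, List.ofFn_mul, catFin, List.flatMap_def, List.ofFn_eq_map]
  congr 1
  refine List.map_congr_left fun t _ => ?_
  rw [toL]
  congr 1; funext j
  simp only [splitBits, Equiv.trans_apply, Equiv.curry_apply, Equiv.arrowCongr_apply,
    Function.curry, Function.comp_apply, Equiv.refl_apply, Equiv.symm_symm]
  congr 1
  refine Fin.ext ?_
  simp [finProdFinEquiv]; ring

theorem FSamp.fin (hI : FLen F inp) {A : ∀ θ, F.ι θ → Type} [∀ θ i, Fintype (A θ i)]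
    [∀ θ i, Nonempty (A θ i)] {e : ∀ θ i, A θ i → List Bool} (h : FSamp F inp A e)
    {z : F.Θ → ℕ} (hz : F.PB z) :
    FSamp F inp (fun θ i => Fin (z θ) → A θ i) fun θ i a => catFin fun t => e θ i (a t) := by
  obtain ⟨κ, c, f, m, s, h1, h2, h3, h4, h5, h6, h7⟩ := h
  refine FSamp.mk' hI (hz.mul h1) (hz.mul h3) (hz.mul h4)
    (fun θ i r t => f θ i (splitBits (z θ) (κ θ) r t)) (fun θ i a => length_catFin fun t => h5 _ _ _)
    (fun l => ?_) fun θ i => ?_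
  · have l1 : FLen (F.ext fun θ _ => Bits (z θ * κ θ)) fun θ p => toL p.2 :=
      FLen.toL (hz.mul h1).ext _
    have k1 := (FComp.id l).left l l1
    have k2 := (FComp.id l).right l l1 hI.ext
    have e1 : (fun θ p => toL p.2 : (F.ext fun θ _ => Bits (z θ * κ θ)).Str) =
        fun θ p => catFin fun t => toL (splitBits (z θ) (κ θ) p.2 t) := by
      funext θ p; exact (toL_splitBits _).symm
    rw [e1] at k1
    have k3 := FComp.catFin_get (F := F.ext fun θ _ => Bits (z θ * κ θ)) (m := κ)
      (f := fun θ p t => toL (splitBits (z θ) (κ θ) p.2 t)) (fun _ _ _ => length_toL _) l k1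
    refine FComp.catFin l hz ?_
    have k4 := FComp.circuit l.loop (k3.append l.loop k2.loop) (fun p => c p.1) (Fam.PB.loop h2)
    simpa only [h6] using k4
  · have := close_pi (h7 θ i) (z θ)
    have e2 := unif_map_equiv (splitBits (z θ) (κ θ))
    rw [← e2, PMF.map_comp] at this
    refine this.mono ?_
    rw [Nat.cast_mul, mul_div_assoc]

theorem FSamp.fun_bool (hI : FLen F inp) {A : ∀ θ, F.ι θ → Type} [∀ θ i, Fintype (A θ i)]
    [∀ θ i, Nonempty (A θ i)] {e : ∀ θ i, A θ i → List Bool} (h : FSamp F inp A e) :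
    FSamp F inp (fun θ i => Bool → A θ i) fun θ i a => catBool fun b => e θ i (a b) :=
  (h.fin hI (.const 2)).map (fun θ i => finTwoEquiv.arrowCongr (Equiv.refl _)) fun θ i a => by
    simp only [catBool, catFin, List.finRange_succ]
    simp
    rfl

end

/-! ### Rejection sampling modulo `p`. -/

/-- The last block, among the first `j`, that represents a number below `p`. -/
def rejectTo {T m : ℕ} (p : ℕ) (r : Fin T → Bits m) : ℕ → ZMod p
  | 0 => 0
  | j + 1 => if h : j < T then
      if natOf (toL (r ⟨j, h⟩)) < p then (natOf (toL (r ⟨j, h⟩)) : ZMod p) else rejectTo p r j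
    else 0

/-- Bit strings as numbers. -/
def bitsEquivFin (m : ℕ) : Bits m ≃ Fin (2 ^ m) where
  toFun b := ⟨natOf (toL b), by simpa [length_toL] using natOf_lt (toL b)⟩
  invFun a := natBits m a
  left_inv b := natBits_natOf b
  right_inv a := Fin.ext <| by simp [natOf_natBits, Nat.mod_eq_of_lt a.2]

theorem sum_range_zmod {p : ℕ} [NeZero p] (φ : ZMod p → ℝ≥0∞) :
    ∑ k ∈ Finset.range p, φ (k : ZMod p) = ∑ a, φ a := by
  rw [Finset.sum_range]
  refine Fintype.sum_bijective (fun k : Fin p => ((k : ℕ) : ZMod p)) ⟨fun a b h => ?_, fun a => ?_⟩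
    _ _ fun _ => rfl
  · have := congrArg ZMod.val h
    simp only [ZMod.val_cast_of_lt a.2, ZMod.val_cast_of_lt b.2] at this
    exact Fin.ext this
  · exact ⟨⟨a.val, a.val_lt⟩, by simp⟩

theorem ex_unif_bits {m : ℕ} (φ : ℕ → ℝ≥0∞) :
    ex (unif (Bits m)) (fun b => φ (natOf (toL b))) = (∑ k ∈ Finset.range (2 ^ m), φ k) / 2 ^ m := by
  rw [ex_unif, Finset.sum_range, ← (bitsEquivFin m).sum_comp]
  simp [bitsEquivFin]

/-- Conditioned on acceptance the draw is uniform below `p`, so the uniform distribution is a fixed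
point of one round of rejection. -/
theorem reject_fix {p m : ℕ} [NeZero p] (hp : p ≤ 2 ^ m) :
    ((unif (Bits m)).bind fun b => if natOf (toL b) < p then
      PMF.pure ((natOf (toL b) : ℕ) : ZMod p) else unif (ZMod p)) = unif (ZMod p) := by
  refine pmf_ext_ex fun φ => ?_
  rw [ex_bind, ex_unif_bits (φ := fun k => ex (if k < p then PMF.pure (k : ZMod p)
    else unif (ZMod p)) φ)]
  set x := ex (unif (ZMod p)) φ with hx
  have hp0 : (p : ℝ≥0∞) ≠ 0 := by simp [NeZero.ne p]
  have hS : ∑ k ∈ Finset.range p, φ (k : ZMod p) = p * x := by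
    rw [hx, ex_unif, sum_range_zmod, ZMod.card,
      ENNReal.mul_div_cancel hp0 (ENNReal.natCast_ne_top p)]
  rw [← Finset.sum_range_add_sum_Ico _ hp]
  have h1 : ∑ k ∈ Finset.range p, ex (if k < p then PMF.pure (k : ZMod p) else unif (ZMod p)) φ =
      p * x := by
    rw [← hS]
    refine Finset.sum_congr rfl fun k hk => ?_
    rw [if_pos (Finset.mem_range.1 hk), ex_pure]
  have h2 : ∑ k ∈ Finset.Ico p (2 ^ m), ex (if k < p then PMF.pure (k : ZMod p)
      else unif (ZMod p)) φ = (2 ^ m - p : ℕ) * x := by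
    rw [Finset.sum_congr rfl fun k hk => by
      rw [if_neg (not_lt.2 (Finset.mem_Ico.1 hk).1)]]
    simp [← hx]
  rw [h1, h2, ← add_mul, ← Nat.cast_add, Nat.add_sub_cancel' hp]
  push_cast
  rw [mul_comm, mul_div_assoc, ENNReal.div_self (by simp) (by simp), mul_one]

/-- Since `2 ^ m ≤ 2 * p`, at least half of the strings of `m` bits are accepted. -/
theorem ex_reject {p m : ℕ} [NeZero p] (hp : p ≤ 2 ^ m) (hp2 : 2 ^ m ≤ 2 * p) (c : ℝ≥0∞) :
    ex (unif (Bits m)) (fun b => if natOf (toL b) < p then 0 else c) ≤ c / 2 := by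
  rw [ex_unif_bits (φ := fun k => if k < p then 0 else c), ← Finset.sum_range_add_sum_Ico _ hp]
  have h1 : ∑ k ∈ Finset.range p, (if k < p then 0 else c) = 0 :=
    Finset.sum_eq_zero fun k hk => by rw [if_pos (Finset.mem_range.1 hk)]
  have h2 : ∑ k ∈ Finset.Ico p (2 ^ m), (if k < p then 0 else c) = (2 ^ m - p : ℕ) * c := by
    rw [Finset.sum_congr rfl fun k hk => by
      rw [if_neg (not_lt.2 (Finset.mem_Ico.1 hk).1)]]
    simp
  rw [h1, h2, zero_add]
  refine ENNReal.div_le_of_le_mul ?_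
  have h3 : ((2 ^ m - p : ℕ) : ℝ≥0∞) ≤ 2⁻¹ * 2 ^ m := by
    rw [← ENNReal.div_eq_inv_mul, ENNReal.le_div_iff_mul_le (by simp) (by simp)]
    exact_mod_cast (show (2 ^ m - p) * 2 ≤ 2 ^ m by omega)
  calc _ ≤ 2⁻¹ * 2 ^ m * c := by gcongr
    _ = _ := by rw [ENNReal.div_eq_inv_mul]; ring

theorem rejectTo_update {T m p : ℕ} (r : Fin T → Bits m) (t : Fin T) (b : Bits m) :
    ∀ j ≤ (t : ℕ), rejectTo p (Function.update r t b) j = rejectTo p r j := by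
  intro j
  induction j with
  | zero => intro _; rfl
  | succ j ih =>
    intro hj
    have hjT : j < T := by omega
    have : (⟨j, hjT⟩ : Fin T) ≠ t := fun h => by rw [← h] at hj; simp at hj
    simp only [rejectTo, dif_pos hjT, Function.update_of_ne this, ih (by omega)]

/-- Compare one round of the sampler with the fixed point `reject_fix`. They differ only on
rejection, which has probability at most `1 / 2`, and then by the error of the earlier rounds; so
each round halves the error. -/
theorem close_rejectTo {T m p : ℕ} [NeZero p] (hp : p ≤ 2 ^ m) (hp2 : 2 ^ m ≤ 2 * p) :
    ∀ j ≤ T, Close ((2 : ℝ≥0∞)⁻¹ ^ j)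
      ((unif (Fin T → Bits m)).map fun r => rejectTo p r j) (unif (ZMod p)) := by
  intro j
  induction j with
  | zero => intro _; exact Close.one _ _ (by simp)
  | succ j ih =>
    intro hj
    have hjT : j < T := hj
    have e1 : ((unif (Fin T → Bits m)).map fun r => rejectTo p r (j + 1)) =
        (unif (Bits m)).bind fun b => if natOf (toL b) < p then
          PMF.pure ((natOf (toL b) : ℕ) : ZMod p) else
          (unif (Fin T → Bits m)).map fun r => rejectTo p r j := by
      rw [PMF.map, ← unif_resample (⟨j, hjT⟩ : Fin T), PMF.bind_comm]
      congr 1; funext b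
      simp only [Function.comp_apply, rejectTo, dif_pos hjT, Function.update_self]
      split_ifs with h
      · simp
      · simp only [rejectTo_update _ _ _ _ le_rfl]; rfl
    rw [e1]
    conv_rhs => rw [← reject_fix hp]
    refine (Close.bind_ex (δ := fun b => if natOf (toL b) < p then 0 else (2 : ℝ≥0∞)⁻¹ ^ j)
      fun b => ?_).mono ((ex_reject hp hp2 _).trans_eq ?_)
    · split_ifs with h
      · exact Close.refl _ _
      · exact ih (by omega)
    · rw [pow_succ, ENNReal.div_eq_inv_mul, mul_comm]

/-! ### Exponents -/

section zpw
variable {H : Type} [CommGroup H] [Fintype H]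

theorem pow_mod_card' (h : H) (a : ℕ) : h ^ (a % Fintype.card H) = h ^ a := pow_mod_card h a

theorem zpw_add (h : H) (a b : ZMod (Fintype.card H)) : zpw h (a + b) = zpw h a * zpw h b := by
  rw [zpw, zpw, zpw, ZMod.val_add, pow_mod_card', pow_add]

theorem zpw_zero (h : H) : zpw h (0 : ZMod (Fintype.card H)) = 1 := by simp [zpw]

theorem zpw_neg (h : H) (a : ZMod (Fintype.card H)) : zpw h (-a) = (zpw h a)⁻¹ := by
  rw [eq_inv_iff_mul_eq_one, ← zpw_add, neg_add_cancel, zpw_zero]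

theorem zpw_sub (h : H) (a b : ZMod (Fintype.card H)) : zpw h (a - b) = zpw h a / zpw h b := by
  rw [sub_eq_add_neg, zpw_add, zpw_neg, div_eq_mul_inv]

theorem zpw_mul (h : H) (a b : ZMod (Fintype.card H)) : zpw h (a * b) = zpw (zpw h a) b := by
  rw [zpw, zpw, zpw, ZMod.val_mul, pow_mod_card', pow_mul]

theorem zpw_injective {g : H} (hg : ∀ x, x ∈ Subgroup.zpowers g) :
    Function.Injective (zpw g : ZMod (Fintype.card H) → H) := by
  intro a b h
  have ho := orderOf_eq_card_of_forall_mem_zpowers hg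
  rw [Nat.card_eq_fintype_card] at ho
  have : NeZero (Fintype.card H) := ⟨Fintype.card_ne_zero⟩
  have := (pow_inj_mod (x := g)).1 h
  rw [ho, Nat.mod_eq_of_lt (ZMod.val_lt a), Nat.mod_eq_of_lt (ZMod.val_lt b)] at this
  exact ZMod.val_injective _ this

end zpw

/-! ### Group operations by circuits -/

section grp
variable {𝔾 : GroupGen}

/-- The group generated with coins `c`. -/
abbrev GroupGen.El (𝔾 : GroupGen) (n : ℕ) (c : Bits (𝔾.coinLen n)) : Type :=
  𝔾.Grp n (𝔾.gen n c)

/-- Exponents for the group generated with coins `c`. -/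
abbrev GroupGen.Ex (𝔾 : GroupGen) (n : ℕ) (c : Bits (𝔾.coinLen n)) : Type :=
  ZMod (𝔾.p n (𝔾.gen n c))

/-- The description of the group generated with coins `c`. -/
def GroupGen.desc (𝔾 : GroupGen) (n : ℕ) (c : Bits (𝔾.coinLen n)) : List Bool := toL (𝔾.gen n c)

/-- Encoded group elements. -/
def GroupGen.eL (𝔾 : GroupGen) {n : ℕ} {c : Bits (𝔾.coinLen n)} (h : 𝔾.El n c) : List Bool :=
  toL (𝔾.encode n (𝔾.gen n c) h)

/-- The generator of the group generated with coins `c`. -/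
def GroupGen.gen0 (𝔾 : GroupGen) (n : ℕ) (c : Bits (𝔾.coinLen n)) : 𝔾.El n c :=
  𝔾.g n (𝔾.gen n c)

theorem GroupGen.p_lt {n : ℕ} (hn : 1 ≤ n) (c : Bits (𝔾.coinLen n)) :
    𝔾.p n (𝔾.gen n c) < 2 ^ (n + 1) := by
  have := Nat.lt_pow_succ_log_self (b := 2) (by norm_num) (𝔾.p n (𝔾.gen n c))
  rwa [𝔾.log_card n c hn] at this

theorem GroupGen.le_p {n : ℕ} (hn : 1 ≤ n) (c : Bits (𝔾.coinLen n)) :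
    2 ^ n ≤ 𝔾.p n (𝔾.gen n c) := by
  have := Nat.pow_log_le_self 2 (x := 𝔾.p n (𝔾.gen n c)) Fintype.card_ne_zero
  rwa [𝔾.log_card n c hn] at this

variable {F : Fam} {inp : F.Str} {gc : ∀ θ, F.ι θ → Bits (𝔾.coinLen (F.n θ))}

theorem FLen.desc : FLen F fun θ i => 𝔾.desc (F.n θ) (gc θ i) :=
  FLen.toL (Fam.PB.poly 𝔾.descLen_poly) _

theorem FLen.eL (h : ∀ θ i, 𝔾.El (F.n θ) (gc θ i)) : FLen F fun θ i => 𝔾.eL (h θ i) :=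
  FLen.toL (Fam.PB.poly 𝔾.elemLen_poly) _

theorem length_eL {n : ℕ} {c : Bits (𝔾.coinLen n)} (h : 𝔾.El n c) :
    (𝔾.eL h).length = 𝔾.elemLen n := length_toL _

theorem FComp.gmul (hI : FLen F inp) (hd : FComp F inp fun θ i => 𝔾.desc (F.n θ) (gc θ i))
    {a b : ∀ θ i, 𝔾.El (F.n θ) (gc θ i)} (ha : FComp F inp fun θ i => 𝔾.eL (a θ i))
    (hb : FComp F inp fun θ i => 𝔾.eL (b θ i)) :
    FComp F inp fun θ i => 𝔾.eL (a θ i * b θ i) :=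
  FComp.apply 𝔾.mul_poly hI (fun θ i => ⟨gc θ i, a θ i, b θ i⟩) ((hd.append hI ha).append hI hb)

theorem FComp.ginv (hI : FLen F inp) (hd : FComp F inp fun θ i => 𝔾.desc (F.n θ) (gc θ i))
    {a : ∀ θ i, 𝔾.El (F.n θ) (gc θ i)} (ha : FComp F inp fun θ i => 𝔾.eL (a θ i)) :
    FComp F inp fun θ i => 𝔾.eL (a θ i)⁻¹ :=
  FComp.apply 𝔾.inv_poly hI (fun θ i => ⟨gc θ i, a θ i⟩) (hd.append hI ha)

theorem FComp.gdiv (hI : FLen F inp) (hd : FComp F inp fun θ i => 𝔾.desc (F.n θ) (gc θ i))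
    {a b : ∀ θ i, 𝔾.El (F.n θ) (gc θ i)} (ha : FComp F inp fun θ i => 𝔾.eL (a θ i))
    (hb : FComp F inp fun θ i => 𝔾.eL (b θ i)) :
    FComp F inp fun θ i => 𝔾.eL (a θ i / b θ i) := by
  simp only [div_eq_mul_inv]
  exact hd.gmul hI ha (hd.ginv hI hb)

theorem FComp.ggen (hI : FLen F inp) (hd : FComp F inp fun θ i => 𝔾.desc (F.n θ) (gc θ i)) :
    FComp F inp fun θ i => 𝔾.eL (𝔾.gen0 (F.n θ) (gc θ i)) :=
  FComp.apply 𝔾.g_poly hI gc hd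

theorem FComp.gdesc (hI : FLen F inp) (hc : FComp F inp fun θ i => toL (gc θ i)) :
    FComp F inp fun θ i => 𝔾.desc (F.n θ) (gc θ i) :=
  FComp.apply 𝔾.gen_poly hI gc hc

theorem take_drop_toL {m : ℕ} (b : Bits m) {j : ℕ} (hj : j < m) :
    ((toL b).drop j).take 1 = [b ⟨j, hj⟩] := by
  apply List.ext_getElem
  · simp [toL]; omega
  · intro i h1 h2
    have : i = 0 := by simpa using h2
    subst this
    simp [toL]

/-- Square and multiply from the least significant bit: after `j` rounds the state holds `h ^ (2 ^
j)` and `h ^ (a mod 2 ^ j)`. As `p < 2 ^ (n + 1)`, the bound `1 ≤ n` ensures that `n + 1` rounds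
exhaust the exponent. -/
theorem FComp.gexp (h1 : ∀ θ, 1 ≤ F.n θ) (hI : FLen F inp)
    (hd : FComp F inp fun θ i => 𝔾.desc (F.n θ) (gc θ i))
    {h : ∀ θ i, 𝔾.El (F.n θ) (gc θ i)} (hh : FComp F inp fun θ i => 𝔾.eL (h θ i))
    {a : ∀ θ i, 𝔾.Ex (F.n θ) (gc θ i)} (ha : FComp F inp fun θ i => expL (F.n θ) (a θ i)) :
    FComp F inp fun θ i => 𝔾.eL (zpw (h θ i) (a θ i)) := by
  have hT : F.PB fun θ => F.n θ + 1 := Fam.PB.n.add (.const 1)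
  let B : ∀ (θ) (j : ℕ) (i), 𝔾.El (F.n θ) (gc θ i) := fun θ j i => h θ i ^ 2 ^ j
  let Ac : ∀ (θ) (j : ℕ) (i), 𝔾.El (F.n θ) (gc θ i) := fun θ j i => h θ i ^ ((a θ i).val % 2 ^ j)
  have h0 : FComp F inp fun θ i => 𝔾.eL (Ac θ 0 i) := by
    -- The encoding of the neutral element is obtained as that of `h * h⁻¹`.
    have := hd.gmul hI hh (hd.ginv hI hh)
    simpa [Ac, Nat.mod_one] using this
  have hB : FComp F inp fun θ i => 𝔾.eL (B θ 0 i) := by simpa [B] using hh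
  have key := FComp.iterate hI hT (fun θ j i => 𝔾.desc (F.n θ) (gc θ i) ++ (expL (F.n θ) (a θ i) ++
    (𝔾.eL (B θ j i) ++ 𝔾.eL (Ac θ j i)))) (hd.append hI (ha.append hI (hB.append hI h0))) (by
      let F' := F.loop fun θ => F.n θ + 1
      have l1 : FLen F' fun p i => 𝔾.desc (F.n p.1) (gc p.1 i) := FLen.desc.loop
      have l2 : FLen F' fun p i => expL (F.n p.1) (a p.1 i) := FLen.expL (F := F') _
      have l3 : FLen F' fun p i => 𝔾.eL (B p.1 p.2 i) := FLen.eL (F := F') _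
      have l4 : FLen F' fun p i => 𝔾.eL (Ac p.1 p.2 i) := FLen.eL (F := F') _
      let src : F'.Str := fun p i => 𝔾.desc (F.n p.1) (gc p.1 i) ++ (expL (F.n p.1) (a p.1 i) ++
        (𝔾.eL (B p.1 p.2 i) ++ 𝔾.eL (Ac p.1 p.2 i)))
      have l : FLen F' src := l1.append (l2.append (l3.append l4))
      have k1 := (FComp.id l).left l l1
      have k' := (FComp.id l).right l l1 (l2.append (l3.append l4))
      have k2 := k'.left l l2
      have k'' := k'.right l l2 (l3.append l4)
      have k3 := k''.left l l3
      have k4 := k''.right l l3 l4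
      have e1 : FComp F' src fun p i => 𝔾.eL (B p.1 (p.2 + 1) i) := by
        have := FComp.gmul (F := F') (gc := fun p i => gc p.1 i) l k1 k3 k3
        simpa only [B, pow_succ, mul_two, pow_add, pow_mul, pow_one] using this
      have bit : FComp F' src fun p i => [(a p.1 i).val.testBit p.2] := by
        have := k2.slice l (fun p => p.2) (fun _ => 1)
        simp only [expL] at this
        convert this using 3 with p i
        rw [take_drop_toL _ p.2.2]; rfl
      have e2 : FComp F' src fun p i => 𝔾.eL (Ac p.1 (p.2 + 1) i) := by
        have := bit.mux l (FComp.gmul (F := F') (gc := fun p i => gc p.1 i) l k1 k4 k3) k4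
          fun p i => by rw [length_eL, length_eL]
        convert this using 3 with p i
        simp only [Ac, B]
        rw [Nat.mod_pow_succ, pow_add]
        rw [← apply_ite]
        congr 1
        have : (a p.1 i).val / 2 ^ (p.2 : ℕ) % 2 = ((a p.1 i).val.testBit p.2).toNat := by
          rw [Nat.toNat_testBit]
        rw [this]
        cases (a p.1 i).val.testBit p.2 <;> simp
      exact k1.append l (k2.append l (e1.append l e2)))
  have r1 := key.right hI FLen.desc ((FLen.expL _).append ((FLen.eL _).append (FLen.eL _)))
  have r2 := r1.right hI (FLen.expL _) ((FLen.eL _).append (FLen.eL _))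
  have r3 := r2.right hI (FLen.eL _) (FLen.eL _)
  convert r3 using 3 with θ i
  simp only [Ac, zpw]
  rw [Nat.mod_eq_of_lt ((ZMod.val_lt _).trans (GroupGen.p_lt (h1 θ) _))]

/-- Rejection sampling with `n` blocks of `n + 1` bits. The bounds `2 ^ n ≤ p < 2 ^ (n + 1)` make
each block succeed with probability at least `1 / 2`, which leaves an error of `2 ^ (-n)`. The
circuit carries the current candidate and overwrites it when a block lies below `p`. -/
theorem FSamp.ex (h1 : ∀ θ, 1 ≤ F.n θ) (hI : FLen F inp)
    (hd : FComp F inp fun θ i => 𝔾.desc (F.n θ) (gc θ i)) :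
    FSamp F inp (fun θ i => 𝔾.Ex (F.n θ) (gc θ i)) fun θ _ a => expL (F.n θ) a := by
  have hm : F.PB fun θ => F.n θ + 1 := Fam.PB.n.add (.const 1)
  refine FSamp.mk' hI (κ := fun θ => F.n θ * (F.n θ + 1)) (Fam.PB.n.mul hm) hm (.const 1)
    (fun θ i r => rejectTo _ (splitBits _ _ r) (F.n θ)) (fun _ _ _ => length_toL _) (fun l => ?_)
    fun θ i => ?_
  · let F' := F.ext fun θ _ => Bits (F.n θ * (F.n θ + 1))
    let src : F'.Str := fun θ p => toL p.2 ++ inp θ p.1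
    have hn : F'.PB fun θ => F.n θ := Fam.PB.n (F := F')
    have hm' : F'.PB fun θ => F.n θ + 1 := hm
    have l1 : FLen F' fun θ p => toL p.2 := FLen.toL (hn.mul hm') _
    have k1 := (FComp.id l).left l l1
    have k2 := (FComp.id l).right l l1 hI.ext
    have kd := k2.comp l hd.ext
    have ko := FComp.apply 𝔾.order_poly l (fun θ p => gc θ p.1) kd
    have e1 : (fun θ p => toL p.2 : F'.Str) =
        fun θ p => catFin fun t => toL (splitBits (F.n θ) (F.n θ + 1) p.2 t) := by
      funext θ p; exact (toL_splitBits _).symm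
    let st : ∀ θ, ℕ → F'.ι θ → List Bool := fun θ j p => expL (F.n θ)
      (rejectTo (𝔾.p (F.n θ) (𝔾.gen (F.n θ) (gc θ p.1))) (splitBits (F.n θ) (F.n θ + 1) p.2) j)
    have ls : ∀ j, FLen F' fun θ p => st θ j p := fun j => FLen.toL hm' _
    have key := FComp.iterate l hn (fun θ j p => src θ p ++ st θ j p)
      ((FComp.id l).append l (by
        convert FComp.const l (fun θ => List.replicate (F.n θ + 1) false) (by simpa using hm')
          using 3 with θ p
        simp only [st, rejectTo, expL]
        apply List.ext_getElem
        · simp [toL]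
        · intro j _ _; simp only [toL, natBits, List.getElem_ofFn, List.getElem_replicate]; simp)) (by
      have lsl : FLen (F'.loop fun θ => F.n θ) fun q p => st q.1 q.2 p :=
        FLen.toL (Fam.PB.loop hm') _
      have ll := l.loop.append lsl
      have m1 := (FComp.id ll).left ll l.loop
      have m2 := (FComp.id ll).right ll l.loop lsl
      rw [e1] at k1
      have b1 := m1.comp ll (FComp.catFin_get (F := F') (m := fun θ => F.n θ + 1)
        (f := fun θ p t => toL (splitBits (F.n θ) (F.n θ + 1) p.2 t))
        (fun _ _ _ => length_toL _) l k1)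
      have o1 := m1.comp ll ko.loop
      have c1 := FComp.lt ll b1 o1 fun _ _ => by rw [length_toL, length_toL]
      refine m1.append ll ?_
      convert c1.mux ll b1 m2 fun _ _ => by simp only [st, expL, length_toL] using 3 with q p
      have hp := GroupGen.p_lt (h1 q.1) (gc q.1 p.1)
      rw [natOf_natBits, Nat.mod_eq_of_lt hp]
      simp only [st, rejectTo, dif_pos q.2.2]
      by_cases hlt : natOf (toL (splitBits (F.n q.1) (F.n q.1 + 1) p.2 q.2)) <
        𝔾.p (F.n q.1) (𝔾.gen (F.n q.1) (gc q.1 p.1))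
      · rw [if_pos hlt, if_pos (by simpa using hlt), expL, ZMod.val_cast_of_lt hlt, natBits_natOf]
      · rw [if_neg hlt, if_neg (by simpa using hlt)])
    exact key.right l l (FLen.toL hm' _)
  · have hp := GroupGen.p_lt (h1 θ) (gc θ i)
    have hp' := GroupGen.le_p (h1 θ) (gc θ i)
    have := close_rejectTo (T := F.n θ) hp.le (by rw [pow_succ]; omega) (F.n θ) le_rfl
    rw [← unif_map_equiv (splitBits _ _), PMF.map_comp] at this
    refine this.mono ?_
    rw [← ENNReal.inv_pow, ENNReal.div_eq_inv_mul]; simp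

end grp

/-! ### Lazy sampling of the random oracle -/

/-- The answer to the query `q` recorded in a table, and `a` if there is none. -/
def lookup (tbl : List (List Bool × List Bool)) (q a : List Bool) : List Bool :=
  tbl.foldl (fun acc e => if e.1 = q then e.2 else acc) a

theorem lookup_snoc (tbl : List (List Bool × List Bool)) (e : List Bool × List Bool)
    (q a : List Bool) : lookup (tbl ++ [e]) q a = if e.1 = q then e.2 else lookup tbl q a := by
  simp [lookup]

/-- One gate with lazily sampled answers to the queries of length `ℓ`: the state consists of the
memory and the table of earlier queries. -/
def lazyStep (ℓ : ℕ) (st : List Bool × List (List Bool × List Bool)) (g : Gate × List Bool) :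
    List Bool × List (List Bool × List Bool) :=
  match g.1 with
  | .op f i j k => (st.1 ++ [f (st.1.getD i false) (st.1.getD j false) (st.1.getD k false)], st.2)
  | .query q => if q.length = ℓ then
      (st.1 ++ lookup st.2 (q.map fun i => st.1.getD i false) g.2,
        st.2 ++ [(q.map fun i => st.1.getD i false,
          lookup st.2 (q.map fun i => st.1.getD i false) g.2)])
      else st

/-- Run of gates with lazily sampled answers `ans`. -/
def lazyRun (ℓ : ℕ) (gs : List Gate) (ans : List (List Bool))
    (st : List Bool × List (List Bool × List Bool)) : List Bool × List (List Bool × List Bool) :=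
  (gs.zip ans).foldl (lazyStep ℓ) st

/-- The oracle `G` with the answers of a table. -/
def tableOracle {ℓ k : ℕ} (G : Bits ℓ → Bits k) (tbl : List (List Bool × List Bool)) :
    List Bool → List Bool := fun q =>
  if q.length = ℓ then lookup tbl q (oracleOf G q) else []

theorem oracleOf_toL {ℓ k : ℕ} (G : Bits ℓ → Bits k) (v : Bits ℓ) :
    oracleOf G (toL v) = toL (G v) := by
  have h : (toL v).length = ℓ := length_toL v
  rw [oracleOf, dif_pos h]
  congr 2; funext i
  simp only [toL, List.get_ofFn]
  rfl

theorem oracleOf_of_ne {ℓ k : ℕ} (G : Bits ℓ → Bits k) {q : List Bool} (h : q.length ≠ ℓ) :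
    oracleOf G q = [] := dif_neg h

theorem exists_toL {ℓ : ℕ} {q : List Bool} (h : q.length = ℓ) : ∃ v : Bits ℓ, toL v = q := by
  subst h; exact ⟨q.get, List.ofFn_get q⟩

theorem answerLen_oracleOf {ι : Type} {ℓ k : ℕ} (G : ι → Bits ℓ → Bits k) :
    AnswerLen (fun i => oracleOf (G i)) fun m => if m = ℓ then k else 0 := by
  intro i q
  simp only
  split_ifs with h
  · obtain ⟨v, rfl⟩ := exists_toL h
    rw [oracleOf_toL, length_toL]
  · rw [oracleOf_of_ne _ h]; rfl

theorem tableOracle_nil {ℓ k : ℕ} (G : Bits ℓ → Bits k) : tableOracle G [] = oracleOf G := by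
  funext q
  by_cases h : q.length = ℓ
  · simp [tableOracle, h, lookup]
  · simp [tableOracle, h, oracleOf_of_ne]

/-- Once a point is recorded, the table shadows the value of `G` there, so that value is free to be
resampled. -/
theorem tableOracle_update {ℓ k : ℕ} (G : Bits ℓ → Bits k) (tbl : List (List Bool × List Bool))
    (v : Bits ℓ) (a : Bits k) (r : List Bool) :
    tableOracle (Function.update G v a) (tbl ++ [(toL v, r)]) =
      tableOracle G (tbl ++ [(toL v, r)]) := by
  funext q
  unfold tableOracle
  split_ifs with h
  · obtain ⟨w, rfl⟩ := exists_toL h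
    rw [lookup_snoc, lookup_snoc]
    split_ifs with h'
    · rfl
    · rw [oracleOf_toL, oracleOf_toL, Function.update_of_ne]
      rintro rfl; exact h' rfl
  · rfl

/-- Recording the answer that would have been given anyway changes nothing. -/
theorem tableOracle_snoc_self {ℓ k : ℕ} (G : Bits ℓ → Bits k)
    (tbl : List (List Bool × List Bool)) (v : Bits ℓ) :
    tableOracle G (tbl ++ [(toL v, lookup tbl (toL v) (toL (G v)))]) = tableOracle G tbl := by
  funext q
  unfold tableOracle
  split_ifs with h
  · rw [lookup_snoc]
    split_ifs with h'
    · rw [← h', oracleOf_toL]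
    · rfl
  · rfl

/-- Running gates with a uniformly random oracle amounts to sampling its answers lazily. -/
theorem lazyRun_dist {ℓ k : ℕ} (gs : List Gate) :
    ∀ st : List Bool × List (List Bool × List Bool),
      ((unif (Bits ℓ → Bits k)).map fun G => runGates (tableOracle G st.2) gs st.1) =
      (unif (Fin gs.length → Bits k)).map fun r =>
        (lazyRun ℓ gs (List.ofFn fun t => toL (r t)) st).1 := by
  induction gs with
  | nil =>
    intro st
    simp only [runGates, List.foldl_nil, lazyRun, List.zip_nil_left]
    exact (PMF.map_const _ _).trans (PMF.map_const _ _).symm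
  | cons g gs ih =>
    rintro ⟨mem, tbl⟩
    have hR : ((unif (Fin (g :: gs).length → Bits k)).map fun r =>
        (lazyRun ℓ (g :: gs) (List.ofFn fun t => toL (r t)) (mem, tbl)).1) =
        (unif (Bits k)).bind fun a => (unif (Fin gs.length → Bits k)).map fun r =>
          (lazyRun ℓ gs (List.ofFn fun t => toL (r t)) (lazyStep ℓ (mem, tbl) (g, toL a))).1 := by
      rw [List.length_cons, unif_fin_succ, PMF.map_bind]
      simp only [PMF.map_bind, PMF.pure_map]
      congr 1; funext a
      rw [PMF.map]
      congr 1; funext r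
      simp only [lazyRun, Function.comp_apply, List.ofFn_succ, Fin.cons_zero, Fin.cons_succ,
        List.zip_cons_cons, List.foldl_cons]
    rw [hR]
    simp only [← ih]
    cases g with
    | op f i j k' =>
      -- One answer is drawn for every gate; a gate without a query leaves it unused.
      simp only [lazyStep, PMF.bind_const]
      rfl
    | query q =>
      by_cases hq : q.length = ℓ
      · obtain ⟨v, hv⟩ := exists_toL (q := q.map fun i => mem.getD i false)
          (ℓ := ℓ) (by simpa using hq)
        simp only [lazyStep, hq, if_true, ← hv]
        -- Resample `G` at the queried point `v`. The fresh value `a` is the answer if `v` is not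
        -- yet in the table, and after the answer has been recorded `G v` is never consulted again,
        -- so the rest of the run sees the original `G`.
        rw [PMF.map, ← unif_resample v, PMF.bind_comm]
        congr 1; funext a
        rw [PMF.map]
        congr 1; funext G
        simp only [Function.comp_apply]
        congr 1
        have h1 : tableOracle (Function.update G v a) tbl (toL v) = lookup tbl (toL v) (toL a) := by
          rw [tableOracle, if_pos (length_toL v), oracleOf_toL, Function.update_self]
        have h2 := tableOracle_snoc_self (Function.update G v a) tbl v
        rw [Function.update_self, tableOracle_update] at h2
        simp only [runGates, List.foldl_cons]
        rw [Gate.step, ← hv, h1, h2]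
      · simp only [lazyStep, hq, if_false, PMF.bind_const]
        congr 1; funext G
        simp only [runGates, List.foldl_cons, Gate.step]
        rw [tableOracle, if_neg (by simpa using hq), List.append_nil]

/-! ### Lazy sampling by circuits -/

/-- A table as a string. -/
def flatTable (tbl : List (List Bool × List Bool)) : List Bool := tbl.flatMap fun e => e.1 ++ e.2

theorem length_flatTable {ℓ k : ℕ} {tbl : List (List Bool × List Bool)}
    (h : ∀ e ∈ tbl, e.1.length = ℓ ∧ e.2.length = k) :
    (flatTable tbl).length = tbl.length * (ℓ + k) :=
  length_flatMap_const tbl fun e he => by rw [List.length_append, (h e he).1, (h e he).2]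

/-- The table is scanned entry by entry; a match overwrites the candidate answer carried in the
state. -/
theorem FComp.lookup {F : Fam} {inp : F.Str} (hI : FLen F inp)
    {tbl : ∀ θ, F.ι θ → List (List Bool × List Bool)} {v a : F.Str} {N ℓ k : F.Θ → ℕ}
    (hN : F.PB N) (hk : F.PB k) (hl : ∀ θ i, (tbl θ i).length = N θ)
    (hv' : ∀ θ i, (v θ i).length = ℓ θ) (ha' : ∀ θ i, (a θ i).length = k θ)
    (he : ∀ θ i, ∀ e ∈ tbl θ i, e.1.length = ℓ θ ∧ e.2.length = k θ)
    (ht : FComp F inp fun θ i => flatTable (tbl θ i)) (hv : FComp F inp v) (ha : FComp F inp a) :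
    FComp F inp fun θ i => DUQMR.lookup (tbl θ i) (v θ i) (a θ i) := by
  let acc : ∀ θ, ℕ → F.ι θ → List Bool := fun θ j i =>
    DUQMR.lookup ((tbl θ i).take j) (v θ i) (a θ i)
  have hacc : ∀ θ j i, (acc θ j i).length = k θ := by
    intro θ j i
    have : ∀ L : List (List Bool × List Bool), (∀ e ∈ L, e.2.length = k θ) → ∀ b : List Bool,
        b.length = k θ → (DUQMR.lookup L (v θ i) b).length = k θ := by
      intro L
      induction L with
      | nil => intro _ b hb; simpa [DUQMR.lookup] using hb
      | cons e L ih =>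
        intro hL b hb
        simp only [DUQMR.lookup, List.foldl_cons]
        exact ih (fun e he => hL e (by simp [he])) _ (by
          split_ifs
          · exact hL e (by simp)
          · exact hb)
    exact this _ (fun e h => (he θ i e (List.mem_of_mem_take h)).2) _ (ha' θ i)
  have key := FComp.iterate hI hN (fun θ j i => acc θ j i ++ (v θ i ++ flatTable (tbl θ i)))
    (FComp.append hI (by simpa [acc, DUQMR.lookup] using ha) (hv.append hI ht)) (by
      let F' := F.loop N
      let src : F'.Str := fun p i => acc p.1 p.2 i ++ (v p.1 i ++ flatTable (tbl p.1 i))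
      have l1 : FLen F' fun p i => acc p.1 p.2 i := ⟨_, hk.loop, fun p i => hacc _ _ _⟩
      have l2 : FLen F' fun p i => v p.1 i := hv.len.loop
      have l3 : FLen F' fun p i => flatTable (tbl p.1 i) := ht.len.loop
      have l : FLen F' src := l1.append (l2.append l3)
      have k1 : FComp F' src fun p i => acc p.1 p.2 i := (FComp.id l).left l l1
      have k23 := (FComp.id l).right l l1 (l2.append l3)
      have k2 := k23.left l l2
      have k3 := k23.right l l2 l3
      have hj : ∀ (p : F'.Θ) (i : F'.ι p), (p.2 : ℕ) < (tbl p.1 i).length := fun p i => by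
        rw [hl]; exact p.2.2
      have m1 : FComp F' src fun p i => ((tbl p.1 i)[(p.2 : ℕ)]'(hj p i)).1 ++
          ((tbl p.1 i)[(p.2 : ℕ)]'(hj p i)).2 := by
        have := k3.slice l (fun p => p.2 * (ℓ p.1 + k p.1)) (fun p => ℓ p.1 + k p.1)
        convert this using 3 with p i
        exact (slice_flatMap (f := fun e : List Bool × List Bool => e.1 ++ e.2) (tbl p.1 i)
          (fun e h => by rw [List.length_append, (he _ _ e h).1, (he _ _ e h).2]) _ (hj p i)).symm
      have g1 : ∀ (p : F'.Θ) (i : F'.ι p), (((tbl p.1 i)[(p.2 : ℕ)]'(hj p i)).1).length = ℓ p.1 :=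
        fun p i => (he _ _ _ (List.getElem_mem _)).1
      have g2 : ∀ (p : F'.Θ) (i : F'.ι p), (((tbl p.1 i)[(p.2 : ℕ)]'(hj p i)).2).length = k p.1 :=
        fun p i => (he _ _ _ (List.getElem_mem _)).2
      have lv := hv.len
      have lm1 : FLen F' fun p i => ((tbl p.1 i)[(p.2 : ℕ)]'(hj p i)).1 := by
        obtain ⟨L, hL, hL'⟩ := lv
        exact ⟨_, hL.loop, fun p i => by rw [g1, ← hv' p.1 i, hL']⟩
      have lm2 : FLen F' fun p i => ((tbl p.1 i)[(p.2 : ℕ)]'(hj p i)).2 := ⟨_, hk.loop, g2⟩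
      have q1 := m1.left l lm1
      have q2 := m1.right l lm1 lm2
      have c1 := FComp.eq l q1 k2 fun p i => by rw [g1, hv']
      have r := c1.mux l q2 k1 fun p i => by rw [g2, hacc]
      convert r.append l k23 using 4 with p i
      simp only [acc]
      rw [List.take_succ_eq_append_getElem (hj p i), lookup_snoc]
      simp)
  have := key.left hI ⟨_, hk, fun θ i => hacc θ _ i⟩
  convert this using 3 with θ i
  simp only [acc]
  rw [← hl θ i, List.take_length]

/-- The number of wires that a gate adds, if queries of length `ℓ` have answers of length `k`. -/
def growMem (ℓ k : ℕ) : Gate → ℕ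
  | .op _ _ _ _ => 1
  | .query q => if q.length = ℓ then k else 0

/-- The number of table entries that a gate adds. -/
def growTable (ℓ : ℕ) : Gate → ℕ
  | .op _ _ _ _ => 0
  | .query q => if q.length = ℓ then 1 else 0

theorem length_lookup {k : ℕ} {tbl : List (List Bool × List Bool)} {q a : List Bool}
    (h : ∀ e ∈ tbl, e.2.length = k) (ha : a.length = k) : (lookup tbl q a).length = k := by
  induction tbl using List.reverseRecOn with
  | nil => exact ha
  | append_singleton tbl e ih =>
    rw [lookup_snoc]
    split_ifs
    · exact h e (by simp)
    · exact ih fun e he => h e (by simp [he])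

/-- The sizes of memory and table are determined by the gates, not by the answers, so the state of a
lazy run can be stored as a string of known format. -/
theorem lazyRun_inv {ℓ k : ℕ} (gs : List Gate) :
    ∀ (ans : List (List Bool)) (st : List Bool × List (List Bool × List Bool)),
      gs.length ≤ ans.length → (∀ a ∈ ans, a.length = k) →
      (∀ e ∈ st.2, e.1.length = ℓ ∧ e.2.length = k) →
      (lazyRun ℓ gs ans st).1.length = st.1.length + (gs.map (growMem ℓ k)).sum ∧
      (lazyRun ℓ gs ans st).2.length = st.2.length + (gs.map (growTable ℓ)).sum ∧
      ∀ e ∈ (lazyRun ℓ gs ans st).2, e.1.length = ℓ ∧ e.2.length = k := by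
  induction gs with
  | nil => intro ans st _ _ h; exact ⟨rfl, rfl, h⟩
  | cons g gs ih =>
    rintro (_ | ⟨a, ans⟩) st hlen hans hst
    · simp at hlen
    have hstep : (lazyStep ℓ st (g, a)).1.length = st.1.length + growMem ℓ k g ∧
        (lazyStep ℓ st (g, a)).2.length = st.2.length + growTable ℓ g ∧
        ∀ e ∈ (lazyStep ℓ st (g, a)).2, e.1.length = ℓ ∧ e.2.length = k := by
      cases g with
      | op f i j k => exact ⟨by simp [lazyStep, growMem], by simp [lazyStep, growTable], hst⟩
      | query q =>
        have hl : ∀ q', (lookup st.2 q' a).length = k := fun q' =>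
          length_lookup (fun e he => (hst e he).2) (hans a (by simp))
        by_cases hq : q.length = ℓ
        · refine ⟨by simp [lazyStep, growMem, hq, hl], by simp [lazyStep, growTable, hq], ?_⟩
          intro e he
          simp only [lazyStep, hq, if_true, List.mem_append, List.mem_singleton] at he
          rcases he with he | rfl
          · exact hst e he
          · exact ⟨by simpa using hq, hl _⟩
        · simp only [lazyStep, growMem, growTable, hq, if_false]
          exact ⟨rfl, rfl, hst⟩
    have := ih ans (lazyStep ℓ st (g, a)) (by simpa using hlen) (fun b hb => hans b (by simp [hb]))
      hstep.2.2
    rw [hstep.1, hstep.2.1] at this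
    simp only [lazyRun, List.zip_cons_cons, List.foldl_cons, List.map_cons, List.sum_cons] at this ⊢
    exact ⟨by rw [this.1]; ring, by rw [this.2.1]; ring, this.2.2⟩

theorem lazyRun_succ {ℓ : ℕ} (gs : List Gate) (ans : List (List Bool))
    (st : List Bool × List (List Bool × List Bool)) (t : ℕ) (h : t < gs.length)
    (h' : t < ans.length) :
    lazyRun ℓ (gs.take (t + 1)) (ans.take (t + 1)) st =
      lazyStep ℓ (lazyRun ℓ (gs.take t) (ans.take t) st) (gs[t], ans[t]) := by
  simp only [lazyRun]
  rw [List.take_succ_eq_append_getElem h, List.take_succ_eq_append_getElem h', List.zip_append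
    (by simp; omega), List.foldl_append]
  rfl

theorem sum_map_le {κ : Type} (L : List κ) (f : κ → ℕ) (b : ℕ) (h : ∀ x ∈ L, f x ≤ b) :
    (L.map f).sum ≤ L.length * b := by
  have := List.sum_le_card_nsmul (L.map f) b (by simpa using h)
  simpa using this

/-- Parameters of lazy sampling: query and answer lengths, input length, oracle circuit. -/
@[reducible] def lazyFam : Fam where
  Θ := ℕ × ℕ × ℕ × RandCircuit
  n _ := 0
  sz θ := θ.1 + θ.2.1 + θ.2.2.1 + θ.2.2.2.size
  ι θ := Bits (θ.2.2.2.gates.length * θ.2.1) × Bits θ.2.2.2.coins × Bits θ.2.2.1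
  O _ _ := noOracle
  ol _ _ := 0
  K _ := 0
  n_le _ := Nat.zero_le _
  hO _ _ _ := rfl
  hK _ _ := le_rfl
  hKpoly := ⟨0, fun _ => Nat.zero_le _⟩

theorem length_gates_le (c : Circuit) : c.gates.length ≤ c.size := by
  have : ∀ gs : List Gate, gs.length ≤ (gs.map Gate.cost).sum := by
    intro gs
    induction gs with
    | nil => simp
    | cons g gs ih =>
      simp only [List.length_cons, List.map_cons, List.sum_cons]
      cases g <;> simp only [Gate.cost] <;> omega
  exact (this _).trans (Nat.le_add_right _ _)

/-- The answers, as strings. -/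
def lazyAns (θ : lazyFam.Θ) (i : lazyFam.ι θ) : List (List Bool) :=
  List.ofFn fun t => toL (splitBits θ.2.2.2.gates.length θ.2.1 i.1 t)

/-- The state after `t` gates. -/
def lazySt (θ : lazyFam.Θ) (t : ℕ) (i : lazyFam.ι θ) : List Bool × List (List Bool × List Bool) :=
  lazyRun θ.1 (θ.2.2.2.gates.take t) ((lazyAns θ i).take t) (toL i.2.1 ++ toL i.2.2, [])

theorem lazySt_inv (θ : lazyFam.Θ) (t : ℕ) (i : lazyFam.ι θ) :
    (lazySt θ t i).1.length = θ.2.2.2.coins + θ.2.2.1 +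
      ((θ.2.2.2.gates.take t).map (growMem θ.1 θ.2.1)).sum ∧
    (lazySt θ t i).2.length = ((θ.2.2.2.gates.take t).map (growTable θ.1)).sum ∧
    ∀ e ∈ (lazySt θ t i).2, e.1.length = θ.1 ∧ e.2.length = θ.2.1 := by
  have := lazyRun_inv (ℓ := θ.1) (k := θ.2.1) (θ.2.2.2.gates.take t) ((lazyAns θ i).take t)
    (toL i.2.1 ++ toL i.2.2, []) (by simp [lazyAns]) (fun a ha => by
      have := List.mem_of_mem_take ha
      simp only [lazyAns, List.mem_ofFn] at this
      obtain ⟨s, rfl⟩ := this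
      exact length_toL _) (by simp)
  exact ⟨this.1.trans (by rw [List.length_append, length_toL, length_toL]),
    this.2.1.trans (Nat.zero_add _), this.2.2⟩

/-- The state consists of all pre-drawn answers, the table and the memory. Each simulated gate
becomes a gadget of polynomial size that advances this state by one step, and the gadgets are
chained. -/
theorem lazy_comp :
    FComp lazyFam (fun _ i => toL i.1 ++ (toL i.2.1 ++ toL i.2.2))
      fun θ i => (lazySt θ θ.2.2.2.gates.length i).1 := by
  have pℓ : lazyFam.PB fun θ => θ.1 := Fam.PB.sz.mono fun θ => by dsimp only; omega
  have pk : lazyFam.PB fun θ => θ.2.1 := Fam.PB.sz.mono fun θ => by dsimp only; omega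
  have pM : lazyFam.PB fun θ => θ.2.2.1 := Fam.PB.sz.mono fun θ => by dsimp only; omega
  have pc : lazyFam.PB fun θ => θ.2.2.2.coins := Fam.PB.sz.mono fun θ => by
    simp only [RandCircuit.size]; omega
  have pT : lazyFam.PB fun θ => θ.2.2.2.gates.length := Fam.PB.sz.mono fun θ => by
    have := length_gates_le θ.2.2.2.toCircuit
    simp only [RandCircuit.size]; omega
  have lI : FLen lazyFam fun _ i => toL i.1 ++ (toL i.2.1 ++ toL i.2.2) :=
    (FLen.toL (pT.mul pk) _).append ((FLen.toL pc _).append (FLen.toL pM _))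
  let F := lazyFam.loop fun θ => θ.2.2.2.gates.length
  have pmem : F.PB fun p => p.1.2.2.2.coins + p.1.2.2.1 +
      ((p.1.2.2.2.gates.take p.2).map (growMem p.1.1 p.1.2.1)).sum := by
    refine (((pc.add pM).add (pT.mul ((Fam.PB.const 1).add pk))).loop).mono fun p => ?_
    have := sum_map_le (p.1.2.2.2.gates.take p.2) (growMem p.1.1 p.1.2.1) (1 + p.1.2.1)
      fun g _ => by
        cases g with
        | op => simp [growMem]
        | query q => simp only [growMem]; split_ifs <;> omega
    have h2 : (p.1.2.2.2.gates.take p.2).length ≤ p.1.2.2.2.gates.length := by simp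
    have := this.trans (Nat.mul_le_mul_right _ h2)
    omega
  have ptbl : F.PB fun p => ((p.1.2.2.2.gates.take p.2).map (growTable p.1.1)).sum := by
    refine pT.loop.mono fun p => ?_
    have := sum_map_le (p.1.2.2.2.gates.take p.2) (growTable p.1.1) 1 fun g _ => by
        cases g with
        | op => simp [growTable]
        | query q => simp only [growTable]; split_ifs <;> omega
    have h2 : (p.1.2.2.2.gates.take p.2).length ≤ p.1.2.2.2.gates.length := by simp
    omega
  have key := FComp.iterate lI pT (fun θ t i => toL i.1 ++ (flatTable (lazySt θ t i).2 ++
    (lazySt θ t i).1)) (by simpa [lazySt, lazyRun, flatTable] using FComp.id lI) (by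
      let src : F.Str := fun p i => toL i.1 ++ (flatTable (lazySt p.1 p.2 i).2 ++
        (lazySt p.1 p.2 i).1)
      have l1 : FLen F fun p i => toL i.1 := FLen.toL (pT.mul pk).loop _
      have l2 : FLen F fun p i => flatTable (lazySt p.1 p.2 i).2 :=
        ⟨_, ptbl.mul (pℓ.add pk).loop, fun p i => by
          have := lazySt_inv p.1 p.2 i
          exact (length_flatTable this.2.2).trans (by rw [this.2.1])⟩
      have l3 : FLen F fun p i => (lazySt p.1 p.2 i).1 :=
        ⟨_, pmem, fun p i => (lazySt_inv p.1 p.2 i).1⟩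
      have l : FLen F src := l1.append (l2.append l3)
      have k1 : FComp F src fun p i => toL i.1 := (FComp.id l).left l l1
      have k23 := (FComp.id l).right l l1 (l2.append l3)
      have k2 := k23.left l l2
      have k3 := k23.right l l2 l3
      have hs : ∀ (p : F.Θ) (i : F.ι p), lazySt p.1 (p.2 + 1) i = lazyStep p.1.1
          (lazySt p.1 p.2 i) (p.1.2.2.2.gates[(p.2 : ℕ)]'p.2.2,
            toL (splitBits p.1.2.2.2.gates.length p.1.2.1 i.1 p.2)) := fun p i => by
        rw [lazySt, lazyRun_succ _ _ _ _ p.2.2 (by simp [lazyAns])]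
        simp [lazyAns, lazySt]
      refine k1.append l ?_
      -- The simulated circuit is part of the parameter, so the kind of the current gate is known
      -- when the gadget is built. Queries of a length other than `ℓ` get no answer and fall in the
      -- second case.
      refine FComp.cases_sub (fun p => ∃ q, p.1.2.2.2.gates[(p.2 : ℕ)]'p.2.2 = .query q ∧
        q.length = p.1.1) ?_ ?_
      · let F' := F.sub fun p => ∃ q, p.1.2.2.2.gates[(p.2 : ℕ)]'p.2.2 = .query q ∧ q.length = p.1.1
        let q : F'.Θ → List ℕ := fun p => p.2.choose
        have hq1 : ∀ p : F'.Θ, p.1.1.2.2.2.gates[(p.1.2 : ℕ)]'p.1.2.2 = .query (q p) :=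
          fun p => p.2.choose_spec.1
        have hq2 : ∀ p : F'.Θ, (q p).length = p.1.1.1 := fun p => p.2.choose_spec.2
        have psub : ∀ {f : F.Θ → ℕ}, F.PB f → F'.PB fun p => f p.1 :=
          fun ⟨r, hr⟩ => ⟨r, fun p => hr p.1⟩
        have l' : FLen F' fun p i => src p.1 i := l.sub
        have v1 := FComp.rewire l' k3.sub q ((psub pℓ.loop).mono fun p => (hq2 p).le)
        have e1 : (fun p i => toL i.1 : F.Str) = fun p i => catFin fun t =>
            toL (splitBits p.1.2.2.2.gates.length p.1.2.1 i.1 t) := by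
          funext p i; exact (toL_splitBits _).symm
        have a1 : FComp F src fun p i =>
            toL (splitBits p.1.2.2.2.gates.length p.1.2.1 i.1 p.2) := by
          rw [e1] at k1
          have := k1.slice l (fun p => p.2 * p.1.2.1) (fun p => p.1.2.1)
          convert this using 3 with p i
          exact (slice_catFin (fun t => length_toL _) p.2).symm
        have r1 := FComp.lookup (F := F') l' (tbl := fun p i => (lazySt p.1.1 p.1.2 i).2)
          (ℓ := fun p => p.1.1.1) (psub ptbl)
          (psub pk.loop) (fun p i => (lazySt_inv _ _ _).2.1) (fun p i => by simp [hq2])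
          (fun p i => length_toL _) (fun p i => (lazySt_inv _ _ _).2.2) k2.sub v1 a1.sub
        have := (k2.sub.append l' (v1.append l' r1)).append l' (k3.sub.append l' r1)
        convert this using 3 with p i
        rw [hs, hq1]
        simp only [lazyStep, hq2, if_true, flatTable, List.flatMap_append, List.flatMap_cons,
          List.flatMap_nil, List.append_nil]
      · let F' := F.sub fun p => ¬ ∃ q, p.1.2.2.2.gates[(p.2 : ℕ)]'p.2.2 = .query q ∧
          q.length = p.1.1
        have psub : ∀ {f : F.Θ → ℕ}, F.PB f → F'.PB fun p => f p.1 :=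
          fun ⟨r, hr⟩ => ⟨r, fun p => hr p.1⟩
        have l' : FLen F' fun p i => src p.1 i := l.sub
        let spec : F'.Θ → List ((Bool → Bool → Bool → Bool) × ℕ × ℕ × ℕ) := fun p =>
          match p.1.1.2.2.2.gates[(p.1.2 : ℕ)]'p.1.2.2 with
          | .op f i j k => [(f, i, j, k)]
          | .query _ => []
        have v1 := FComp.local l' k3.sub spec ((Fam.PB.const 1).mono fun p => by
          simp only [spec]; split <;> simp)
        have := k2.sub.append l' (k3.sub.append l' v1)
        convert this using 3 with p i
        rw [hs]
        have hn : ¬ ∃ q, p.1.1.2.2.2.gates[(p.1.2 : ℕ)]'p.1.2.2 = .query q ∧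
          q.length = p.1.1.1 := p.2
        simp only [spec]
        generalize p.1.1.2.2.2.gates[(p.1.2 : ℕ)]'p.1.2.2 = g at hn
        cases g with
        | op f a b c => simp [lazyStep, localVal]
        | query q =>
          have : q.length ≠ p.1.1.1 := fun h => hn ⟨q, rfl, h⟩
          simp [lazyStep, this])
  have pT' : lazyFam.PB fun θ => ((θ.2.2.2.gates.take θ.2.2.2.gates.length).map
      (growTable θ.1)).sum := by
    refine pT.mono fun θ => ?_
    have := sum_map_le (θ.2.2.2.gates.take θ.2.2.2.gates.length) (growTable θ.1) 1 fun g _ => by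
        cases g with
        | op => simp [growTable]
        | query q => simp only [growTable]; split_ifs <;> omega
    simpa using this
  have l2 : FLen lazyFam fun θ i => flatTable (lazySt θ θ.2.2.2.gates.length i).2 :=
    ⟨_, pT'.mul (pℓ.add pk), fun p i => by
      have := lazySt_inv p p.2.2.2.gates.length i
      exact (length_flatTable this.2.2).trans (by rw [this.2.1])⟩
  have l3 : FLen lazyFam fun θ i => (lazySt θ θ.2.2.2.gates.length i).1 := by
    refine ⟨fun θ => θ.2.2.2.coins + θ.2.2.1 +
      ((θ.2.2.2.gates.take θ.2.2.2.gates.length).map (growMem θ.1 θ.2.1)).sum, ?_,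
      fun p i => (lazySt_inv p _ i).1⟩
    refine ((pc.add pM).add (pT.mul ((Fam.PB.const 1).add pk))).mono fun p => ?_
    have := sum_map_le (p.2.2.2.gates.take p.2.2.2.gates.length) (growMem p.1 p.2.1) (1 + p.2.1)
      fun g _ => by
        cases g with
        | op => simp [growMem]
        | query q => simp only [growMem]; split_ifs <;> omega
    rw [List.take_length] at this ⊢
    omega
  exact (key.right lI (FLen.toL (pT.mul pk) _) (l2.append l3)).right lI l2 l3

/-- Oracle circuits can be simulated without the oracle, by lazy sampling. -/
theorem lazy_circuit : ∃ q : Polynomial ℕ, ∀ (ℓ k M : ℕ) (c : RandCircuit), ∃ c' : RandCircuit,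
    c'.size ≤ q.eval (ℓ + k + M + c.size) ∧ ∀ x : List Bool, x.length = M →
      c'.run noOracle x = (unif (Bits ℓ → Bits k)).bind fun G => c.run (oracleOf G) x := by
  have pT : lazyFam.PB fun θ => θ.2.2.2.gates.length := Fam.PB.sz.mono fun θ => by
    have := length_gates_le θ.2.2.2.toCircuit
    simp only [RandCircuit.size]; omega
  have pk : lazyFam.PB fun θ => θ.2.1 := Fam.PB.sz.mono fun θ => by dsimp only; omega
  have pM : lazyFam.PB fun θ => θ.2.2.1 := Fam.PB.sz.mono fun θ => by dsimp only; omega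
  have pc : lazyFam.PB fun θ => θ.2.2.2.coins := Fam.PB.sz.mono fun θ => by
    simp only [RandCircuit.size]; omega
  have po : lazyFam.PB fun θ => θ.2.2.2.outs.length := Fam.PB.sz.mono fun θ => by
    simp only [RandCircuit.size, Circuit.size]; omega
  have lI : FLen lazyFam fun _ i => toL i.1 ++ (toL i.2.1 ++ toL i.2.2) :=
    (FLen.toL (pT.mul pk) _).append ((FLen.toL pc _).append (FLen.toL pM _))
  obtain ⟨s, hs, h⟩ := FComp.rewire lI lazy_comp (fun θ => θ.2.2.2.outs) po
  obtain ⟨q, hq⟩ := hs.add ((pT.mul pk).add pc)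
  refine ⟨q, fun ℓ k M c => ?_⟩
  let θ : lazyFam.Θ := (ℓ, k, M, c)
  obtain ⟨C, hC, he⟩ := h θ
  refine ⟨⟨C, c.gates.length * k + c.coins⟩, le_trans ?_ (hq θ), ?_⟩
  · exact Nat.add_le_add_right hC _
  · intro x hx
    obtain ⟨x, rfl⟩ := exists_toL hx
    have e1 : ∀ a b, C.eval noOracle (toL (Fin.append a b : Bits (c.gates.length * k + c.coins)) ++
        toL x) = c.outs.map fun j => (lazyRun ℓ c.gates
          (List.ofFn fun t => toL (splitBits c.gates.length k a t)) (toL b ++ toL x, [])).1.getD j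
            false := fun a b => by
      have := he (a, b, x)
      rw [toL_append, List.append_assoc]
      refine this.trans ?_
      simp only [lazySt, θ, List.take_length]
      rw [List.take_of_length_le (by simp [lazyAns])]
      rfl
    rw [RandCircuit.run, PMF.map, unif_bits_add]
    simp only [Function.comp_apply, e1, RandCircuit.run]
    rw [PMF.bind_comm]
    simp only [PMF.map]
    -- Fix the coins `b` of the circuit first; what is left is the statement of `lazyRun_dist` read
    -- off at the output wires.
    rw [PMF.bind_comm (unif (Bits ℓ → Bits k))]
    congr 1; funext b
    have := congrArg (PMF.map fun m : List Bool => c.outs.map fun j => m.getD j false)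
      (lazyRun_dist (ℓ := ℓ) (k := k) c.gates (toL b ++ toL x, []))
    simp only [tableOracle_nil, PMF.map_comp] at this
    refine Eq.trans ?_ this.symm
    rw [PMF.map, ← unif_bind_equiv (splitBits c.gates.length k)]
    rfl

theorem ex_comm {α β : Type} (P : PMF α) (Q : PMF β) (φ : α → β → ℝ≥0∞) :
    (ex P fun a => ex Q fun b => φ a b) = ex Q fun b => ex P fun a => φ a b := by
  simp only [ex, ← ENNReal.tsum_mul_left]
  rw [ENNReal.tsum_comm]
  congr 1; funext b; congr 1; funext a; ring

theorem apply_true (P : PMF Bool) : P true = ex P fun b => if b then 1 else 0 := by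
  rw [← ex_eq_apply]

theorem PolyBounded.comp_poly {B : ℕ → ℕ} (hB : PolyBounded B) (q : Polynomial ℕ) :
    PolyBounded fun n => q.eval (B n) :=
  let ⟨r, hr⟩ := hB
  ⟨q.comp r, fun n => by rw [Polynomial.eval_comp]; exact eval_mono q (hr n)⟩

theorem ENeg.sampling {B : ℕ → ℕ} (hB : PolyBounded B) : ENeg fun n => (B n : ℝ≥0∞) / 2 ^ n := by
  simpa only [ENNReal.div_eq_inv_mul, mul_comm] using ENeg.two_pow.poly_mul hB

/-! ### The computational assumptions against adversaries with a random oracle. -/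

/-- Indices at which adversaries with a random oracle are considered: a security parameter, a
size, and the context `X`, with the oracle. -/
@[reducible] def romFam (Θ : Type) (n sz : Θ → ℕ) (hn : ∀ θ, n θ ≤ sz θ) (X : Θ → Type)
    (ℓ k : ℕ → ℕ) (hk : PolyBounded k) : Fam where
  Θ := Θ
  n := n
  sz := sz
  ι θ := X θ × (Bits (ℓ (n θ)) → Bits (k (n θ)))
  O _ i := oracleOf i.2
  ol θ m := if m = ℓ (n θ) then k (n θ) else 0
  K θ := k (n θ)
  n_le := hn
  hO θ := answerLen_oracleOf fun i : X θ × (Bits (ℓ (n θ)) → Bits (k (n θ))) => i.2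
  hK θ m := by split_ifs <;> omega
  hKpoly := let ⟨q, hq⟩ := hk
    ⟨q, fun θ => (hq _).trans (eval_mono q (hn θ))⟩

/-- Randomised oracle circuits can be replaced by circuits without oracle if only a uniformly
random oracle matters. -/
theorem FRand.lazy {Θ : Type} {n sz : Θ → ℕ} {hn : ∀ θ, n θ ≤ sz θ} {X : Θ → Type} {ℓ k : ℕ → ℕ}
    (hℓ : PolyBounded ℓ) {hk : PolyBounded k} {inp : ∀ θ, X θ → List Bool}
    (hI : FLen (romFam Θ n sz hn X ℓ k hk) fun θ i => inp θ i.1)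
    {D : ∀ θ, X θ × (Bits (ℓ (n θ)) → Bits (k (n θ))) → PMF (List Bool)}
    (hD : FRand (romFam Θ n sz hn X ℓ k hk) (fun θ i => inp θ i.1) D) {B : ℕ → ℕ}
    (hB : PolyBounded B) :
    ∃ B', PolyBounded B' ∧ ∀ θ, sz θ ≤ B (n θ) → ∃ c : RandCircuit, c.size ≤ B' (n θ) ∧
      ∀ x, Close (B' (n θ) / 2 ^ n θ) (c.run noOracle (inp θ x))
        ((unif (Bits (ℓ (n θ)) → Bits (k (n θ)))).bind fun G => D θ (x, G)) := by
  obtain ⟨L, hL, hL'⟩ := hI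
  obtain ⟨s, hs, hc⟩ := hD
  obtain ⟨q, hq⟩ := lazy_circuit
  let F := romFam Θ n sz hn X ℓ k hk
  obtain ⟨r, hr⟩ : F.PB fun θ => (ℓ (F.n θ) + k (F.n θ) + L θ + s θ) :=
    (((Fam.PB.poly hℓ).add (Fam.PB.poly hk)).add hL).add hs
  obtain ⟨r', hr'⟩ : F.PB s := hs
  -- The first summand bounds the size of the circuit after removal of the oracle, the second the
  -- numerator of the sampling error.
  refine ⟨fun m => (q.comp r + r').eval (B m), hB.comp_poly _, fun θ hθ => ?_⟩
  obtain ⟨c, hcs, hcD⟩ := hc θ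
  obtain ⟨c', h1, h2⟩ := hq (ℓ (n θ)) (k (n θ)) (L θ) c
  refine ⟨c', ?_, fun x => ?_⟩
  · simp only [Polynomial.eval_add, Polynomial.eval_comp]
    refine (h1.trans ?_).trans (Nat.le_add_right _ _)
    refine (eval_mono q ?_).trans (eval_mono q ((hr θ).trans (eval_mono r hθ)))
    exact Nat.add_le_add_left hcs _
  · rw [h2 _ (hL' θ (x, fun _ _ => false))]
    refine Close.bind_right fun G => (hcD (x, G)).mono ?_
    gcongr
    simp only [Polynomial.eval_add]
    exact ((hr' θ).trans (eval_mono r' hθ)).trans (Nat.le_add_left _ _)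

/-- CDH for adversaries with a random oracle. -/
theorem GroupGen.CDH.rom {𝔾 : GroupGen} (hCDH : 𝔾.CDH) {Θ : Type} {n sz : Θ → ℕ}
    {hn : ∀ θ, n θ ≤ sz θ} {k : ℕ → ℕ} {hk : PolyBounded k}
    {D : ∀ θ, (Σ c, 𝔾.El (n θ) c × 𝔾.El (n θ) c) × (Bits (𝔾.elemLen (n θ)) → Bits (k (n θ))) →
      PMF (List Bool)}
    (hD : FRand (romFam Θ n sz hn (fun θ => Σ c, 𝔾.El (n θ) c × 𝔾.El (n θ) c) 𝔾.elemLen k hk)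
      (fun θ i => 𝔾.desc (n θ) i.1.1 ++ (𝔾.eL i.1.2.1 ++ 𝔾.eL i.1.2.2)) D) {B : ℕ → ℕ}
    (hB : PolyBounded B) :
    ∃ ε, ENeg ε ∧ ∀ θ, sz θ ≤ B (n θ) →
      (ex (unif (Bits (𝔾.coinLen (n θ)))) fun c => ex (unif (𝔾.Ex (n θ) c)) fun a₁ =>
        ex (unif (𝔾.Ex (n θ) c)) fun a₂ => ex (unif _) fun G =>
          D θ (⟨c, zpw (𝔾.gen0 (n θ) c) a₁, zpw (𝔾.gen0 (n θ) c) a₂⟩, G)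
            (𝔾.eL (zpw (𝔾.gen0 (n θ) c) (a₁ * a₂)))) ≤ ε (n θ) := by
  let F := romFam Θ n sz hn (fun θ => Σ c, 𝔾.El (n θ) c × 𝔾.El (n θ) c) 𝔾.elemLen k hk
  have hI : FLen F fun θ i => 𝔾.desc (n θ) i.1.1 ++ (𝔾.eL i.1.2.1 ++ 𝔾.eL i.1.2.2) :=
    (FLen.desc (F := F) (gc := fun _ i => i.1.1)).append
      ((FLen.eL (F := F) (gc := fun _ i => i.1.1) fun _ i => i.1.2.1).append
        (FLen.eL (F := F) (gc := fun _ i => i.1.1) fun _ i => i.1.2.2))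
  obtain ⟨B', hB', h⟩ := FRand.lazy (D := D) (hk := hk) (hn := hn)
    (X := fun θ => Σ c, 𝔾.El (n θ) c × 𝔾.El (n θ) c)
    (inp := fun θ i => 𝔾.desc (n θ) i.1 ++ (𝔾.eL i.2.1 ++ 𝔾.eL i.2.2)) 𝔾.elemLen_poly hI hD hB
  obtain ⟨μ, hμ, hμ'⟩ := hCDH B' hB'
  refine ⟨_, (ENeg.of_negligible hμ).add (ENeg.sampling hB'), fun θ hθ => ?_⟩
  obtain ⟨A, hA, hAD⟩ := h θ hθ
  have key : (ex (unif (Bits (𝔾.coinLen (n θ)))) fun c => ex (unif (𝔾.Ex (n θ) c)) fun a₁ =>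
        ex (unif (𝔾.Ex (n θ) c)) fun a₂ => A.run noOracle (𝔾.desc (n θ) c ++
          (𝔾.eL (zpw (𝔾.gen0 (n θ) c) a₁) ++ 𝔾.eL (zpw (𝔾.gen0 (n θ) c) a₂)))
            (𝔾.eL (zpw (𝔾.gen0 (n θ) c) (a₁ * a₂)))) ≤ ENNReal.ofReal (μ (n θ)) := by
    refine le_trans (le_of_eq ?_) (ENNReal.ofReal_le_ofReal (hμ' (n θ) A hA))
    rw [GroupGen.cdhProb, ENNReal.ofReal_toReal (PMF.apply_ne_top _ _), apply_true]
    simp only [bind, pure, ex_bind, ex_pure, decide_eq_true_eq, List.append_assoc]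
    simp only [ex_eq_apply]
    rfl
  calc _ ≤ (ex (unif (Bits (𝔾.coinLen (n θ)))) fun c => ex (unif (𝔾.Ex (n θ) c)) fun a₁ =>
        ex (unif (𝔾.Ex (n θ) c)) fun a₂ => A.run noOracle (𝔾.desc (n θ) c ++
          (𝔾.eL (zpw (𝔾.gen0 (n θ) c) a₁) ++ 𝔾.eL (zpw (𝔾.gen0 (n θ) c) a₂)))
            (𝔾.eL (zpw (𝔾.gen0 (n θ) c) (a₁ * a₂))) + B' (n θ) / 2 ^ n θ) := by
        refine ex_mono fun c => ex_mono fun a₁ => ex_mono fun a₂ => ?_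
        -- Success is the mass of the single string that encodes the solution, and closeness bounds
        -- point masses.
        have := (hAD ⟨c, zpw (𝔾.gen0 (n θ) c) a₁, zpw (𝔾.gen0 (n θ) c) a₂⟩).symm.apply_le
          (𝔾.eL (zpw (𝔾.gen0 (n θ) c) (a₁ * a₂)))
        rw [← ex_eq_apply, ex_bind] at this
        simpa only [ex_eq_apply] using this
    _ ≤ _ := by
        simp only [ex_add, ex_const]
        gcongr

theorem AHE.keyCoins_poly (E : AHE) : PolyBounded E.keyCoins :=
  let ⟨q, hq⟩ := E.len_poly
  ⟨q, fun n => le_trans (by dsimp only; omega) (hq n)⟩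

theorem AHE.encCoins_poly (E : AHE) : PolyBounded E.encCoins :=
  let ⟨q, hq⟩ := E.len_poly
  ⟨q, fun n => le_trans (by dsimp only; omega) (hq n)⟩

theorem AHE.addCoins_poly (E : AHE) : PolyBounded E.addCoins :=
  let ⟨q, hq⟩ := E.len_poly
  ⟨q, fun n => le_trans (by dsimp only; omega) (hq n)⟩

theorem AHE.mulCoins_poly (E : AHE) : PolyBounded E.mulCoins :=
  let ⟨q, hq⟩ := E.len_poly
  ⟨q, fun n => le_trans (by dsimp only; omega) (hq n)⟩

theorem AHE.skLen_poly (E : AHE) : PolyBounded E.skLen :=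
  let ⟨q, hq⟩ := E.len_poly
  ⟨q, fun n => le_trans (by dsimp only; omega) (hq n)⟩

theorem AHE.pkLen_poly (E : AHE) : PolyBounded E.pkLen :=
  let ⟨q, hq⟩ := E.len_poly
  ⟨q, fun n => le_trans (by dsimp only; omega) (hq n)⟩

theorem AHE.ptLen_poly (E : AHE) : PolyBounded E.ptLen :=
  let ⟨q, hq⟩ := E.len_poly
  ⟨q, fun n => le_trans (by dsimp only; omega) (hq n)⟩

theorem AHE.ctLen_poly (E : AHE) : PolyBounded E.ctLen :=
  let ⟨q, hq⟩ := E.len_poly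
  ⟨q, fun n => le_trans (by dsimp only; omega) (hq n)⟩

theorem natOf_replicate_false (k : ℕ) : natOf (List.replicate k false) = 0 := by
  induction k with
  | zero => rfl
  | succ k ih => rw [List.replicate_succ, natOf_cons, ih]; rfl

/-- The circuit that chooses the plaintexts `0` and `1`, of `m` bits, on inputs of `Λ` bits. -/
def chooseCircuit (Λ m : ℕ) : Circuit where
  gates := [.op (fun _ _ _ => true) 0 0 0]
  outs := List.replicate m (Λ + 1) ++ (Λ :: List.replicate (m - 1) (Λ + 1))

theorem chooseCircuit_eval {Λ : ℕ} (m : ℕ) {x : List Bool} (h : x.length = Λ) :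
    (chooseCircuit Λ m).eval noOracle x =
      List.replicate m false ++ (true :: List.replicate (m - 1) false) := by
  subst h
  simp [chooseCircuit, Circuit.eval, Gate.step]

/-- Indistinguishability of encryptions of `0` and `1` for adversaries with a random oracle. -/
theorem AHE.INDCPA.rom {E : AHE} (hCPA : E.INDCPA) {Θ : Type} {n sz : Θ → ℕ}
    {hn : ∀ θ, n θ ≤ sz θ} (h2 : ∀ θ kc, 2 ≤ E.modulus (n θ) (E.kgen (n θ) kc).2) {ℓ k : ℕ → ℕ}
    (hℓ : PolyBounded ℓ) {hk : PolyBounded k}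
    {D : ∀ θ, (Bits (E.keyCoins (n θ)) × Bits (E.ctLen (n θ))) ×
      (Bits (ℓ (n θ)) → Bits (k (n θ))) → PMF (List Bool)}
    (hD : FRand (romFam Θ n sz hn (fun θ => Bits (E.keyCoins (n θ)) × Bits (E.ctLen (n θ))) ℓ k hk)
      (fun θ i => toL (E.kgen (n θ) i.1.1).2 ++ toL i.1.2) D) {B : ℕ → ℕ} (hB : PolyBounded B) :
    ∃ ε, ENeg ε ∧ ∀ θ, sz θ ≤ B (n θ) → ∀ b : Bool,
      (ex (unif (Bits (E.keyCoins (n θ)))) fun kc => ex (unif (Bits (E.encCoins (n θ)))) fun re =>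
        ex (unif _) fun G => D θ ((kc, E.enc (n θ) (E.kgen (n θ) kc).2 b.toNat re), G) [true]) ≤
      (ex (unif (Bits (E.keyCoins (n θ)))) fun kc => ex (unif (Bits (E.encCoins (n θ)))) fun re =>
        ex (unif _) fun G => D θ ((kc, E.enc (n θ) (E.kgen (n θ) kc).2 (!b).toNat re), G) [true]) +
      ε (n θ) := by
  let F := romFam Θ n sz hn (fun θ => Bits (E.keyCoins (n θ)) × Bits (E.ctLen (n θ))) ℓ k hk
  have hI : FLen F fun θ i => toL (E.kgen (n θ) i.1.1).2 ++ toL i.1.2 :=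
    (FLen.toL (F := F) (Fam.PB.poly E.pkLen_poly) fun θ i => (E.kgen (n θ) i.1.1).2).append
      (FLen.toL (F := F) (Fam.PB.poly E.ctLen_poly) fun θ i => i.1.2)
  obtain ⟨B', hB', h⟩ := FRand.lazy (D := D) (hk := hk) (hn := hn)
    (X := fun θ => Bits (E.keyCoins (n θ)) × Bits (E.ctLen (n θ)))
    (inp := fun θ i => toL (E.kgen (n θ) i.1).2 ++ toL i.2) hℓ hI hD hB
  -- Coins and guessing circuit are covered by `2 * B'`; the choosing circuit has one gate and two
  -- plaintexts of output wires.
  obtain ⟨B'', hB'', hBB⟩ : ∃ B'', PolyBounded B'' ∧ ∀ m, B'' m =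
      2 * B' m + (2 + 2 * E.ptLen m) := by
    obtain ⟨q, hq⟩ := hB'
    obtain ⟨r, hr⟩ := E.ptLen_poly
    refine ⟨_, ⟨2 * q + (2 + 2 * r), fun m => ?_⟩, fun m => rfl⟩
    have h1 := hq m
    have h3 := hr m
    simp only [Polynomial.eval_add, Polynomial.eval_mul, Polynomial.eval_ofNat]
    omega
  obtain ⟨μ, hμ, hμ'⟩ := hCPA B'' hB''
  refine ⟨_, ((ENeg.of_negligible hμ).add (ENeg.sampling hB')).add (ENeg.sampling hB'),
    fun θ hθ b => ?_⟩
  obtain ⟨A, hA, hAD⟩ := h θ hθ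
  -- A modulus of at least `2` leaves room for one bit of plaintext, so the choosing circuit can
  -- write the plaintext `1`.
  have hpt : 1 ≤ E.ptLen (n θ) := by
    have h1 := (h2 θ fun _ => false).trans (E.modulus_le (n θ) fun _ => false)
    by_contra h0
    have : E.ptLen (n θ) = 0 := by omega
    rw [this] at h1; norm_num at h1
  let A' : CPAAdversary := ⟨A.coins, chooseCircuit (A.coins + E.pkLen (n θ)) (E.ptLen (n θ)),
    A.toCircuit⟩
  have hA' : A'.size ≤ B'' (n θ) := by
    rw [hBB]
    simp only [RandCircuit.size] at hA
    simp only [CPAAdversary.size, A', chooseCircuit, Circuit.size] at hA ⊢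
    simp [Gate.cost]
    omega
  let q : Bool → ℝ≥0∞ := fun b => ex (unif (Bits (E.keyCoins (n θ)))) fun kc =>
    ex (unif (Bits (E.encCoins (n θ)))) fun re =>
      A.run noOracle (toL (E.kgen (n θ) kc).2 ++
        toL (E.enc (n θ) (E.kgen (n θ) kc).2 b.toNat re)) [true]
  have hq : ∀ b, E.cpaProb (n θ) A' b = (q b).toReal := fun b => by
    rw [AHE.cpaProb, apply_true]
    congr 1
    simp only [bind, pure, ex_bind, ex_pure, decide_eq_true_eq, q]
    refine congrArg (ex _) (funext fun kc => ?_)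
    rw [ex_comm]
    refine congrArg (ex _) (funext fun re => ?_)
    rw [RandCircuit.run, ← ex_eq_apply, ex_map]
    refine congrArg (ex _) (funext fun r => ?_)
    have e1 : (chooseCircuit (A.coins + E.pkLen (n θ)) (E.ptLen (n θ))).eval noOracle
        (toL r ++ toL (E.kgen (n θ) kc).2) = _ :=
      chooseCircuit_eval _ (by rw [List.length_append, length_toL, length_toL])
    have e2 : natOf (true :: List.replicate (E.ptLen (n θ) - 1) false) = 1 := by
      rw [natOf_cons, natOf_replicate_false]; rfl
    have hN := h2 θ kc
    simp only [A', e1]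
    rw [List.take_left' (by simp), List.drop_left' (by simp), List.take_of_length_le
      (by simp; omega), natOf_replicate_false, e2, Nat.zero_mod, Nat.mod_eq_of_lt (by omega),
      List.append_assoc]
    cases b <;> rfl
  have hqt : ∀ b, q b ≠ ⊤ := fun b =>
    ((ex_le fun _ => ex_le fun _ => PMF.coe_le_one _ _).trans_lt ENNReal.one_lt_top).ne
  have hbd : q b ≤ q (!b) + ENNReal.ofReal (μ (n θ)) := by
    have := hμ' (n θ) A' hA'
    rw [hq, hq] at this
    have : (q b).toReal ≤ (q !b).toReal + μ (n θ) := by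
      cases b <;> simp only [Bool.not_false, Bool.not_true] <;> [skip; skip] <;>
        linarith [abs_le.1 this]
    rw [← ENNReal.ofReal_toReal (hqt b), ← ENNReal.ofReal_toReal (hqt !b)]
    refine (ENNReal.ofReal_le_ofReal this).trans ENNReal.ofReal_add_le
  have hcl : ∀ kc ct, (ex (unif _) fun G => D θ ((kc, ct), G) [true]) =
      ((unif (Bits (ℓ (n θ)) → Bits (k (n θ)))).bind fun G => D θ ((kc, ct), G)) [true] :=
    fun kc ct => by rw [← ex_eq_apply, ex_bind]; simp only [ex_eq_apply]
  simp only [hcl]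
  -- The sampling error enters twice, once for each of the two experiments in which the oracle is
  -- removed.
  calc _ ≤ ex (unif (Bits (E.keyCoins (n θ)))) fun kc =>
        ex (unif (Bits (E.encCoins (n θ)))) fun re => A.run noOracle (toL (E.kgen (n θ) kc).2 ++
        toL (E.enc (n θ) (E.kgen (n θ) kc).2 b.toNat re)) [true] + B' (n θ) / 2 ^ n θ :=
        ex_mono fun kc => ex_mono fun re => (hAD (kc, _)).symm.apply_le _
    _ ≤ q b + B' (n θ) / 2 ^ n θ := by simp only [ex_add, ex_const, q]; rfl
    _ ≤ q (!b) + ENNReal.ofReal (μ (n θ)) + B' (n θ) / 2 ^ n θ := by gcongr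
    _ ≤ (ex (unif (Bits (E.keyCoins (n θ)))) fun kc =>
        ex (unif (Bits (E.encCoins (n θ)))) fun re =>
        ((unif (Bits (ℓ (n θ)) → Bits (k (n θ)))).bind fun G =>
          D θ ((kc, E.enc (n θ) (E.kgen (n θ) kc).2 (!b).toNat re), G)) [true] +
            B' (n θ) / 2 ^ n θ) + ENNReal.ofReal (μ (n θ)) + B' (n θ) / 2 ^ n θ := by
        gcongr
        exact ex_mono fun kc => ex_mono fun re => (hAD (kc, _)).apply_le _
    _ ≤ _ := by
        simp only [ex_add, ex_const]
        exact le_of_eq (by ring)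

/-! ### Circuits whose oracle answers are changed at a few points -/

/-- The circuit that outputs the string queried by the `j`-th gate of `c`. -/
def Circuit.trunc (c : Circuit) (j : ℕ) : Circuit where
  gates := c.gates.take j
  outs := match c.gates[j]? with
    | some (.query q) => q
    | _ => []

/-- The randomised circuit that outputs the string queried by the `j`-th gate of `c`. -/
def RandCircuit.trunc (c : RandCircuit) (j : ℕ) : RandCircuit := ⟨c.toCircuit.trunc j, c.coins⟩

/-- The truncated circuit has as many output wires as the query at gate `j` has bits, and the cost
of that gate already pays for them. -/
theorem Circuit.size_trunc (c : Circuit) (j : ℕ) : (c.trunc j).size ≤ c.size := by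
  obtain ⟨gs, outs⟩ := c
  simp only [Circuit.size, Circuit.trunc]
  by_cases h : j < gs.length
  · have h1 : (gs.map Gate.cost).sum =
        ((gs.take j).map Gate.cost).sum + (gs[j].cost + ((gs.drop (j + 1)).map Gate.cost).sum) := by
      conv_lhs => rw [← List.take_append_drop j gs, List.drop_eq_getElem_cons h]
      rw [List.map_append, List.sum_append, List.map_cons, List.sum_cons]
    rw [h1, List.getElem?_eq_getElem h]
    cases gs[j] with
    | op f a b c => simp only [List.length_nil]; omega
    | query q => simp only [Gate.cost]; omega
  · rw [List.getElem?_eq_none (by omega), List.take_of_length_le (by omega)]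
    simp

theorem RandCircuit.size_trunc (c : RandCircuit) (j : ℕ) : (c.trunc j).size ≤ c.size :=
  Nat.add_le_add_right (Circuit.size_trunc _ _) _

/-- Up to the first query in `S` the two runs have equal memories. The bad event is therefore
expressed through the run with `O` alone, which will be the idealised experiment. -/
theorem Circuit.eval_eq_of_agree (c : Circuit) {O O' : List Bool → List Bool}
    {S : List Bool → Prop} (hO : ∀ q, ¬ S q → O q = O' q) (x : List Bool) :
    c.eval O x = c.eval O' x ∨ ∃ j < c.gates.length, S ((c.trunc j).eval O x) := by
  by_cases hS : ∃ j < c.gates.length, S ((c.trunc j).eval O x)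
  · exact .inr hS
  push Not at hS
  have key : ∀ j ≤ c.gates.length,
      (c.gates.take j).foldl (Gate.step O) x = (c.gates.take j).foldl (Gate.step O') x := by
    intro j
    induction j with
    | zero => intro _; rfl
    | succ j ih =>
      intro hj
      have h := hS j hj
      rw [List.take_succ_eq_append_getElem hj, List.foldl_append, List.foldl_append,
        ← ih (by omega)]
      simp only [Circuit.trunc, Circuit.eval, List.getElem?_eq_getElem hj] at h
      generalize c.gates[j] = g at h
      cases g with
      | op f a b c => rfl
      | query q =>
        simp only [List.foldl_cons, List.foldl_nil, Gate.step]
        rw [hO _ h]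
  left
  have := key _ le_rfl
  rw [List.take_length] at this
  rw [Circuit.eval, this]; rfl

/-- Running a circuit with two oracles that differ only on the points `pts`. -/
theorem RandCircuit.run_le_of_agree {J : Type} [Fintype J] (c : RandCircuit)
    {O O' : List Bool → List Bool} (pts : J → List Bool)
    (hO : ∀ q, (∀ j, pts j ≠ q) → O q = O' q) (x a : List Bool) :
    c.run O' x a ≤ c.run O x a + ∑ i ∈ Finset.range c.gates.length, ∑ j : J,
      (c.trunc i).run O x (pts j) ∧
    c.run O x a ≤ c.run O' x a + ∑ i ∈ Finset.range c.gates.length, ∑ j : J,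
      (c.trunc i).run O x (pts j) := by
  classical
  -- For coins on which the outputs differ, some query of the run with `O` hits a point; the double
  -- sum counts such hits.
  have h : ∀ r : Bits c.coins, c.eval O (toL r ++ x) ≠ c.eval O' (toL r ++ x) →
      (1 : ℝ≥0∞) ≤ ∑ i ∈ Finset.range c.gates.length, ∑ j : J,
        if (c.toCircuit.trunc i).eval O (toL r ++ x) = pts j then 1 else 0 := by
    intro r hr
    obtain hh | ⟨i, hi, j, hj⟩ := c.toCircuit.eval_eq_of_agree (S := fun q => ∃ j, pts j = q)
      (fun q hq => hO q (by simpa using hq)) (toL r ++ x)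
    · exact absurd hh hr
    · refine le_trans ?_ (Finset.single_le_sum (fun _ _ => zero_le) (Finset.mem_range.2 hi))
      refine le_trans ?_ (Finset.single_le_sum (fun _ _ => zero_le) (Finset.mem_univ j))
      rw [if_pos hj.symm]
  have e : ∀ (C : Circuit) O a, RandCircuit.run O ⟨C, c.coins⟩ x a =
      ex (unif (Bits c.coins)) fun r => if C.eval O (toL r ++ x) = a then 1 else 0 := by
    intro C O a
    rw [RandCircuit.run, ← ex_eq_apply, ex_map]
  simp only [RandCircuit.trunc, e, ← ex_sum, ← ex_add]
  constructor
  · refine ex_mono fun r => ?_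
    by_cases hr : c.eval O (toL r ++ x) = c.eval O' (toL r ++ x)
    · rw [hr]; exact le_self_add
    · exact le_trans (by split_ifs <;> simp) ((h r hr).trans le_add_self)
  · refine ex_mono fun r => ?_
    by_cases hr : c.eval O (toL r ++ x) = c.eval O' (toL r ++ x)
    · rw [hr]; exact le_self_add
    · exact le_trans (by split_ifs <;> simp) ((h r hr).trans le_add_self)

theorem ex_unif_override {J A B : Type} [Fintype J] [DecidableEq J] [Fintype A] [DecidableEq A]
    [Fintype B] [Nonempty B] {pts : J → A} (hp : Function.Injective pts)
    (φ : (A → B) → ℝ≥0∞) :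
    (ex (unif (A → B)) fun G => ex (unif (J → B)) fun u => φ (override G pts u)) =
      ex (unif (A → B)) φ := by
  have := congrArg (ex · φ) (unif_bind_override hp PMF.pure)
  simpa using this

/-- Replacing the values of the random oracle at the points `pts` in the input of a circuit by
fresh random strings. The error is the probability that the circuit queries one of the points. -/
theorem rom_swap {J : Type} [Fintype J] [DecidableEq J] {ℓ k : ℕ} {pts : J → Bits ℓ}
    (hp : Function.Injective pts) (V : (Bits ℓ → Bits k) → (J → Bits k) → List Bool)
    (hV : ∀ G u, V (override G pts u) u = V G u) (c : RandCircuit) (a : List Bool) :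
    (ex (unif (Bits ℓ → Bits k)) fun G => c.run (oracleOf G) (V G fun j => G (pts j)) a) ≤
      (ex (unif (Bits ℓ → Bits k)) fun G => ex (unif (J → Bits k)) fun u =>
        c.run (oracleOf G) (V G u) a) +
      (ex (unif (Bits ℓ → Bits k)) fun G => ex (unif (J → Bits k)) fun u =>
        ∑ i ∈ Finset.range c.gates.length, ∑ j : J,
          (c.trunc i).run (oracleOf G) (V G u) (toL (pts j))) ∧
    (ex (unif (Bits ℓ → Bits k)) fun G => ex (unif (J → Bits k)) fun u =>
        c.run (oracleOf G) (V G u) a) ≤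
      (ex (unif (Bits ℓ → Bits k)) fun G => c.run (oracleOf G) (V G fun j => G (pts j)) a) +
      (ex (unif (Bits ℓ → Bits k)) fun G => ex (unif (J → Bits k)) fun u =>
        ∑ i ∈ Finset.range c.gates.length, ∑ j : J,
          (c.trunc i).run (oracleOf G) (V G u) (toL (pts j))) := by
  -- Overriding a uniform oracle at the points keeps it uniform and turns the real input into `V G
  -- u`, since `V` does not depend on the overridden values otherwise. Both experiments now have the
  -- same input, and their oracles differ on the points only.
  rw [← ex_unif_override hp fun G => c.run (oracleOf G) (V G fun j => G (pts j)) a]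
  simp only [override_pts _ hp, hV, ← ex_add]
  have hO : ∀ (G : Bits ℓ → Bits k) u q, (∀ j, toL (pts j) ≠ q) →
      oracleOf G q = oracleOf (override G pts u) q := fun G u q hq => by
    by_cases hl : q.length = ℓ
    · obtain ⟨w, rfl⟩ := exists_toL hl
      rw [oracleOf_toL, oracleOf_toL, override_of_ne _ _ _ fun j hj => hq j (by rw [hj])]
    · rw [oracleOf_of_ne _ hl, oracleOf_of_ne _ hl]
  exact ⟨ex_mono fun G => ex_mono fun u => (c.run_le_of_agree _ (hO G u) _ _).1,
    ex_mono fun G => ex_mono fun u => (c.run_le_of_agree _ (hO G u) _ _).2⟩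

/-! ### Products of samples -/

theorem ex_unif_prod {α β : Type} [Fintype α] [Nonempty α] [Fintype β] [Nonempty β]
    (φ : α × β → ℝ≥0∞) :
    ex (unif (α × β)) φ = ex (unif α) fun a => ex (unif β) fun b => φ (a, b) := by
  rw [unif_prod, ex_bind]; simp

theorem ex_unif_equiv {α β : Type} [Fintype α] [Nonempty α] [Fintype β] [Nonempty β] (e : α ≃ β)
    (φ : β → ℝ≥0∞) : (ex (unif α) fun a => φ (e a)) = ex (unif β) φ := by
  rw [← unif_map_equiv e, ex_map]

theorem close_prod {R R' A A' : Type} [Fintype R] [Nonempty R] [Fintype R'] [Nonempty R']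
    [Fintype A] [Nonempty A] [Fintype A'] [Nonempty A'] {f : R → A} {f' : R' → A'} {ε ε' : ℝ≥0∞}
    (h : Close ε ((unif R).map f) (unif A)) (h' : Close ε' ((unif R').map f') (unif A')) :
    Close (ε + ε') ((unif (R × R')).map fun r => (f r.1, f' r.2)) (unif (A × A')) := by
  have h1 := h.bind_left fun b => ((unif R').map f').map fun b' => (b, b')
  have h2 := Close.bind_right (P := unif A) fun b => h'.map fun b' => (b, b')
  rw [unif_prod, unif_prod, PMF.map_bind]
  simpa only [PMF.bind_map, PMF.map_comp, Function.comp_def] using h1.trans h2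

theorem FSamp.prod {F : Fam} {inp : F.Str} (hI : FLen F inp) {A A' : ∀ θ, F.ι θ → Type}
    [∀ θ i, Fintype (A θ i)] [∀ θ i, Nonempty (A θ i)] [∀ θ i, Fintype (A' θ i)]
    [∀ θ i, Nonempty (A' θ i)] {e : ∀ θ i, A θ i → List Bool} {e' : ∀ θ i, A' θ i → List Bool}
    (h : FSamp F inp A e) (h' : FSamp F inp A' e') :
    FSamp F inp (fun θ i => A θ i × A' θ i) fun θ i a => e θ i a.1 ++ e' θ i a.2 := by
  obtain ⟨κ, c, f, m, s, h1, h2, h3, h4, h5, h6, h7⟩ := h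
  obtain ⟨κ', c', f', m', s', h1', h2', h3', h4', h5', h6', h7'⟩ := h'
  refine FSamp.mk' hI (h1.add h1') (h3.add h3') (h4.add h4')
    (fun θ i r => (f θ i fun j => r (Fin.castAdd _ j), f' θ i fun j => r (Fin.natAdd _ j)))
    (fun θ i a => by rw [List.length_append, h5, h5']) (fun l => ?_) fun θ i => ?_
  · let F' := F.ext fun θ _ => Bits (κ θ + κ' θ)
    have e1 : ∀ (θ : F'.Θ) (p : F'.ι θ), toL p.2 = toL (fun j => p.2 (Fin.castAdd _ j)) ++
        toL fun j => p.2 (Fin.natAdd _ j) := fun θ p => by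
      rw [← toL_append]; congr 1; funext j
      exact (congrFun (Fin.append_castAdd_natAdd) j).symm
    have l1 : FLen F' fun θ p => toL p.2 := FLen.toL (h1.add h1').ext _
    have la : FLen F' fun θ p => toL fun j => p.2 (Fin.castAdd _ j) := FLen.toL h1.ext _
    have lb : FLen F' fun θ p => toL fun j => p.2 (Fin.natAdd _ j) := FLen.toL h1'.ext _
    have k1 := (FComp.id l).left l l1
    have k2 := (FComp.id l).right l l1 hI.ext
    have k1' : FComp F' (fun θ p => toL p.2 ++ inp θ p.1) fun θ p =>
        toL (fun j => p.2 (Fin.castAdd _ j)) ++ toL fun j => p.2 (Fin.natAdd _ j) := by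
      simpa only [← e1] using k1
    have ka := k1'.left l la
    have kb := k1'.right l la lb
    have r1 := FComp.circuit l (ka.append l k2) c h2.ext
    have r2 := FComp.circuit l (kb.append l k2) c' h2'.ext
    have r1' : FComp F' (fun θ p => toL p.2 ++ inp θ p.1) fun θ p =>
        e θ p.1 (f θ p.1 fun j => p.2 (Fin.castAdd _ j)) := by simpa only [h6] using r1
    have r2' : FComp F' (fun θ p => toL p.2 ++ inp θ p.1) fun θ p =>
        e' θ p.1 (f' θ p.1 fun j => p.2 (Fin.natAdd _ j)) := by simpa only [h6'] using r2
    exact r1'.append l r2'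
  · have := close_prod (h7 θ i) (h7' θ i)
    rw [← unif_map_equiv (Fin.appendEquiv (κ θ) (κ' θ)).symm, PMF.map_comp] at this
    rw [← ofNat_div_add]
    exact this

/-! ### Acceptance probabilities and simulators -/

/-- The probability, over a random oracle, that `c` accepts a sample of `X G`. -/
def acc {ℓ k : ℕ} (X : (Bits ℓ → Bits k) → PMF (List Bool)) (c : RandCircuit) : ℝ≥0∞ :=
  ex (unif (Bits ℓ → Bits k)) fun G => ex (X G) fun v => c.run (oracleOf G) v [true]

theorem acc_le_one {ℓ k : ℕ} (X : (Bits ℓ → Bits k) → PMF (List Bool)) (c : RandCircuit) :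
    acc X c ≤ 1 := ex_le fun _ => ex_le fun _ => PMF.coe_le_one _ _

theorem acceptProb_eq {ℓ k : ℕ} (X : (Bits ℓ → Bits k) → PMF (List Bool)) (c : RandCircuit) :
    acceptProb X c = (acc X c).toReal := by
  rw [acceptProb, apply_true, acc]
  congr 1
  simp only [bind, pure, ex_bind, ex_pure, decide_eq_true_eq]
  simp only [ex_eq_apply]

theorem acc_le_of_close {ℓ k : ℕ} {X Y : (Bits ℓ → Bits k) → PMF (List Bool)} {ε : ℝ≥0∞}
    (h : ∀ G, Close ε (X G) (Y G)) (c : RandCircuit) : acc X c ≤ acc Y c + ε := by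
  refine (ex_mono fun G => h G (fun v => c.run (oracleOf G) v [true])
    fun _ => PMF.coe_le_one _ _).trans_eq ?_
  rw [ex_add, ex_const]; rfl

/-- Two acceptance probabilities that differ by at most `ε`. -/
def Near (ε a b : ℝ≥0∞) : Prop := a ≤ b + ε ∧ b ≤ a + ε

theorem Near.refl (a : ℝ≥0∞) {ε : ℝ≥0∞} : Near ε a a := ⟨le_self_add, le_self_add⟩

theorem Near.symm {ε a b : ℝ≥0∞} (h : Near ε a b) : Near ε b a := ⟨h.2, h.1⟩

theorem Near.trans {ε δ a b c : ℝ≥0∞} (h : Near ε a b) (h' : Near δ b c) : Near (ε + δ) a c :=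
  ⟨h.1.trans (by rw [add_comm ε, ← add_assoc]; gcongr; exact h'.1),
    h'.2.trans (by rw [← add_assoc]; gcongr; exact h.2)⟩

theorem Near.mono {ε δ a b : ℝ≥0∞} (h : Near ε a b) (hε : ε ≤ δ) : Near δ a b :=
  ⟨h.1.trans (by gcongr), h.2.trans (by gcongr)⟩

theorem Near.ex {α : Type} {P : PMF α} {ε φ ψ : α → ℝ≥0∞} (h : ∀ a, Near (ε a) (φ a) (ψ a)) :
    Near (ex P ε) (ex P φ) (ex P ψ) := by
  constructor <;> rw [← ex_add]
  · exact ex_mono fun a => (h a).1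
  · exact ex_mono fun a => (h a).2

theorem Near.acc_of_close {ℓ k : ℕ} {X Y : (Bits ℓ → Bits k) → PMF (List Bool)} {ε : ℝ≥0∞}
    (h : ∀ G, Close ε (X G) (Y G)) (c : RandCircuit) : Near ε (acc X c) (acc Y c) :=
  ⟨acc_le_of_close h c, acc_le_of_close (fun G => (h G).symm) c⟩

theorem Near.abs_toReal {a b ε : ℝ≥0∞} {μ : ℝ} (ha : a ≤ 1) (hb : b ≤ 1) (h : Near ε a b)
    (hε : ε ≤ ENNReal.ofReal μ) (hμ : 0 ≤ μ) : |a.toReal - b.toReal| ≤ μ := by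
  have hf : ∀ {x : ℝ≥0∞}, x ≤ 1 → x ≠ ⊤ := fun h => (h.trans_lt ENNReal.one_lt_top).ne
  have key : ∀ {x y : ℝ≥0∞}, y ≤ 1 → x ≤ y + ε → x.toReal ≤ y.toReal + μ := by
    intro x y hy hxy
    have h1 : x ≤ y + ENNReal.ofReal μ := hxy.trans (by gcongr)
    have := ENNReal.toReal_mono (ENNReal.add_ne_top.2 ⟨hf hy, ENNReal.ofReal_ne_top⟩) h1
    rwa [ENNReal.toReal_add (hf hy) ENNReal.ofReal_ne_top, ENNReal.toReal_ofReal hμ] at this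
  rw [abs_le]
  have h1 := key hb h.1
  have h2 := key ha h.2
  constructor <;> linarith

/-- Families in which simulators are built: the size is the security parameter plus a number `τ`
determined by the length of the input of the simulator. -/
@[reducible] def simFam (X : {n : ℕ // 1 ≤ n} → ℕ → Type) (ℓ k : ℕ → ℕ) (hk : PolyBounded k) :
    Fam :=
  romFam ({n : ℕ // 1 ≤ n} × ℕ) (fun θ => θ.1) (fun θ => θ.1 + θ.2) (fun _ => Nat.le_add_right _ _)
    (fun θ => X θ.1 θ.2) ℓ k hk

/-- What the simulator for `P` is given. -/
def given {σ : ℕ} (P : Party) (x : Input σ) : List Bool := x.of P ++ functionality x P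

/-- Security against one party, from a family of samplers for a distribution close to its view. -/
theorem simulator_of {ℓ k σ : ℕ → ℕ} {hk : PolyBounded k}
    (Γ : (n : ℕ) → Input (σ n) → (Bits (ℓ n) → Bits (k n)) → PMF (Party → List Bool)) (P : Party)
    (X : {n : ℕ // 1 ≤ n} → ℕ → Type) (t : ∀ n, Input (σ n) → ℕ) (ht : ∀ n x, t n x ≤ x.z)
    (e : ∀ (n : {n : ℕ // 1 ≤ n}) (x : Input (σ n)), X n (t n x))
    (τ : ℕ → ℕ → ℕ) (hτ : ∀ n L, τ n L ≤ L) (hτ' : ∀ n x, τ n (given P x).length = t n x)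
    (inp : ∀ θ : {n : ℕ // 1 ≤ n} × ℕ, X θ.1 θ.2 → List Bool)
    (hinp : ∀ (n : {n : ℕ // 1 ≤ n}) x, inp (n, t n x) (e n x) = given P x)
    (D : ∀ θ : {n : ℕ // 1 ≤ n} × ℕ, X θ.1 θ.2 × (Bits (ℓ θ.1) → Bits (k θ.1)) → PMF (List Bool))
    (hD : FRand (simFam X ℓ k hk) (fun θ i => inp θ i.1) D)
    (hreal : ∀ B : ℕ → ℕ, PolyBounded B → ∃ ε, ENeg ε ∧ ∀ (n : {n : ℕ // 1 ≤ n})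
      (x : Input (σ n)) (A : RandCircuit), x.z ≤ B n → A.size ≤ B n →
      Near (ε n) (acc (fun G => D (n, t n x) (e n x, G)) A)
        (acc (fun G => (Γ n x G).map fun views => views P) A)) :
    ∃ Sim : ℕ → ℕ → RandCircuit,
      (∃ q : Polynomial ℕ, ∀ n L, (Sim n L).size ≤ q.eval (n + L)) ∧
      ∀ B : ℕ → ℕ, PolyBounded B → ∃ μ : ℕ → ℝ, Negligible μ ∧
        ∀ n (x : Input (σ n)) (A : RandCircuit), x.z ≤ B n → A.size ≤ B n →
          |acceptProb (fun G : Bits (ℓ n) → Bits (k n) =>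
              (Sim n (x.of P ++ functionality x P).length).run (oracleOf G)
                (x.of P ++ functionality x P)) A -
            acceptProb (fun G => (Γ n x G).map fun views => views P) A| ≤ μ n := by
  obtain ⟨s, ⟨q, hq⟩, hs⟩ := hD
  choose c hc hcD using hs
  -- The bounds on the group order are available for `1 ≤ n` only. The numbers determined by the
  -- input, such as `z`, are read off its length by `τ`.
  let Sim : ℕ → ℕ → RandCircuit := fun n L =>
    if h : 1 ≤ n then c (⟨n, h⟩, τ n L) else ⟨⟨[], []⟩, 0⟩
  refine ⟨Sim, ⟨q, fun n L => ?_⟩, fun B hB => ?_⟩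
  · simp only [Sim]
    split_ifs with h
    · refine ((hc _).trans (hq _)).trans (eval_mono q ?_)
      exact Nat.add_le_add_left (hτ n L) n
    · simp [RandCircuit.size, Circuit.size]
  obtain ⟨ε, hε, hreal⟩ := hreal B hB
  have hB' : PolyBounded fun n => q.eval (n + B n) :=
    PolyBounded.comp_poly (B := fun n => n + B n) (let ⟨r, hr⟩ := hB
      ⟨Polynomial.X + r, fun n => by simpa using hr n⟩) q
  obtain ⟨μ, h1, h2, h3⟩ := (ENeg.sampling hB').add hε
  -- Negligibility ignores the value at `0`, where the simulator is void and the trivial bound `1`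
  -- is used.
  refine ⟨fun n => if n = 0 then 1 else μ n, ?_, fun n x A hx hA => ?_⟩
  · refine Asymptotics.SuperpolynomialDecay.congr' h1 ?_
    filter_upwards [Filter.eventually_gt_atTop 0] with n hn
    rw [if_neg (by omega)]
  rw [acceptProb_eq, acceptProb_eq]
  beta_reduce
  split_ifs with h0
  · have := acc_le_one (fun G : Bits (ℓ n) → Bits (k n) =>
      (Sim n (x.of P ++ functionality x P).length).run (oracleOf G)
        (x.of P ++ functionality x P)) A
    refine Near.abs_toReal (ε := 1) this (acc_le_one _ _) ⟨this.trans le_add_self,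
      (acc_le_one _ _).trans le_add_self⟩ (by simp) zero_le_one
  · have hn : 1 ≤ n := by omega
    refine Near.abs_toReal (acc_le_one _ _) (acc_le_one _ _) (Near.trans (Near.acc_of_close
      (fun G => ?_) A) (hreal ⟨n, hn⟩ x A hx hA)) (h3 n) (h2 n)
    have hSim : Sim n (x.of P ++ functionality x P).length = c (⟨n, hn⟩, t n x) := by
      simp only [Sim, dif_pos hn]
      rw [← hτ' n x]; rfl
    rw [hSim]
    have := hcD (⟨n, hn⟩, t n x) (e ⟨n, hn⟩ x, G)
    have hi := hinp ⟨n, hn⟩ x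
    dsimp only at this hi
    rw [hi] at this
    refine this.mono ?_
    gcongr
    exact (hq _).trans (eval_mono q (Nat.add_le_add_left ((ht n x).trans hx) n))

/-! ### Simulators of the sender, the issuer and the second proxy -/

section
variable {F : Fam} {inp : F.Str}

/-- Sample a uniform element and continue with its encoding, together with the input. -/
theorem FRand.sample (hI : FLen F inp) {A : ∀ θ, F.ι θ → Type} [∀ θ i, Fintype (A θ i)]
    [∀ θ i, Nonempty (A θ i)] {e : ∀ θ i, A θ i → List Bool} (hA : FSamp F inp A e)
    {D : ∀ θ i, A θ i → PMF (List Bool)}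
    (h : ∀ inp' : (F.ext A).Str, FLen (F.ext A) inp' →
      FComp (F.ext A) inp' (fun θ p => inp θ p.1) →
      FComp (F.ext A) inp' (fun θ p => e θ p.1 p.2) →
      FRand (F.ext A) inp' fun θ p => D θ p.1 p.2) :
    FRand F inp fun θ i => (unif (A θ i)).bind (D θ i) :=
  FRand.bind hI hA fun l => h _ l ((FComp.id l).left l hI.ext) ((FComp.id l).right l hI.ext hA.flen)

theorem FComp.pk {E : AHE} (hI : FLen F inp) {kc : ∀ θ, F.ι θ → Bits (E.keyCoins (F.n θ))}
    (h : FComp F inp fun θ i => toL (kc θ i)) :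
    FComp F inp fun θ i => toL (E.kgen (F.n θ) (kc θ i)).2 :=
  (FComp.apply E.kgen_poly hI kc h).right hI (FLen.toL (Fam.PB.poly E.skLen_poly) _)
    (FLen.toL (Fam.PB.poly E.pkLen_poly) _)

end

/-! ### The queries as a uniform pair with product `C`. -/

/-- The queries `β₀ = B`, `β₁ = C / B` when `i = 0`, and `β₁ = B`, `β₀ = C / B` when `i = 1`. -/
def pairOf {H : Type} [CommGroup H] (C B : H) (i : Bool) : Bool → H :=
  fun j => if j = i then B else C / B

/-- The `δ` that leads to `β i = B`. -/
def deltaOf {H : Type} [CommGroup H] {p : ℕ} (g C B : H) (r₁ : ZMod p) (s₁ i : Bool) : Bool → H :=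
  if s₁ = i then pairOf C (B / zpw g r₁) false else pairOf C (B * zpw g r₁) true

/-- For a uniform `r₂`, every `β i` is uniform. -/
theorem exists_query_equiv {H : Type} [CommGroup H] [Fintype H] (g : H)
    (a r₁ : ZMod (Fintype.card H)) (s₁ s₂ i : Bool) :
    ∃ e : ZMod (Fintype.card H) ≃ ZMod (Fintype.card H), ∀ r₂,
      genQueryP2 g (zpw g a) r₂ s₂ = deltaOf g (zpw g a) (zpw g (e r₂)) r₁ s₁ i ∧
      genQueryP1 g r₁ s₁ (genQueryP2 g (zpw g a) r₂ s₂) = pairOf (zpw g a) (zpw g (e r₂)) i := by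
  -- If `s₁ = i`, then `β i = δ₀ * g ^ r₁`, with exponent `r₂ + r₁` or `a + r₁ - r₂` according to
  -- `s₂`. Otherwise `β i = δ₁ / g ^ r₁`, with exponent `r₂ - r₁` or `a - r₁ - r₂`. Each is a
  -- bijection in `r₂`.
  refine ⟨if s₁ = i then (if s₂ = false then Equiv.addRight r₁ else Equiv.subLeft (a + r₁)) else
    (if s₂ = true then Equiv.addRight (-r₁) else Equiv.subLeft (a - r₁)), fun r₂ => ⟨?_, ?_⟩⟩ <;>
  · funext j
    cases s₁ <;> cases s₂ <;> cases i <;> cases j <;>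
      simp only [genQueryP2, genQueryP1, deltaOf, pairOf, if_true, if_false, reduceCtorEq,
        Equiv.coe_addRight, Equiv.subLeft_apply, ← zpw_add, ← zpw_sub] <;> congr 1 <;> ring

section
variable {𝔾 : GroupGen} {E : AHE} {σ : ℕ → ℕ}

/-- The encoded input of `S`. -/
def encS {σ z : ℕ} (m : Fin z → Bool → Bits σ) : List Bool :=
  unary z ++ [false] ++ catFin fun t => catBool fun i => toL (m t i)

/-- The view of `S`. -/
def viewS (𝔾 : GroupGen) (E : AHE) {σ : ℕ} (n : ℕ) {z : ℕ} (m : Fin z → Bool → Bits σ)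
    (gc : Bits (𝔾.coinLen n)) (a : 𝔾.Ex n gc) (kc : Bits (E.keyCoins n)) (b : 𝔾.Ex n gc)
    (r₃ : Bits n) (y : Fin z → Bool → 𝔾.Ex n gc) (π : Bits z) : List Bool :=
  encS m ++ (toL gc ++ expL n a ++ (catFin fun t => catBool fun i => expL n (y t i)) ++ toL π) ++
    (toL (E.kgen n kc).2 ++ toL r₃ ++ catBool fun i =>
      𝔾.eL (pairOf (zpw (𝔾.gen0 n gc) a) (zpw (𝔾.gen0 n gc) b) false i))

theorem length_encS {σ z : ℕ} (m : Fin z → Bool → Bits σ) :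
    (encS m).length = z * (1 + (σ + σ)) + 1 := by
  simp only [DUQMR.encS, List.length_append]
  rw [length_catFin (m := σ + σ) fun t => by simp [DUQMR.catBool, length_toL]]
  simp [unary]; ring

theorem FLen.encS {F : Fam} {z : F.Θ → ℕ} (hz : F.PB z) (hσ : PolyBounded σ)
    (m : ∀ θ, F.ι θ → Fin (z θ) → Bool → Bits (σ (F.n θ))) : FLen F fun θ i => encS (m θ i) := by
  have pσ : F.PB fun θ => σ (F.n θ) := Fam.PB.poly hσ
  exact ⟨_, (hz.mul ((Fam.PB.const 1).add (pσ.add pσ))).add (.const 1), fun θ i => length_encS _⟩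

theorem frand_viewS {F : Fam} (h1 : ∀ θ, 1 ≤ F.n θ) {inp : F.Str} (hI : FLen F inp) {z : F.Θ → ℕ}
    (hz : F.PB z) {m : ∀ θ, F.ι θ → Fin (z θ) → Bool → Bits (σ (F.n θ))}
    (hm : FComp F inp fun θ i => encS (m θ i)) :
    FRand F inp fun θ i => (unif (Bits (𝔾.coinLen (F.n θ)))).bind fun gc =>
      (unif (𝔾.Ex (F.n θ) gc × Bits (E.keyCoins (F.n θ)) × 𝔾.Ex (F.n θ) gc × Bits (F.n θ) ×
        (Fin (z θ) → Bool → 𝔾.Ex (F.n θ) gc) × Bits (z θ))).bind fun r =>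
      PMF.pure (viewS 𝔾 E (F.n θ) (m θ i) gc r.1 r.2.1 r.2.2.1 r.2.2.2.1 r.2.2.2.2.1
        r.2.2.2.2.2) := by
  refine FRand.sample hI (FSamp.bits hI (Fam.PB.poly 𝔾.coinLen_poly)) fun inp' l kI kc => ?_
  let F' := F.ext fun θ _ => Bits (𝔾.coinLen (F.n θ))
  have kd := FComp.gdesc (F := F') (gc := fun θ p => p.2) l kc
  have se := FSamp.ex (F := F') (gc := fun θ p => p.2) h1 l kd
  have hz' : F'.PB z := hz
  refine FRand.sample (F := F') l (FSamp.prod l se (FSamp.prod l (FSamp.bits l (Fam.PB.poly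
    E.keyCoins_poly)) (FSamp.prod l se (FSamp.prod l (FSamp.bits l Fam.PB.n) (FSamp.prod l
    ((se.fun_bool l).fin l hz') (FSamp.bits l hz')))))) fun inp'' l' kI' ks => ?_
  let F'' := F'.ext fun θ p => 𝔾.Ex (F.n θ) p.2 × Bits (E.keyCoins (F.n θ)) × 𝔾.Ex (F.n θ) p.2 ×
    Bits (F.n θ) × (Fin (z θ) → Bool → 𝔾.Ex (F.n θ) p.2) × Bits (z θ)
  have hz'' : F''.PB z := hz
  have lx : ∀ a : ∀ (θ : F''.Θ) (p : F''.ι θ), 𝔾.Ex (F.n θ) p.1.2, FLen F'' fun θ p =>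
    expL (F.n θ) (a θ p) := fun a => FLen.expL (F := F'') _
  have lk : FLen F'' fun θ p => toL p.2.2.1 := FLen.toL (Fam.PB.poly (F := F'') E.keyCoins_poly) _
  have lr : FLen F'' fun θ p => toL p.2.2.2.2.1 := FLen.toL (Fam.PB.n (F := F'')) _
  have lp : FLen F'' fun θ p => toL p.2.2.2.2.2.2 := FLen.toL hz'' _
  have ly : FLen F'' fun θ p => catFin fun t => catBool fun i => expL (F.n θ) (p.2.2.2.2.2.1 t i) :=
    FLen.catFin (F := F'') (m := fun θ => (F.n θ + 1) + (F.n θ + 1)) hz'' (((Fam.PB.n (F := F'')).add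
      (.const 1)).add ((Fam.PB.n (F := F'')).add (.const 1))) fun θ p t => by
        simp [DUQMR.catBool, DUQMR.expL, length_toL]
  have l5 := ly.append lp
  have l4 := lr.append l5
  have l3 := (lx fun θ p => p.2.2.2.1).append l4
  have l2 := lk.append l3
  have ka := ks.left l' (lx fun θ p => p.2.1)
  have q2 := ks.right l' (lx fun θ p => p.2.1) l2
  have kk := q2.left l' lk
  have q3 := q2.right l' lk l3
  have kb := q3.left l' (lx fun θ p => p.2.2.2.1)
  have q4 := q3.right l' (lx fun θ p => p.2.2.2.1) l4
  have kr := q4.left l' lr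
  have q5 := q4.right l' lr l5
  have ky := q5.left l' ly
  have kp := q5.right l' ly lp
  have kI2 := FComp.comp l' kI' kI.ext
  have kc2 := FComp.comp l' kI' kc.ext
  have kd2 := FComp.comp l' kI' kd.ext
  have km := FComp.comp l' kI2 (FComp.ext (FComp.ext hm))
  have kg := FComp.ggen (F := F'') (gc := fun θ p => p.1.2) l' kd2
  have kC := FComp.gexp (F := F'') (gc := fun θ p => p.1.2) h1 l' kd2 kg ka
  have kB := FComp.gexp (F := F'') (gc := fun θ p => p.1.2) h1 l' kd2 kg kb
  have kD := FComp.gdiv (F := F'') (gc := fun θ p => p.1.2) l' kd2 kC kB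
  have kpk := FComp.pk (F := F'') l' kk
  exact FRand.pure ((km.append l' (((kc2.append l' ka).append l' ky).append l' kp)).append l'
    ((kpk.append l' kr).append l' (FComp.catBool l' kB kD)))

/-- For fixed `r₁` and `s₁` the exponent of `β false` is a bijective function of `r₂`. Substituting
it makes `r₁`, `s₁` and the bit `s` drop out. -/
theorem protocol_S (n : ℕ) (x : Input (σ n)) (G : Bits (𝔾.elemLen n) → Bits (σ n + n)) :
    (protocol 𝔾 E σ n x G).map (fun views => views .S) =
      (unif (Bits (𝔾.coinLen n))).bind fun gc =>
      (unif (𝔾.Ex n gc × Bits (E.keyCoins n) × 𝔾.Ex n gc × Bits n ×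
        (Fin x.z → Bool → 𝔾.Ex n gc) × Bits x.z)).bind fun r =>
      PMF.pure (viewS 𝔾 E n x.m gc r.1 r.2.1 r.2.2.1 r.2.2.2.1 r.2.2.2.2.1 r.2.2.2.2.2) := by
  refine pmf_ext_ex fun φ => ?_
  simp only [protocol, bind, pure, ex_map, ex_bind, ex_pure, ex_const, ex_unif_prod]
  refine congrArg (ex _) (funext fun gc => congrArg (ex _) (funext fun a =>
    congrArg (ex _) (funext fun kc => ?_)))
  refine Eq.trans (congrArg (ex _) (funext fun r₁ => ?_)) (ex_const (unif (𝔾.Ex n gc)) _)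
  rw [ex_comm]
  refine Eq.trans (congrArg (ex _) (funext fun s₁ => ?_)) (ex_const (unif Bool) _)
  obtain ⟨e, he⟩ := exists_query_equiv (𝔾.gen0 n gc) a r₁ s₁ (xor s₁ x.s) false
  refine Eq.trans ?_ (ex_unif_equiv e _)
  refine congrArg (ex _) (funext fun r₂ => congrArg (ex _) (funext fun r₃ =>
    congrArg (ex _) (funext fun y => congrArg (ex _) (funext fun π => congrArg φ ?_))))
  rw [viewS, ← (he r₂).2]
  rfl

/-- The encoded input of `T`. -/
def encT {z : ℕ} (v : Fin z) (s : Bool) : List Bool :=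
  unary z ++ [false] ++ toL (natBits z v) ++ [s]

/-- The view of `T`. -/
def viewT (𝔾 : GroupGen) (E : AHE) (n : ℕ) {z : ℕ} (v : Fin z) (s : Bool)
    (gc : Bits (𝔾.coinLen n)) (a : 𝔾.Ex n gc) (kc : Bits (E.keyCoins n))
    (rT : Fin z → Bits (E.encCoins n)) (s₁ : Bool) (r₃ : Bits n) : List Bool :=
  encT v s ++ ((catFin fun t => toL (rT t)) ++ [s₁] ++ toL r₃) ++
    (𝔾.desc n gc ++ 𝔾.eL (zpw (𝔾.gen0 n gc) a) ++ toL (E.kgen n kc).2)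

theorem protocol_T (n : ℕ) (x : Input (σ n)) (G : Bits (𝔾.elemLen n) → Bits (σ n + n)) :
    (protocol 𝔾 E σ n x G).map (fun views => views .T) =
      (unif (Bits (𝔾.coinLen n))).bind fun gc =>
      (unif (𝔾.Ex n gc × Bits (E.keyCoins n) × (Fin x.z → Bits (E.encCoins n)) × Bool ×
        Bits n)).bind fun r =>
      PMF.pure (viewT 𝔾 E n x.v x.s gc r.1 r.2.1 r.2.2.1 r.2.2.2.1 r.2.2.2.2) := by
  refine pmf_ext_ex fun φ => ?_
  simp only [protocol, bind, pure, ex_map, ex_bind, ex_pure, ex_const, ex_unif_prod]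
  rfl

/-- The view of `P₂`. -/
def viewP2 (𝔾 : GroupGen) (n : ℕ) (gc : Bits (𝔾.coinLen n)) (a r₂ : 𝔾.Ex n gc) (s₂ : Bool) :
    List Bool :=
  𝔾.desc n gc ++ 𝔾.eL (zpw (𝔾.gen0 n gc) a) ++ expL n r₂ ++ [s₂]

/-- One-time pad on a bit: this is all that hides `s` from `P₂`. -/
theorem ex_xor (s : Bool) (φ : Bool → ℝ≥0∞) :
    (ex (unif Bool) fun b => φ (xor b s)) = ex (unif Bool) φ := by
  cases s
  · simp
  · simpa using ex_unif_equiv Equiv.boolNot φ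

theorem protocol_P2 (n : ℕ) (x : Input (σ n)) (G : Bits (𝔾.elemLen n) → Bits (σ n + n)) :
    (protocol 𝔾 E σ n x G).map (fun views => views .P2) =
      (unif (Bits (𝔾.coinLen n))).bind fun gc =>
      (unif (𝔾.Ex n gc × 𝔾.Ex n gc × Bool)).bind fun r =>
      PMF.pure (viewP2 𝔾 n gc r.1 r.2.1 r.2.2) := by
  refine pmf_ext_ex fun φ => ?_
  simp only [protocol, bind, pure, ex_map, ex_bind, ex_pure, ex_const, ex_unif_prod]
  refine congrArg (ex _) (funext fun gc => congrArg (ex _) (funext fun a =>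
    congrArg (ex _) (funext fun r₂ => ?_)))
  exact ex_xor x.s fun s₂ => φ (viewP2 𝔾 n gc a r₂ s₂)

theorem frand_viewT {F : Fam} (h1 : ∀ θ, 1 ≤ F.n θ) {inp : F.Str} (hI : FLen F inp) {z : F.Θ → ℕ}
    (hz : F.PB z) {v : ∀ θ, F.ι θ → Fin (z θ)} {s : ∀ θ, F.ι θ → Bool}
    (hv : FComp F inp fun θ i => encT (v θ i) (s θ i)) :
    FRand F inp fun θ i => (unif (Bits (𝔾.coinLen (F.n θ)))).bind fun gc =>
      (unif (𝔾.Ex (F.n θ) gc × Bits (E.keyCoins (F.n θ)) × (Fin (z θ) →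
        Bits (E.encCoins (F.n θ))) × Bool × Bits (F.n θ))).bind fun r =>
      PMF.pure (viewT 𝔾 E (F.n θ) (v θ i) (s θ i) gc r.1 r.2.1 r.2.2.1 r.2.2.2.1 r.2.2.2.2) := by
  refine FRand.sample hI (FSamp.bits hI (Fam.PB.poly 𝔾.coinLen_poly)) fun inp' l kI kc => ?_
  let F' := F.ext fun θ _ => Bits (𝔾.coinLen (F.n θ))
  have kd := FComp.gdesc (F := F') (gc := fun θ p => p.2) l kc
  have se := FSamp.ex (F := F') (gc := fun θ p => p.2) h1 l kd
  have hz' : F'.PB z := hz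
  refine FRand.sample (F := F') l (FSamp.prod l se (FSamp.prod l (FSamp.bits l (Fam.PB.poly
    E.keyCoins_poly)) (FSamp.prod l ((FSamp.bits l (Fam.PB.poly E.encCoins_poly)).fin l hz')
      (FSamp.prod l (FSamp.bool l) (FSamp.bits l Fam.PB.n))))) fun inp'' l' kI' ks => ?_
  let F'' := F'.ext fun θ p => 𝔾.Ex (F.n θ) p.2 × Bits (E.keyCoins (F.n θ)) × (Fin (z θ) →
    Bits (E.encCoins (F.n θ))) × Bool × Bits (F.n θ)
  have la : FLen F'' fun θ p => expL (F.n θ) p.2.1 := FLen.expL (F := F'') _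
  have lk : FLen F'' fun θ p => toL p.2.2.1 := FLen.toL (Fam.PB.poly (F := F'') E.keyCoins_poly) _
  have lr : FLen F'' fun θ p => catFin fun t => toL (p.2.2.2.1 t) :=
    FLen.catFin (F := F'') hz (Fam.PB.poly (F := F'') E.encCoins_poly) fun _ _ _ => length_toL _
  have ls : FLen F'' fun θ p => [p.2.2.2.2.1] := FLen.single (F := F'') _
  have l3 : FLen F'' fun θ p => toL p.2.2.2.2.2 := FLen.toL (Fam.PB.n (F := F'')) _
  have m3 := ls.append l3
  have m2 := lr.append m3
  have m1 := lk.append m2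
  have ka := ks.left l' la
  have q1 := ks.right l' la m1
  have kk := q1.left l' lk
  have q2 := q1.right l' lk m2
  have kI2 := FComp.comp l' kI' kI.ext
  have kd2 := FComp.comp l' kI' kd.ext
  have km := FComp.comp l' kI2 (FComp.ext (FComp.ext hv))
  have kg := FComp.ggen (F := F'') (gc := fun θ p => p.1.2) l' kd2
  have kC := FComp.gexp (F := F'') (gc := fun θ p => p.1.2) h1 l' kd2 kg ka
  have kpk := FComp.pk (F := F'') l' kk
  have := FRand.pure ((km.append l' q2).append l' ((kd2.append l' kC).append l' kpk))
  simpa only [viewT, List.append_assoc] using this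

theorem frand_viewP2 {F : Fam} (h1 : ∀ θ, 1 ≤ F.n θ) {inp : F.Str} (hI : FLen F inp) :
    FRand F inp fun θ _ => (unif (Bits (𝔾.coinLen (F.n θ)))).bind fun gc =>
      (unif (𝔾.Ex (F.n θ) gc × 𝔾.Ex (F.n θ) gc × Bool)).bind fun r =>
      PMF.pure (viewP2 𝔾 (F.n θ) gc r.1 r.2.1 r.2.2) := by
  refine FRand.sample hI (FSamp.bits hI (Fam.PB.poly 𝔾.coinLen_poly)) fun inp' l kI kc => ?_
  let F' := F.ext fun θ _ => Bits (𝔾.coinLen (F.n θ))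
  have kd := FComp.gdesc (F := F') (gc := fun θ p => p.2) l kc
  have se := FSamp.ex (F := F') (gc := fun θ p => p.2) h1 l kd
  refine FRand.sample (F := F') l (FSamp.prod l se (FSamp.prod l se (FSamp.bool l)))
    fun inp'' l' kI' ks => ?_
  let F'' := F'.ext fun θ p => 𝔾.Ex (F.n θ) p.2 × 𝔾.Ex (F.n θ) p.2 × Bool
  have la : FLen F'' fun θ p => expL (F.n θ) p.2.1 := FLen.expL (F := F'') _
  have lb : FLen F'' fun θ p => expL (F.n θ) p.2.2.1 := FLen.expL (F := F'') _
  have ls : FLen F'' fun θ p => [p.2.2.2] := FLen.single (F := F'') _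
  have ka := ks.left l' la
  have kd2 := FComp.comp l' kI' kd.ext
  have kg := FComp.ggen (F := F'') (gc := fun θ p => p.1.2) l' kd2
  have kC := FComp.gexp (F := F'') (gc := fun θ p => p.1.2) h1 l' kd2 kg ka
  have := FRand.pure ((kd2.append l' kC).append l' (ks.right l' la (lb.append ls)))
  simpa only [viewP2, List.append_assoc] using this

theorem PolyBounded.add_id (hσ : PolyBounded σ) : PolyBounded fun n => σ n + n :=
  let ⟨q, hq⟩ := hσ
  ⟨q + Polynomial.X, fun n => by simpa using hq n⟩

theorem length_encT {z : ℕ} (v : Fin z) (s : Bool) : (encT v s).length = z * 2 + 2 := by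
  simp [encT, unary, length_toL]; ring

theorem eneg_zero : ENeg fun _ => 0 := ENeg.two_pow.mono fun _ => zero_le

/-- The conclusion of the theorem for one party. -/
def SimulatorFor (𝔾 : GroupGen) (E : AHE) (σ : ℕ → ℕ) (P : Party) : Prop :=
  ∃ Sim : ℕ → ℕ → RandCircuit,
    (∃ q : Polynomial ℕ, ∀ n L, (Sim n L).size ≤ q.eval (n + L)) ∧
    ∀ B : ℕ → ℕ, PolyBounded B → ∃ μ : ℕ → ℝ, Negligible μ ∧
      ∀ n (x : Input (σ n)) (D : RandCircuit), x.z ≤ B n → D.size ≤ B n →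
        |acceptProb (fun G : Bits (𝔾.elemLen n) → Bits (σ n + n) =>
            (Sim n (x.of P ++ functionality x P).length).run (oracleOf G)
              (x.of P ++ functionality x P)) D -
          acceptProb (fun G => (protocol 𝔾 E σ n x G).map fun views => views P) D| ≤ μ n

theorem simulator_S (hσ : PolyBounded σ) : SimulatorFor 𝔾 E σ .S := by
  let X : {n : ℕ // 1 ≤ n} → ℕ → Type := fun n z => Fin z → Bool → Bits (σ n)
  let F := simFam X 𝔾.elemLen (fun n => σ n + n) hσ.add_id
  have hz : F.PB fun θ => θ.2 := Fam.PB.sz.mono fun θ => Nat.le_add_left _ _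
  have hI : FLen F fun θ i => encS i.1 := FLen.encS hz hσ _
  refine simulator_of (hk := hσ.add_id) _ .S X (fun n x => x.z) (fun _ _ => le_rfl)
    -- The encoded input of `S` has `z * (1 + 2 * σ) + 1` bits, which determines `z`.
    (fun n x => x.m) (fun n L => (L - 1) / (1 + (σ n + σ n)))
    (fun n L => (Nat.div_le_self _ _).trans (Nat.sub_le _ _)) (fun n x => ?_)
    (fun θ m => encS m) (fun n x => (List.append_nil _).symm) _
    (frand_viewS (F := F) (𝔾 := 𝔾) (E := E) (z := fun θ => θ.2) (fun θ => θ.1.2) hI hz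
      (FComp.id hI)) fun B hB => ⟨_, eneg_zero, fun n x A _ _ => ?_⟩
  · have : given .S x = encS x.m := List.append_nil _
    rw [this, length_encS, Nat.add_sub_cancel, Nat.mul_div_cancel _ (by omega)]
  · simp only [protocol_S]
    exact Near.refl _

theorem simulator_T (hσ : PolyBounded σ) : SimulatorFor 𝔾 E σ .T := by
  let X : {n : ℕ // 1 ≤ n} → ℕ → Type := fun n z => Fin z × Bool
  let F := simFam X 𝔾.elemLen (fun n => σ n + n) hσ.add_id
  have hz : F.PB fun θ => θ.2 := Fam.PB.sz.mono fun θ => Nat.le_add_left _ _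
  have hI : FLen F fun θ i => encT i.1.1 i.1.2 :=
    ⟨_, (hz.mul (.const 2)).add (.const 2), fun θ i => length_encT _ _⟩
  refine simulator_of (hk := hσ.add_id) _ .T X (fun n x => x.z) (fun _ _ => le_rfl)
    -- The encoded input of `T` has `2 * z + 2` bits.
    (fun n x => (x.v, x.s)) (fun n L => (L - 2) / 2)
    (fun n L => (Nat.div_le_self _ _).trans (Nat.sub_le _ _)) (fun n x => ?_)
    (fun θ i => encT i.1 i.2) (fun n x => (List.append_nil _).symm) _
    (frand_viewT (F := F) (𝔾 := 𝔾) (E := E) (z := fun θ => θ.2) (fun θ => θ.1.2) hI hz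
      (FComp.id hI)) fun B hB => ⟨_, eneg_zero, fun n x A _ _ => ?_⟩
  · have : given .T x = encT x.v x.s := List.append_nil _
    rw [this, length_encT, Nat.add_sub_cancel, Nat.mul_div_cancel _ (by omega)]
  · simp only [protocol_T]
    exact Near.refl _

theorem simulator_P2 (hσ : PolyBounded σ) : SimulatorFor 𝔾 E σ .P2 := by
  let X : {n : ℕ // 1 ≤ n} → ℕ → Type := fun _ _ => Unit
  let F := simFam X 𝔾.elemLen (fun n => σ n + n) hσ.add_id
  have hI : FLen F fun _ _ => [] := ⟨_, .const 0, fun _ _ => rfl⟩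
  refine simulator_of (hk := hσ.add_id) _ .P2 X (fun n x => 0) (fun _ _ => Nat.zero_le _)
    (fun n x => ()) (fun n L => 0) (fun n L => Nat.zero_le _) (fun n x => rfl)
    (fun θ i => []) (fun n x => rfl) _
    (frand_viewP2 (F := F) (𝔾 := 𝔾) (fun θ => θ.1.2) hI)
    fun B hB => ⟨_, eneg_zero, fun n x A _ _ => ?_⟩
  simp only [protocol_P2]
  exact Near.refl _

end
set_option synthInstance.maxSize 4000
set_option synthInstance.maxHeartbeats 400000

/-! ### The view of the first proxy -/

theorem FComp.enc {E : AHE} {F : Fam} {inp : F.Str} (hI : FLen F inp)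
    {kc : ∀ θ, F.ι θ → Bits (E.keyCoins (F.n θ))}
    (hk : FComp F inp fun θ i => toL (E.kgen (F.n θ) (kc θ i)).2) {m : ∀ θ, F.ι θ → ℕ}
    (hN : ∀ θ i, m θ i < E.modulus (F.n θ) (E.kgen (F.n θ) (kc θ i)).2)
    (hm : FComp F inp fun θ i => toL (natBits (E.ptLen (F.n θ)) (m θ i)))
    {r : ∀ θ, F.ι θ → Bits (E.encCoins (F.n θ))} (hr : FComp F inp fun θ i => toL (r θ i)) :
    FComp F inp fun θ i => toL (E.enc (F.n θ) (E.kgen (F.n θ) (kc θ i)).2 (m θ i) (r θ i)) :=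
  FComp.apply E.enc_poly hI (fun θ i => ⟨kc θ i, ⟨m θ i, hN θ i⟩, r θ i⟩)
    ((hk.append hI hm).append hI hr)

section
variable {𝔾 : GroupGen} {E : AHE}

/-- The view of `P₁`. -/
def viewP1 (𝔾 : GroupGen) (E : AHE) {n k z : ℕ} (gc : Bits (𝔾.coinLen n)) (C : 𝔾.El n gc)
    (kc : Bits (E.keyCoins n)) (w : Fin z → Bits (E.ctLen n)) (r₁ : 𝔾.Ex n gc) (s₁ : Bool)
    (δ : Bool → 𝔾.El n gc) (e : Fin z → Bool → 𝔾.El n gc × Bits k)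
    (ra : Bool → Bool → Fin z → Bits (E.addCoins n))
    (rm : Bool → Bool → Fin z → Bits (E.mulCoins n)) : List Bool :=
  ((catBool fun i => catBool fun i' => catFin fun t => toL (ra i i' t)) ++
    catBool fun i => catBool fun i' => catFin fun t => toL (rm i i' t)) ++
  (𝔾.desc n gc ++ 𝔾.eL C ++ toL (E.kgen n kc).2 ++ (catFin fun t => toL (w t)) ++ expL n r₁ ++
    [s₁] ++ (catBool fun i => 𝔾.eL (δ i)) ++
    catFin fun t => catBool fun i => 𝔾.eL (e t i).1 ++ toL (e t i).2)

/-- What remains to be sampled for the view of `P₁`: the exponents of `C`, the coins of the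
encryptions, `r₁`, `s₁`, the exponents `y`, the coins of the homomorphic operations, and the second
components of the response. -/
abbrev RestP1 (𝔾 : GroupGen) (E : AHE) (n k z : ℕ) (gc : Bits (𝔾.coinLen n)) : Type :=
  𝔾.Ex n gc × (Fin z → Bits (E.encCoins n)) × 𝔾.Ex n gc × Bool × (Fin z → Bool → 𝔾.Ex n gc) ×
    (Bool → Bool → Fin z → Bits (E.addCoins n)) × (Bool → Bool → Fin z → Bits (E.mulCoins n)) ×
    (Fin z → Bool → Bits k)

/-- The view of `P₁` with uniform second components of the response, with the ciphertext `ct` at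
position `v` of the query vector, with `β i = B`, and with the group element `A` in the `(t₀, j₀)`-th
place of the response. -/
def coreP1 (𝔾 : GroupGen) (E : AHE) {n k z : ℕ} (v t₀ : ℕ) (i j₀ : Bool)
    (gc : Bits (𝔾.coinLen n)) (kc : Bits (E.keyCoins n)) (ct : Bits (E.ctLen n)) (B A : 𝔾.El n gc)
    (r : RestP1 𝔾 E n k z gc) : List Bool :=
  viewP1 𝔾 E gc (zpw (𝔾.gen0 n gc) r.1) kc
    (fun t => if (t : ℕ) = v then ct else E.enc n (E.kgen n kc).2 0 (r.2.1 t)) r.2.2.1 r.2.2.2.1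
    (deltaOf (𝔾.gen0 n gc) (zpw (𝔾.gen0 n gc) r.1) B r.2.2.1 r.2.2.2.1 i)
    (fun t j => (if (t : ℕ) = t₀ ∧ j = j₀ then A else zpw (𝔾.gen0 n gc) (r.2.2.2.2.1 t j),
      r.2.2.2.2.2.2.2 t j)) r.2.2.2.2.2.1 r.2.2.2.2.2.2.1

theorem FLen.funs {F : Fam} {z m : F.Θ → ℕ} (hz : F.PB z) (hm : F.PB m)
    {f : ∀ θ, F.ι θ → Fin (z θ) → Bool → List Bool} (hf : ∀ θ i t j, (f θ i t j).length = m θ) :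
    FLen F fun θ i => DUQMR.catFin fun t => DUQMR.catBool fun j => f θ i t j :=
  FLen.catFin (m := fun θ => m θ + m θ) hz (hm.add hm) fun θ i t => by
    simp [DUQMR.catBool, hf]

theorem FLen.coins {F : Fam} {z m : F.Θ → ℕ} (hz : F.PB z) (hm : F.PB m)
    (f : ∀ θ, F.ι θ → Bool → Bool → Fin (z θ) → Bits (m θ)) :
    FLen F fun θ i => DUQMR.catBool fun j => DUQMR.catBool fun j' =>
      DUQMR.catFin fun t => DUQMR.toL (f θ i j j' t) :=
  FLen.catBool fun _ => FLen.catBool fun _ => FLen.catFin hz hm fun _ _ _ => length_toL _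

theorem FComp.pairs_get {F : Fam} {inp : F.Str} {z m : F.Θ → ℕ} (hm : F.PB m)
    {f : ∀ θ, F.ι θ → Fin (z θ) → Bool → List Bool} (hf : ∀ θ i t j, (f θ i t j).length = m θ)
    (hI : FLen F inp)
    (h : FComp F inp fun θ i => DUQMR.catFin fun t => DUQMR.catBool fun j => f θ i t j) (j : Bool) :
    FComp (F.loop z) (fun p i => inp p.1 i) fun p i => f p.1 i p.2 j := by
  have := FComp.catFin_get (m := fun θ => m θ + m θ) (fun θ i t => by
    simp [DUQMR.catBool, hf]) hI h
  have l : ∀ j, FLen (F.loop z) fun p i => f p.1 i p.2 j := fun j =>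
    ⟨_, Fam.PB.loop hm, fun p i => hf _ _ _ _⟩
  cases j
  · exact this.left hI.loop (l _)
  · exact this.right hI.loop (l false) (l true)

/-- The group elements `A`, `B` and the ciphertext `ct` are used without their exponents or coins.
Hence `A` and `B` may be a CDH challenge and `ct` an IND-CPA challenge; this single construction
serves both reductions and the simulator. -/
theorem frand_coreP1 {F : Fam} (h1 : ∀ θ, 1 ≤ F.n θ) {inp : F.Str} (hI : FLen F inp)
    {z : F.Θ → ℕ} (hz : F.PB z) {k : ℕ → ℕ} (hk : PolyBounded k) (v t₀ : F.Θ → ℕ)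
    (b j₀ : F.Θ → Bool) {gc : ∀ θ, F.ι θ → Bits (𝔾.coinLen (F.n θ))}
    {kc : ∀ θ, F.ι θ → Bits (E.keyCoins (F.n θ))} {ct : ∀ θ, F.ι θ → Bits (E.ctLen (F.n θ))}
    {B A : ∀ θ i, 𝔾.El (F.n θ) (gc θ i)} (hd : FComp F inp fun θ i => 𝔾.desc (F.n θ) (gc θ i))
    (hpk : FComp F inp fun θ i => toL (E.kgen (F.n θ) (kc θ i)).2)
    (hct : FComp F inp fun θ i => toL (ct θ i)) (hB : FComp F inp fun θ i => 𝔾.eL (B θ i))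
    (hA : FComp F inp fun θ i => 𝔾.eL (A θ i)) :
    FRand F inp fun θ i => (unif (RestP1 𝔾 E (F.n θ) (k (F.n θ)) (z θ) (gc θ i))).bind fun r =>
      PMF.pure (coreP1 𝔾 E (v θ) (t₀ θ) (b θ) (j₀ θ) (gc θ i) (kc θ i) (ct θ i) (B θ i) (A θ i)
        r) := by
  have se := FSamp.ex (F := F) (gc := gc) h1 hI hd
  refine FRand.sample hI (FSamp.prod hI se (FSamp.prod hI ((FSamp.bits hI (Fam.PB.poly
    E.encCoins_poly)).fin hI hz) (FSamp.prod hI se (FSamp.prod hI (FSamp.bool hI) (FSamp.prod hI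
    ((se.fun_bool hI).fin hI hz) (FSamp.prod hI ((((FSamp.bits hI (Fam.PB.poly
    E.addCoins_poly)).fin hI hz).fun_bool hI).fun_bool hI) (FSamp.prod hI ((((FSamp.bits hI
    (Fam.PB.poly E.mulCoins_poly)).fin hI hz).fun_bool hI).fun_bool hI)
    (((FSamp.bits hI (Fam.PB.poly hk)).fun_bool hI).fin hI hz)))))))) fun inp' l kI ks => ?_
  let F' := F.ext fun θ i => RestP1 𝔾 E (F.n θ) (k (F.n θ)) (z θ) (gc θ i)
  have hz' : F'.PB z := hz
  have pn : F'.PB fun θ => F.n θ + 1 := (Fam.PB.n (F := F')).add (.const 1)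
  have l1 : FLen F' fun θ p => expL (F.n θ) p.2.1 := FLen.expL (F := F') _
  have l2 : FLen F' fun θ p => catFin fun t => toL (p.2.2.1 t) := FLen.catFin (F := F') hz'
    (Fam.PB.poly (F := F') E.encCoins_poly) fun _ _ _ => length_toL _
  have l3 : FLen F' fun θ p => expL (F.n θ) p.2.2.2.1 := FLen.expL (F := F') _
  have l4 : FLen F' fun θ p => [p.2.2.2.2.1] := FLen.single (F := F') _
  have l5 : FLen F' fun θ p => catFin fun t => catBool fun j => expL (F.n θ) (p.2.2.2.2.2.1 t j) :=
    FLen.funs (F := F') hz' pn fun _ _ _ _ => length_toL _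
  have l6 : FLen F' fun θ p => catBool fun j => catBool fun j' => catFin fun t =>
      toL (p.2.2.2.2.2.2.1 j j' t) :=
    FLen.coins (F := F') hz' (Fam.PB.poly (F := F') E.addCoins_poly) _
  have l7 : FLen F' fun θ p => catBool fun j => catBool fun j' => catFin fun t =>
      toL (p.2.2.2.2.2.2.2.1 j j' t) :=
    FLen.coins (F := F') hz' (Fam.PB.poly (F := F') E.mulCoins_poly) _
  have pk : F'.PB fun θ => k (F.n θ) := Fam.PB.poly (F := F') hk
  have l8 : FLen F' fun θ p => catFin fun t => catBool fun j => toL (p.2.2.2.2.2.2.2.2 t j) :=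
    FLen.funs (F := F') hz' pk fun _ _ _ _ => length_toL _
  have m7 := l7.append l8
  have m6 := l6.append m7
  have m5 := l5.append m6
  have m4 := l4.append m5
  have m3 := l3.append m4
  have m2 := l2.append m3
  have k1 := ks.left l l1
  have q1 := ks.right l l1 m2
  have k2 := q1.left l l2
  have q2 := q1.right l l2 m3
  have k3 := q2.left l l3
  have q3 := q2.right l l3 m4
  have k4 := q3.left l l4
  have q4 := q3.right l l4 m5
  have k5 := q4.left l l5
  have q5 := q4.right l l5 m6
  have k6 := q5.left l l6
  have q6 := q5.right l l6 m7
  have k7 := q6.left l l7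
  have k8 := q6.right l l7 l8
  have kd := FComp.comp l kI hd.ext
  have kpk := FComp.comp l kI hpk.ext
  have kct := FComp.comp l kI hct.ext
  have kB := FComp.comp l kI hB.ext
  have kA := FComp.comp l kI hA.ext
  have kg := FComp.ggen (F := F') (gc := fun θ p => gc θ p.1) l kd
  have kC := FComp.gexp (F := F') (gc := fun θ p => gc θ p.1) h1 l kd kg k1
  have kR := FComp.gexp (F := F') (gc := fun θ p => gc θ p.1) h1 l kd kg k3
  have kw : FComp F' inp' fun θ p => catFin fun t : Fin (z θ) => toL (if (t : ℕ) = v θ then ct θ p.1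
      else E.enc (F.n θ) (E.kgen (F.n θ) (kc θ p.1)).2 0 (p.2.2.1 t)) := by
    refine FComp.catFin (F := F') l hz' ?_
    have kr := FComp.catFin_get (F := F') (m := fun θ => E.encCoins (F.n θ))
      (fun _ _ _ => length_toL _) l k2
    have k0 : FComp (F'.loop z) (fun p i => inp' p.1 i) fun p _ =>
        toL (natBits (E.ptLen (F.n p.1)) 0) :=
      FComp.const l.loop _ (by
        simp only [length_toL]
        exact Fam.PB.loop (F := F') (Fam.PB.poly (F := F') E.ptLen_poly))
    have ke := FComp.enc (F := F'.loop z) (kc := fun p i => kc p.1 i.1) (m := fun _ _ => 0) l.loop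
      kpk.loop (fun p i => E.modulus_pos _ _) k0 kr
    refine FComp.cases_sub (F := F'.loop z) (fun p => (p.2 : ℕ) = v p.1) ?_ ?_
    · have := FComp.sub (F := F'.loop z) (P := fun p => (p.2 : ℕ) = v p.1) kct.loop
      convert this using 3 with p i
      rw [if_pos p.2]
    · have := FComp.sub (F := F'.loop z) (P := fun p => ¬ (p.2 : ℕ) = v p.1) ke
      convert this using 3 with p i
      rw [if_neg p.2]
  have kδ : FComp F' inp' fun θ p => catBool fun j => 𝔾.eL (deltaOf (𝔾.gen0 (F.n θ) (gc θ p.1))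
      (zpw (𝔾.gen0 (F.n θ) (gc θ p.1)) p.2.1) (B θ p.1) p.2.2.2.1 p.2.2.2.2.1 (b θ) j) := by
    have d1 := FComp.gdiv (F := F') (gc := fun θ p => gc θ p.1) l kd kB kR
    have d2 := FComp.gmul (F := F') (gc := fun θ p => gc θ p.1) l kd kB kR
    have d3 := FComp.gdiv (F := F') (gc := fun θ p => gc θ p.1) l kd kC d1
    have d4 := FComp.gdiv (F := F') (gc := fun θ p => gc θ p.1) l kd kC d2
    have kb : FComp F' inp' fun θ _ => [b θ] := FComp.const l _ (.const 1)
    have kc := FComp.eq l k4 kb fun _ _ => rfl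
    refine FComp.catBool l ?_ ?_
    · convert kc.mux l d1 d4 fun _ _ => by rw [length_eL, length_eL] using 3 with θ p
      rw [← apply_ite]
      by_cases h : p.2.2.2.2.1 = b θ <;> simp [deltaOf, pairOf, h] <;> rfl
    · convert kc.mux l d3 d2 fun _ _ => by rw [length_eL, length_eL] using 3 with θ p
      rw [← apply_ite]
      by_cases h : p.2.2.2.2.1 = b θ <;> simp [deltaOf, pairOf, h] <;> rfl
  have ky : FComp F' inp' fun θ p => catFin fun t : Fin (z θ) => catBool fun j =>
      𝔾.eL (if (t : ℕ) = t₀ θ ∧ j = j₀ θ then A θ p.1 else zpw (𝔾.gen0 (F.n θ) (gc θ p.1))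
        (p.2.2.2.2.2.1 t j)) ++ toL (p.2.2.2.2.2.2.2.2 t j) := by
    refine FComp.catFin (F := F') l hz' ?_
    have key : ∀ j : Bool, FComp (F'.loop z) (fun p i => inp' p.1 i) fun p i =>
        𝔾.eL (if (p.2 : ℕ) = t₀ p.1 ∧ j = j₀ p.1 then A p.1 i.1 else
          zpw (𝔾.gen0 (F.n p.1) (gc p.1 i.1)) (i.2.2.2.2.2.1 p.2 j)) ++
            toL (i.2.2.2.2.2.2.2.2 p.2 j) := by
      intro j
      have e1 := FComp.pairs_get (F := F') pn (fun _ _ _ _ => length_toL _) l k5 j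
      have e2 := FComp.pairs_get (F := F') pk (fun _ _ _ _ => length_toL _) l k8 j
      have e3 := FComp.gexp (F := F'.loop z) (gc := fun p i => gc p.1 i.1) (fun p => h1 p.1) l.loop
        kd.loop kg.loop e1
      refine FComp.append l.loop ?_ e2
      refine FComp.cases_sub (F := F'.loop z) (fun p => (p.2 : ℕ) = t₀ p.1 ∧ j = j₀ p.1) ?_ ?_
      · have := FComp.sub (F := F'.loop z) (P := fun p => (p.2 : ℕ) = t₀ p.1 ∧ j = j₀ p.1) kA.loop
        convert this using 3 with p i
        rw [if_pos p.2]
      · have := FComp.sub (F := F'.loop z) (P := fun p => ¬ ((p.2 : ℕ) = t₀ p.1 ∧ j = j₀ p.1)) e3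
        convert this using 3 with p i
        rw [if_neg p.2]
    exact FComp.catBool l.loop (key false) (key true)
  exact FRand.pure ((k6.append l k7).append l (((((((kd.append l kC).append l kpk).append l
    kw).append l k3).append l k4).append l kδ).append l ky))

end

/-! ### Masking by the random oracle -/

theorem ex_resample {A B : Type} [Fintype A] [DecidableEq A] [Fintype B] [Nonempty B] (q : A)
    (φ : (A → B) → ℝ≥0∞) :
    (ex (unif (A → B)) fun G => ex (unif B) fun b => φ (Function.update G q b)) =
      ex (unif (A → B)) φ := by
  simpa using congrArg (ex · φ) (unif_resample q PMF.pure)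

theorem ex_resample₂ {A C B : Type} [Fintype A] [DecidableEq A] [Fintype C] [DecidableEq C]
    [Fintype B] [Nonempty B] (t : A) (i : C) (φ : (A → C → B) → ℝ≥0∞) :
    (ex (unif (A → C → B)) fun y => ex (unif B) fun b =>
      φ (Function.update y t (Function.update (y t) i b))) = ex (unif (A → C → B)) φ := by
  simpa using congrArg (ex · φ) (unif_resample₂ t i PMF.pure)

theorem xorBits_xorBits {k : ℕ} (a b : Bits k) : xorBits (xorBits a b) b = a := by
  funext i; simp [xorBits]

/-- Exclusive or with a fixed function. -/
def xorEquiv {J : Type} {k : ℕ} (M : J → Bits k) : (J → Bits k) ≃ (J → Bits k) where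
  toFun := fun u j => xorBits (u j) (M j)
  invFun := fun u j => xorBits (u j) (M j)
  left_inv _ := funext fun _ => xorBits_xorBits _ _
  right_inv _ := funext fun _ => xorBits_xorBits _ _

/-- Values of the random oracle at distinct points mask messages unless a point is queried. -/
theorem rom_mask {J : Type} [Fintype J] [DecidableEq J] {ℓ k : ℕ} (pts : J → Bits ℓ)
    (M : J → Bits k) (V : (J → Bits k) → List Bool) (c : RandCircuit) (a : List Bool) :
    Near ((open Classical in if Function.Injective pts then 0 else 1) +
      (ex (unif (Bits ℓ → Bits k)) fun G => ex (unif (J → Bits k)) fun u =>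
        ∑ i ∈ Finset.range c.gates.length, ∑ j : J,
          (c.trunc i).run (oracleOf G) (V u) (toL (pts j))))
      (ex (unif (Bits ℓ → Bits k)) fun G =>
        c.run (oracleOf G) (V fun j => xorBits (G (pts j)) (M j)) a)
      (ex (unif (Bits ℓ → Bits k)) fun G => ex (unif (J → Bits k)) fun u =>
        c.run (oracleOf G) (V u) a) := by
  split_ifs with hp
  · have := rom_swap hp (fun _ u => V fun j => xorBits (u j) (M j)) (fun _ _ => rfl) c a
    have e : ∀ φ : (J → Bits k) → ℝ≥0∞, (ex (unif (J → Bits k)) fun u =>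
        φ fun j => xorBits (u j) (M j)) = ex (unif (J → Bits k)) φ :=
      fun φ => ex_unif_equiv (xorEquiv M) φ
    have e1 : ∀ G : Bits ℓ → Bits k, _ := fun G => e fun u => c.run (oracleOf G) (V u) a
    have e2 : ∀ G : Bits ℓ → Bits k, _ := fun G => e fun u =>
      ∑ i ∈ Finset.range c.gates.length, ∑ j : J,
          (c.trunc i).run (oracleOf G) (V u) (toL (pts j))
    simp only [e1, e2] at this
    rw [zero_add]
    exact this
  · refine ⟨(ex_le fun _ => PMF.coe_le_one _ _).trans ?_,
      (ex_le fun _ => ex_le fun _ => PMF.coe_le_one _ _).trans ?_⟩ <;>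
    exact le_self_add.trans le_add_self

/-- For uniform `b` and `y` in a field of order `p`, the equation `b * y = f b` holds with
probability at most `2 / p`. -/
theorem ex_mul_eq_le {p : ℕ} [Fact p.Prime] (f : ZMod p → ZMod p) :
    (ex (unif (ZMod p)) fun b => ex (unif (ZMod p)) fun y => if b * y = f b then 1 else 0) ≤
      2 * (p : ℝ≥0∞)⁻¹ := by
  have h : ∀ b : ZMod p, (ex (unif (ZMod p)) fun y => if b * y = f b then (1 : ℝ≥0∞) else 0) ≤
      (if b = 0 then 1 else 0) + (p : ℝ≥0∞)⁻¹ := by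
    intro b
    split_ifs with hb
    · exact (ex_le fun y => by split_ifs <;> simp).trans le_self_add
    · rw [zero_add]
      have := ex_unif_eq (b⁻¹ * f b)
      rw [ZMod.card] at this
      rw [← this]
      refine ex_mono fun y => ?_
      have : b * y = f b ↔ y = b⁻¹ * f b := by
        constructor
        · intro h; rw [← h]; field_simp
        · rintro rfl; field_simp
      simp only [this, le_refl]
  refine (ex_mono h).trans ?_
  rw [ex_add, ex_const, ex_unif_eq, ZMod.card, two_mul]

theorem card_inv_le {𝔾 : GroupGen} {n : ℕ} (hn : 1 ≤ n) (gc : Bits (𝔾.coinLen n)) :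
    ((𝔾.p n (𝔾.gen n gc) : ℕ) : ℝ≥0∞)⁻¹ ≤ ((2 : ℝ≥0∞) ^ n)⁻¹ := by
  rw [ENNReal.inv_le_inv]
  exact_mod_cast GroupGen.le_p hn gc

theorem one_le_of_not_injective {J A : Type} [Fintype J] [DecidableEq J] [DecidableEq A]
    (pts : J → A) : (open Classical in if Function.Injective pts then (0 : ℝ≥0∞) else 1) ≤
      ∑ j : J, ∑ j' : J, if j ≠ j' ∧ pts j = pts j' then 1 else 0 := by
  split_ifs with h
  · exact zero_le
  · rw [Function.Injective] at h
    push Not at h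
    obtain ⟨j, j', h1, h2⟩ := h
    refine le_trans ?_ (Finset.single_le_sum (fun _ _ => zero_le) (Finset.mem_univ j))
    refine le_trans ?_ (Finset.single_le_sum (fun _ _ => zero_le) (Finset.mem_univ j'))
    rw [if_pos ⟨h2, h1⟩]

section
variable {𝔾 : GroupGen} {E : AHE} {σ : ℕ → ℕ}

instance {n : ℕ} (gc : Bits (𝔾.coinLen n)) : Fact (𝔾.p n (𝔾.gen n gc)).Prime :=
  ⟨𝔾.prime_card n gc⟩

theorem gen0_zpw_injective {n : ℕ} (gc : Bits (𝔾.coinLen n)) :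
    Function.Injective fun a : 𝔾.Ex n gc => zpw (𝔾.gen0 n gc) a :=
  zpw_injective (𝔾.g_generates n gc)

/-- Two different points at which the sender evaluates the random oracle rarely collide. -/
theorem collision_le {n z : ℕ} (hn : 1 ≤ n) (gc : Bits (𝔾.coinLen n)) (a r₁ : 𝔾.Ex n gc)
    (s₁ s₂ : Bool) (ι : Fin z × Bool → Bool) {J J' : Fin z × Bool} (hJ : J ≠ J') :
    (ex (unif (Fin z → Bool → 𝔾.Ex n gc)) fun y => ex (unif (𝔾.Ex n gc)) fun r₂ =>
      open Classical in
      let β := genQueryP1 (𝔾.gen0 n gc) r₁ s₁ (genQueryP2 (𝔾.gen0 n gc) (zpw (𝔾.gen0 n gc) a) r₂ s₂)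
      if zpw (β (ι J)) (y J.1 J.2) = zpw (β (ι J')) (y J'.1 J'.2) then (1 : ℝ≥0∞) else 0) ≤
    2 * ((2 : ℝ≥0∞) ^ n)⁻¹ := by
  obtain ⟨e, he⟩ := exists_query_equiv (𝔾.gen0 n gc) a r₁ s₁ s₂ (ι J)
  -- The exponent belonging to `J` becomes a fresh variable `y₀`; the one belonging to `J'` is
  -- unaffected because `J ≠ J'`.
  rw [← ex_resample₂ J.1 J.2]
  refine ex_le fun y => ?_
  have hy : ∀ y₀ : 𝔾.Ex n gc, Function.update y J.1 (Function.update (y J.1) J.2 y₀) J'.1 J'.2 =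
      y J'.1 J'.2 := fun y₀ => by
    by_cases h : J'.1 = J.1
    · have h' : J'.2 ≠ J.2 := fun h' => hJ (Prod.ext h.symm h'.symm)
      rw [h, Function.update_self, Function.update_of_ne h']
    · rw [Function.update_of_ne h]
  rw [ex_comm]
  -- With `b` the uniform exponent of the query at `J`, the query at `J'` has exponent `b` or `a -
  -- b`. The points collide exactly when `b * y₀ = f b`.
  let f : 𝔾.Ex n gc → 𝔾.Ex n gc := fun b => if ι J' = ι J then b * y J'.1 J'.2 else
    (a - b) * y J'.1 J'.2
  refine le_trans ?_ (mul_le_mul_right (card_inv_le hn gc) 2)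
  refine le_trans (le_of_eq ?_) (ex_mul_eq_le f)
  classical
  refine Eq.trans ?_ (ex_unif_equiv e _)
  refine congrArg (ex _) (funext fun r₂ => congrArg (ex _) (funext fun y₀ => if_congr ?_ rfl rfl))
  have h1 : pairOf (zpw (𝔾.gen0 n gc) a) (zpw (𝔾.gen0 n gc) (e r₂)) (ι J) (ι J) =
    zpw (𝔾.gen0 n gc) (e r₂) := if_pos rfl
  have h2 : zpw (pairOf (zpw (𝔾.gen0 n gc) a) (zpw (𝔾.gen0 n gc) (e r₂)) (ι J) (ι J'))
      (y J'.1 J'.2) = zpw (𝔾.gen0 n gc) (f (e r₂)) := by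
    simp only [pairOf, f]
    split_ifs
    · rw [zpw_mul]
    · rw [zpw_mul, zpw_sub]
  rw [(he r₂).2, h1, hy, h2, Function.update_self, Function.update_self, ← zpw_mul]
  exact (gen0_zpw_injective gc).eq_iff

end

/-! ### The distribution of the view of the first proxy -/

section
variable {𝔾 : GroupGen} {E : AHE} {σ : ℕ → ℕ}

/-- The queries to the sender. -/
abbrev betaOf (𝔾 : GroupGen) {n : ℕ} (gc : Bits (𝔾.coinLen n)) (a r₁ r₂ : 𝔾.Ex n gc)
    (s₁ s : Bool) : Bool → 𝔾.El n gc :=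
  genQueryP1 (𝔾.gen0 n gc) r₁ s₁ (genQueryP2 (𝔾.gen0 n gc) (zpw (𝔾.gen0 n gc) a) r₂ (xor s₁ s))

/-- Expectation of a function of the view of `P₁` with uniform second components `u` of the
response. -/
def jointP1 (𝔾 : GroupGen) (E : AHE) {n k z : ℕ} (gc : Bits (𝔾.coinLen n)) (v : Fin z) (s : Bool)
    (bit : ℕ) (Ψ : List Bool → (Bool → 𝔾.El n gc) → (Fin z → Bool → 𝔾.Ex n gc) →
      (Bits (𝔾.elemLen n) → Bits k) → ℝ≥0∞) : ℝ≥0∞ :=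
  ex (unif (Bits (E.keyCoins n))) fun kc => ex (unif (𝔾.Ex n gc)) fun a =>
  ex (unif (Fin z → Bits (E.encCoins n))) fun rT => ex (unif (𝔾.Ex n gc)) fun r₁ =>
  ex (unif Bool) fun s₁ => ex (unif (Fin z → Bool → 𝔾.Ex n gc)) fun y =>
  ex (unif (Bool → Bool → Fin z → Bits (E.addCoins n))) fun ra =>
  ex (unif (Bool → Bool → Fin z → Bits (E.mulCoins n))) fun rm =>
  ex (unif (𝔾.Ex n gc)) fun r₂ => ex (unif (Bits (𝔾.elemLen n) → Bits k)) fun G =>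
  ex (unif (Fin z × Bool → Bits k)) fun u =>
    Ψ (viewP1 𝔾 E gc (zpw (𝔾.gen0 n gc) a) kc
      (fun t => E.enc n (E.kgen n kc).2 (if t = v then bit else 0) (rT t)) r₁ s₁
      (genQueryP2 (𝔾.gen0 n gc) (zpw (𝔾.gen0 n gc) a) r₂ (xor s₁ s))
      (fun t j => (zpw (𝔾.gen0 n gc) (y t j), u (t, j))) ra rm)
      (betaOf 𝔾 gc a r₁ r₂ s₁ s) y G

/-- Prepares the reductions. Resampling separates the coins of the ciphertext at `v` and the
exponent at `(t₀, j₀)` from the rest, and the bijection between `r₂` and the exponent `b` of `β i`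
makes the latter an independent variable. What remains is `coreP1` applied to independent
challenges. -/
theorem jointP1_eq {n k z : ℕ} (gc : Bits (𝔾.coinLen n)) (v t₀ : Fin z) (i j₀ s : Bool) (bit : ℕ)
    (Ψ : List Bool → 𝔾.El n gc → 𝔾.Ex n gc → (Bits (𝔾.elemLen n) → Bits k) → ℝ≥0∞) :
    jointP1 𝔾 E gc v s bit (fun V β y G => Ψ V (β i) (y t₀ j₀) G) =
      ex (unif (𝔾.Ex n gc)) fun b => ex (unif (𝔾.Ex n gc)) fun y₀ =>
      ex (unif (Bits (E.keyCoins n))) fun kc => ex (unif (Bits (E.encCoins n))) fun re =>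
      ex (unif (Bits (𝔾.elemLen n) → Bits k)) fun G => ex (unif (RestP1 𝔾 E n k z gc)) fun r =>
        Ψ (coreP1 𝔾 E v t₀ i j₀ gc kc (E.enc n (E.kgen n kc).2 bit re) (zpw (𝔾.gen0 n gc) b)
          (zpw (𝔾.gen0 n gc) y₀) r) (zpw (𝔾.gen0 n gc) b) y₀ G := by
  let e : (Bits (E.keyCoins n) × 𝔾.Ex n gc × (Fin z → Bits (E.encCoins n)) × Bits (E.encCoins n) ×
      𝔾.Ex n gc × Bool × (Fin z → Bool → 𝔾.Ex n gc) × 𝔾.Ex n gc ×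
      (Bool → Bool → Fin z → Bits (E.addCoins n)) × (Bool → Bool → Fin z → Bits (E.mulCoins n)) ×
      𝔾.Ex n gc × (Bits (𝔾.elemLen n) → Bits k) × (Fin z → Bool → Bits k)) ≃
      (𝔾.Ex n gc × 𝔾.Ex n gc × Bits (E.keyCoins n) × Bits (E.encCoins n) ×
        (Bits (𝔾.elemLen n) → Bits k) × RestP1 𝔾 E n k z gc) :=
    ⟨fun ⟨kc, a, rT, re, r₁, s₁, y, y₀, ra, rm, b, G, u⟩ =>
        ⟨b, y₀, kc, re, G, a, rT, r₁, s₁, y, ra, rm, u⟩,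
      fun ⟨b, y₀, kc, re, G, a, rT, r₁, s₁, y, ra, rm, u⟩ =>
        ⟨kc, a, rT, re, r₁, s₁, y, y₀, ra, rm, b, G, u⟩, fun _ => rfl, fun _ => rfl⟩
  have h := ex_unif_equiv e fun q =>
    Ψ (coreP1 𝔾 E v t₀ i j₀ gc q.2.2.1 (E.enc n (E.kgen n q.2.2.1).2 bit q.2.2.2.1)
      (zpw (𝔾.gen0 n gc) q.1) (zpw (𝔾.gen0 n gc) q.2.1) q.2.2.2.2.2) (zpw (𝔾.gen0 n gc) q.1) q.2.1
      q.2.2.2.2.1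
  rw [ex_unif_prod (β := 𝔾.Ex n gc × Bits (E.keyCoins n) × Bits (E.encCoins n) ×
        (Bits (𝔾.elemLen n) → Bits k) × RestP1 𝔾 E n k z gc)] at h
  simp only [ex_unif_prod] at h ⊢
  refine Eq.trans ?_ h
  rw [jointP1]
  refine congrArg (ex _) (funext fun kc => congrArg (ex _) (funext fun a => ?_))
  refine (ex_resample v _).symm.trans ?_
  refine congrArg (ex _) (funext fun rT => congrArg (ex _) (funext fun re =>
    congrArg (ex _) (funext fun r₁ => congrArg (ex _) (funext fun s₁ => ?_))))
  refine (ex_resample₂ t₀ j₀ _).symm.trans ?_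
  refine congrArg (ex _) (funext fun y => congrArg (ex _) (funext fun y₀ =>
    congrArg (ex _) (funext fun ra => congrArg (ex _) (funext fun rm => ?_))))
  obtain ⟨q, hq⟩ := exists_query_equiv (𝔾.gen0 n gc) a r₁ s₁ (xor s₁ s) i
  refine Eq.trans ?_ (ex_unif_equiv q _)
  refine congrArg (ex _) (funext fun r₂ => congrArg (ex _) (funext fun G => ?_))
  refine Eq.trans ?_ (ex_unif_equiv (Equiv.curry (Fin z) Bool (Bits k)) _)
  refine congrArg (ex _) (funext fun u => ?_)
  have hw : (fun t => E.enc n (E.kgen n kc).2 (if t = v then bit else 0)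
      (Function.update rT v re t)) = fun t : Fin z => if (t : ℕ) = v then
        E.enc n (E.kgen n kc).2 bit re else E.enc n (E.kgen n kc).2 0 (rT t) := by
    funext t
    by_cases ht : t = v
    · subst ht; simp
    · rw [if_neg ht, if_neg (fun h => ht (Fin.ext h)), Function.update_of_ne ht]
  have hy : (fun t j => (zpw (𝔾.gen0 n gc) (Function.update y t₀ (Function.update (y t₀) j₀ y₀) t j),
      u (t, j))) = fun (t : Fin z) j => (if (t : ℕ) = t₀ ∧ j = j₀ then zpw (𝔾.gen0 n gc) y₀ else
        zpw (𝔾.gen0 n gc) (y t j), Equiv.curry (Fin z) Bool (Bits k) u t j) := by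
    funext t j
    refine Prod.ext ?_ rfl
    by_cases ht : t = t₀
    · subst ht
      by_cases hj : j = j₀
      · subst hj; simp
      · simp [hj]
    · rw [Function.update_of_ne ht, if_neg fun h => ht (Fin.ext h.1)]
  have hβ : betaOf 𝔾 gc a r₁ r₂ s₁ s i = zpw (𝔾.gen0 n gc) (q r₂) := by
    rw [betaOf, (hq r₂).2]; exact if_pos rfl
  have hy₀ : Function.update y t₀ (Function.update (y t₀) j₀ y₀) t₀ j₀ = y₀ := by simp
  rw [hβ, hy₀, hy, hw, (hq r₂).1]
  rfl

theorem genRes_of_eq {H : Type} [CommGroup H] {p ℓ τ n z : ℕ} (encode : H → Bits ℓ)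
    (G : Bits ℓ → Bits (τ + n)) (g C : H) {β : Bool → H} (hC : C = β false * β true)
    (m : Fin z → Bool → Bits τ) (r₃ : Bits n) (y : Fin z → Bool → ZMod p) (π : Fin z → Bool) :
    genRes encode G g C β m r₃ y π = some fun t j => (zpw g (y t (xor j (π t))),
      xorBits (G (encode (zpw (β (xor j (π t))) (y t (xor j (π t))))))
        (Fin.append (m t (xor j (π t))) r₃)) := by
  rw [genRes, if_pos hC]

/-- In an honest run the check of the sender succeeds, so it never aborts. -/
theorem betaOf_mul {n : ℕ} (gc : Bits (𝔾.coinLen n)) (a r₁ r₂ : 𝔾.Ex n gc) (s₁ s : Bool) :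
    zpw (𝔾.gen0 n gc) a = betaOf 𝔾 gc a r₁ r₂ s₁ s false * betaOf 𝔾 gc a r₁ r₂ s₁ s true := by
  obtain ⟨e, he⟩ := exists_query_equiv (𝔾.gen0 n gc) a r₁ s₁ (xor s₁ s) false
  rw [betaOf, (he r₂).2]
  simp [pairOf]

/-- The distribution of the view of `P₁` in the protocol. -/
theorem acc_protocol_P1 {n : ℕ} (x : Input (σ n)) (A : RandCircuit) :
    acc (fun G => (protocol 𝔾 E σ n x G).map fun views => views .P1) A =
    ex (unif (Bits x.z)) fun π => ex (unif (Bits n)) fun r₃ =>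
    ex (unif (Bits (𝔾.coinLen n))) fun gc =>
    ex (unif (Bits (E.keyCoins n))) fun kc => ex (unif (𝔾.Ex n gc)) fun a =>
    ex (unif (Fin x.z → Bits (E.encCoins n))) fun rT => ex (unif (𝔾.Ex n gc)) fun r₁ =>
    ex (unif Bool) fun s₁ => ex (unif (Fin x.z → Bool → 𝔾.Ex n gc)) fun y =>
    ex (unif (Bool → Bool → Fin x.z → Bits (E.addCoins n))) fun ra =>
    ex (unif (Bool → Bool → Fin x.z → Bits (E.mulCoins n))) fun rm =>
    ex (unif (𝔾.Ex n gc)) fun r₂ =>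
    ex (unif (Bits (𝔾.elemLen n) → Bits (σ n + n))) fun G =>
      A.run (oracleOf G) (viewP1 𝔾 E gc (zpw (𝔾.gen0 n gc) a) kc
      (fun t => E.enc n (E.kgen n kc).2 (if t = x.v then 1 else 0) (rT t)) r₁ s₁
      (genQueryP2 (𝔾.gen0 n gc) (zpw (𝔾.gen0 n gc) a) r₂ (xor s₁ x.s))
      (fun t j => (zpw (𝔾.gen0 n gc) (y t j), xorBits (G (𝔾.encode n _
        (zpw (betaOf 𝔾 gc a r₁ r₂ s₁ x.s (xor j (π t))) (y t j))))
          (Fin.append (x.m t (xor j (π t))) r₃))) ra rm) [true] := by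
  simp only [acc, protocol, bind, pure, ex_map, ex_bind, ex_pure]
  rw [ex_comm]
  conv_rhs => enter [2, π]; rw [ex_comm]
  conv_rhs => rw [ex_comm]
  refine congrArg (ex _) (funext fun gc => ?_)
  -- Besides reordering the samples, this bijection renames the exponents by their place after the
  -- random swap. The first components then show uniform elements in place order, and the
  -- permutation survives only in the masked strings.
  let e : ((Bits (𝔾.elemLen n) → Bits (σ n + n)) × 𝔾.Ex n gc × Bits (E.keyCoins n) ×
      (Fin x.z → Bits (E.encCoins n)) × 𝔾.Ex n gc × 𝔾.Ex n gc × Bool × Bits n ×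
      (Fin x.z → Bool → 𝔾.Ex n gc) × (Fin x.z → Bool) ×
      (Bool → Bool → Fin x.z → Bits (E.addCoins n)) ×
      (Bool → Bool → Fin x.z → Bits (E.mulCoins n))) ≃
      (Bits x.z × Bits n × Bits (E.keyCoins n) × 𝔾.Ex n gc × (Fin x.z → Bits (E.encCoins n)) ×
      𝔾.Ex n gc × Bool × (Fin x.z → Bool → 𝔾.Ex n gc) ×
      (Bool → Bool → Fin x.z → Bits (E.addCoins n)) ×
      (Bool → Bool → Fin x.z → Bits (E.mulCoins n)) × 𝔾.Ex n gc ×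
      (Bits (𝔾.elemLen n) → Bits (σ n + n))) :=
    ⟨fun ⟨G, a, kc, rT, r₁, r₂, s₁, r₃, y, π, ra, rm⟩ =>
        ⟨π, r₃, kc, a, rT, r₁, s₁, fun t j => y t (xor j (π t)), ra, rm, r₂, G⟩,
      fun ⟨π, r₃, kc, a, rT, r₁, s₁, y, ra, rm, r₂, G⟩ =>
        ⟨G, a, kc, rT, r₁, r₂, s₁, r₃, fun t j => y t (xor j (π t)), π, ra, rm⟩,
      fun _ => by simp, fun _ => by simp⟩
  have h := ex_unif_equiv e fun q =>
      A.run (oracleOf q.2.2.2.2.2.2.2.2.2.2.2) (viewP1 𝔾 E gc (zpw (𝔾.gen0 n gc) q.2.2.2.1) q.2.2.1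
      (fun t => E.enc n (E.kgen n q.2.2.1).2 (if t = x.v then 1 else 0) (q.2.2.2.2.1 t))
      q.2.2.2.2.2.1 q.2.2.2.2.2.2.1
      (genQueryP2 (𝔾.gen0 n gc) (zpw (𝔾.gen0 n gc) q.2.2.2.1) q.2.2.2.2.2.2.2.2.2.2.1
        (xor q.2.2.2.2.2.2.1 x.s))
      (fun t j => (zpw (𝔾.gen0 n gc) (q.2.2.2.2.2.2.2.1 t j),
        xorBits (q.2.2.2.2.2.2.2.2.2.2.2 (𝔾.encode n _
        (zpw (betaOf 𝔾 gc q.2.2.2.1 q.2.2.2.2.2.1 q.2.2.2.2.2.2.2.2.2.2.1 q.2.2.2.2.2.2.1 x.s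
          (xor j (q.1 t))) (q.2.2.2.2.2.2.2.1 t j))))
          (Fin.append (x.m t (xor j (q.1 t))) q.2.1))) q.2.2.2.2.2.2.2.2.1
          q.2.2.2.2.2.2.2.2.2.1) [true]
  simp only [ex_unif_prod] at h
  refine Eq.trans ?_ h
  refine congrArg (ex _) (funext fun G => congrArg (ex _) (funext fun a =>
    congrArg (ex _) (funext fun kc => congrArg (ex _) (funext fun rT =>
    congrArg (ex _) (funext fun r₁ => congrArg (ex _) (funext fun r₂ =>
    congrArg (ex _) (funext fun s₁ => congrArg (ex _) (funext fun r₃ =>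
    congrArg (ex _) (funext fun y => congrArg (ex _) (funext fun π =>
    congrArg (ex _) (funext fun ra => congrArg (ex _) (funext fun rm => ?_))))))))))))
  have := genRes_of_eq (𝔾.encode n (𝔾.gen n gc)) G (𝔾.gen0 n gc) (zpw (𝔾.gen0 n gc) a)
    (betaOf_mul gc a r₁ r₂ s₁ x.s) x.m r₃ y π
  refine congrArg (fun l => A.run (oracleOf G) l [true]) ?_
  change [] ++ _ ++ (_ ++ Option.elim (genRes (𝔾.encode n (𝔾.gen n gc)) G (𝔾.gen0 n gc)
    (zpw (𝔾.gen0 n gc) a) (betaOf 𝔾 gc a r₁ r₂ s₁ x.s) x.m r₃ y π) _ _) = _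
  rw [this]
  rfl

end

/-! ### Simulator of the first proxy -/

theorem bind_apply_ex {α β : Type} (P : PMF α) (f : α → PMF β) (b : β) :
    (P.bind f) b = ex P fun a => f a b := rfl

/-- The distribution of `b` and `y` depends on `a`, so the three are packed into one sample of a
sigma type and moved as a block. -/
theorem ex_comm_block {A K R H : Type} {B : A → Type} (P : PMF A) (Q : ∀ a, PMF (B a)) (Pk : PMF K)
    (Pr : PMF R) (Ph : PMF H) (φ : ∀ a, B a → B a → K → R → H → ℝ≥0∞) :
    (ex P fun a => ex (Q a) fun b => ex (Q a) fun y => ex Pk fun k => ex Pr fun r => ex Ph fun h =>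
      φ a b y k r h) =
    ex Pk fun k => ex Pr fun r => ex Ph fun h => ex P fun a => ex (Q a) fun b => ex (Q a) fun y =>
      φ a b y k r h := by
  have := ex_comm (P.bind fun a => (Q a).bind fun b => (Q a).map fun y =>
    (⟨a, b, y⟩ : Σ a, B a × B a)) (Pk.bind fun k => Pr.bind fun r => Ph.map fun h => (k, r, h))
    fun q w => φ q.1 q.2.1 q.2.2 w.1 w.2.1 w.2.2
  simpa only [ex_bind, ex_map] using this

section
variable {𝔾 : GroupGen} {E : AHE} {σ : ℕ → ℕ}

/-- The simulated view of `P₁` for a given public key and a given ciphertext at position `v` of the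
query vector. -/
def openP1 (𝔾 : GroupGen) (E : AHE) (n k z : ℕ) (v t₀ : ℕ) (kc : Bits (E.keyCoins n))
    (ct : Bits (E.ctLen n)) : PMF (List Bool) :=
  (unif (Bits (𝔾.coinLen n))).bind fun gc => (unif (𝔾.Ex n gc × 𝔾.Ex n gc)).bind fun q =>
    (unif (RestP1 𝔾 E n k z gc)).bind fun r =>
      PMF.pure (coreP1 𝔾 E v t₀ false false gc kc ct (zpw (𝔾.gen0 n gc) q.1)
        (zpw (𝔾.gen0 n gc) q.2) r)

theorem frand_openP1 {F : Fam} (h1 : ∀ θ, 1 ≤ F.n θ) {inp : F.Str} (hI : FLen F inp)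
    {z : F.Θ → ℕ} (hz : F.PB z) {k : ℕ → ℕ} (hk : PolyBounded k) (v t₀ : F.Θ → ℕ)
    {kc : ∀ θ, F.ι θ → Bits (E.keyCoins (F.n θ))} {ct : ∀ θ, F.ι θ → Bits (E.ctLen (F.n θ))}
    (hpk : FComp F inp fun θ i => toL (E.kgen (F.n θ) (kc θ i)).2)
    (hct : FComp F inp fun θ i => toL (ct θ i)) :
    FRand F inp fun θ i => openP1 𝔾 E (F.n θ) (k (F.n θ)) (z θ) (v θ) (t₀ θ) (kc θ i) (ct θ i) := by
  refine FRand.sample hI (FSamp.bits hI (Fam.PB.poly 𝔾.coinLen_poly)) fun inp' l kI kg => ?_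
  let F' := F.ext fun θ _ => Bits (𝔾.coinLen (F.n θ))
  have kd := FComp.gdesc (F := F') (gc := fun θ p => p.2) l kg
  have se := FSamp.ex (F := F') (gc := fun θ p => p.2) h1 l kd
  refine FRand.sample (F := F') l (FSamp.prod l se se) fun inp'' l' kI' ks => ?_
  let F'' := F'.ext fun θ p => 𝔾.Ex (F.n θ) p.2 × 𝔾.Ex (F.n θ) p.2
  have la : FLen F'' fun θ p => expL (F.n θ) p.2.1 := FLen.expL (F := F'') _
  have lb : FLen F'' fun θ p => expL (F.n θ) p.2.2 := FLen.expL (F := F'') _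
  have kd2 := FComp.comp l' kI' kd.ext
  have kg2 := FComp.ggen (F := F'') (gc := fun θ p => p.1.2) l' kd2
  have kA := FComp.gexp (F := F'') (gc := fun θ p => p.1.2) h1 l' kd2 kg2 (ks.left l' la)
  have kB := FComp.gexp (F := F'') (gc := fun θ p => p.1.2) h1 l' kd2 kg2 (ks.right l' la lb)
  have kpk := FComp.comp l' kI' (FComp.comp l kI hpk.ext).ext
  have kct := FComp.comp l' kI' (FComp.comp l kI hct.ext).ext
  have hz'' : F''.PB z := hz
  exact frand_coreP1 (F := F'') h1 l' hz'' hk v t₀ (fun _ => false) (fun _ => false)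
    (gc := fun θ p => p.1.2) (kc := fun θ p => kc θ p.1.1) kd2 kpk kct kA kB

/-- The simulated view of `P₁`. -/
def simP1 (𝔾 : GroupGen) (E : AHE) (n k z : ℕ) : PMF (List Bool) :=
  (unif (Bits (E.keyCoins n) × Bits (E.encCoins n))).bind fun q =>
    openP1 𝔾 E n k z 0 0 q.1 (E.enc n (E.kgen n q.1).2 0 q.2)

theorem FComp.enc_const {F : Fam} {inp : F.Str} (hI : FLen F inp)
    {kc : ∀ θ, F.ι θ → Bits (E.keyCoins (F.n θ))}
    (hk : FComp F inp fun θ i => toL (E.kgen (F.n θ) (kc θ i)).2) (m : ℕ)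
    (hN : ∀ θ i, m < E.modulus (F.n θ) (E.kgen (F.n θ) (kc θ i)).2)
    {r : ∀ θ, F.ι θ → Bits (E.encCoins (F.n θ))} (hr : FComp F inp fun θ i => toL (r θ i)) :
    FComp F inp fun θ i => toL (E.enc (F.n θ) (E.kgen (F.n θ) (kc θ i)).2 m (r θ i)) :=
  FComp.enc (m := fun _ _ => m) hI hk hN (FComp.const hI _ (by
    simp only [length_toL]
    exact Fam.PB.poly (F := F) E.ptLen_poly)) hr

theorem frand_simP1 {F : Fam} (h1 : ∀ θ, 1 ≤ F.n θ) {inp : F.Str} (hI : FLen F inp)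
    {z : F.Θ → ℕ} (hz : F.PB z) {k : ℕ → ℕ} (hk : PolyBounded k) :
    FRand F inp fun θ _ => simP1 𝔾 E (F.n θ) (k (F.n θ)) (z θ) := by
  refine FRand.sample hI (FSamp.prod hI (FSamp.bits hI (Fam.PB.poly E.keyCoins_poly))
    (FSamp.bits hI (Fam.PB.poly E.encCoins_poly))) fun inp' l kI ks => ?_
  let F' := F.ext fun θ _ => Bits (E.keyCoins (F.n θ)) × Bits (E.encCoins (F.n θ))
  have la : FLen F' fun θ p => toL p.2.1 := FLen.toL (Fam.PB.poly (F := F') E.keyCoins_poly) _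
  have lb : FLen F' fun θ p => toL p.2.2 := FLen.toL (Fam.PB.poly (F := F') E.encCoins_poly) _
  have kpk := FComp.pk (F := F') l (ks.left l la)
  have hz' : F'.PB z := hz
  exact frand_openP1 (F := F') h1 l hz' hk (fun _ => 0) (fun _ => 0) kpk
    (FComp.enc_const (F := F') l kpk 0 (fun θ p => E.modulus_pos _ _) (ks.right l la lb))

/-- Encryptions of `0` and `1` in the query vector are indistinguishable for `P₁`. -/
theorem cpa_P1 (hCPA : E.INDCPA) (h2 : ∀ n kc, 1 ≤ n → 2 ≤ E.modulus n (E.kgen n kc).2)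
    {k : ℕ → ℕ} (hk : PolyBounded k) {B : ℕ → ℕ} (hB : PolyBounded B) :
    ∃ ε, ENeg ε ∧ ∀ n, 1 ≤ n → ∀ z (v : Fin z) (s : Bool) (A : RandCircuit), z ≤ B n →
      A.size ≤ B n → Near (ε n)
        (ex (unif (Bits (𝔾.coinLen n))) fun gc => jointP1 𝔾 E (k := k n) gc v s 1
          fun V _ _ G => A.run (oracleOf G) V [true])
        (ex (unif (Bits (𝔾.coinLen n))) fun gc => jointP1 𝔾 E (k := k n) gc v s 0
          fun V _ _ G => A.run (oracleOf G) V [true]) := by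
  -- Number of messages, position and distinguisher are parameters of the reduction: the adversary
  -- is non-uniform, and one negligible bound then holds for all of them.
  let Θ := {n : ℕ // 1 ≤ n} × (Σ z : ℕ, Fin z) × RandCircuit
  let N : Θ → ℕ := fun θ => θ.1
  let F := romFam Θ N (fun θ => θ.1 + (θ.2.1.1 + θ.2.2.size)) (fun θ => Nat.le_add_right _ _)
    (fun θ => Bits (E.keyCoins (N θ)) × Bits (E.ctLen (N θ))) 𝔾.elemLen k hk
  have lpk : FLen F fun θ i => toL (E.kgen (N θ) i.1.1).2 :=
    FLen.toL (Fam.PB.poly (F := F) E.pkLen_poly) _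
  have lct : FLen F fun θ i => toL i.1.2 := FLen.toL (Fam.PB.poly (F := F) E.ctLen_poly) _
  have hI := lpk.append lct
  have hz : F.PB fun θ => θ.2.1.1 := Fam.PB.sz.mono fun θ =>
    (Nat.le_add_right _ _).trans (Nat.le_add_left _ _)
  have hA : F.PB fun θ => θ.2.2.size := Fam.PB.sz.mono fun θ =>
    (Nat.le_add_left _ _).trans (Nat.le_add_left _ _)
  have hD := FRand.run hI (frand_openP1 (F := F) (𝔾 := 𝔾) (E := E) (fun θ => θ.1.2) hI hz hk
    (fun θ => θ.2.1.2) (fun θ => θ.2.1.2) (kc := fun θ i => i.1.1) (ct := fun θ i => i.1.2)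
    ((FComp.id hI).left hI lpk) ((FComp.id hI).right hI lpk lct)) (fun θ => θ.2.2) hA
  have hB' : PolyBounded fun n => n + (B n + B n) := by
    obtain ⟨q, hq⟩ := hB
    exact ⟨Polynomial.X + (q + q), fun n => by simpa using add_le_add (hq n) (hq n)⟩
  obtain ⟨ε, hε, h⟩ := hCPA.rom (Θ := Θ) (n := N) (sz := fun θ => θ.1 + (θ.2.1.1 + θ.2.2.size))
    (hn := fun θ => Nat.le_add_right _ _) (fun θ kc => h2 _ kc θ.1.2) 𝔾.elemLen_poly (hk := hk) hD
    hB'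
  refine ⟨ε, hε, fun n hn z v s A hz hA => ?_⟩
  let θ : Θ := (⟨n, hn⟩, ⟨z, v⟩, A)
  have key : ∀ b : Bool, (ex (unif (Bits (𝔾.coinLen n))) fun gc => jointP1 𝔾 E (k := k n) gc v s
      b.toNat fun V _ _ G => A.run (oracleOf G) V [true]) =
      ex (unif (Bits (E.keyCoins n))) fun kc => ex (unif (Bits (E.encCoins n))) fun re =>
        ex (unif (Bits (𝔾.elemLen n) → Bits (k n))) fun G => ((openP1 𝔾 E n (k n) z v v kc
          (E.enc n (E.kgen n kc).2 b.toNat re)).bind fun V => A.run (oracleOf G) V) [true] := by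
    intro b
    refine Eq.trans (congrArg (ex _) (funext fun gc => jointP1_eq gc v v false false s b.toNat
      fun V _ _ G => A.run (oracleOf G) V [true])) ?_
    refine Eq.trans (ex_comm_block (unif (Bits (𝔾.coinLen n))) (fun gc => unif (𝔾.Ex n gc)) _ _ _
      fun gc b' y₀ kc re G => ex (unif (RestP1 𝔾 E n (k n) z gc)) fun r => A.run (oracleOf G)
        (coreP1 𝔾 E v v false false gc kc (E.enc n (E.kgen n kc).2 b.toNat re)
          (zpw (𝔾.gen0 n gc) b') (zpw (𝔾.gen0 n gc) y₀) r) [true]) ?_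
    refine congrArg (ex _) (funext fun kc => congrArg (ex _) (funext fun re =>
      congrArg (ex _) (funext fun G => ?_)))
    rw [bind_apply_ex, openP1, ex_bind]
    refine congrArg (ex _) (funext fun gc => ?_)
    simp only [ex_bind, ex_pure]
    rw [ex_unif_prod]
  have hsz : n + (z + A.size) ≤ n + (B n + B n) := by omega
  have t := key true
  have f := key false
  rw [Bool.toNat_true] at t
  rw [Bool.toNat_false] at f
  rw [t, f]
  exact ⟨h θ hsz true, h θ hsz false⟩

/-- `P₁` cannot compute the points at which the sender evaluates the random oracle. -/
theorem cdh_P1 (hCDH : 𝔾.CDH) (h2 : ∀ n kc, 1 ≤ n → 2 ≤ E.modulus n (E.kgen n kc).2)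
    {k : ℕ → ℕ} (hk : PolyBounded k) {B : ℕ → ℕ} (hB : PolyBounded B) :
    ∃ ε, ENeg ε ∧ ∀ n, 1 ≤ n → ∀ z (v t₀ : Fin z) (i j₀ s : Bool) (A : RandCircuit), z ≤ B n →
      A.size ≤ B n → (ex (unif (Bits (𝔾.coinLen n))) fun gc => jointP1 𝔾 E (k := k n) gc v s 1
          fun V β y G => A.run (oracleOf G) V (𝔾.eL (zpw (β i) (y t₀ j₀)))) ≤ ε n := by
  let Θ := {n : ℕ // 1 ≤ n} × (Σ z : ℕ, Fin z × Fin z) × (Bool × Bool) × RandCircuit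
  let N : Θ → ℕ := fun θ => θ.1
  let F := romFam Θ N (fun θ => θ.1 + (θ.2.1.1 + θ.2.2.2.size)) (fun θ => Nat.le_add_right _ _)
    (fun θ => Σ c, 𝔾.El (N θ) c × 𝔾.El (N θ) c) 𝔾.elemLen k hk
  have ld : FLen F fun θ i => 𝔾.desc (N θ) i.1.1 := FLen.desc (F := F) (gc := fun θ i => i.1.1)
  have lB : FLen F fun θ i => 𝔾.eL i.1.2.1 := FLen.eL (F := F) (gc := fun θ i => i.1.1) _
  have lA : FLen F fun θ i => 𝔾.eL i.1.2.2 := FLen.eL (F := F) (gc := fun θ i => i.1.1) _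
  have hI := ld.append (lB.append lA)
  have hz : F.PB fun θ => θ.2.1.1 := Fam.PB.sz.mono fun θ =>
    (Nat.le_add_right _ _).trans (Nat.le_add_left _ _)
  have hA : F.PB fun θ => θ.2.2.2.size := Fam.PB.sz.mono fun θ =>
    (Nat.le_add_left _ _).trans (Nat.le_add_left _ _)
  have hC : FRand F (fun θ i => 𝔾.desc (N θ) i.1.1 ++ (𝔾.eL i.1.2.1 ++ 𝔾.eL i.1.2.2)) fun θ i =>
      (unif (Bits (E.keyCoins (N θ)) × Bits (E.encCoins (N θ)))).bind fun q =>
      (unif (RestP1 𝔾 E (N θ) (k (N θ)) θ.2.1.1 i.1.1)).bind fun r =>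
      PMF.pure (coreP1 𝔾 E θ.2.1.2.1 θ.2.1.2.2 θ.2.2.1.1 θ.2.2.1.2 i.1.1 q.1
        (E.enc (N θ) (E.kgen (N θ) q.1).2 1 q.2) i.1.2.1 i.1.2.2 r) := by
    refine FRand.sample hI (FSamp.prod hI (FSamp.bits hI (Fam.PB.poly E.keyCoins_poly))
      (FSamp.bits hI (Fam.PB.poly E.encCoins_poly))) fun inp' l kI ks => ?_
    let F' := F.ext fun θ _ => Bits (E.keyCoins (F.n θ)) × Bits (E.encCoins (F.n θ))
    have la : FLen F' fun θ p => toL p.2.1 := FLen.toL (Fam.PB.poly (F := F') E.keyCoins_poly) _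
    have lb : FLen F' fun θ p => toL p.2.2 := FLen.toL (Fam.PB.poly (F := F') E.encCoins_poly) _
    have kpk := FComp.pk (F := F') l (ks.left l la)
    have hz' : F'.PB fun θ => θ.2.1.1 := hz
    have kr := (FComp.id hI).right hI ld (lB.append lA)
    have kd := FComp.comp l kI ((FComp.id hI).left hI ld).ext
    have kB := FComp.comp l kI (kr.left hI lB).ext
    have kA := FComp.comp l kI (kr.right hI lB lA).ext
    exact frand_coreP1 (F := F') (fun θ => θ.1.2) l hz' hk (fun θ => θ.2.1.2.1)
      (fun θ => θ.2.1.2.2) (fun θ => θ.2.2.1.1) (fun θ => θ.2.2.1.2) (gc := fun θ p => p.1.1.1)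
      kd kpk (FComp.enc_const (F := F') l kpk 1 (fun θ p => h2 _ _ θ.1.2) (ks.right l la lb)) kB kA
  have hD := FRand.run hI hC (fun θ => θ.2.2.2) hA
  have hB' : PolyBounded fun n => n + (B n + B n) := by
    obtain ⟨q, hq⟩ := hB
    exact ⟨Polynomial.X + (q + q), fun n => by simpa using add_le_add (hq n) (hq n)⟩
  obtain ⟨ε, hε, h⟩ := hCDH.rom (Θ := Θ) (n := N) (sz := fun θ => θ.1 + (θ.2.1.1 + θ.2.2.2.size))
    (hn := fun θ => Nat.le_add_right _ _) (hk := hk) hD hB'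
  refine ⟨ε, hε, fun n hn z v t₀ i j₀ s A hz hA => ?_⟩
  let θ : Θ := (⟨n, hn⟩, ⟨z, v, t₀⟩, (i, j₀), A)
  have hsz : n + (z + A.size) ≤ n + (B n + B n) := by omega
  refine le_trans (le_of_eq ?_) (h θ hsz)
  refine congrArg (ex _) (funext fun gc => ?_)
  rw [jointP1_eq gc v t₀ i j₀ s 1 fun V b y G => A.run (oracleOf G) V (𝔾.eL (zpw b y))]
  refine congrArg (ex _) (funext fun b => congrArg (ex _) (funext fun y₀ => ?_))
  conv_rhs =>
    enter [2, G]
    rw [bind_apply_ex, ex_bind, ex_unif_prod]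
  conv_lhs => enter [2, kc]; rw [ex_comm]
  rw [ex_comm]
  refine congrArg (ex _) (funext fun G => congrArg (ex _) (funext fun kc =>
    congrArg (ex _) (funext fun re => ?_)))
  simp only [ex_bind, ex_pure, zpw_mul]
  rfl

end

section
variable {𝔾 : GroupGen} {E : AHE} {σ : ℕ → ℕ}

theorem jointP1_sum {n k z : ℕ} (gc : Bits (𝔾.coinLen n)) (v : Fin z) (s : Bool) (bit : ℕ)
    {κ : Type} (S : Finset κ) (Ψ : κ → List Bool → (Bool → 𝔾.El n gc) →
      (Fin z → Bool → 𝔾.Ex n gc) → (Bits (𝔾.elemLen n) → Bits k) → ℝ≥0∞) :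
    jointP1 𝔾 E gc v s bit (fun V β y G => ∑ i ∈ S, Ψ i V β y G) =
      ∑ i ∈ S, jointP1 𝔾 E gc v s bit (Ψ i) := by
  simp only [jointP1, ex_sum]

/-- When every entry encrypts `0`, the position no longer matters; the simulator, which does not
know `v`, can use any. -/
theorem jointP1_zero {n k z : ℕ} (gc : Bits (𝔾.coinLen n)) (v v' : Fin z) (s : Bool)
    (Ψ : List Bool → (Bool → 𝔾.El n gc) → (Fin z → Bool → 𝔾.Ex n gc) →
      (Bits (𝔾.elemLen n) → Bits k) → ℝ≥0∞) :
    jointP1 𝔾 E gc v s 0 Ψ = jointP1 𝔾 E gc v' s 0 Ψ := by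
  simp only [jointP1, ite_self]

/-- The points at which the sender evaluates the random oracle. -/
abbrev maskPts (𝔾 : GroupGen) {n z : ℕ} {gc : Bits (𝔾.coinLen n)} (π : Bits z)
    (β : Bool → 𝔾.El n gc) (y : Fin z → Bool → 𝔾.Ex n gc) (J : Fin z × Bool) :
    Bits (𝔾.elemLen n) :=
  𝔾.encode n (𝔾.gen n gc) (zpw (β (xor J.2 (π J.1))) (y J.1 J.2))

/-- Union bound over the `(2 * z) ^ 2` ordered pairs of points, each pair colliding with probability
at most `2 / 2 ^ n` by `collision_le`. -/
theorem not_injective_le {n z : ℕ} (hn : 1 ≤ n) (gc : Bits (𝔾.coinLen n)) (s : Bool) (π : Bits z) :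
    (ex (unif (Bits (E.keyCoins n))) fun _ => ex (unif (𝔾.Ex n gc)) fun a =>
      ex (unif (Fin z → Bits (E.encCoins n))) fun _ => ex (unif (𝔾.Ex n gc)) fun r₁ =>
      ex (unif Bool) fun s₁ => ex (unif (Fin z → Bool → 𝔾.Ex n gc)) fun y =>
      ex (unif (Bool → Bool → Fin z → Bits (E.addCoins n))) fun _ =>
      ex (unif (Bool → Bool → Fin z → Bits (E.mulCoins n))) fun _ =>
      ex (unif (𝔾.Ex n gc)) fun r₂ => open Classical in
        if Function.Injective (maskPts 𝔾 π (betaOf 𝔾 gc a r₁ r₂ s₁ s) y) then (0 : ℝ≥0∞) else 1) ≤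
      ((2 * z) * (2 * z) * 2 : ℕ) * ((2 : ℝ≥0∞) ^ n)⁻¹ := by
  classical
  simp only [ex_const]
  refine ex_le fun a => ex_le fun r₁ => ex_le fun s₁ => ?_
  refine (ex_mono fun y => ex_mono fun r₂ => one_le_of_not_injective _).trans ?_
  simp only [ex_sum]
  have hc : ∀ J J' : Fin z × Bool, (ex (unif (Fin z → Bool → 𝔾.Ex n gc)) fun y =>
      ex (unif (𝔾.Ex n gc)) fun r₂ => if J ≠ J' ∧ maskPts 𝔾 π (betaOf 𝔾 gc a r₁ r₂ s₁ s) y J =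
        maskPts 𝔾 π (betaOf 𝔾 gc a r₁ r₂ s₁ s) y J' then (1 : ℝ≥0∞) else 0) ≤
      2 * ((2 : ℝ≥0∞) ^ n)⁻¹ := by
    intro J J'
    by_cases hJ : J = J'
    · refine ex_le fun y => ex_le fun r₂ => ?_
      rw [if_neg fun h => h.1 hJ]
      exact zero_le
    · refine le_trans (ex_mono fun y => ex_mono fun r₂ => ?_) (collision_le hn gc a r₁ s₁ (xor s₁ s)
        (fun J => xor J.2 (π J.1)) hJ)
      simp only [(𝔾.encode_injective n gc).eq_iff]
      split_ifs with h1 h2 <;> simp_all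
  refine (Finset.sum_le_sum fun J _ => Finset.sum_le_sum fun J' _ => hc J J').trans_eq ?_
  simp only [Finset.sum_const, Finset.card_univ, Fintype.card_prod, Fintype.card_fin,
    Fintype.card_bool, nsmul_eq_mul]
  push_cast
  ring

/-- Two hops. The first makes the pads uniform, at the price of collisions and of one CDH term per
gate and point. The second replaces the encryption of `1` by one of `0`. The result depends on
neither messages nor query and is what the simulator samples. -/
theorem simulator_P1 (hσ : PolyBounded σ) (hCDH : 𝔾.CDH) (hCPA : E.INDCPA)
    (h2 : ∀ n kc, 1 ≤ n → 2 ≤ E.modulus n (E.kgen n kc).2) : SimulatorFor 𝔾 E σ .P1 := by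
  let X : {n : ℕ // 1 ≤ n} → ℕ → Type := fun _ _ => Unit
  let F := simFam X 𝔾.elemLen (fun n => σ n + n) hσ.add_id
  have hz : F.PB fun θ => θ.2 := Fam.PB.sz.mono fun θ => Nat.le_add_left _ _
  have hI : FLen F fun θ _ => unary θ.2 := ⟨_, hz, fun _ _ => List.length_replicate⟩
  refine simulator_of (hk := hσ.add_id) _ .P1 X (fun n x => x.z) (fun _ _ => le_rfl)
    (fun n x => ()) (fun n L => L) (fun n L => le_rfl) (fun n x => List.length_replicate)
    (fun θ _ => unary θ.2) (fun n x => rfl) _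
    (frand_simP1 (F := F) (𝔾 := 𝔾) (E := E) (z := fun θ => θ.2) (fun θ => θ.1.2) hI hz hσ.add_id)
    fun B hB => ?_
  obtain ⟨ε₁, hε₁, h1⟩ := cpa_P1 (𝔾 := 𝔾) hCPA h2 hσ.add_id hB
  obtain ⟨ε₂, hε₂, h3⟩ := cdh_P1 hCDH h2 hσ.add_id hB
  obtain ⟨q, hq⟩ := id hB
  have p1 : PolyBounded fun n => (2 * B n) * (2 * B n) * 2 :=
    ⟨(2 * q) * (2 * q) * 2, fun n => by
      simp only [Polynomial.eval_mul, Polynomial.eval_ofNat]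
      gcongr <;> exact hq n⟩
  have p2 : PolyBounded fun n => B n * (2 * B n) :=
    ⟨q * (2 * q), fun n => by
      simp only [Polynomial.eval_mul, Polynomial.eval_ofNat]
      gcongr <;> exact hq n⟩
  refine ⟨_, ((ENeg.two_pow.poly_mul p1).add (hε₂.poly_mul p2)).add hε₁, fun n x A hx hA => ?_⟩
  refine Near.symm ?_
  have hz0 : 0 < x.z := x.v.pos
  refine Near.trans (b := ex (unif (Bits (𝔾.coinLen n))) fun gc =>
    jointP1 𝔾 E (k := σ n + n) gc x.v x.s 1 fun V _ _ G => A.run (oracleOf G) V [true]) ?_ ?_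
  · rw [acc_protocol_P1]
    -- Once the pads are uniform, `π` and `r₃` no longer occur; they are reinserted as dummies so
    -- that both sides average over the same variables.
    have e : ∀ b : ℝ≥0∞, (ex (unif (Bits x.z)) fun _ => ex (unif (Bits n)) fun _ => b) = b := by
      simp
    rw [← e (ex (unif (Bits (𝔾.coinLen n))) fun gc => _)]
    refine Near.mono (Near.ex fun π => Near.ex fun r₃ => Near.ex fun gc => Near.ex fun kc =>
      Near.ex fun a => Near.ex fun rT => Near.ex fun r₁ => Near.ex fun s₁ => Near.ex fun y =>
      Near.ex fun ra => Near.ex fun rm => Near.ex fun r₂ =>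
      rom_mask (maskPts 𝔾 π (betaOf 𝔾 gc a r₁ r₂ s₁ x.s) y)
        (fun J => Fin.append (x.m J.1 (xor J.2 (π J.1))) r₃)
        (fun u => viewP1 𝔾 E gc (zpw (𝔾.gen0 n gc) a) kc
          (fun t => E.enc n (E.kgen n kc).2 (if t = x.v then 1 else 0) (rT t)) r₁ s₁
          (genQueryP2 (𝔾.gen0 n gc) (zpw (𝔾.gen0 n gc) a) r₂ (xor s₁ x.s))
          (fun t j => (zpw (𝔾.gen0 n gc) (y t j), u (t, j))) ra rm) A [true]) ?_
    simp only [ex_add]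
    refine add_le_add ?_ ?_
    · refine ex_le fun π => ex_le fun r₃ => ex_le fun gc => ?_
      refine (not_injective_le n.2 gc x.s π).trans ?_
      gcongr
    · refine ex_le fun π => ex_le fun r₃ => ?_
      change (ex (unif (Bits (𝔾.coinLen n))) fun gc => jointP1 𝔾 E gc x.v x.s 1 fun V β y G =>
        ∑ i ∈ Finset.range A.gates.length, ∑ J : Fin x.z × Bool,
          (A.trunc i).run (oracleOf G) V (toL (maskPts 𝔾 π β y J))) ≤ _
      simp only [jointP1_sum, ex_sum]
      -- For a fixed gate and a fixed point, the distinguisher truncated at that gate is a CDH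
      -- solver. The bit `xor J.2 (π J.1)` names the query whose power is the point.
      have hb : ∀ i (J : Fin x.z × Bool), (ex (unif (Bits (𝔾.coinLen n))) fun gc =>
          jointP1 𝔾 E gc x.v x.s 1 fun V β y G =>
            (A.trunc i).run (oracleOf G) V (toL (maskPts 𝔾 π β y J))) ≤ ε₂ n := fun i J =>
        h3 n n.2 x.z x.v J.1 (xor J.2 (π J.1)) J.2 x.s (A.trunc i) hx
          ((RandCircuit.size_trunc A i).trans hA)
      refine (Finset.sum_le_sum fun i _ => Finset.sum_le_sum fun J _ => hb i J).trans ?_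
      simp only [Finset.sum_const, Finset.card_univ, Fintype.card_prod, Fintype.card_fin,
        Fintype.card_bool, nsmul_eq_mul, Finset.card_range, ← mul_assoc, ← Nat.cast_mul]
      rw [mul_right_comm]
      gcongr
      exact (length_gates_le _).trans (le_trans (Nat.le_add_right _ _) hA)
  · convert h1 n n.2 x.z x.v x.s A hx hA using 1
    -- With zeros throughout, `v` may be moved to position `0`, which exists as `0 < z`; the view is
    -- then the one with the parameters of `simP1`.
    have e0 : (ex (unif (Bits (𝔾.coinLen n))) fun gc => jointP1 𝔾 E (k := σ n + n) gc x.v x.s 0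
        fun V _ _ G => A.run (oracleOf G) V [true]) = _ :=
      congrArg (ex _) (funext fun gc => (jointP1_zero gc x.v ⟨0, hz0⟩ x.s _).trans
        (jointP1_eq gc ⟨0, hz0⟩ ⟨0, hz0⟩ false false x.s 0
          fun V _ _ G => A.run (oracleOf G) V [true]))
    rw [e0]
    refine Eq.trans ?_ (ex_comm_block (unif (Bits (𝔾.coinLen n))) (fun gc => unif (𝔾.Ex n gc)) _ _ _
      fun gc b y₀ kc re G => ex (unif (RestP1 𝔾 E n (σ n + n) x.z gc)) fun r =>
        A.run (oracleOf G) (coreP1 𝔾 E 0 0 false false gc kc (E.enc n (E.kgen n kc).2 0 re)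
          (zpw (𝔾.gen0 n gc) b) (zpw (𝔾.gen0 n gc) y₀) r) [true]).symm
    rw [acc]
    conv_rhs => enter [2, kc]; rw [ex_comm]
    conv_rhs => rw [ex_comm]
    refine congrArg (ex _) (funext fun G => ?_)
    rw [simP1, ex_bind, ex_unif_prod]
    refine congrArg (ex _) (funext fun kc => congrArg (ex _) (funext fun re => ?_))
    rw [openP1, ex_bind]
    refine congrArg (ex _) (funext fun gc => ?_)
    simp only [ex_bind, ex_pure]
    rw [ex_unif_prod]

end

/-! ### The homomorphically computed ciphertexts -/

section
variable {E : AHE} {n : ℕ} {kc : Bits (E.keyCoins n)} {δ : ℝ≥0∞}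

/-- Under the key with coins `kc`, homomorphic operations return encryptions up to `δ`. -/
def Rerandomizes (E : AHE) (n : ℕ) (kc : Bits (E.keyCoins n)) (δ : ℝ≥0∞) : Prop :=
  (∀ m₁ m₂, m₁ < E.modulus n (E.kgen n kc).2 → m₂ < E.modulus n (E.kgen n kc).2 →
    ∀ φ : Bits (E.ctLen n) → ℝ≥0∞, (∀ c, φ c ≤ 1) →
    (ex (unif (Bits (E.encCoins n))) fun r₁ => ex (unif (Bits (E.encCoins n))) fun r₂ =>
      ex (unif (Bits (E.addCoins n))) fun r => φ (E.add n (E.kgen n kc).2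
        (E.enc n (E.kgen n kc).2 m₁ r₁) (E.enc n (E.kgen n kc).2 m₂ r₂) r)) ≤
    (ex (unif (Bits (E.encCoins n))) fun r => φ (E.enc n (E.kgen n kc).2
      ((m₁ + m₂) % E.modulus n (E.kgen n kc).2) r)) + δ) ∧
  ∀ m a r₁, m < E.modulus n (E.kgen n kc).2 → a < E.modulus n (E.kgen n kc).2 →
    ∀ φ : Bits (E.ctLen n) → ℝ≥0∞, (∀ c, φ c ≤ 1) →
    (ex (unif (Bits (E.mulCoins n))) fun r => φ (E.mul n (E.kgen n kc).2
      (E.enc n (E.kgen n kc).2 m r₁) a r)) ≤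
    (ex (unif (Bits (E.encCoins n))) fun r => φ (E.enc n (E.kgen n kc).2
      ((m * a) % E.modulus n (E.kgen n kc).2) r)) + δ

theorem AHE.ReturnsEncryptions.rerandomizes (h : E.ReturnsEncryptions) :
    ∃ δ, ENeg δ ∧ ∀ n kc, Rerandomizes E n kc (δ n) := by
  obtain ⟨μ, hμ, h⟩ := h
  have hμ2 : Negligible fun n => 2 * μ n := Asymptotics.SuperpolynomialDecay.const_mul hμ 2
  refine ⟨_, ENeg.of_negligible hμ2, fun n kc => ⟨fun m₁ m₂ h₁ h₂ φ hφ => ?_,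
    fun m a r₁ hm ha φ hφ => ?_⟩⟩
  · have := close_of_statDist ((h n kc).1 m₁ m₂ h₁ h₂) φ hφ
    simpa only [ex_map, ex_unif_prod] using this
  · have := close_of_statDist ((h n kc).2 m a r₁ hm ha) φ hφ
    simpa only [ex_map] using this

theorem foldl_congr_mem {α β : Type} (f g : β → α → β) (l : List α) :
    ∀ b, (∀ a ∈ l, ∀ b, f b a = g b a) → l.foldl f b = l.foldl g b := by
  induction l with
  | nil => intro b _; rfl
  | cons a l ih =>
    intro b h
    simp only [List.foldl_cons]
    rw [h a (by simp), ih _ fun a' ha' => h a' (by simp [ha'])]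

/-- Induction along the list. At each entry the product becomes a fresh encryption, whatever the
coins of the query vector, and the sum of two fresh encryptions becomes fresh as well, so an entry
costs `2 * δ`. The fixed coins `rT` matter: the same query vector serves all four filtered
ciphertexts, and only the coins of the operations make these independent. -/
theorem foldl_add_le (hR : Rerandomizes E n kc δ) {z : ℕ} (b c : Fin z → ℕ)
    (hb : ∀ t, b t < E.modulus n (E.kgen n kc).2) (hc : ∀ t, c t < E.modulus n (E.kgen n kc).2)
    (rT : Fin z → Bits (E.encCoins n)) (φ : Bits (E.ctLen n) → ℝ≥0∞) (hφ : ∀ c, φ c ≤ 1)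
    (ts : List (Fin z)) : ts.Nodup → ∀ m₀ < E.modulus n (E.kgen n kc).2,
    (ex (unif (Bits (E.encCoins n))) fun r₀ =>
      ex (unif (Fin z → Bits (E.addCoins n))) fun ra =>
      ex (unif (Fin z → Bits (E.mulCoins n))) fun rm =>
      φ (ts.foldl (fun acc u => E.add n (E.kgen n kc).2 acc (E.mul n (E.kgen n kc).2
        (E.enc n (E.kgen n kc).2 (b u) (rT u)) (c u) (rm u)) (ra u))
        (E.enc n (E.kgen n kc).2 m₀ r₀))) ≤
    (ex (unif (Bits (E.encCoins n))) fun r => φ (E.enc n (E.kgen n kc).2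
      ((m₀ + (ts.map fun u => b u * c u).sum) % E.modulus n (E.kgen n kc).2) r)) +
      (2 * ts.length : ℕ) * δ := by
  have hN := E.modulus_pos n kc
  induction ts with
  | nil =>
    intro _ m₀ hm₀
    simp [Nat.mod_eq_of_lt hm₀]
  | cons u us ih =>
    intro hn m₀ hm₀
    obtain ⟨hu, hn⟩ := List.nodup_cons.1 hn
    set N := E.modulus n (E.kgen n kc).2 with hNdef
    have hm1 : (m₀ + b u * c u % N) % N < N := Nat.mod_lt _ hN
    have ih' := ih hn _ hm1
    let ψ : (Fin z → Bits (E.addCoins n)) → (Fin z → Bits (E.mulCoins n)) →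
        Bits (E.ctLen n) → ℝ≥0∞ := fun ra rm ct =>
      φ (us.foldl (fun acc u => E.add n (E.kgen n kc).2 acc (E.mul n (E.kgen n kc).2
        (E.enc n (E.kgen n kc).2 (b u) (rT u)) (c u) (rm u)) (ra u)) ct)
    have hψ : ∀ ra rm ct, ψ ra rm ct ≤ 1 := fun _ _ _ => hφ _
    -- The list has no duplicates, so the remaining entries do not use the coins at `u`, and these
    -- can be resampled independently.
    have hup : ∀ ra a rm m ct, ψ (Function.update ra u a) (Function.update rm u m) ct =
        ψ ra rm ct := by
      intro ra a rm m ct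
      refine congrArg φ (foldl_congr_mem _ _ _ _ fun w hw acc => ?_)
      have : w ≠ u := fun h => hu (h ▸ hw)
      rw [Function.update_of_ne this, Function.update_of_ne this]
    calc _ = ex (unif (Bits (E.encCoins n))) fun r₀ =>
          ex (unif (Fin z → Bits (E.addCoins n))) fun ra =>
          ex (unif (Fin z → Bits (E.mulCoins n))) fun rm => ψ ra rm (E.add n (E.kgen n kc).2
            (E.enc n (E.kgen n kc).2 m₀ r₀) (E.mul n (E.kgen n kc).2
              (E.enc n (E.kgen n kc).2 (b u) (rT u)) (c u) (rm u)) (ra u)) := rfl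
      _ = ex (unif (Fin z → Bits (E.addCoins n))) fun ra =>
          ex (unif (Fin z → Bits (E.mulCoins n))) fun rm =>
          ex (unif (Bits (E.encCoins n))) fun r₀ => ex (unif (Bits (E.addCoins n))) fun a =>
          ex (unif (Bits (E.mulCoins n))) fun m => ψ ra rm (E.add n (E.kgen n kc).2
            (E.enc n (E.kgen n kc).2 m₀ r₀) (E.mul n (E.kgen n kc).2
              (E.enc n (E.kgen n kc).2 (b u) (rT u)) (c u) m) a) := by
        rw [ex_comm]
        conv_lhs => enter [2, ra]; rw [ex_comm]
        rw [← ex_resample u]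
        refine congrArg (ex _) (funext fun ra => ?_)
        rw [ex_comm, ← ex_resample u]
        refine congrArg (ex _) (funext fun rm => ?_)
        conv_lhs => enter [2, m]; rw [ex_comm]
        rw [ex_comm]
        refine congrArg (ex _) (funext fun r₀ => ?_)
        rw [ex_comm]
        simp only [hup, Function.update_self]
      _ ≤ ex (unif (Fin z → Bits (E.addCoins n))) fun ra =>
          ex (unif (Fin z → Bits (E.mulCoins n))) fun rm =>
          (ex (unif (Bits (E.encCoins n))) fun r => ψ ra rm (E.enc n (E.kgen n kc).2
            ((m₀ + b u * c u % N) % N) r)) + (δ + δ) := by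
        refine ex_mono fun ra => ex_mono fun rm => ?_
        have h1 : ∀ r₀ a, _ := fun r₀ a => hR.2 (b u) (c u) (rT u) (hb u) (hc u)
          (fun ct => ψ ra rm (E.add n (E.kgen n kc).2 (E.enc n (E.kgen n kc).2 m₀ r₀) ct a))
          fun _ => hψ _ _ _
        refine (ex_mono fun r₀ => ex_mono fun a => h1 r₀ a).trans ?_
        simp only [ex_add, ex_const]
        rw [← add_assoc]
        gcongr
        refine le_trans (le_of_eq ?_) (hR.1 m₀ (b u * c u % N) hm₀ (Nat.mod_lt _ hN) (ψ ra rm)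
          fun _ => hψ _ _ _)
        exact congrArg (ex _) (funext fun r₀ => ex_comm _ _ _)
      _ = (ex (unif (Bits (E.encCoins n))) fun r =>
          ex (unif (Fin z → Bits (E.addCoins n))) fun ra =>
          ex (unif (Fin z → Bits (E.mulCoins n))) fun rm => ψ ra rm (E.enc n (E.kgen n kc).2
            ((m₀ + b u * c u % N) % N) r)) + (δ + δ) := by
        simp only [ex_add, ex_const]
        congr 1
        conv_lhs => enter [2, ra]; rw [ex_comm]
        rw [ex_comm]
      _ ≤ _ := by
        refine (add_le_add ih' le_rfl).trans_eq ?_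
        have e : ((m₀ + b u * c u % N) % N + (us.map fun u => b u * c u).sum) % N =
            (m₀ + ((u :: us).map fun u => b u * c u).sum) % N := by
          rw [List.map_cons, List.sum_cons, ← add_assoc]
          simp [Nat.add_mod]
        rw [e, add_assoc]
        congr 1
        simp only [List.length_cons]
        push_cast
        ring

/-- Up to `2 * z * δ`, the filtered ciphertext is a fresh encryption of the selected plaintext. -/
theorem homSum_le (hR : Rerandomizes E n kc δ) {z : ℕ} (v : Fin z) (c : Fin z → ℕ)
    (h1 : 1 < E.modulus n (E.kgen n kc).2) (hc : ∀ t, c t < E.modulus n (E.kgen n kc).2)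
    (rT : Fin z → Bits (E.encCoins n)) (φ : Bits (E.ctLen n) → ℝ≥0∞) (hφ : ∀ c, φ c ≤ 1) :
    (ex (unif (Fin z → Bits (E.addCoins n))) fun ra =>
      ex (unif (Fin z → Bits (E.mulCoins n))) fun rm =>
      φ (E.homSum n (E.kgen n kc).2 (fun t => E.mul n (E.kgen n kc).2
        (E.enc n (E.kgen n kc).2 (if t = v then 1 else 0) (rT t)) (c t) (rm t)) ra)) ≤
    (ex (unif (Bits (E.encCoins n))) fun r => φ (E.enc n (E.kgen n kc).2 (c v) r)) +
      (2 * z : ℕ) * δ := by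
  let b : Fin z → ℕ := fun t => if t = v then 1 else 0
  have hb : ∀ t, b t < E.modulus n (E.kgen n kc).2 := fun t => by
    simp only [b]; split_ifs <;> omega
  have hsum : ((List.finRange z).map fun u => b u * c u).sum = c v := by
    rw [← Fin.sum_univ_def]; simp [b]
  have hnd := List.nodup_finRange z
  have hlen : (List.finRange z).length = z := List.length_finRange
  obtain ⟨t, ts, hts⟩ : ∃ t ts, List.finRange z = t :: ts :=
    List.exists_cons_of_ne_nil fun h => by
      have := v.pos
      rw [h] at hlen; simp at hlen; omega
  rw [hts] at hsum hnd hlen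
  obtain ⟨ht, hnd⟩ := List.nodup_cons.1 hnd
  have hN := E.modulus_pos n kc
  -- The first product, once replaced by a fresh encryption, plays the role of the initial
  -- accumulator.
  have hf := foldl_add_le hR b c hb hc rT φ hφ ts hnd _ (Nat.mod_lt (b t * c t) hN)
  simp only [AHE.homSum, hts]
  -- The first entry needs only one `δ`, for its product; the other one is slack that is given away
  -- below.
  have hz : (2 * z : ℕ) * δ = (2 * ts.length : ℕ) * δ + δ + δ := by
    have hl : 2 * z = 2 * ts.length + 1 + 1 := by rw [List.length_cons] at hlen; omega
    rw [hl]; push_cast; ring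
  have hv : (b t * c t % E.modulus n (E.kgen n kc).2 + (ts.map fun u => b u * c u).sum) %
      E.modulus n (E.kgen n kc).2 = c v := by
    rw [Nat.mod_add_mod, ← hsum, List.map_cons, List.sum_cons]
    rw [List.map_cons, List.sum_cons] at hsum
    rw [hsum]
    exact Nat.mod_eq_of_lt (hc v)
  rw [hv] at hf
  rw [hz, ← add_assoc, ← add_assoc]
  refine le_trans ?_ le_self_add
  refine le_trans ?_ (add_le_add hf le_rfl)
  let ψ : (Fin z → Bits (E.addCoins n)) → (Fin z → Bits (E.mulCoins n)) →
        Bits (E.ctLen n) → ℝ≥0∞ := fun ra rm ct =>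
      φ (ts.foldl (fun acc u => E.add n (E.kgen n kc).2 acc (E.mul n (E.kgen n kc).2
        (E.enc n (E.kgen n kc).2 (b u) (rT u)) (c u) (rm u)) (ra u)) ct)
  have hup : ∀ ra rm m ct, ψ ra (Function.update rm t m) ct = ψ ra rm ct := by
    intro ra rm m ct
    refine congrArg φ (foldl_congr_mem _ _ _ _ fun w hw acc => ?_)
    have : w ≠ t := fun h => ht (h ▸ hw)
    rw [Function.update_of_ne this]
  calc _ = ex (unif (Fin z → Bits (E.addCoins n))) fun ra =>
        ex (unif (Fin z → Bits (E.mulCoins n))) fun rm => ψ ra rm (E.mul n (E.kgen n kc).2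
          (E.enc n (E.kgen n kc).2 (b t) (rT t)) (c t) (rm t)) := rfl
    _ = ex (unif (Fin z → Bits (E.addCoins n))) fun ra =>
        ex (unif (Fin z → Bits (E.mulCoins n))) fun rm => ex (unif (Bits (E.mulCoins n))) fun m =>
        ψ ra rm (E.mul n (E.kgen n kc).2 (E.enc n (E.kgen n kc).2 (b t) (rT t)) (c t) m) := by
      refine congrArg (ex _) (funext fun ra => ?_)
      rw [← ex_resample t]
      simp only [hup, Function.update_self]
    _ ≤ _ := by
      refine (ex_mono fun ra => ex_mono fun rm => hR.2 (b t) (c t) (rT t) (hb t) (hc t) (ψ ra rm)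
        fun _ => hφ _).trans_eq ?_
      simp only [ex_add, ex_const]
      congr 1
      conv_lhs => enter [2, ra]; rw [ex_comm]
      rw [ex_comm]

end

theorem ex_unif_bool_fun {R : Type} [Fintype R] [Nonempty R] (φ : (Bool → R) → ℝ≥0∞) :
    ex (unif (Bool → R)) φ =
      ex (unif R) fun a => ex (unif R) fun b => φ fun i => if i then b else a := by
  rw [← ex_unif_equiv (Equiv.boolArrowEquivProd R).symm, ex_unif_prod]
  refine congrArg (ex _) (funext fun a => congrArg (ex _) (funext fun b => congrArg φ ?_))
  funext i; cases i <;> rfl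

/-- Two independent approximations. -/
theorem ex_bool_fun_le {R R' X : Type} [Fintype R] [Nonempty R] [Fintype R'] [Nonempty R']
    {f : Bool → R → X} {g : Bool → R' → X} {ε : ℝ≥0∞}
    (h : ∀ i (φ : X → ℝ≥0∞), (∀ a, φ a ≤ 1) →
      (ex (unif R) fun r => φ (f i r)) ≤ (ex (unif R') fun r => φ (g i r)) + ε)
    (φ : (Bool → X) → ℝ≥0∞) (hφ : ∀ a, φ a ≤ 1) :
    (ex (unif (Bool → R)) fun r => φ fun i => f i (r i)) ≤
      (ex (unif (Bool → R')) fun r => φ fun i => g i (r i)) + 2 * ε := by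
  rw [ex_unif_bool_fun, ex_unif_bool_fun]
  have e : ∀ {Y : Type} (k : Bool → Y → X) (a b : Y),
      (fun i => k i (if i = true then b else a)) = fun i => if i then k true b else k false a := by
    intro Y k a b; funext i; cases i <;> rfl
  simp only [e]
  refine (ex_mono fun a => h true (fun x => φ fun i => if i then x else f false a)
    fun _ => hφ _).trans ?_
  rw [ex_add, ex_const, ex_comm, two_mul, ← add_assoc]
  gcongr
  refine (ex_mono fun b => h false (fun x => φ fun i => if i then g true b else x)
    fun _ => hφ _).trans_eq ?_
  rw [ex_add, ex_const, ex_comm]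

/-- Ciphertexts of the components of a pair. -/
def encRes (E : AHE) {n : ℕ} (kc : Bits (E.keyCoins n)) {H : Type} {ℓ k : ℕ} (encode : H → Bits ℓ)
    (e : Bool → H × Bits k) (re : Bool → Bool → Bits (E.encCoins n)) :
    Bool → Bool → Bits (E.ctLen n) :=
  fun i i' => E.enc n (E.kgen n kc).2 (component encode (e i) i') (re i i')

theorem component_lt {H : Type} {ℓ k N : ℕ} (encode : H → Bits ℓ) (hN : 2 ^ max ℓ k ≤ N)
    (e : H × Bits k) (i' : Bool) : component encode e i' < N := by
  have h1 := natOf_lt (toL (encode e.1))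
  have h2 := natOf_lt (toL e.2)
  rw [length_toL] at h1 h2
  have h3 : 2 ^ ℓ ≤ 2 ^ max ℓ k := Nat.pow_le_pow_right (by norm_num) (le_max_left _ _)
  have h4 : 2 ^ k ≤ 2 ^ max ℓ k := Nat.pow_le_pow_right (by norm_num) (le_max_right _ _)
  rw [component]
  split_ifs <;> omega

/-- Up to `8 * z * δ`, oblivious filtering returns fresh encryptions of the selected pair. -/
theorem oblFilter_le {E : AHE} {n : ℕ} {kc : Bits (E.keyCoins n)} {δ : ℝ≥0∞}
    (hR : Rerandomizes E n kc δ) {H : Type} {ℓ k z : ℕ} (encode : H → Bits ℓ)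
    (h1 : 1 < E.modulus n (E.kgen n kc).2) (hN : 2 ^ max ℓ k ≤ E.modulus n (E.kgen n kc).2)
    (res : Fin z → Bool → H × Bits k) (v : Fin z) (rT : Fin z → Bits (E.encCoins n))
    (φ : (Bool → Bool → Bits (E.ctLen n)) → ℝ≥0∞) (hφ : ∀ c, φ c ≤ 1) :
    (ex (unif (Bool → Bool → Fin z → Bits (E.addCoins n))) fun ra =>
      ex (unif (Bool → Bool → Fin z → Bits (E.mulCoins n))) fun rm =>
      φ (oblFilter E n (E.kgen n kc).2 encode res
        (fun t => E.enc n (E.kgen n kc).2 (if t = v then 1 else 0) (rT t)) ra rm)) ≤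
    (ex (unif (Bool → Bool → Bits (E.encCoins n))) fun re => φ (encRes E kc encode (res v) re)) +
      (8 * z : ℕ) * δ := by
  let e : (Bool → Bool → (Fin z → Bits (E.addCoins n)) × (Fin z → Bits (E.mulCoins n))) ≃
      (Bool → Bool → Fin z → Bits (E.addCoins n)) × (Bool → Bool → Fin z → Bits (E.mulCoins n)) :=
    ⟨fun r => (fun i i' => (r i i').1, fun i i' => (r i i').2), fun r i i' => (r.1 i i', r.2 i i'),
      fun _ => rfl, fun _ => rfl⟩
  let f : Bool → Bool → (Fin z → Bits (E.addCoins n)) × (Fin z → Bits (E.mulCoins n)) →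
      Bits (E.ctLen n) := fun i i' r => E.homSum n (E.kgen n kc).2 (fun t =>
        E.mul n (E.kgen n kc).2 (E.enc n (E.kgen n kc).2 (if t = v then 1 else 0) (rT t))
          (component encode (res t i) i') (r.2 t)) r.1
  have hs : ∀ i i' (φ : Bits (E.ctLen n) → ℝ≥0∞), (∀ a, φ a ≤ 1) →
      (ex (unif ((Fin z → Bits (E.addCoins n)) × (Fin z → Bits (E.mulCoins n)))) fun r =>
        φ (f i i' r)) ≤ (ex (unif (Bits (E.encCoins n))) fun r =>
          φ (E.enc n (E.kgen n kc).2 (component encode (res v i) i') r)) + (2 * z : ℕ) * δ := by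
    intro i i' φ hφ
    rw [ex_unif_prod]
    exact homSum_le hR v (fun t => component encode (res t i) i') h1
      (fun t => component_lt encode hN _ _) rT φ hφ
  -- Four ciphertexts at `2 * z * δ` each; the two bits of their index are treated one after the
  -- other.
  have h4 := ex_bool_fun_le (fun i => ex_bool_fun_le (hs i)) φ hφ
  have h8 : ((8 * z : ℕ) : ℝ≥0∞) * δ = 2 * (2 * ((2 * z : ℕ) * δ)) := by push_cast; ring
  rw [h8]
  refine le_trans (le_of_eq ?_) h4
  have := ex_unif_equiv e fun r => φ (oblFilter E n (E.kgen n kc).2 encode res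
        (fun t => E.enc n (E.kgen n kc).2 (if t = v then 1 else 0) (rT t)) r.1 r.2)
  rw [ex_unif_prod] at this
  exact this.symm

/-! ### Message extraction -/

/-- The one-sided bound holds for all tests, hence also for complements; `Close.symm` supplies the
other direction. -/
theorem oblFilter_near {E : AHE} {n : ℕ} {kc : Bits (E.keyCoins n)} {δ : ℝ≥0∞}
    (hR : Rerandomizes E n kc δ) {H : Type} {ℓ k z : ℕ} (encode : H → Bits ℓ)
    (h1 : 1 < E.modulus n (E.kgen n kc).2) (hN : 2 ^ max ℓ k ≤ E.modulus n (E.kgen n kc).2)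
    (res : Fin z → Bool → H × Bits k) (v : Fin z) (rT : Fin z → Bits (E.encCoins n))
    (φ : (Bool → Bool → Bits (E.ctLen n)) → ℝ≥0∞) (hφ : ∀ c, φ c ≤ 1) :
    Near ((8 * z : ℕ) * δ) (ex (unif (Bool → Bool → Fin z → Bits (E.addCoins n))) fun ra =>
      ex (unif (Bool → Bool → Fin z → Bits (E.mulCoins n))) fun rm =>
      φ (oblFilter E n (E.kgen n kc).2 encode res
        (fun t => E.enc n (E.kgen n kc).2 (if t = v then 1 else 0) (rT t)) ra rm))
    (ex (unif (Bool → Bool → Bits (E.encCoins n))) fun re => φ (encRes E kc encode (res v) re)) := by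
  let P := (unif (Bool → Bool → Fin z → Bits (E.addCoins n))).bind fun ra =>
    (unif (Bool → Bool → Fin z → Bits (E.mulCoins n))).map fun rm =>
      oblFilter E n (E.kgen n kc).2 encode res
        (fun t => E.enc n (E.kgen n kc).2 (if t = v then 1 else 0) (rT t)) ra rm
  let Q := (unif (Bool → Bool → Bits (E.encCoins n))).map (encRes E kc encode (res v))
  have hP : ∀ ψ, ex P ψ = _ := fun ψ => by simp only [P, ex_bind, ex_map]; rfl
  have hQ : ∀ ψ, ex Q ψ = _ := fun ψ => by simp only [Q, ex_map]; rfl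
  have hc : Close ((8 * z : ℕ) * δ) P Q := fun ψ hψ => by
    rw [hP, hQ]; exact oblFilter_le hR encode h1 hN res v rT ψ hψ
  have h2 := hc φ hφ
  have h3 := hc.symm φ hφ
  rw [hP, hQ] at h2 h3
  exact ⟨h2, h3⟩

/-- The last `n` bits of a string. -/
def tailBits {τ n : ℕ} (b : Bits (τ + n)) : Bits n := fun j => b (Fin.natAdd τ j)

/-- For distinct points, resample `G` at `p`: its last `n` bits are uniform and hit the fixed string
at `q` with probability `2 ^ (-n)`. -/
theorem ex_tailBits_eq_le {ℓ τ n : ℕ} (p q : Bits ℓ) :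
    (ex (unif (Bits ℓ → Bits (τ + n))) fun G =>
      if tailBits (G p) = tailBits (G q) then (1 : ℝ≥0∞) else 0) ≤
      (if p = q then 1 else 0) + ((2 : ℝ≥0∞) ^ n)⁻¹ := by
  split_ifs with h
  · exact (ex_le fun G => by split_ifs <;> simp).trans le_self_add
  · rw [zero_add, ← ex_resample p]
    refine ex_le fun G => ?_
    have e := congrArg (ex · fun b : Bits (τ + n) => if tailBits b = tailBits (G q) then (1 : ℝ≥0∞)
      else 0) (unif_bits_add (a := τ) (b := n) PMF.pure)
    simp only [PMF.bind_pure, ex_bind, ex_pure] at e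
    have hq : ∀ b, Function.update G p b q = G q := fun b => Function.update_of_ne (Ne.symm h) _ _
    simp only [hq, Function.update_self]
    rw [e]
    refine ex_le fun b₁ => ?_
    have ht : ∀ b₂ : Bits n, tailBits (Fin.append b₁ b₂) = b₂ := fun b₂ => by
      funext j; exact Fin.append_right _ _ _
    simp only [ht]
    rw [ex_unif_eq]
    simp

section
variable {𝔾 : GroupGen} {E : AHE} {σ : ℕ → ℕ}

theorem decodeElem_natOf {n : ℕ} (gc : Bits (𝔾.coinLen n)) (h : 𝔾.El n gc) :
    decodeElem (𝔾.encode n (𝔾.gen n gc)) (natOf (toL (𝔾.encode n (𝔾.gen n gc) h))) = h := by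
  have hx : ∃ u, natOf (toL (𝔾.encode n (𝔾.gen n gc) u)) =
    natOf (toL (𝔾.encode n (𝔾.gen n gc) h)) := ⟨h, rfl⟩
  rw [decodeElem, dif_pos hx]
  exact 𝔾.encode_injective n gc (natOf_toL_injective hx.choose_spec)

/-- The point at which the sender and the receiver evaluate the oracle, for `β = h`. -/
abbrev hashPt (𝔾 : GroupGen) {n : ℕ} {gc : Bits (𝔾.coinLen n)} (h : 𝔾.El n gc) (y : 𝔾.Ex n gc) :
    Bits (𝔾.elemLen n) :=
  𝔾.encode n (𝔾.gen n gc) (zpw h y)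

/-- The pair selected for the receiver: the element for the chosen message is computed from
`β = h`, the message with its tag `M`, and `y`; the other one is `(A, u)`. -/
def respR (𝔾 : GroupGen) {n k : ℕ} {gc : Bits (𝔾.coinLen n)} (h : 𝔾.El n gc)
    (G : Bits (𝔾.elemLen n) → Bits k) (M : Bits k) (y : 𝔾.Ex n gc) (A : 𝔾.El n gc) (u : Bits k)
    (loc : Bool) : Bool → 𝔾.El n gc × Bits k :=
  fun j => if xor j loc then (A, u) else (zpw (𝔾.gen0 n gc) y, xorBits (G (hashPt 𝔾 h y)) M)

/-- The exponent of the receiver. -/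
abbrev expR {p : ℕ} (r₁ r₂ : ZMod p) (s₂ : Bool) : ZMod p := r₂ + r₁ * (-1) ^ s₂.toNat

/-- At the place `loc` both parties hash the same point, because `(g ^ y₀) ^ x = (g ^ x) ^ y₀`. At
the other place the tags cancel, and the test passes only if the two pads agree on their last `n`
bits, which `hG` excludes. That attempt must fail, since the attempt `true` takes precedence when
both succeed. -/
theorem retrieve_respR {n τ : ℕ} (gc : Bits (𝔾.coinLen n)) (kc : Bits (E.keyCoins n))
    (hN : 2 ^ max (𝔾.elemLen n) (τ + n) ≤ E.modulus n (E.kgen n kc).2)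
    (G : Bits (𝔾.elemLen n) → Bits (τ + n)) (r₁ r₂ : 𝔾.Ex n gc) (s₂ : Bool) (r₃ : Bits n)
    (m m' : Bits τ) (y₀ y₁ : 𝔾.Ex n gc) (h : 𝔾.El n gc) (loc : Bool)
    (re : Bool → Bool → Bits (E.encCoins n))
    (hG : tailBits (G (hashPt 𝔾 (zpw (𝔾.gen0 n gc) y₁) (expR r₁ r₂ s₂))) ≠
      tailBits (G (hashPt 𝔾 h y₁))) :
    retrieve E n (E.kgen n kc).1 (𝔾.encode n (𝔾.gen n gc)) G r₁ r₂ s₂ r₃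
      (encRes E kc (𝔾.encode n (𝔾.gen n gc)) (respR 𝔾 (zpw (𝔾.gen0 n gc) (expR r₁ r₂ s₂)) G
        (Fin.append m r₃) y₀ (zpw (𝔾.gen0 n gc) y₁)
        (xorBits (G (hashPt 𝔾 h y₁)) (Fin.append m' r₃)) loc) re) = some m := by
  set x := expR r₁ r₂ s₂ with hx
  set e := respR 𝔾 (zpw (𝔾.gen0 n gc) x) G (Fin.append m r₃) y₀ (zpw (𝔾.gen0 n gc) y₁)
        (xorBits (G (hashPt 𝔾 h y₁)) (Fin.append m' r₃)) loc with he
  let att : Bool → Option (Bits τ) := fun i =>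
    let w := xorBits (G (hashPt 𝔾 (e i).1 x)) (e i).2
    if (fun j => w (Fin.natAdd τ j)) = r₃ then some fun j => w (Fin.castAdd n j) else none
  have h0 : retrieve E n (E.kgen n kc).1 (𝔾.encode n (𝔾.gen n gc)) G r₁ r₂ s₂ r₃
      (encRes E kc (𝔾.encode n (𝔾.gen n gc)) e re) = (att true).or (att false) := by
    have h1 : ∀ i, decodeElem (𝔾.encode n (𝔾.gen n gc)) (E.dec n (E.kgen n kc).1
        (encRes E kc (𝔾.encode n (𝔾.gen n gc)) e re i false)) = (e i).1 := fun i => by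
      rw [encRes, E.dec_enc _ _ _ _ (component_lt _ hN _ _)]
      exact decodeElem_natOf gc _
    have h2 : ∀ i, natBits (τ + n) (E.dec n (E.kgen n kc).1
        (encRes E kc (𝔾.encode n (𝔾.gen n gc)) e re i true)) = (e i).2 := fun i => by
      rw [encRes, E.dec_enc _ _ _ _ (component_lt _ hN _ _)]
      exact natBits_natOf _
    simp only [retrieve, h1, h2]
    rfl
  have hs : att loc = some m := by
    have e1 : e loc = (zpw (𝔾.gen0 n gc) y₀, xorBits (G (hashPt 𝔾 (zpw (𝔾.gen0 n gc) x) y₀))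
      (Fin.append m r₃)) := by rw [he, respR, Bool.xor_self]; rfl
    have e2 : hashPt 𝔾 (zpw (𝔾.gen0 n gc) y₀) x = hashPt 𝔾 (zpw (𝔾.gen0 n gc) x) y₀ := by
      rw [hashPt, hashPt, ← zpw_mul, ← zpw_mul, mul_comm]
    have e3 : ∀ a b : Bits (τ + n), xorBits a (xorBits a b) = b := fun a b => by
      funext j; simp [xorBits]
    simp only [att, e1, e2, e3, Fin.append_right, Fin.append_left, if_true]
  have hn : att (!loc) = none := by
    have e1 : e (!loc) = (zpw (𝔾.gen0 n gc) y₁, xorBits (G (hashPt 𝔾 h y₁))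
      (Fin.append m' r₃)) := by rw [he, respR]; simp
    simp only [att, e1]
    have key : ∀ a b c : Bool, xor a (xor b c) = c → a = b := by decide
    rw [if_neg]
    intro h'
    refine hG (funext fun j => ?_)
    have := congrFun h' j
    simp only [xorBits, Fin.append_right, tailBits] at this ⊢
    exact key _ _ _ this
  rw [h0]
  cases loc <;> simp_all

/-- The view of `R`. -/
def viewR (𝔾 : GroupGen) (E : AHE) {n : ℕ} (gc : Bits (𝔾.coinLen n)) (C : 𝔾.El n gc)
    (kc : Bits (E.keyCoins n)) (r₁ r₂ : 𝔾.Ex n gc) (s₂ : Bool) (r₃ : Bits n)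
    (o : Bool → Bool → Bits (E.ctLen n)) (out : List Bool) : List Bool :=
  (toL kc ++ expL n r₁ ++ expL n r₂) ++ (𝔾.desc n gc ++ 𝔾.eL C ++ [s₂] ++ toL r₃ ++
    catBool fun i => catBool fun i' => toL (o i i')) ++ out

/-- Correctness and privacy of the delegated query: the exponent of the receiver is the discrete
logarithm of the query for the chosen message, while the other query involves the exponent `a` of
`C`, unknown to the receiver. -/
theorem genQuery_R {n : ℕ} (gc : Bits (𝔾.coinLen n)) (a r₁ r₂ : 𝔾.Ex n gc) (s₁ s i : Bool) :
    betaOf 𝔾 gc a r₁ r₂ s₁ s i = zpw (𝔾.gen0 n gc)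
      (if xor i s then a - expR r₁ r₂ (xor s₁ s) else expR r₁ r₂ (xor s₁ s)) := by
  cases s₁ <;> cases s <;> cases i <;>
    simp only [betaOf, genQueryP2, genQueryP1, expR, ← zpw_add, ← zpw_sub, Bool.xor_false,
      Bool.xor_true, Bool.not_true, Bool.not_false, if_true, if_false, reduceCtorEq,
      Bool.toNat_true, Bool.toNat_false, pow_zero, pow_one] <;>
    congr 1 <;> ring

/-- The distribution of the view of `R` in the protocol. -/
theorem acc_protocol_R {n : ℕ} (x : Input (σ n)) (A : RandCircuit) :
    acc (fun G => (protocol 𝔾 E σ n x G).map fun views => views .R) A =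
    ex (unif (Bits (𝔾.coinLen n))) fun gc => ex (unif (Bits (E.keyCoins n))) fun kc =>
    ex (unif (𝔾.Ex n gc)) fun r₁ => ex (unif (𝔾.Ex n gc)) fun r₂ => ex (unif Bool) fun s₂ =>
    ex (unif (Bits n)) fun r₃ => ex (unif (𝔾.Ex n gc)) fun a =>
    ex (unif (Fin x.z → Bits (E.encCoins n))) fun rT =>
    ex (unif (Fin x.z → (Bool → 𝔾.Ex n gc) × Bool)) fun y =>
    ex (unif (Bits (𝔾.elemLen n) → Bits (σ n + n))) fun G =>
    ex (unif (Bool → Bool → Fin x.z → Bits (E.addCoins n))) fun ra =>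
    ex (unif (Bool → Bool → Fin x.z → Bits (E.mulCoins n))) fun rm =>
      let o := oblFilter E n (E.kgen n kc).2 (𝔾.encode n (𝔾.gen n gc))
        (fun t => respR 𝔾 (zpw (𝔾.gen0 n gc) (expR r₁ r₂ s₂)) G (Fin.append (x.m t x.s) r₃)
          ((y t).1 false) (zpw (𝔾.gen0 n gc) ((y t).1 true))
          (xorBits (G (hashPt 𝔾 (zpw (𝔾.gen0 n gc) a) ((y t).1 true)))
            (Fin.append (x.m t !x.s) r₃)) (y t).2)
        (fun t => E.enc n (E.kgen n kc).2 (if t = x.v then 1 else 0) (rT t)) ra rm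
      A.run (oracleOf G) (viewR 𝔾 E gc (zpw (𝔾.gen0 n gc) (a + expR r₁ r₂ s₂)) kc r₁ r₂ s₂ r₃ o
        ((retrieve E n (E.kgen n kc).1 (𝔾.encode n (𝔾.gen n gc)) G r₁ r₂ s₂ r₃ o).elim [] toL))
        [true] := by
  simp only [acc, protocol, bind, pure, ex_map, ex_bind, ex_pure]
  rw [ex_comm]
  refine congrArg (ex _) (funext fun gc => ?_)
  -- A change of variables adapted to the receiver: `s₁` becomes `s₂`; `a` becomes the exponent `a -
  -- x` of the query for the other message, still uniform; the exponents `y` are indexed by chosen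
  -- or not chosen; `π t` becomes the place of the chosen half.
  let e : ((Bits (𝔾.elemLen n) → Bits (σ n + n)) × 𝔾.Ex n gc × Bits (E.keyCoins n) ×
      (Fin x.z → Bits (E.encCoins n)) × 𝔾.Ex n gc × 𝔾.Ex n gc × Bool × Bits n ×
      (Fin x.z → Bool → 𝔾.Ex n gc) × (Fin x.z → Bool) ×
      (Bool → Bool → Fin x.z → Bits (E.addCoins n)) ×
      (Bool → Bool → Fin x.z → Bits (E.mulCoins n))) ≃
      (Bits (E.keyCoins n) × 𝔾.Ex n gc × 𝔾.Ex n gc × Bool × Bits n × 𝔾.Ex n gc ×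
      (Fin x.z → Bits (E.encCoins n)) × (Fin x.z → (Bool → 𝔾.Ex n gc) × Bool) ×
      (Bits (𝔾.elemLen n) → Bits (σ n + n)) ×
      (Bool → Bool → Fin x.z → Bits (E.addCoins n)) ×
      (Bool → Bool → Fin x.z → Bits (E.mulCoins n))) :=
    ⟨fun ⟨G, a, kc, rT, r₁, r₂, s₁, r₃, y, π, ra, rm⟩ =>
        ⟨kc, r₁, r₂, xor s₁ x.s, r₃, a - expR r₁ r₂ (xor s₁ x.s), rT,
          fun t => (fun b => y t (xor b x.s), xor (π t) x.s), G, ra, rm⟩,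
      fun ⟨kc, r₁, r₂, s₂, r₃, a, rT, y, G, ra, rm⟩ =>
        ⟨G, a + expR r₁ r₂ s₂, kc, rT, r₁, r₂, xor s₂ x.s, r₃, fun t b => (y t).1 (xor b x.s),
          fun t => xor (y t).2 x.s, ra, rm⟩,
      fun _ => by simp, fun _ => by simp⟩
  have h := ex_unif_equiv e fun q =>
      let o := oblFilter E n (E.kgen n q.1).2 (𝔾.encode n (𝔾.gen n gc))
        (fun t => respR 𝔾 (zpw (𝔾.gen0 n gc) (expR q.2.1 q.2.2.1 q.2.2.2.1)) q.2.2.2.2.2.2.2.2.1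
          (Fin.append (x.m t x.s) q.2.2.2.2.1)
          ((q.2.2.2.2.2.2.2.1 t).1 false) (zpw (𝔾.gen0 n gc) ((q.2.2.2.2.2.2.2.1 t).1 true))
          (xorBits (q.2.2.2.2.2.2.2.2.1 (hashPt 𝔾 (zpw (𝔾.gen0 n gc) q.2.2.2.2.2.1)
            ((q.2.2.2.2.2.2.2.1 t).1 true)))
            (Fin.append (x.m t !x.s) q.2.2.2.2.1)) (q.2.2.2.2.2.2.2.1 t).2)
        (fun t => E.enc n (E.kgen n q.1).2 (if t = x.v then 1 else 0) (q.2.2.2.2.2.2.1 t))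
        q.2.2.2.2.2.2.2.2.2.1 q.2.2.2.2.2.2.2.2.2.2
      A.run (oracleOf q.2.2.2.2.2.2.2.2.1) (viewR 𝔾 E gc
        (zpw (𝔾.gen0 n gc) (q.2.2.2.2.2.1 + expR q.2.1 q.2.2.1 q.2.2.2.1)) q.1 q.2.1 q.2.2.1
        q.2.2.2.1 q.2.2.2.2.1 o
        ((retrieve E n (E.kgen n q.1).1 (𝔾.encode n (𝔾.gen n gc)) q.2.2.2.2.2.2.2.2.1 q.2.1 q.2.2.1
          q.2.2.2.1 q.2.2.2.2.1 o).elim [] toL))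
        [true]
  simp only [ex_unif_prod] at h
  refine Eq.trans ?_ h
  refine congrArg (ex _) (funext fun G => congrArg (ex _) (funext fun a =>
    congrArg (ex _) (funext fun kc => congrArg (ex _) (funext fun rT =>
    congrArg (ex _) (funext fun r₁ => congrArg (ex _) (funext fun r₂ =>
    congrArg (ex _) (funext fun s₁ => congrArg (ex _) (funext fun r₃ =>
    congrArg (ex _) (funext fun y => congrArg (ex _) (funext fun π =>
    congrArg (ex _) (funext fun ra => congrArg (ex _) (funext fun rm => ?_))))))))))))
  have hg := genRes_of_eq (𝔾.encode n (𝔾.gen n gc)) G (𝔾.gen0 n gc) (zpw (𝔾.gen0 n gc) a)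
    (betaOf_mul gc a r₁ r₂ s₁ x.s) x.m r₃ y π
  have hr : (fun t j => (zpw (𝔾.gen0 n gc) (y t (xor j (π t))),
      xorBits (G (𝔾.encode n (𝔾.gen n gc) (zpw (betaOf 𝔾 gc a r₁ r₂ s₁ x.s (xor j (π t)))
        (y t (xor j (π t)))))) (Fin.append (x.m t (xor j (π t))) r₃))) = fun t =>
      respR 𝔾 (zpw (𝔾.gen0 n gc) (expR r₁ r₂ (xor s₁ x.s))) G (Fin.append (x.m t x.s) r₃)
          (y t (xor false x.s)) (zpw (𝔾.gen0 n gc) (y t (xor true x.s)))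
          (xorBits (G (hashPt 𝔾 (zpw (𝔾.gen0 n gc) (a - expR r₁ r₂ (xor s₁ x.s)))
            (y t (xor true x.s)))) (Fin.append (x.m t !x.s) r₃)) (xor (π t) x.s) := by
    funext t j
    simp only [genQuery_R, respR]
    cases x.s <;> cases j <;> cases π t <;> simp
  rw [hr] at hg
  refine congrArg (fun l => A.run (oracleOf G) l [true]) ?_
  have ha : a - expR r₁ r₂ (xor s₁ x.s) + expR r₁ r₂ (xor s₁ x.s) = a := sub_add_cancel _ _
  change [] ++ _ ++ (_ ++ Option.elim (Option.map _ (genRes (𝔾.encode n (𝔾.gen n gc)) G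
    (𝔾.gen0 n gc) (zpw (𝔾.gen0 n gc) a) (betaOf 𝔾 gc a r₁ r₂ s₁ x.s) x.m r₃ y π)) _ _) ++
    Option.elim (Option.bind (Option.map _ (genRes (𝔾.encode n (𝔾.gen n gc)) G
    (𝔾.gen0 n gc) (zpw (𝔾.gen0 n gc) a) (betaOf 𝔾 gc a r₁ r₂ s₁ x.s) x.m r₃ y π)) _) _ _ = _
  rw [hg]
  simp only [e, Equiv.coe_fn_mk, ha]
  rfl

end

/-! ### The simulated view of the receiver -/

section
variable {𝔾 : GroupGen} {E : AHE} {σ : ℕ → ℕ}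

/-- What is sampled for the view of `R`: the coins of the key, `r₁`, `r₂`, `s₂`, `r₃`, `y`, a random
second component, the order of the pair, and the coins of the encryptions. -/
abbrev RestR (𝔾 : GroupGen) (E : AHE) (n k : ℕ) (gc : Bits (𝔾.coinLen n)) : Type :=
  Bits (E.keyCoins n) × 𝔾.Ex n gc × 𝔾.Ex n gc × Bool × Bits n × 𝔾.Ex n gc × Bits k × Bool ×
    (Bool → Bool → Bits (E.encCoins n))

/-- The view of `R` in which `C = A₁ * g ^ x`, and the element for the other message is `A₂` with a
random string. -/
def coreR (𝔾 : GroupGen) (E : AHE) {n τ : ℕ} (m : Bits τ) (G : Bits (𝔾.elemLen n) → Bits (τ + n))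
    (gc : Bits (𝔾.coinLen n)) (A₁ A₂ : 𝔾.El n gc) (r : RestR 𝔾 E n (τ + n) gc) : List Bool :=
  viewR 𝔾 E gc (A₁ * zpw (𝔾.gen0 n gc) (expR r.2.1 r.2.2.1 r.2.2.2.1)) r.1 r.2.1 r.2.2.1 r.2.2.2.1
    r.2.2.2.2.1 (encRes E r.1 (𝔾.encode n (𝔾.gen n gc))
      (respR 𝔾 (zpw (𝔾.gen0 n gc) (expR r.2.1 r.2.2.1 r.2.2.2.1)) G (Fin.append m r.2.2.2.2.1)
        r.2.2.2.2.2.1 A₂ r.2.2.2.2.2.2.1 r.2.2.2.2.2.2.2.1) r.2.2.2.2.2.2.2.2) (toL m)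

theorem FLen.catBool₂ {F : Fam} {m : F.Θ → ℕ} (hm : F.PB m)
    (f : ∀ θ, F.ι θ → Bool → Bool → Bits (m θ)) :
    FLen F fun θ i => DUQMR.catBool fun j => DUQMR.catBool fun j' => DUQMR.toL (f θ i j j') :=
  FLen.catBool fun _ => FLen.catBool fun _ => FLen.toL hm _

theorem FComp.catBool_get {F : Fam} {inp : F.Str} {f : ∀ θ, F.ι θ → Bool → List Bool}
    (hI : FLen F inp) (hf : ∀ j, FLen F fun θ i => f θ i j)
    (h : FComp F inp fun θ i => DUQMR.catBool fun j => f θ i j) (j : Bool) :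
    FComp F inp fun θ i => f θ i j := by
  cases j
  · exact h.left hI (hf _)
  · exact h.right hI (hf false) (hf true)

theorem FComp.padded {F : Fam} {inp : F.Str} (hI : FLen F inp) {k P : F.Θ → ℕ} (hP : F.PB P)
    (hk : ∀ θ, k θ ≤ P θ) {b : ∀ θ, F.ι θ → Bits (k θ)} (h : FComp F inp fun θ i => toL (b θ i)) :
    FComp F inp fun θ i => toL (natBits (P θ) (natOf (toL (b θ i)))) := by
  simp only [toL_natBits_natOf (hk _)]
  exact h.append hI (FComp.const hI (fun θ => List.replicate (P θ - k θ) false)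
    (hP.mono fun θ => by simp))

/-- Encryptions of the components of the pair of `R`. -/
theorem FComp.encRes {F : Fam} {inp : F.Str} (hI : FLen F inp) {k : F.Θ → ℕ}
    (hN : ∀ θ kc, 2 ^ max (𝔾.elemLen (F.n θ)) (k θ) ≤ E.modulus (F.n θ) (E.kgen (F.n θ) kc).2)
    {gc : ∀ θ, F.ι θ → Bits (𝔾.coinLen (F.n θ))} {kc : ∀ θ, F.ι θ → Bits (E.keyCoins (F.n θ))}
    {e : ∀ θ i, Bool → 𝔾.El (F.n θ) (gc θ i) × Bits (k θ)}
    {re : ∀ θ, F.ι θ → Bool → Bool → Bits (E.encCoins (F.n θ))}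
    (hpk : FComp F inp fun θ i => toL (E.kgen (F.n θ) (kc θ i)).2)
    (he₁ : ∀ j, FComp F inp fun θ i => 𝔾.eL (e θ i j).1)
    (he₂ : ∀ j, FComp F inp fun θ i => toL (e θ i j).2)
    (hre : FComp F inp fun θ i => DUQMR.catBool fun j => DUQMR.catBool fun j' => toL (re θ i j j')) :
    FComp F inp fun θ i => DUQMR.catBool fun j => DUQMR.catBool fun j' =>
      toL (DUQMR.encRes E (kc θ i) (𝔾.encode (F.n θ) (𝔾.gen (F.n θ) (gc θ i))) (e θ i) (re θ i) j
        j') := by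
  have hP : F.PB fun θ => E.ptLen (F.n θ) := Fam.PB.poly E.ptLen_poly
  have hmax : ∀ θ, max (𝔾.elemLen (F.n θ)) (k θ) ≤ E.ptLen (F.n θ) := fun θ =>
    (Nat.pow_le_pow_iff_right (by norm_num)).1
      ((hN θ fun _ => false).trans (E.modulus_le (F.n θ) fun _ => false))
  have lre : ∀ j j', FLen F fun θ i => toL (re θ i j j') := fun _ _ =>
    FLen.toL (Fam.PB.poly E.encCoins_poly) _
  have key : ∀ j j', FComp F inp fun θ i => toL (DUQMR.encRes E (kc θ i)
      (𝔾.encode (F.n θ) (𝔾.gen (F.n θ) (gc θ i))) (e θ i) (re θ i) j j') := by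
    intro j j'
    have hr := FComp.catBool_get hI (lre j) (FComp.catBool_get hI
      (fun j => FLen.catBool fun j' => lre j j') hre j) j'
    refine FComp.enc (m := fun θ i => component (𝔾.encode (F.n θ) (𝔾.gen (F.n θ) (gc θ i)))
      (e θ i j) j') hI hpk (fun θ i => component_lt _ (hN θ _) _ _) ?_ hr
    cases j'
    · exact FComp.padded hI hP (fun θ => (le_max_left _ _).trans (hmax θ)) (he₁ j)
    · exact FComp.padded hI hP (fun θ => (le_max_right _ _).trans (hmax θ)) (he₂ j)
  exact FComp.catBool hI (FComp.catBool hI (key _ _) (key _ _))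
    (FComp.catBool hI (key _ _) (key _ _))

/-- The elements `A₁`, `A₂` enter without their exponents, so they may be a CDH challenge; `C` is
obtained as `A₁ * g ^ x`. The single oracle query is made for the chosen message, where `x` and the
exponent `y` are known. -/
theorem frand_coreR {F : Fam} (h1 : ∀ θ, 1 ≤ F.n θ) {inp : F.Str} (hI : FLen F inp)
    (hσ : PolyBounded σ)
    (hN : ∀ n kc, 2 ^ max (𝔾.elemLen n) (σ n + n) ≤ E.modulus n (E.kgen n kc).2)
    {G : ∀ θ, F.ι θ → Bits (𝔾.elemLen (F.n θ)) → Bits (σ (F.n θ) + F.n θ)}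
    (hO : ∀ θ i, F.O θ i = oracleOf (G θ i))
    {m : ∀ θ, F.ι θ → Bits (σ (F.n θ))} {gc : ∀ θ, F.ι θ → Bits (𝔾.coinLen (F.n θ))}
    {A₁ A₂ : ∀ θ i, 𝔾.El (F.n θ) (gc θ i)} (hm : FComp F inp fun θ i => toL (m θ i))
    (hd : FComp F inp fun θ i => 𝔾.desc (F.n θ) (gc θ i))
    (hA₁ : FComp F inp fun θ i => 𝔾.eL (A₁ θ i)) (hA₂ : FComp F inp fun θ i => 𝔾.eL (A₂ θ i)) :
    FRand F inp fun θ i => (unif (RestR 𝔾 E (F.n θ) (σ (F.n θ) + F.n θ) (gc θ i))).bind fun r =>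
      PMF.pure (coreR 𝔾 E (m θ i) (G θ i) (gc θ i) (A₁ θ i) (A₂ θ i) r) := by
  have se := FSamp.ex (F := F) (gc := gc) h1 hI hd
  refine FRand.sample hI (FSamp.prod hI (FSamp.bits hI (Fam.PB.poly E.keyCoins_poly))
    (FSamp.prod hI se (FSamp.prod hI se (FSamp.prod hI (FSamp.bool hI) (FSamp.prod hI
    (FSamp.bits hI Fam.PB.n) (FSamp.prod hI se (FSamp.prod hI (FSamp.bits hI
    (Fam.PB.poly hσ.add_id)) (FSamp.prod hI (FSamp.bool hI) (((FSamp.bits hI (Fam.PB.poly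
    E.encCoins_poly)).fun_bool hI).fun_bool hI))))))))) fun inp' l kI ks => ?_
  let F' := F.ext fun θ i => RestR 𝔾 E (F.n θ) (σ (F.n θ) + F.n θ) (gc θ i)
  have l1 : FLen F' fun θ p => toL p.2.1 := FLen.toL (Fam.PB.poly (F := F') E.keyCoins_poly) _
  have l2 : FLen F' fun θ p => expL (F.n θ) p.2.2.1 := FLen.expL (F := F') _
  have l3 : FLen F' fun θ p => expL (F.n θ) p.2.2.2.1 := FLen.expL (F := F') _
  have l4 : FLen F' fun θ p => [p.2.2.2.2.1] := FLen.single (F := F') _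
  have l5 : FLen F' fun θ p => toL p.2.2.2.2.2.1 := FLen.toL (Fam.PB.n (F := F')) _
  have l6 : FLen F' fun θ p => expL (F.n θ) p.2.2.2.2.2.2.1 := FLen.expL (F := F') _
  have l7 : FLen F' fun θ p => toL p.2.2.2.2.2.2.2.1 :=
    FLen.toL (Fam.PB.poly (F := F') hσ.add_id) _
  have l8 : FLen F' fun θ p => [p.2.2.2.2.2.2.2.2.1] := FLen.single (F := F') _
  have l9 : FLen F' fun θ p => catBool fun j => catBool fun j' =>
      toL (p.2.2.2.2.2.2.2.2.2 j j') :=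
    FLen.catBool₂ (F := F') (Fam.PB.poly (F := F') E.encCoins_poly) _
  have m8 := l8.append l9
  have m7 := l7.append m8
  have m6 := l6.append m7
  have m5 := l5.append m6
  have m4 := l4.append m5
  have m3 := l3.append m4
  have m2 := l2.append m3
  have k1 := ks.left l l1
  have q1 := ks.right l l1 m2
  have k2 := q1.left l l2
  have q2 := q1.right l l2 m3
  have k3 := q2.left l l3
  have q3 := q2.right l l3 m4
  have k4 := q3.left l l4
  have q4 := q3.right l l4 m5
  have k5 := q4.left l l5
  have q5 := q4.right l l5 m6
  have k6 := q5.left l l6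
  have q6 := q5.right l l6 m7
  have k7 := q6.left l l7
  have q7 := q6.right l l7 m8
  have k8 := q7.left l l8
  have k9 := q7.right l l8 l9
  have kd := FComp.comp l kI hd.ext
  have km := FComp.comp l kI hm.ext
  have kA₁ := FComp.comp l kI hA₁.ext
  have kA₂ := FComp.comp l kI hA₂.ext
  have kg := FComp.ggen (F := F') (gc := fun θ p => gc θ p.1) l kd
  have kp := FComp.pk (F := F') l k1
  have g1 := FComp.gexp (F := F') (gc := fun θ p => gc θ p.1) h1 l kd kg k2
  have g2 := FComp.gexp (F := F') (gc := fun θ p => gc θ p.1) h1 l kd kg k3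
  have gy := FComp.gexp (F := F') (gc := fun θ p => gc θ p.1) h1 l kd kg k6
  have kh : FComp F' inp' fun θ p => 𝔾.eL (zpw (𝔾.gen0 (F.n θ) (gc θ p.1))
      (expR p.2.2.1 p.2.2.2.1 p.2.2.2.2.1)) := by
    have d1 := FComp.gdiv (F := F') (gc := fun θ p => gc θ p.1) l kd g2 g1
    have d2 := FComp.gmul (F := F') (gc := fun θ p => gc θ p.1) l kd g2 g1
    convert k4.mux l d1 d2 fun _ _ => by rw [length_eL, length_eL] using 3 with θ p
    rw [← apply_ite]
    congr 1
    cases p.2.2.2.2.1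
    · simp only [expR, Bool.toNat_false, pow_zero, mul_one, zpw_add]; rfl
    · simp only [expR, Bool.toNat_true, pow_one, mul_neg, mul_one, ← sub_eq_add_neg, zpw_sub]; rfl
  have kC := FComp.gmul (F := F') (gc := fun θ p => gc θ p.1) l kd kA₁ kh
  have kq := FComp.gexp (F := F') (gc := fun θ p => gc θ p.1) h1 l kd kh k6
  have kG : FComp F' inp' fun θ p => toL (G θ p.1 (hashPt 𝔾 (zpw (𝔾.gen0 (F.n θ) (gc θ p.1))
      (expR p.2.2.1 p.2.2.2.1 p.2.2.2.2.1)) p.2.2.2.2.2.2.1)) := by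
    convert FComp.query l kq using 3 with θ p
    change _ = F.O θ p.1 _
    rw [hO]
    exact (oracleOf_toL _ _).symm
  have kM : FComp F' inp' fun θ p => toL (Fin.append (m θ p.1) p.2.2.2.2.2.1) := by
    simp only [toL_append]
    exact km.append l k5
  have kX := FComp.xorBits (F := F') (m := fun θ => σ (F.n θ) + F.n θ) l kG kM
  have ke₁ : ∀ j, FComp F' inp' fun θ p => 𝔾.eL (respR 𝔾 (zpw (𝔾.gen0 (F.n θ) (gc θ p.1))
      (expR p.2.2.1 p.2.2.2.1 p.2.2.2.2.1)) (G θ p.1) (Fin.append (m θ p.1) p.2.2.2.2.2.1)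
      p.2.2.2.2.2.2.1 (A₂ θ p.1) p.2.2.2.2.2.2.2.1 p.2.2.2.2.2.2.2.2.1 j).1 := by
    intro j
    cases j
    · convert k8.mux l kA₂ gy fun _ _ => by rw [length_eL, length_eL] using 3 with θ p
      rw [respR]; cases p.2.2.2.2.2.2.2.2.1 <;> rfl
    · convert k8.mux l gy kA₂ fun _ _ => by rw [length_eL, length_eL] using 3 with θ p
      rw [respR]; cases p.2.2.2.2.2.2.2.2.1 <;> rfl
  have ke₂ : ∀ j, FComp F' inp' fun θ p => toL (respR 𝔾 (zpw (𝔾.gen0 (F.n θ) (gc θ p.1))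
      (expR p.2.2.1 p.2.2.2.1 p.2.2.2.2.1)) (G θ p.1) (Fin.append (m θ p.1) p.2.2.2.2.2.1)
      p.2.2.2.2.2.2.1 (A₂ θ p.1) p.2.2.2.2.2.2.2.1 p.2.2.2.2.2.2.2.2.1 j).2 := by
    intro j
    cases j
    · convert k8.mux l k7 kX fun _ _ => by rw [length_toL, length_toL] using 3 with θ p
      rw [respR]; cases p.2.2.2.2.2.2.2.2.1 <;> rfl
    · convert k8.mux l kX k7 fun _ _ => by rw [length_toL, length_toL] using 3 with θ p
      rw [respR]; cases p.2.2.2.2.2.2.2.2.1 <;> rfl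
  have ko := FComp.encRes (F := F') (E := E) (gc := fun θ p => gc θ p.1) l (fun θ => hN (F.n θ))
    kp ke₁ ke₂ k9
  exact FRand.pure ((((k1.append l k2).append l k3).append l ((((kd.append l kC).append l k4).append
    l k5).append l ko)).append l km)

end

/-! ### Simulator of the receiver -/

/-- The value of the random oracle at `q` masks a message unless `q` is queried. -/
theorem rom_mask_one {ℓ k : ℕ} (p q : Bits ℓ) (M : Bits k) (V : Bits k → Bits k → List Bool)
    (c : RandCircuit) (a : List Bool) :
    Near ((if p = q then 1 else 0) +
      (ex (unif (Bits ℓ → Bits k)) fun G => ex (unif (Bits k)) fun u =>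
        ∑ i ∈ Finset.range c.gates.length, (c.trunc i).run (oracleOf G) (V (G p) u) (toL q)))
      (ex (unif (Bits ℓ → Bits k)) fun G =>
        c.run (oracleOf G) (V (G p) (xorBits (G q) M)) a)
      (ex (unif (Bits ℓ → Bits k)) fun G => ex (unif (Bits k)) fun u =>
        c.run (oracleOf G) (V (G p) u) a) := by
  split_ifs with h
  · refine ⟨(ex_le fun _ => PMF.coe_le_one _ _).trans ?_,
      (ex_le fun _ => ex_le fun _ => PMF.coe_le_one _ _).trans ?_⟩ <;>
    exact le_self_add.trans le_add_self
  · have := rom_swap (J := Unit) (pts := fun _ => q) (fun _ _ _ => rfl)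
      (fun G u => V (G p) (xorBits (u ()) M)) (fun G u => by
        rw [override_of_ne _ _ _ fun _ => Ne.symm h]) c a
    let e : (Unit → Bits k) ≃ Bits k :=
      (Equiv.funUnique Unit (Bits k)).trans ⟨fun u => xorBits u M, fun u => xorBits u M,
        fun _ => xorBits_xorBits _ _, fun _ => xorBits_xorBits _ _⟩
    have e' : ∀ φ : Bits k → ℝ≥0∞, (ex (unif (Unit → Bits k)) fun u =>
        φ (xorBits (u ()) M)) = ex (unif (Bits k)) φ := fun φ => ex_unif_equiv e φ
    have e1 : ∀ G : Bits ℓ → Bits k, _ := fun G => e' fun u => c.run (oracleOf G) (V (G p) u) a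
    have e2 : ∀ G : Bits ℓ → Bits k, _ := fun G => e' fun u =>
      ∑ i ∈ Finset.range c.gates.length, (c.trunc i).run (oracleOf G) (V (G p) u) (toL q)
    simp only [Finset.univ_unique, Finset.sum_singleton, e1, e2] at this
    rw [zero_add]
    exact this

theorem ex_unif_eval {A B : Type} [Fintype A] [DecidableEq A] [Fintype B] [Nonempty B] (q : A)
    (φ : B → ℝ≥0∞) : (ex (unif (A → B)) fun G => φ (G q)) = ex (unif B) φ := by
  rw [← ex_resample q]; simp

section
variable {𝔾 : GroupGen} {E : AHE} {σ : ℕ → ℕ}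

/-- Expectation of a function of the view of `R` with a random string for the other message. -/
def jointR (𝔾 : GroupGen) (E : AHE) {n τ : ℕ} (gc : Bits (𝔾.coinLen n)) (m : Bits τ)
    (Ψ : List Bool → 𝔾.Ex n gc → 𝔾.Ex n gc → (Bits (𝔾.elemLen n) → Bits (τ + n)) → ℝ≥0∞) : ℝ≥0∞ :=
  ex (unif (Bits (E.keyCoins n))) fun kc => ex (unif (𝔾.Ex n gc)) fun r₁ =>
  ex (unif (𝔾.Ex n gc)) fun r₂ => ex (unif Bool) fun s₂ => ex (unif (Bits n)) fun r₃ =>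
  ex (unif (𝔾.Ex n gc)) fun a => ex (unif (𝔾.Ex n gc)) fun y₀ => ex (unif (𝔾.Ex n gc)) fun y₁ =>
  ex (unif Bool) fun loc => ex (unif (Bool → Bool → Bits (E.encCoins n))) fun re =>
  ex (unif (Bits (𝔾.elemLen n) → Bits (τ + n))) fun G => ex (unif (Bits (τ + n))) fun u =>
    Ψ (coreR 𝔾 E m G gc (zpw (𝔾.gen0 n gc) a) (zpw (𝔾.gen0 n gc) y₁)
      (kc, r₁, r₂, s₂, r₃, y₀, u, loc, re)) a y₁ G

theorem jointR_eq {n τ : ℕ} (gc : Bits (𝔾.coinLen n)) (m : Bits τ)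
    (Ψ : List Bool → 𝔾.Ex n gc → 𝔾.Ex n gc → (Bits (𝔾.elemLen n) → Bits (τ + n)) → ℝ≥0∞) :
    jointR 𝔾 E gc m Ψ = ex (unif (𝔾.Ex n gc)) fun a => ex (unif (𝔾.Ex n gc)) fun y₁ =>
      ex (unif (Bits (𝔾.elemLen n) → Bits (τ + n))) fun G =>
      ex (unif (RestR 𝔾 E n (τ + n) gc)) fun r =>
        Ψ (coreR 𝔾 E m G gc (zpw (𝔾.gen0 n gc) a) (zpw (𝔾.gen0 n gc) y₁) r) a y₁ G := by
  let e : (Bits (E.keyCoins n) × 𝔾.Ex n gc × 𝔾.Ex n gc × Bool × Bits n × 𝔾.Ex n gc × 𝔾.Ex n gc ×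
      𝔾.Ex n gc × Bool × (Bool → Bool → Bits (E.encCoins n)) ×
      (Bits (𝔾.elemLen n) → Bits (τ + n)) × Bits (τ + n)) ≃
      (𝔾.Ex n gc × 𝔾.Ex n gc × (Bits (𝔾.elemLen n) → Bits (τ + n)) × RestR 𝔾 E n (τ + n) gc) :=
    ⟨fun ⟨kc, r₁, r₂, s₂, r₃, a, y₀, y₁, loc, re, G, u⟩ =>
        ⟨a, y₁, G, kc, r₁, r₂, s₂, r₃, y₀, u, loc, re⟩,
      fun ⟨a, y₁, G, kc, r₁, r₂, s₂, r₃, y₀, u, loc, re⟩ =>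
        ⟨kc, r₁, r₂, s₂, r₃, a, y₀, y₁, loc, re, G, u⟩, fun _ => rfl, fun _ => rfl⟩
  have h := ex_unif_equiv e fun q =>
    Ψ (coreR 𝔾 E m q.2.2.1 gc (zpw (𝔾.gen0 n gc) q.1) (zpw (𝔾.gen0 n gc) q.2.1) q.2.2.2) q.1 q.2.1
      q.2.2.1
  rw [ex_unif_prod (β := 𝔾.Ex n gc × (Bits (𝔾.elemLen n) → Bits (τ + n)) ×
    RestR 𝔾 E n (τ + n) gc)] at h
  simp only [ex_unif_prod] at h ⊢
  exact h

theorem jointR_sum {n τ : ℕ} (gc : Bits (𝔾.coinLen n)) (m : Bits τ) {κ : Type} (S : Finset κ)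
    (Ψ : κ → List Bool → 𝔾.Ex n gc → 𝔾.Ex n gc → (Bits (𝔾.elemLen n) → Bits (τ + n)) → ℝ≥0∞) :
    jointR 𝔾 E gc m (fun V a y G => ∑ i ∈ S, Ψ i V a y G) = ∑ i ∈ S, jointR 𝔾 E gc m (Ψ i) := by
  simp only [jointR, ex_sum]

/-- `R` cannot compute the point at which the sender evaluates the random oracle for the other
message. -/
theorem cdh_R (hσ : PolyBounded σ) (hCDH : 𝔾.CDH)
    (hN : ∀ n kc, 2 ^ max (𝔾.elemLen n) (σ n + n) ≤ E.modulus n (E.kgen n kc).2)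
    {B : ℕ → ℕ} (hB : PolyBounded B) :
    ∃ ε, ENeg ε ∧ ∀ n, 1 ≤ n → ∀ (m : Bits (σ n)) (A : RandCircuit), A.size ≤ B n →
      (ex (unif (Bits (𝔾.coinLen n))) fun gc => jointR 𝔾 E gc m fun V a y G =>
        A.run (oracleOf G) V (toL (hashPt 𝔾 (zpw (𝔾.gen0 n gc) a) y))) ≤ ε n := by
  -- The message is a parameter, hard-wired into the reduction, so that the bound is uniform in it.
  let Θ := (Σ n : {n : ℕ // 1 ≤ n}, Bits (σ n)) × RandCircuit
  let N : Θ → ℕ := fun θ => θ.1.1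
  let k : ℕ → ℕ := fun n => σ n + n
  have hk : PolyBounded k := hσ.add_id
  let F := romFam Θ N (fun θ => θ.1.1 + θ.2.size) (fun θ => Nat.le_add_right _ _)
    (fun θ => Σ c, 𝔾.El (N θ) c × 𝔾.El (N θ) c) 𝔾.elemLen k hk
  have ld : FLen F fun θ i => 𝔾.desc (N θ) i.1.1 := FLen.desc (F := F) (gc := fun θ i => i.1.1)
  have lA : FLen F fun θ i => 𝔾.eL i.1.2.1 := FLen.eL (F := F) (gc := fun θ i => i.1.1) _
  have lB : FLen F fun θ i => 𝔾.eL i.1.2.2 := FLen.eL (F := F) (gc := fun θ i => i.1.1) _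
  have hI := ld.append (lA.append lB)
  have hA : F.PB fun θ => θ.2.size := Fam.PB.sz.mono fun θ => Nat.le_add_left _ _
  have kr := (FComp.id hI).right hI ld (lA.append lB)
  have hm : FComp F (fun θ i => 𝔾.desc (N θ) i.1.1 ++ (𝔾.eL i.1.2.1 ++ 𝔾.eL i.1.2.2))
      fun θ _ => toL θ.1.2 := FComp.const hI _ (by
    simp only [length_toL]
    exact Fam.PB.poly (F := F) hσ)
  have hC := frand_coreR (F := F) (𝔾 := 𝔾) (E := E) (fun θ => θ.1.1.2) hI hσ hN
    (G := fun θ i => i.2) (fun _ _ => rfl) (m := fun θ _ => θ.1.2) (gc := fun θ i => i.1.1)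
    (A₁ := fun θ i => i.1.2.1) (A₂ := fun θ i => i.1.2.2) hm ((FComp.id hI).left hI ld)
    (kr.left hI lA) (kr.right hI lA lB)
  have hD := FRand.run hI hC (fun θ => θ.2) hA
  have hB' : PolyBounded fun n => n + B n := by
    obtain ⟨q, hq⟩ := hB
    exact ⟨Polynomial.X + q, fun n => by simpa using hq n⟩
  obtain ⟨ε, hε, h⟩ := hCDH.rom (Θ := Θ) (n := N) (sz := fun θ => θ.1.1 + θ.2.size)
    (hn := fun θ => Nat.le_add_right _ _) (hk := hk) hD hB'
  refine ⟨ε, hε, fun n hn m A hA => ?_⟩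
  let θ : Θ := (⟨⟨n, hn⟩, m⟩, A)
  refine le_trans (le_of_eq ?_) (h θ (Nat.add_le_add_left hA n))
  refine congrArg (ex _) (funext fun gc => ?_)
  rw [jointR_eq gc m fun V a y G => A.run (oracleOf G) V (toL (hashPt 𝔾 (zpw (𝔾.gen0 n gc) a) y))]
  refine congrArg (ex _) (funext fun b => congrArg (ex _) (funext fun y₀ =>
    congrArg (ex _) (funext fun G => ?_)))
  rw [bind_apply_ex, ex_bind]
  simp only [ex_pure, zpw_mul]
  rfl

/-- The pads of the chosen and of the other message share their point exactly when `a * y₁ = x * y`,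
an equation with `a` and `y₁` uniform. -/
theorem ex_hash_eq_le {n : ℕ} (hn : 1 ≤ n) (gc : Bits (𝔾.coinLen n)) (x y : 𝔾.Ex n gc) :
    (ex (unif (𝔾.Ex n gc)) fun a => ex (unif (𝔾.Ex n gc)) fun y₁ =>
      if hashPt 𝔾 (zpw (𝔾.gen0 n gc) x) y = hashPt 𝔾 (zpw (𝔾.gen0 n gc) a) y₁ then (1 : ℝ≥0∞)
        else 0) ≤ 2 * ((2 : ℝ≥0∞) ^ n)⁻¹ := by
  refine le_trans ?_ (mul_le_mul_right (card_inv_le hn gc) 2)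
  refine le_trans (le_of_eq ?_) (ex_mul_eq_le fun _ => x * y)
  refine congrArg (ex _) (funext fun a => congrArg (ex _) (funext fun y₁ => if_congr ?_ rfl rfl))
  rw [hashPt, hashPt, (𝔾.encode_injective n gc).eq_iff, ← zpw_mul, ← zpw_mul,
    (gen0_zpw_injective gc).eq_iff, eq_comm]

/-- The receiver's attempt on the wrong half hashes `g ^ (y₁ * x)` where the sender hashed `g ^ (a *
y₁)`. These agree exactly when `(a - x) * y₁ = 0`. -/
theorem ex_hash_eq_le' {n : ℕ} (hn : 1 ≤ n) (gc : Bits (𝔾.coinLen n)) (x : 𝔾.Ex n gc) :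
    (ex (unif (𝔾.Ex n gc)) fun a => ex (unif (𝔾.Ex n gc)) fun y₁ =>
      if hashPt 𝔾 (zpw (𝔾.gen0 n gc) y₁) x = hashPt 𝔾 (zpw (𝔾.gen0 n gc) a) y₁ then (1 : ℝ≥0∞)
        else 0) ≤ 2 * ((2 : ℝ≥0∞) ^ n)⁻¹ := by
  refine le_trans ?_ (mul_le_mul_right (card_inv_le hn gc) 2)
  refine le_trans (le_of_eq ?_) (ex_mul_eq_le fun _ => 0)
  refine Eq.trans ?_ (ex_unif_equiv (Equiv.subRight x) _)
  refine congrArg (ex _) (funext fun a => congrArg (ex _) (funext fun y₁ => if_congr ?_ rfl rfl))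
  rw [hashPt, hashPt, (𝔾.encode_injective n gc).eq_iff, ← zpw_mul, ← zpw_mul,
    (gen0_zpw_injective gc).eq_iff, Equiv.subRight_apply, sub_mul, sub_eq_zero, eq_comm, mul_comm y₁]

/-- Fresh encryptions of the pair selected for `R`, in place of what `P₁` computes. -/
def freshR (𝔾 : GroupGen) (E : AHE) {n τ : ℕ} (gc : Bits (𝔾.coinLen n)) (m m' : Bits τ)
    (kc : Bits (E.keyCoins n)) (r₁ r₂ : 𝔾.Ex n gc) (s₂ : Bool) (r₃ : Bits n) (a y₀ y₁ : 𝔾.Ex n gc)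
    (loc : Bool) (re : Bool → Bool → Bits (E.encCoins n))
    (G : Bits (𝔾.elemLen n) → Bits (τ + n)) : Bool → Bool → Bits (E.ctLen n) :=
  encRes E kc (𝔾.encode n (𝔾.gen n gc)) (respR 𝔾 (zpw (𝔾.gen0 n gc) (expR r₁ r₂ s₂)) G
    (Fin.append m r₃) y₀ (zpw (𝔾.gen0 n gc) y₁)
    (xorBits (G (hashPt 𝔾 (zpw (𝔾.gen0 n gc) a) y₁)) (Fin.append m' r₃)) loc) re

/-- Replacing the filtered ciphertexts by fresh ones. -/
theorem filtered_near {n : ℕ} {δ : ℝ≥0∞} (hR : ∀ kc, Rerandomizes E n kc δ)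
    (h2 : ∀ kc, 2 ≤ E.modulus n (E.kgen n kc).2)
    (hN : ∀ kc, 2 ^ max (𝔾.elemLen n) (σ n + n) ≤ E.modulus n (E.kgen n kc).2)
    (x : Input (σ n)) (A : RandCircuit) :
    Near ((8 * x.z : ℕ) * δ) (acc (fun G => (protocol 𝔾 E σ n x G).map fun views => views .R) A)
      (ex (unif (Bits (𝔾.coinLen n))) fun gc => ex (unif (Bits (E.keyCoins n))) fun kc =>
      ex (unif (𝔾.Ex n gc)) fun r₁ => ex (unif (𝔾.Ex n gc)) fun r₂ => ex (unif Bool) fun s₂ =>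
      ex (unif (Bits n)) fun r₃ => ex (unif (𝔾.Ex n gc)) fun a => ex (unif (𝔾.Ex n gc)) fun y₀ =>
      ex (unif (𝔾.Ex n gc)) fun y₁ => ex (unif Bool) fun loc =>
      ex (unif (Bool → Bool → Bits (E.encCoins n))) fun re =>
      ex (unif (Bits (𝔾.elemLen n) → Bits (σ n + n))) fun G =>
      let o := freshR 𝔾 E gc (x.m x.v x.s) (x.m x.v !x.s) kc r₁ r₂ s₂ r₃ a y₀ y₁ loc re G
      A.run (oracleOf G) (viewR 𝔾 E gc (zpw (𝔾.gen0 n gc) (a + expR r₁ r₂ s₂)) kc r₁ r₂ s₂ r₃ o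
        ((retrieve E n (E.kgen n kc).1 (𝔾.encode n (𝔾.gen n gc)) G r₁ r₂ s₂ r₃ o).elim [] toL))
        [true]) := by
  rw [acc_protocol_R]
  -- The constant error is written as a nested mean, to match the form that `Near.ex` produces.
  have e : ∀ (c : ℝ≥0∞) (gc : Bits (𝔾.coinLen n)), c = ex (unif (Fin x.z → Bits (E.encCoins n)))
      fun _ => ex (unif (Fin x.z → (Bool → 𝔾.Ex n gc) × Bool)) fun _ =>
        ex (unif (Bits (𝔾.elemLen n) → Bits (σ n + n))) fun _ => c := by simp
  have e' : ∀ c : ℝ≥0∞, c = ex (unif (Bits (𝔾.coinLen n))) fun gc =>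
      ex (unif (Bits (E.keyCoins n))) fun kc =>
      ex (unif (𝔾.Ex n gc)) fun r₁ => ex (unif (𝔾.Ex n gc)) fun r₂ => ex (unif Bool) fun s₂ =>
      ex (unif (Bits n)) fun r₃ => ex (unif (𝔾.Ex n gc)) fun a => c := by simp
  rw [e' ((8 * x.z : ℕ) * δ)]
  refine Near.ex fun gc => Near.ex fun kc => Near.ex fun r₁ => Near.ex fun r₂ => Near.ex fun s₂ =>
    Near.ex fun r₃ => Near.ex fun a => ?_
  rw [e ((8 * x.z : ℕ) * δ) gc]
  let φ : (Bool → Bool → Bits (E.ctLen n)) → (Bits (𝔾.elemLen n) → Bits (σ n + n)) → ℝ≥0∞ :=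
    fun o G => A.run (oracleOf G) (viewR 𝔾 E gc (zpw (𝔾.gen0 n gc) (a + expR r₁ r₂ s₂)) kc r₁ r₂ s₂
      r₃ o ((retrieve E n (E.kgen n kc).1 (𝔾.encode n (𝔾.gen n gc)) G r₁ r₂ s₂ r₃ o).elim [] toL))
        [true]
  -- Only the entry of `y` at `x.v` reaches the receiver; the other entries, and the coins of the
  -- query vector, average out.
  have key : (ex (unif (𝔾.Ex n gc)) fun y₀ =>
      ex (unif (𝔾.Ex n gc)) fun y₁ => ex (unif Bool) fun loc =>
      ex (unif (Bool → Bool → Bits (E.encCoins n))) fun re =>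
      ex (unif (Bits (𝔾.elemLen n) → Bits (σ n + n))) fun G =>
      φ (freshR 𝔾 E gc (x.m x.v x.s) (x.m x.v !x.s) kc r₁ r₂ s₂ r₃ a y₀ y₁ loc re G) G) =
      ex (unif (Fin x.z → Bits (E.encCoins n))) fun _ =>
      ex (unif (Fin x.z → (Bool → 𝔾.Ex n gc) × Bool)) fun y =>
      ex (unif (Bits (𝔾.elemLen n) → Bits (σ n + n))) fun G =>
      ex (unif (Bool → Bool → Bits (E.encCoins n))) fun re =>
      φ (freshR 𝔾 E gc (x.m x.v x.s) (x.m x.v !x.s) kc r₁ r₂ s₂ r₃ a ((y x.v).1 false)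
        ((y x.v).1 true) (y x.v).2 re G) G := by
    rw [ex_const]
    refine Eq.trans ?_ (ex_unif_eval x.v fun q : (Bool → 𝔾.Ex n gc) × Bool =>
      ex (unif (Bits (𝔾.elemLen n) → Bits (σ n + n))) fun G =>
      ex (unif (Bool → Bool → Bits (E.encCoins n))) fun re =>
      φ (freshR 𝔾 E gc (x.m x.v x.s) (x.m x.v !x.s) kc r₁ r₂ s₂ r₃ a (q.1 false)
        (q.1 true) q.2 re G) G).symm
    rw [ex_unif_prod, ex_unif_bool_fun]
    refine congrArg (ex _) (funext fun y₀ => congrArg (ex _) (funext fun y₁ =>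
      congrArg (ex _) (funext fun loc => ?_)))
    rw [ex_comm]
    rfl
  change Near _ _ (ex (unif (𝔾.Ex n gc)) fun y₀ =>
      ex (unif (𝔾.Ex n gc)) fun y₁ => ex (unif Bool) fun loc =>
      ex (unif (Bool → Bool → Bits (E.encCoins n))) fun re =>
      ex (unif (Bits (𝔾.elemLen n) → Bits (σ n + n))) fun G =>
      φ (freshR 𝔾 E gc (x.m x.v x.s) (x.m x.v !x.s) kc r₁ r₂ s₂ r₃ a y₀ y₁ loc re G) G)
  rw [key]
  exact Near.ex fun rT => Near.ex fun y => Near.ex fun G => oblFilter_near (hR kc) _ (h2 kc) (hN kc)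
    (fun t => respR 𝔾 (zpw (𝔾.gen0 n gc) (expR r₁ r₂ s₂)) G (Fin.append (x.m t x.s) r₃)
          ((y t).1 false) (zpw (𝔾.gen0 n gc) ((y t).1 true))
          (xorBits (G (hashPt 𝔾 (zpw (𝔾.gen0 n gc) a) ((y t).1 true)))
            (Fin.append (x.m t !x.s) r₃)) (y t).2) x.v rT (fun o => φ o G)
    fun _ => PMF.coe_le_one _ _

end

section
variable {𝔾 : GroupGen} {E : AHE} {σ : ℕ → ℕ}

/-- The receiver outputs the message it asked for. -/
theorem retrieved_near {n : ℕ} (hn : 1 ≤ n)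
    (hN : ∀ kc, 2 ^ max (𝔾.elemLen n) (σ n + n) ≤ E.modulus n (E.kgen n kc).2)
    (m m' : Bits (σ n)) (A : RandCircuit) :
    Near (2 * ((2 : ℝ≥0∞) ^ n)⁻¹ + ((2 : ℝ≥0∞) ^ n)⁻¹)
      (ex (unif (Bits (𝔾.coinLen n))) fun gc => ex (unif (Bits (E.keyCoins n))) fun kc =>
      ex (unif (𝔾.Ex n gc)) fun r₁ => ex (unif (𝔾.Ex n gc)) fun r₂ => ex (unif Bool) fun s₂ =>
      ex (unif (Bits n)) fun r₃ => ex (unif (𝔾.Ex n gc)) fun a => ex (unif (𝔾.Ex n gc)) fun y₀ =>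
      ex (unif (𝔾.Ex n gc)) fun y₁ => ex (unif Bool) fun loc =>
      ex (unif (Bool → Bool → Bits (E.encCoins n))) fun re =>
      ex (unif (Bits (𝔾.elemLen n) → Bits (σ n + n))) fun G =>
      let o := freshR 𝔾 E gc m m' kc r₁ r₂ s₂ r₃ a y₀ y₁ loc re G
      A.run (oracleOf G) (viewR 𝔾 E gc (zpw (𝔾.gen0 n gc) (a + expR r₁ r₂ s₂)) kc r₁ r₂ s₂ r₃ o
        ((retrieve E n (E.kgen n kc).1 (𝔾.encode n (𝔾.gen n gc)) G r₁ r₂ s₂ r₃ o).elim [] toL))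
        [true])
      (ex (unif (Bits (𝔾.coinLen n))) fun gc => ex (unif (Bits (E.keyCoins n))) fun kc =>
      ex (unif (𝔾.Ex n gc)) fun r₁ => ex (unif (𝔾.Ex n gc)) fun r₂ => ex (unif Bool) fun s₂ =>
      ex (unif (Bits n)) fun r₃ => ex (unif (𝔾.Ex n gc)) fun a => ex (unif (𝔾.Ex n gc)) fun y₀ =>
      ex (unif (𝔾.Ex n gc)) fun y₁ => ex (unif Bool) fun loc =>
      ex (unif (Bool → Bool → Bits (E.encCoins n))) fun re =>
      ex (unif (Bits (𝔾.elemLen n) → Bits (σ n + n))) fun G =>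
      A.run (oracleOf G) (viewR 𝔾 E gc (zpw (𝔾.gen0 n gc) (a + expR r₁ r₂ s₂)) kc r₁ r₂ s₂ r₃
        (freshR 𝔾 E gc m m' kc r₁ r₂ s₂ r₃ a y₀ y₁ loc re G) (toL m)) [true]) := by
  refine Near.mono (Near.ex fun gc => Near.ex fun kc => Near.ex fun r₁ => Near.ex fun r₂ =>
    Near.ex fun s₂ => Near.ex fun r₃ => Near.ex fun a => Near.ex fun y₀ => Near.ex fun y₁ =>
    Near.ex fun loc => Near.ex fun re => Near.ex (ε := fun G => if tailBits (G (hashPt 𝔾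
      (zpw (𝔾.gen0 n gc) y₁) (expR r₁ r₂ s₂))) = tailBits (G (hashPt 𝔾 (zpw (𝔾.gen0 n gc) a) y₁))
      then 1 else 0) fun G => ?_) ?_
  · split_ifs with h
    · exact ⟨(PMF.coe_le_one _ _).trans le_add_self, (PMF.coe_le_one _ _).trans le_add_self⟩
    · simp only [freshR]
      rw [retrieve_respR gc kc (hN kc) G r₁ r₂ s₂ r₃ m m' y₀ y₁ _ loc re h]
      exact Near.refl _
  · refine ex_le fun gc => ex_le fun kc => ex_le fun r₁ => ex_le fun r₂ => ex_le fun s₂ =>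
      ex_le fun r₃ => ?_
    simp only [ex_const]
    -- A false tag needs equal hash points, of probability at most `2 / 2 ^ n`, or agreement of `n`
    -- independent bits.
    refine (ex_mono fun a => ex_mono fun y₁ => ex_tailBits_eq_le _ _).trans ?_
    simp only [ex_add, ex_const]
    exact add_le_add (ex_hash_eq_le' hn gc _) le_rfl

/-- The string for the other message is random for the receiver. -/
theorem masked_near {n : ℕ} (hn : 1 ≤ n) (m m' : Bits (σ n)) (A : RandCircuit) {ε : ℝ≥0∞}
    (hε : ∀ i, (ex (unif (Bits (𝔾.coinLen n))) fun gc => jointR 𝔾 E gc m fun V a y G =>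
        (A.trunc i).run (oracleOf G) V (toL (hashPt 𝔾 (zpw (𝔾.gen0 n gc) a) y))) ≤ ε) :
    Near (2 * ((2 : ℝ≥0∞) ^ n)⁻¹ + A.gates.length * ε)
      (ex (unif (Bits (𝔾.coinLen n))) fun gc => ex (unif (Bits (E.keyCoins n))) fun kc =>
      ex (unif (𝔾.Ex n gc)) fun r₁ => ex (unif (𝔾.Ex n gc)) fun r₂ => ex (unif Bool) fun s₂ =>
      ex (unif (Bits n)) fun r₃ => ex (unif (𝔾.Ex n gc)) fun a => ex (unif (𝔾.Ex n gc)) fun y₀ =>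
      ex (unif (𝔾.Ex n gc)) fun y₁ => ex (unif Bool) fun loc =>
      ex (unif (Bool → Bool → Bits (E.encCoins n))) fun re =>
      ex (unif (Bits (𝔾.elemLen n) → Bits (σ n + n))) fun G =>
      A.run (oracleOf G) (viewR 𝔾 E gc (zpw (𝔾.gen0 n gc) (a + expR r₁ r₂ s₂)) kc r₁ r₂ s₂ r₃
        (freshR 𝔾 E gc m m' kc r₁ r₂ s₂ r₃ a y₀ y₁ loc re G) (toL m)) [true])
      (ex (unif (Bits (𝔾.coinLen n))) fun gc => jointR 𝔾 E gc m fun V _ _ G =>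
        A.run (oracleOf G) V [true]) := by
  have hz : ∀ (gc : Bits (𝔾.coinLen n)) (a r₁ r₂ : 𝔾.Ex n gc) (s₂ : Bool),
      zpw (𝔾.gen0 n gc) (a + expR r₁ r₂ s₂) =
        zpw (𝔾.gen0 n gc) a * zpw (𝔾.gen0 n gc) (expR r₁ r₂ s₂) := fun _ _ _ _ _ => zpw_add _ _ _
  simp only [hz]
  -- The view depends on `G` only through the pad `w` of the chosen message and the masked string
  -- `u`, as `rom_mask_one` requires.
  refine Near.mono (Near.ex fun gc => Near.ex fun kc => Near.ex fun r₁ => Near.ex fun r₂ =>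
    Near.ex fun s₂ => Near.ex fun r₃ => Near.ex fun a => Near.ex fun y₀ => Near.ex fun y₁ =>
    Near.ex fun loc => Near.ex fun re =>
    rom_mask_one (hashPt 𝔾 (zpw (𝔾.gen0 n gc) (expR r₁ r₂ s₂)) y₀)
      (hashPt 𝔾 (zpw (𝔾.gen0 n gc) a) y₁) (Fin.append m' r₃)
      (fun w u => viewR 𝔾 E gc (zpw (𝔾.gen0 n gc) a * zpw (𝔾.gen0 n gc) (expR r₁ r₂ s₂)) kc r₁ r₂ s₂
        r₃ (encRes E kc (𝔾.encode n (𝔾.gen n gc)) (respR 𝔾 (zpw (𝔾.gen0 n gc) (expR r₁ r₂ s₂))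
          (fun _ => w) (Fin.append m r₃) y₀ (zpw (𝔾.gen0 n gc) y₁) u loc) re) (toL m)) A [true]) ?_
  simp only [ex_add]
  refine add_le_add ?_ ?_
  · refine ex_le fun gc => ex_le fun kc => ex_le fun r₁ => ex_le fun r₂ => ex_le fun s₂ =>
      ex_le fun r₃ => ?_
    simp only [ex_const]
    rw [ex_comm]
    exact ex_le fun y₀ => ex_hash_eq_le hn gc _ y₀
  · change (ex (unif (Bits (𝔾.coinLen n))) fun gc => jointR 𝔾 E gc m fun V a y G =>
        ∑ i ∈ Finset.range A.gates.length,
          (A.trunc i).run (oracleOf G) V (toL (hashPt 𝔾 (zpw (𝔾.gen0 n gc) a) y))) ≤ _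
    simp only [jointR_sum, ex_sum]
    refine (Finset.sum_le_sum fun i _ => hε i).trans_eq ?_
    rw [Finset.sum_const, Finset.card_range, nsmul_eq_mul]

/-- The simulated view of `R`. -/
def simR (𝔾 : GroupGen) (E : AHE) {n τ : ℕ} (m : Bits τ)
    (G : Bits (𝔾.elemLen n) → Bits (τ + n)) : PMF (List Bool) :=
  (unif (Bits (𝔾.coinLen n))).bind fun gc => (unif (𝔾.Ex n gc × 𝔾.Ex n gc)).bind fun q =>
    (unif (RestR 𝔾 E n (τ + n) gc)).bind fun r =>
      PMF.pure (coreR 𝔾 E m G gc (zpw (𝔾.gen0 n gc) q.1) (zpw (𝔾.gen0 n gc) q.2) r)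

theorem frand_simR {F : Fam} (h1 : ∀ θ, 1 ≤ F.n θ) {inp : F.Str} (hI : FLen F inp)
    (hσ : PolyBounded σ)
    (hN : ∀ n kc, 2 ^ max (𝔾.elemLen n) (σ n + n) ≤ E.modulus n (E.kgen n kc).2)
    {G : ∀ θ, F.ι θ → Bits (𝔾.elemLen (F.n θ)) → Bits (σ (F.n θ) + F.n θ)}
    (hO : ∀ θ i, F.O θ i = oracleOf (G θ i)) {m : ∀ θ, F.ι θ → Bits (σ (F.n θ))}
    (hm : FComp F inp fun θ i => toL (m θ i)) :
    FRand F inp fun θ i => simR 𝔾 E (m θ i) (G θ i) := by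
  refine FRand.sample hI (FSamp.bits hI (Fam.PB.poly 𝔾.coinLen_poly)) fun inp' l kI kg => ?_
  let F' := F.ext fun θ _ => Bits (𝔾.coinLen (F.n θ))
  have kd := FComp.gdesc (F := F') (gc := fun θ p => p.2) l kg
  have se := FSamp.ex (F := F') (gc := fun θ p => p.2) h1 l kd
  refine FRand.sample (F := F') l (FSamp.prod l se se) fun inp'' l' kI' ks => ?_
  let F'' := F'.ext fun θ p => 𝔾.Ex (F.n θ) p.2 × 𝔾.Ex (F.n θ) p.2
  have la : FLen F'' fun θ p => expL (F.n θ) p.2.1 := FLen.expL (F := F'') _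
  have lb : FLen F'' fun θ p => expL (F.n θ) p.2.2 := FLen.expL (F := F'') _
  have kd2 := FComp.comp l' kI' kd.ext
  have kg2 := FComp.ggen (F := F'') (gc := fun θ p => p.1.2) l' kd2
  have kA := FComp.gexp (F := F'') (gc := fun θ p => p.1.2) h1 l' kd2 kg2 (ks.left l' la)
  have kB := FComp.gexp (F := F'') (gc := fun θ p => p.1.2) h1 l' kd2 kg2 (ks.right l' la lb)
  have km := FComp.comp l' kI' (FComp.comp l kI hm.ext).ext
  exact frand_coreR (F := F'') h1 l' hσ hN (G := fun θ p => G θ p.1.1) (fun θ p => hO θ p.1.1)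
    (m := fun θ p => m θ p.1.1) (gc := fun θ p => p.1.2) km kd2 kA kB

theorem acc_simR {n τ : ℕ} (m : Bits τ) (A : RandCircuit) :
    acc (fun G => simR 𝔾 E (n := n) m G) A = ex (unif (Bits (𝔾.coinLen n))) fun gc =>
      jointR 𝔾 E gc m fun V _ _ G => A.run (oracleOf G) V [true] := by
  rw [acc]
  simp only [simR, ex_bind, ex_pure]
  rw [ex_comm]
  refine congrArg (ex _) (funext fun gc => ?_)
  rw [jointR_eq gc m fun V _ _ G => A.run (oracleOf G) V [true], ex_comm, ex_unif_prod]

/-- Three hops: fresh ciphertexts, then the correct output, then a uniform string for the other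
message. The output is settled before the masking because extraction evaluates the oracle at a
further point, which the view to be masked must not do. -/
theorem simulator_R (hσ : PolyBounded σ) (hCDH : 𝔾.CDH) (hEnc : E.ReturnsEncryptions)
    (h2 : ∀ n kc, 1 ≤ n → 2 ≤ E.modulus n (E.kgen n kc).2)
    (hN : ∀ n kc, 2 ^ max (𝔾.elemLen n) (σ n + n) ≤ E.modulus n (E.kgen n kc).2) :
    SimulatorFor 𝔾 E σ .R := by
  let X : {n : ℕ // 1 ≤ n} → ℕ → Type := fun n _ => Bits (σ n)
  let F := simFam X 𝔾.elemLen (fun n => σ n + n) hσ.add_id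
  have hI : FLen F fun θ i => toL i.1 := FLen.toL (Fam.PB.poly (F := F) hσ) _
  refine simulator_of (hk := hσ.add_id) _ .R X (fun n x => 0) (fun _ _ => Nat.zero_le _)
    (fun n x => x.m x.v x.s) (fun n L => 0) (fun n L => Nat.zero_le _) (fun n x => rfl)
    (fun θ i => toL i) (fun n x => rfl) _
    (frand_simR (F := F) (𝔾 := 𝔾) (E := E) (fun θ => θ.1.2) hI hσ hN (G := fun θ i => i.2)
      (fun _ _ => rfl) (m := fun θ i => i.1) (FComp.id hI)) fun B hB => ?_
  obtain ⟨δ, hδ, hR⟩ := hEnc.rerandomizes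
  obtain ⟨ε, hε, h3⟩ := cdh_R (E := E) hσ hCDH hN hB
  have p1 : PolyBounded fun n => 8 * B n := by
    obtain ⟨q, hq⟩ := hB
    exact ⟨8 * q, fun n => by
      simp only [Polynomial.eval_mul, Polynomial.eval_ofNat]
      gcongr; exact hq n⟩
  have e2 := ENeg.two_pow.add ENeg.two_pow
  refine ⟨_, (((hδ.poly_mul p1).add (e2.add ENeg.two_pow)).add (e2.add (hε.poly_mul hB))),
    fun n x A hx hA => ?_⟩
  rw [acc_simR]
  refine Near.symm (((filtered_near (hR n) (fun kc => h2 n kc n.2) (hN n) x A).trans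
    (retrieved_near n.2 (hN n) _ _ A)).trans (masked_near n.2 _ _ A fun i =>
      h3 n n.2 _ (A.trunc i) ((RandCircuit.size_trunc A i).trans hA))) |>.mono ?_
  rw [two_mul]
  gcongr
  exact (length_gates_le _).trans (le_trans (Nat.le_add_right _ _) hA)

end

end DUQMR

end

theorem mainTheorem4 (𝔾 : DUQMR.GroupGen) (E : DUQMR.AHE) (σ : ℕ → ℕ)
    (hσ : DUQMR.PolyBounded σ)
    (hfit : ∀ n k, 2 ^ max (𝔾.elemLen n) (σ n + n) ≤ E.modulus n (E.kgen n k).2)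
    (hDL : 𝔾.DL) (hCDH : 𝔾.CDH) (hCPA : E.INDCPA) (hEnc : E.ReturnsEncryptions) :
    DUQMR.SecurelyComputes 𝔾.elemLen (fun n => σ n + n) σ (DUQMR.protocol 𝔾 E σ) := by
  -- Plaintexts hold `σ n + n ≥ 1` bits, so the modulus is at least `2` and the plaintexts `0` and
  -- `1` are distinct.
  have h2 : ∀ n kc, 1 ≤ n → 2 ≤ E.modulus n (E.kgen n kc).2 := fun n kc hn =>
    le_trans (Nat.le_self_pow (by omega) 2) (hfit n kc)
  intro P
  cases P with
  | S => exact DUQMR.simulator_S hσ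
  | T => exact DUQMR.simulator_T hσ
  | P1 => exact DUQMR.simulator_P1 hσ hCDH hCPA h2
  | P2 => exact DUQMR.simulator_P2 hσ
  | R => exact DUQMR.simulator_R hσ hCDH hEnc h2 hfit
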